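/- Let $\mathrm{Diff}^\infty([0,\infty))$ be the group of diffeomorphisms of $[0,\infty)$, smooth up to the end point. Let $\varphi,\psi\in \mathrm{Diff}^\infty([0,\infty))$ be expanding ($\varphi(x)>x$ and $\psi(x)>x$ for $x>0$) and infinitely tangent to the identity at $0$, and let $\lambda,\mu\in\mathbb C$ with $|\lambda|,|\mu|>1$. Let $R_{\varphi,\lambda}=(\mathbb C\times[0,\infty)\setminus\{(0,0)\})/T^{\mathbb Z}$ with $T(z,x)=(\lambda z,\varphi(x))$. It is foliated by the images of the slices $x=\mathrm{const}$, with the complex structure of $\mathbb C$ on the leaves, and its boundary leaf is the elliptic curve $H_\lambda=\mathbb C^*/\lambda^{\mathbb Z}$. Let $\overline R_{\psi,\mu}$ be the mirror of $R_{\psi,\mu}$, obtained by reversing the transverse orientation, i.e. by replacing the coordinate $x\ge 0$ by $-x\le 0$. Let $h:H_\lambda\to H_\mu$ be a biholomorphism, and let $(M,\mathcal F,J)$ be the leafwise complex foliation obtained by pasting $R_{\varphi,\lambda}$ and $\overline R_{\psi,\mu}$ along their boundaries by $h$: near a point of the common boundary leaf $H$, the foliated coordinates are $(z,x)$, where $(z,x)$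 stands for the point $[z,x]$ of $R_{\varphi,\lambda}$ if $x\ge0$ and for the point $[\ell(z),x]$ of $\overline R_{\psi,\mu}$ if $x\le0$, with $\ell$ a local holomorphic lift of $h$ to $\mathbb C^*$. For a leafwise complex foliation, an automorphism is a diffeomorphism which preserves the foliation and is biholomorphic between leaves; on $M$ it is also required to preserve the transverse orientation. Automorphism groups carry the $C^\infty$ topology. Let $\mathrm{Aut}_0 H$ be the identity component of the group of biholomorphisms of $H$ (for $H=H_\lambda$ and $H=H_\mu$, identified through $h$). 1. Every automorphism of $R_{\varphi,\lambda}$ or of $\overline R_{\psi,\mu}$ restricts on the boundary leaf to an element of $\mathrm{Aut}_0H$, and restriction to the two components, $F\mapsto(F|_{R_{\varphi,\lambda}},F|_{\overline R_{\psi,\mu}})$, is an isomorphism of groups from $\mathrm{Aut}(M,\mathcal F,J)$ onto the fibre product $$\mathrm{Aut}\,R_{\varphi,\lambda}\times_{\mathrm{Aut}_0H}\mathrm{Aut}\,\overline R_{\psi,\mu}$$ of the two automorphism groups with respect to the restriction homomorphisms to $\mathrm{Aut}_0 H$. 2. If the centralizer $Z_\psi$ of $\psi$ in $\mathrm{Diff}^\infty([0,\infty))$,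 ordered pointwise, is isomorphic to $\mathbb R$ as an ordered group, then there is a group homomorphism $\mathrm{Aut}\,R_{\varphi,\lambda}\to\mathrm{Aut}(M,\mathcal F,J)$ which is a topological embedding. -/

import Mathlib

open scoped ContDiff NNReal Topology

namespace ReebFoliation

/-! ### Diffeomorphisms of the half line `[0, ∞)` -/

/-- A self-map of the half line, read as a real function on `[0, ∞)`. -/
noncomputable def halfLineFun (e : ℝ≥0 → ℝ≥0) (x : ℝ) : ℝ := e x.toNNReal

lemma halfLineFun_nonneg (e : ℝ≥0 → ℝ≥0) (x : ℝ) : 0 ≤ halfLineFun e x := NNReal.coe_nonneg _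

lemma halfLineFun_comp (e e' : ℝ≥0 → ℝ≥0) (x : ℝ) :
    halfLineFun (fun y => e (e' y)) x = halfLineFun e (halfLineFun e' x) := by
  simp [halfLineFun]

/-- The group `Diff^∞([0, ∞))`: homeomorphisms of the half line which are smooth up to the
end point together with their inverses. -/
noncomputable def HalfLineDiffeo : Subgroup (ℝ≥0 ≃ₜ ℝ≥0) where
  carrier := {e | ContDiffOn ℝ ∞ (halfLineFun e) (Set.Ici 0) ∧
    ContDiffOn ℝ ∞ (halfLineFun e.symm) (Set.Ici 0)}
  one_mem' := by
    have h : ContDiffOn ℝ ∞ (halfLineFun fun y => y) (Set.Ici 0) :=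
      contDiffOn_id.congr fun x hx => Real.coe_toNNReal x hx
    exact ⟨h, h⟩
  mul_mem' := by
    have key : ∀ e e' : ℝ≥0 → ℝ≥0, ContDiffOn ℝ ∞ (halfLineFun e) (Set.Ici 0) →
        ContDiffOn ℝ ∞ (halfLineFun e') (Set.Ici 0) →
        ContDiffOn ℝ ∞ (halfLineFun fun y => e (e' y)) (Set.Ici 0) := fun e e' h h' =>
      (h.comp h' fun x _ => halfLineFun_nonneg e' x).congr fun x _ => halfLineFun_comp e e' x
    intro a b ha hb
    exact ⟨key a b ha.1 hb.1, key b.symm a.symm hb.2 ha.2⟩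
  inv_mem' := fun h => ⟨h.2, h.1⟩

/-- `φ(x) > x` for `x > 0`. -/
def IsExpanding (φ : HalfLineDiffeo) : Prop := ∀ x : ℝ≥0, 0 < x → x < φ.1 x

/-- `φ` is infinitely tangent to the identity at `0`: all derivatives of `φ(x) - x` vanish there. -/
def IsFlat (φ : HalfLineDiffeo) : Prop :=
  ∀ k : ℕ, iteratedDerivWithin k (fun x => halfLineFun φ.1 x - x) (Set.Ici 0) 0 = 0

/-- The centralizer `Z_φ` of `φ` in `Diff^∞([0, ∞))`. -/
noncomputable abbrev Centralizer (φ : HalfLineDiffeo) : Subgroup HalfLineDiffeo :=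
  Subgroup.centralizer {φ}

/-- `Z_φ`, ordered by `η ≤ η'` iff `η(x) ≤ η'(x)` for all `x`, is isomorphic to `ℝ` as an
ordered group. -/
def CentralizerIsoReal (φ : HalfLineDiffeo) : Prop :=
  ∃ Θ : Multiplicative ℝ ≃* Centralizer φ, ∀ s t : ℝ,
    s ≤ t ↔ ∀ x : ℝ≥0, (Θ (.ofAdd s)).1.1 x ≤ (Θ (.ofAdd t)).1.1 x

lemma homeomorph_zero (e : ℝ≥0 ≃ₜ ℝ≥0) : e 0 = 0 := by
  rcases e.continuous.strictMono_of_inj e.injective with h | h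
  · obtain ⟨x, hx⟩ := e.surjective 0
    have h1 := h.monotone (zero_le (a := x))
    rw [hx] at h1
    exact le_antisymm h1 zero_le
  · obtain ⟨x, hx⟩ := e.surjective (e 0 + 1)
    have h1 := h.antitone (zero_le (a := x))
    rw [hx] at h1
    exact absurd h1 (not_le.2 (lt_add_of_pos_right _ one_pos))

/-! ### Leafwise complex structures and their automorphisms

The structures below live on quotient spaces, so they are given by local parametrizations
defined on subsets of `ℂ × ℝ` (relatively open in `ℂ × ℝ` or in `ℂ × [0, ∞)`), rather than by
charts: the local inverses of the parametrizations are the foliated charts. The leaves are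
locally the images of the slices `x = const`, with the complex structure of `ℂ`. -/

/-- A family of local parametrizations of `X` by `(z, x) ∈ ℂ × ℝ`. -/
structure Parametrizations (X : Type) where
  ι : Type
  dom : ι → Set (ℂ × ℝ)
  param : (i : ι) → dom i → X

variable {X : Type}

/-- `g` expresses `f` in the `i`-th and `j`-th local coordinates on `U`, is smooth there, maps
slices into slices, and is holomorphic on each slice. -/
structure LeafwiseLift (A : Parametrizations X) (f : X → X) (i j : A.ι)
    (U : Set (ℂ × ℝ)) (g : ℂ × ℝ → ℂ × ℝ) : Prop where
  isOpen : IsOpen U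
  lift : ∀ q (hq : q ∈ A.dom i), q ∈ U →
    ∃ hg : g q ∈ A.dom j, f (A.param i ⟨q, hq⟩) = A.param j ⟨g q, hg⟩
  smooth : ContDiffOn ℝ ∞ g (U ∩ A.dom i)
  slice : ∀ q ∈ U ∩ A.dom i, ∀ q' ∈ U ∩ A.dom i, q.2 = q'.2 → (g q).2 = (g q').2
  holomorphic : ∀ x : ℝ, DifferentiableOn ℂ (fun z => (g (z, x)).1) {z | (z, x) ∈ U ∩ A.dom i}

/-- `f` is smooth, preserves the foliation, and is holomorphic along the leaves. -/
def IsLeafwiseMap (A : Parametrizations X) (f : X → X) : Prop :=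
  ∀ i, ∀ q ∈ A.dom i, ∃ j U g, q ∈ U ∧ LeafwiseLift A f i j U g

/-- In addition, `f` preserves the transverse orientation, given by the coordinate `x`. -/
def IsTransverselyIncreasing (A : Parametrizations X) (f : X → X) : Prop :=
  ∀ i, ∀ q ∈ A.dom i, ∃ j U g, q ∈ U ∧ LeafwiseLift A f i j U g ∧
    ∀ p ∈ U ∩ A.dom i, ∀ p' ∈ U ∩ A.dom i, p.2 < p'.2 → (g p).2 < (g p').2

lemma LeafwiseLift.comp {A : Parametrizations X} {f f' : X → X} {i j k : A.ι}
    {U U' : Set (ℂ × ℝ)} {g g' : ℂ × ℝ → ℂ × ℝ} (h : LeafwiseLift A f i j U g)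
    (h' : LeafwiseLift A f' j k U' g') :
    ∃ V, (∀ q, q ∈ V ∩ A.dom i ↔ q ∈ U ∩ A.dom i ∧ g q ∈ U') ∧
      LeafwiseLift A (fun x => f' (f x)) i k V (fun q => g' (g q)) := by
  obtain ⟨W, hW, hWU⟩ := continuousOn_iff'.1 h.smooth.continuousOn U' h'.isOpen
  have hm : ∀ q, q ∈ (W ∩ U) ∩ A.dom i → g q ∈ U' ∩ A.dom j := fun q hq => by
    have h1 : q ∈ g ⁻¹' U' ∩ (U ∩ A.dom i) := hWU ▸ ⟨hq.1.1, hq.1.2, hq.2⟩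
    exact ⟨h1.1, (h.lift q hq.2 hq.1.2).1⟩
  have hs : ∀ q, q ∈ (W ∩ U) ∩ A.dom i → q ∈ U ∩ A.dom i := fun q hq => ⟨hq.1.2, hq.2⟩
  refine ⟨W ∩ U, fun q => ⟨fun hq => ⟨hs q hq, (hm q hq).1⟩, fun hq => ?_⟩, ?_⟩
  · have h1 : q ∈ W ∩ (U ∩ A.dom i) := hWU ▸ ⟨hq.2, hq.1⟩
    exact ⟨⟨h1.1, h1.2.1⟩, h1.2.2⟩
  refine ⟨hW.inter h.isOpen, fun q hq hqU => ?_, ?_, fun q hq q' hq' he => ?_, fun x => ?_⟩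
  · obtain ⟨h1, h2⟩ := h.lift q hq hqU.2
    obtain ⟨h3, h4⟩ := h'.lift (g q) h1 (hm q ⟨hqU, hq⟩).1
    exact ⟨h3, by rw [h2, h4]⟩
  · exact h'.smooth.comp (h.smooth.mono hs) hm
  · exact h'.slice _ (hm q hq) _ (hm q' hq') (h.slice _ (hs q hq) _ (hs q' hq') he)
  · intro z hz
    have hd := (h'.holomorphic (g (z, x)).2).comp ((h.holomorphic x).mono (fun w hw => hs _ hw))
      (t := {w | (w, (g (z, x)).2) ∈ U' ∩ A.dom j}) (s := {w | (w, x) ∈ (W ∩ U) ∩ A.dom i})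
      (fun w hw => by
        have := hm _ hw
        have he := h.slice _ (hs _ hw) _ (hs _ hz) rfl
        change ((g (w, x)).1, (g (z, x)).2) ∈ U' ∩ A.dom j
        rw [← he]
        exact this)
    refine (hd.congr fun w hw => ?_) z hz
    have he := h.slice _ (hs _ hw) _ (hs _ hz) rfl
    change (g' (g (w, x))).1 = (g' ((g (w, x)).1, (g (z, x)).2)).1
    rw [← he]

lemma leafwiseLift_id (A : Parametrizations X) (i : A.ι) :
    LeafwiseLift A (fun x => x) i i Set.univ (fun q => q) :=
  ⟨isOpen_univ, fun _ hq _ => ⟨hq, rfl⟩, contDiffOn_id, fun _ _ _ _ h => h,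
    fun _ => differentiableOn_id⟩

lemma IsLeafwiseMap.comp {A : Parametrizations X} {f f' : X → X} (h : IsLeafwiseMap A f)
    (h' : IsLeafwiseMap A f') : IsLeafwiseMap A (fun x => f' (f x)) := by
  intro i q hq
  obtain ⟨j, U, g, hU, hg⟩ := h i q hq
  obtain ⟨k, U', g', hU', hg'⟩ := h' j (g q) (hg.lift q hq hU).1
  obtain ⟨V, hV, hL⟩ := hg.comp hg'
  exact ⟨k, V, _, ((hV q).2 ⟨⟨hU, hq⟩, hU'⟩).1, hL⟩

lemma IsTransverselyIncreasing.comp {A : Parametrizations X} {f f' : X → X}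
    (h : IsTransverselyIncreasing A f) (h' : IsTransverselyIncreasing A f') :
    IsTransverselyIncreasing A (fun x => f' (f x)) := by
  intro i q hq
  obtain ⟨j, U, g, hU, hg, hi⟩ := h i q hq
  obtain ⟨k, U', g', hU', hg', hi'⟩ := h' j (g q) (hg.lift q hq hU).1
  obtain ⟨V, hV, hL⟩ := hg.comp hg'
  have hm : ∀ p ∈ V ∩ A.dom i, p ∈ U ∩ A.dom i ∧ g p ∈ U' ∩ A.dom j := fun p hp =>
    ⟨((hV p).1 hp).1, ((hV p).1 hp).2, (hg.lift p hp.2 ((hV p).1 hp).1.1).1⟩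
  exact ⟨k, V, _, ((hV q).2 ⟨⟨hU, hq⟩, hU'⟩).1, hL, fun p hp p' hp' hlt =>
    hi' _ (hm p hp).2 _ (hm p' hp').2 (hi _ (hm p hp).1 _ (hm p' hp').1 hlt)⟩

/-- The group of automorphisms: diffeomorphisms which preserve the foliation and are
biholomorphic between leaves. -/
def Aut [TopologicalSpace X] (A : Parametrizations X) : Subgroup (X ≃ₜ X) where
  carrier := {f | IsLeafwiseMap A f ∧ IsLeafwiseMap A f.symm}
  one_mem' := ⟨fun i _ _ => ⟨i, Set.univ, _, Set.mem_univ _, leafwiseLift_id A i⟩,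
    fun i _ _ => ⟨i, Set.univ, _, Set.mem_univ _, leafwiseLift_id A i⟩⟩
  mul_mem' := fun ha hb => ⟨hb.1.comp ha.1, ha.2.comp hb.2⟩
  inv_mem' := fun h => ⟨h.2, h.1⟩

/-- The subgroup of automorphisms which preserve the transverse orientation. -/
def AutPlus [TopologicalSpace X] (A : Parametrizations X) : Subgroup (Aut A) where
  carrier := {f | IsTransverselyIncreasing A f.1 ∧ IsTransverselyIncreasing A f.1.symm}
  one_mem' := ⟨fun i _ _ => ⟨i, Set.univ, _, Set.mem_univ _, leafwiseLift_id A i, fun _ _ _ _ h => h⟩,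
    fun i _ _ => ⟨i, Set.univ, _, Set.mem_univ _, leafwiseLift_id A i, fun _ _ _ _ h => h⟩⟩
  mul_mem' := fun ha hb => ⟨hb.1.comp ha.1, ha.2.comp hb.2⟩
  inv_mem' := fun h => ⟨h.2, h.1⟩

/-- A basic neighbourhood in the `C^∞` topology: the automorphisms which, in the local
coordinates `i`, `j`, have an expression near the compact set `K` whose derivatives up to order
`n` are `ε`-close on `K` to those of `g₀`. -/
def smoothNhd [TopologicalSpace X] (A : Parametrizations X) (i j : A.ι) (K : Set (ℂ × ℝ)) (g₀ : ℂ × ℝ → ℂ × ℝ)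
    (n : ℕ) (ε : ℝ) : Set (Aut A) :=
  {f | ∃ U g, K ⊆ U ∧ LeafwiseLift A f.1 i j U g ∧ ∀ k ≤ n, ∀ q ∈ K,
    ‖iteratedFDerivWithin ℝ k g (A.dom i) q - iteratedFDerivWithin ℝ k g₀ (A.dom i) q‖ < ε}

/-- The `C^∞` topology on the automorphism group: uniform convergence of all derivatives on
compact sets in local coordinates. -/
instance [TopologicalSpace X] (A : Parametrizations X) : TopologicalSpace (Aut A) :=
  TopologicalSpace.generateFrom {N | ∃ (f₀ : Aut A) (i j : A.ι) (K U₀ : Set (ℂ × ℝ))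
    (g₀ : ℂ × ℝ → ℂ × ℝ) (n : ℕ) (ε : ℝ), IsCompact K ∧ K ⊆ A.dom i ∧ K ⊆ U₀ ∧
    LeafwiseLift A f₀.1 i j U₀ g₀ ∧ 0 < ε ∧ N = smoothNhd A i j K g₀ n ε}

/-! ### The elliptic curve `H = ℂ* / λ^ℤ` -/

/-- `H = ℂ* / λ^ℤ`. -/
abbrev Curve (lam : ℂˣ) : Type := ℂˣ ⧸ Subgroup.zpowers lam

/-- `ℓ` is a holomorphic lift of `h` over the open set `O ⊆ ℂ*`. -/
structure HolLift {lam mu : ℂˣ} (h : Curve lam → Curve mu) (O : Set ℂ) (ℓ : ℂ → ℂ) : Prop where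
  isOpen : IsOpen O
  zero_notMem : (0 : ℂ) ∉ O
  holomorphic : DifferentiableOn ℂ ℓ O
  lift : ∀ u : ℂˣ, (u : ℂ) ∈ O → ∃ v : ℂˣ, (v : ℂ) = ℓ u ∧ h (u : Curve lam) = (v : Curve mu)

/-- `h` is a holomorphic map between the curves. -/
def IsHolomorphic {lam mu : ℂˣ} (h : Curve lam → Curve mu) : Prop :=
  ∀ u : ℂˣ, ∃ O ℓ, (u : ℂ) ∈ O ∧ HolLift h O ℓ

/-- `h` is a biholomorphism between the curves. -/
def IsBiholomorphic {lam mu : ℂˣ} (h : Curve lam ≃ₜ Curve mu) : Prop :=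
  IsHolomorphic h ∧ IsHolomorphic h.symm

lemma isHolomorphic_id (lam : ℂˣ) : IsHolomorphic (fun w : Curve lam => w) := fun u =>
  ⟨{0}ᶜ, fun z => z, u.ne_zero, isOpen_compl_singleton, fun h => h rfl, differentiableOn_id,
    fun u _ => ⟨u, rfl, rfl⟩⟩

lemma IsHolomorphic.comp {lam mu nu : ℂˣ} {h : Curve lam → Curve mu} {h' : Curve mu → Curve nu}
    (H : IsHolomorphic h) (H' : IsHolomorphic h') : IsHolomorphic (fun w => h' (h w)) := by
  intro u
  obtain ⟨O, ℓ, hu, hO⟩ := H u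
  obtain ⟨v, hv, -⟩ := hO.lift u hu
  obtain ⟨O', ℓ', hu', hO'⟩ := H' v
  refine ⟨O ∩ ℓ ⁻¹' O', fun z => ℓ' (ℓ z), ⟨hu, ?_⟩,
    hO.holomorphic.continuousOn.isOpen_inter_preimage hO.isOpen hO'.isOpen,
    fun h0 => hO.zero_notMem h0.1,
    hO'.holomorphic.comp (hO.holomorphic.mono Set.inter_subset_left) fun z hz => hz.2, ?_⟩
  · change ℓ u ∈ O'
    rw [← hv]
    exact hu'
  · intro w hw
    obtain ⟨a, ha, ha'⟩ := hO.lift w hw.1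
    have hw2 : ℓ w ∈ O' := hw.2
    rw [← ha] at hw2
    obtain ⟨b, hb, hb'⟩ := hO'.lift a hw2
    exact ⟨b, by rw [hb, ha], by rw [ha', hb']⟩

/-- The group `Aut H` of biholomorphisms of `H`. -/
noncomputable def AutCurve (lam : ℂˣ) : Subgroup (Curve lam ≃ₜ Curve lam) where
  carrier := {f | IsBiholomorphic f}
  one_mem' := ⟨isHolomorphic_id lam, isHolomorphic_id lam⟩
  mul_mem' := fun ha hb => ⟨hb.1.comp ha.1, ha.2.comp hb.2⟩
  inv_mem' := fun h => ⟨h.2, h.1⟩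

/-- `Aut H` carries the compact-open topology (for a map and its inverse). -/
noncomputable instance (lam : ℂˣ) : TopologicalSpace (AutCurve lam) :=
  TopologicalSpace.induced
    (fun f => ((f.1 : C(Curve lam, Curve lam)), (f.1.symm : C(Curve lam, Curve lam)))) inferInstance

instance (lam : ℂˣ) : IsTopologicalGroup (AutCurve lam) where
  continuous_mul := by
    have hind : Continuous (fun f : AutCurve lam =>
      ((f.1 : C(Curve lam, Curve lam)), (f.1.symm : C(Curve lam, Curve lam)))) :=
      continuous_induced_dom
    refine continuous_induced_rng.2 (Continuous.prodMk ?_ ?_)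
    · exact ContinuousMap.continuous_comp'.comp
        (((hind.comp continuous_snd).fst).prodMk ((hind.comp continuous_fst).fst))
    · exact ContinuousMap.continuous_comp'.comp
        (((hind.comp continuous_fst).snd).prodMk ((hind.comp continuous_snd).snd))
  continuous_inv := by
    have hind : Continuous (fun f : AutCurve lam =>
      ((f.1 : C(Curve lam, Curve lam)), (f.1.symm : C(Curve lam, Curve lam)))) :=
      continuous_induced_dom
    exact continuous_induced_rng.2 (hind.snd.prodMk hind.fst)

/-- `Aut_0 H`, the identity component of `Aut H`. -/
noncomputable def AutCurveZero (lam : ℂˣ) : Subgroup (AutCurve lam) :=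
  Subgroup.connectedComponentOfOne (AutCurve lam)

/-! ### The Reeb component `R_{φ, λ}` -/

/-- `R̃ = ℂ × [0, ∞) ∖ {(0, 0)}`. -/
def cover : Set (ℂ × ℝ) := {q | 0 ≤ q.2 ∧ q ≠ 0}

/-- The orbit relation of `T^ℤ`, where `T(z, x) = (λ z, φ(x))`. -/
def reebSetoid (φ : HalfLineDiffeo) (lam : ℂˣ) : Setoid cover where
  r p q := ∃ n : ℤ, q.1.1 = ((lam ^ n : ℂˣ) : ℂ) * p.1.1 ∧
    q.1.2 = halfLineFun (φ ^ n : HalfLineDiffeo).1 p.1.2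
  iseqv := by
    refine ⟨fun p => ⟨0, by simp, ?_⟩, ?_, ?_⟩
    · simp [halfLineFun, p.2.1]
    · rintro p q ⟨n, h1, h2⟩
      refine ⟨-n, by rw [h1, zpow_neg, ← mul_assoc, Units.inv_mul, one_mul], ?_⟩
      rw [h2, ← halfLineFun_comp, zpow_neg]
      simp [halfLineFun, p.2.1]
    · rintro p q s ⟨n, h1, h2⟩ ⟨m, h3, h4⟩
      refine ⟨m + n, by rw [h3, h1, zpow_add, Units.val_mul, mul_assoc], ?_⟩
      rw [h4, h2, ← halfLineFun_comp, zpow_add]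
      rfl

/-- The Reeb component `R_{φ, λ} = R̃ / T^ℤ`. -/
def Reeb (φ : HalfLineDiffeo) (lam : ℂˣ) : Type := Quotient (reebSetoid φ lam)

instance (φ : HalfLineDiffeo) (lam : ℂˣ) : TopologicalSpace (Reeb φ lam) :=
  inferInstanceAs (TopologicalSpace (Quotient (reebSetoid φ lam)))

/-- The projection `R̃ → R_{φ, λ}`. -/
def Reeb.mk (φ : HalfLineDiffeo) (lam : ℂˣ) (q : cover) : Reeb φ lam :=
  Quotient.mk (reebSetoid φ lam) q

/-- The leafwise complex structure of `R_{φ, λ}`, for which the projection from `R̃` is a local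
isomorphism. -/
def reebParam (φ : HalfLineDiffeo) (lam : ℂˣ) : Parametrizations (Reeb φ lam) where
  ι := Unit
  dom _ := cover
  param _ := Reeb.mk φ lam

/-- The group `Aut R_{φ, λ}`. -/
abbrev AutReeb (φ : HalfLineDiffeo) (lam : ℂˣ) : Subgroup (Reeb φ lam ≃ₜ Reeb φ lam) :=
  Aut (reebParam φ lam)

/-- The mirror of `R_{φ, λ}`: the same space and leaves with the transverse coordinate `x ≥ 0`
replaced by `-x ≤ 0`. -/
def mirrorParam (φ : HalfLineDiffeo) (lam : ℂˣ) : Parametrizations (Reeb φ lam) where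
  ι := Unit
  dom _ := {q | q.2 ≤ 0 ∧ q ≠ 0}
  param _ q := Reeb.mk φ lam ⟨(q.1.1, -q.1.2), neg_nonneg.2 q.2.1, fun h0 => q.2.2
    (Prod.ext (show q.1.1 = 0 from congrArg Prod.fst h0)
      (neg_eq_zero.1 (show -q.1.2 = 0 from congrArg Prod.snd h0)))⟩

/-- The automorphism group of the mirror of `R_{φ, λ}`. -/
abbrev AutMirror (φ : HalfLineDiffeo) (lam : ℂˣ) : Subgroup (Reeb φ lam ≃ₜ Reeb φ lam) :=
  Aut (mirrorParam φ lam)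

/-- The inclusion of `H` as the boundary leaf, `[u] ↦ [(u, 0)]`. -/
def boundary (φ : HalfLineDiffeo) (lam : ℂˣ) : Curve lam → Reeb φ lam :=
  Quotient.lift (fun u : ℂˣ => Reeb.mk φ lam ⟨((u : ℂ), 0), le_rfl, fun h =>
    u.ne_zero (congrArg Prod.fst h)⟩) (by
      intro u v huv
      obtain ⟨n, hn⟩ := Subgroup.mem_zpowers_iff.1 (QuotientGroup.leftRel_apply.1 huv)
      refine Quotient.sound ⟨n, ?_, ?_⟩
      · change (v : ℂ) = ((lam ^ n : ℂˣ) : ℂ) * u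
        rw [hn, ← Units.val_mul]
        congr 1
        rw [mul_comm, mul_inv_cancel_left]
      · change (0 : ℝ) = halfLineFun (φ ^ n : HalfLineDiffeo).1 0
        simp [halfLineFun, homeomorph_zero])

/-! ### Pasting `R_{φ, λ}` and the mirror of `R_{ψ, μ}` -/

section Pasting

variable (φ ψ : HalfLineDiffeo) {lam mu : ℂˣ} (h : Curve lam ≃ₜ Curve mu)

/-- Boundary points `w` of `R_{φ, λ}` and `h(w)` of the mirror of `R_{ψ, μ}` are identified. -/
inductive GlueRel : Reeb φ lam ⊕ Reeb ψ mu → Reeb φ lam ⊕ Reeb ψ mu → Prop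
  | glue (w : Curve lam) : GlueRel (.inl (boundary φ lam w)) (.inr (boundary ψ mu (h w)))

/-- The closed 3-manifold `M` obtained by pasting along `h`. -/
def Pasted : Type := Quot (GlueRel φ ψ h)

instance : TopologicalSpace (Pasted φ ψ h) :=
  inferInstanceAs (TopologicalSpace (Quot (GlueRel φ ψ h)))

/-- The inclusion of `R_{φ, λ}`. -/
def Pasted.inl (p : Reeb φ lam) : Pasted φ ψ h := Quot.mk _ (.inl p)

/-- The inclusion of the mirror of `R_{ψ, μ}`. -/
def Pasted.inr (p : Reeb ψ mu) : Pasted φ ψ h := Quot.mk _ (.inr p)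

/-- The local parametrizations of `M`: the interiors of the two components, and the collars over
open sets `O` of `H`, one for each local holomorphic lift `ℓ` of `h`. -/
inductive PastedIndex : Type
  | left
  | right
  | collar (O : Set ℂ) (ℓ : ℂ → ℂ) (hl : HolLift h O ℓ)

/-- The part of `ℂ × ℝ` on which each local parametrization of `M` is defined. -/
def pastedDom : PastedIndex h → Set (ℂ × ℝ)
  | .left => {q | 0 < q.2}
  | .right => {q | q.2 < 0}
  | .collar O _ _ => {q | q.1 ∈ O}

/-- `(z, x) ↦ [z, x]` in `R_{φ, λ}` for `x ≥ 0`, and, as the mirror reverses the transverse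
orientation, `(z, x) ↦ [z, -x]` in `R_{ψ, μ}` for `x < 0`; in a collar `z` on the negative side is
replaced by `ℓ(z)`. -/
noncomputable def pastedMap : (i : PastedIndex h) → pastedDom h i → Pasted φ ψ h
  | .left, q => Pasted.inl φ ψ h (Reeb.mk φ lam ⟨q.1, le_of_lt q.2, fun h0 =>
      ne_of_gt (show 0 < q.1.2 from q.2) (congrArg Prod.snd h0)⟩)
  | .right, q => Pasted.inr φ ψ h (Reeb.mk ψ mu ⟨(q.1.1, -q.1.2),
      le_of_lt (neg_pos.2 q.2), fun h0 =>
      ne_of_gt (neg_pos.2 (show q.1.2 < 0 from q.2)) (congrArg Prod.snd h0)⟩)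
  | .collar O ℓ hl, q =>
      if hx : 0 ≤ q.1.2 then
        Pasted.inl φ ψ h (Reeb.mk φ lam ⟨q.1, hx, fun h0 =>
          hl.zero_notMem (by
            have h1 : q.1.1 ∈ O := q.2
            rwa [h0] at h1)⟩)
      else
        Pasted.inr φ ψ h (Reeb.mk ψ mu ⟨(ℓ q.1.1, -q.1.2), (neg_pos.2 (not_le.1 hx)).le,
          fun h0 => ne_of_gt (neg_pos.2 (not_le.1 hx)) (congrArg Prod.snd h0)⟩)

/-- The leafwise complex structure of `M`. For holonomies which are infinitely tangent to the
identity, the coordinate changes between collars are smooth across `x = 0`. -/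
noncomputable def pastedParam : Parametrizations (Pasted φ ψ h) where
  ι := PastedIndex h
  dom := pastedDom h
  param := pastedMap φ ψ h

/-- The group of (transverse orientation preserving) automorphisms of `M`. -/
noncomputable abbrev AutPasted : Subgroup (Aut (pastedParam φ ψ h)) :=
  AutPlus (pastedParam φ ψ h)

variable {φ ψ}

/-- The fibre product of `Aut R_{φ, λ}` and the automorphism group of the mirror of `R_{ψ, μ}` with
respect to homomorphisms `r`, `r'` to the groups `Aut_0` of the boundary curves, which are
identified by `h`. -/
def fibreProduct (r : AutReeb φ lam →* AutCurveZero lam)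
    (r' : AutMirror ψ mu →* AutCurveZero mu) : Subgroup (AutReeb φ lam × AutMirror ψ mu) where
  carrier := {p | ∀ w, h ((r p.1).1.1 w) = (r' p.2).1.1 (h w)}
  one_mem' := fun w => by simp
  mul_mem' := fun {a b} ha hb w => by
    have h1 := ha ((r b.1).1.1 w)
    rw [hb w] at h1
    simpa using h1
  inv_mem' := fun {a} ha w => by
    have h1 := ha ((r a.1).1.1.symm w)
    rw [Homeomorph.apply_symm_apply] at h1
    have h2 := congrArg (r' a.2).1.1.symm h1
    rw [Homeomorph.symm_apply_apply] at h2
    simp only [Prod.fst_inv, Prod.snd_inv, map_inv]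
    exact h2.symm

end Pasting

end ReebFoliation

open ReebFoliation

/-! Everything rests on a normal form for the automorphisms of a Reeb component. The cover `ℂ × [0,
∞) ∖ {(0, 0)}` is contractible and its deck group is generated by `T`, so an automorphism lifts to a
map `G` with `G ∘ T = T ^ k ∘ G`. A holomorphic map from an elliptic curve to `ℂ` is constant and
all other leaves are copies of `ℂ`, so the boundary leaf is preserved. Compactness of a fundamental
domain bounds the growth of `G` on the slices `x > 0`: `k ≤ 0` would make it bounded, hence
constant, so `k` is positive; the same holds for the inverse, and `k = 1`. The growth is then
linear, and by Liouville `G(z, x) = (a(x) z + b(x), η(x))`. Comparison with `T` gives `a ∘ φ = a`,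
so `a` is constant because `φ⁻ⁿ x → 0`; moreover `b ∘ φ = λ b`, and `η` commutes with `φ`
(`exists_isReebLift`). On the boundary leaf the automorphism is the translation by `a`.

Since `φ` is flat, `b` and `η - id` are flat at `0` (`flatAtZero_of_schroder`,
`flatAtZero_of_mem_centralizer`). So the data on the two sides of `H` join smoothly, and agreement
on `H` is the only condition for pasting. The map `h` is well behaved in logarithmic coordinates:
its logarithmic derivative is a holomorphic function on `H`, hence a constant `κ`, and `h(exp(s) w)
= exp(κ s) h(w)` (`exists_logDeriv`, `map_expUnit_mul`). This turns the expression of a pasted map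
in a collar into an explicit smooth formula (`exists_leafwiseLift_collar`). Conversely an
automorphism of `M` preserves `H`, since the other leaves are copies of `ℂ`, and being transversely
increasing it preserves both sides (`map_boundary_pasted`, `exists_sides`), so it restricts to the
components.

For the embedding, let `θ` be the one-parameter group `Z_ψ` with `ψ = θ_τ`. The automorphisms `[z,
x] ↦ [a z, θ_{c log |a|}(x)]`, with `c log |μ| = τ`, depend only on the class of `a` modulo `μ`, so
they split the restriction to the boundary leaf (`exists_splitting`). An automorphism `f` of the
first component is pasted with the image under this splitting of its boundary translation. The
inverse of the resulting homomorphism is continuous because closeness of lifts on a small box at the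
boundary propagates to the whole half line, by `b = λ^m b ∘ φ^{-m}` and `η = φ^m η φ^{-m}`
(`LiftTendsto.extend`, `comap_nhds_le`). Continuity of the homomorphism requires `t ↦ θ_t` to be
continuous in the smooth topology, although only an isomorphism of ordered groups is given.
Monotonicity yields uniform continuity of order zero, and a Baire category argument combined with
the group law gains one derivative at a time (`exists_tendsto_derivWithin`, `flow_smoothTendsto`).
-/

namespace ReebFoliation

open Filter Set

/-! ### Calculus of locally uniform convergence of all derivatives. -/

section SmoothConvergence

set_option linter.unusedSectionVars false

variable {P Q E E' F F' G : Type} [NormedAddCommGroup E] [NormedSpace ℝ E]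
  [NormedAddCommGroup E'] [NormedSpace ℝ E'] [NormedAddCommGroup F] [NormedSpace ℝ F]
  [NormedAddCommGroup F'] [NormedSpace ℝ F'] [NormedAddCommGroup G] [NormedSpace ℝ G]

/-- The smooth functions `u p` converge to `u₀` along `l`, locally uniformly on `s` together with
their derivatives up to order `n`. -/
structure CkTendsto (n : ℕ) (l : Filter P) (u : P → E → F) (u₀ : E → F) (s : Set E) : Prop where
  smooth : ∀ᶠ p in l, ContDiffOn ℝ ∞ (u p) s
  smooth_lim : ContDiffOn ℝ ∞ u₀ s
  tendsto : ∀ k ≤ n, ∀ q ∈ s, Tendsto (fun py : P × E => iteratedFDerivWithin ℝ k (u py.1) s py.2)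
    (l ×ˢ 𝓝[s] q) (𝓝 (iteratedFDerivWithin ℝ k u₀ s q))

/-- Locally uniform convergence on `s` of all derivatives. -/
def SmoothTendsto (l : Filter P) (u : P → E → F) (u₀ : E → F) (s : Set E) : Prop :=
  ∀ n, CkTendsto n l u u₀ s

variable {l : Filter P} {s : Set E}

lemma eventually_prod_mem (l : Filter P) (s : Set E) (q : E) :
    ∀ᶠ py : P × E in l ×ˢ 𝓝[s] q, py.2 ∈ s :=
  tendsto_snd.eventually (eventually_mem_nhdsWithin)

lemma eventually_prod_fst {p : P → Prop} (h : ∀ᶠ x in l, p x) (f : Filter E) :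
    ∀ᶠ py : P × E in l ×ˢ f, p py.1 := tendsto_fst.eventually h

lemma ckTendsto_zero_iff {u : P → E → F} {u₀ : E → F} :
    CkTendsto 0 l u u₀ s ↔ (∀ᶠ p in l, ContDiffOn ℝ ∞ (u p) s) ∧ ContDiffOn ℝ ∞ u₀ s ∧
      ∀ q ∈ s, Tendsto (fun py : P × E => u py.1 py.2) (l ×ˢ 𝓝[s] q) (𝓝 (u₀ q)) := by
  have key : ∀ q, Tendsto (fun py : P × E => iteratedFDerivWithin ℝ 0 (u py.1) s py.2)
      (l ×ˢ 𝓝[s] q) (𝓝 (iteratedFDerivWithin ℝ 0 u₀ s q)) ↔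
      Tendsto (fun py : P × E => u py.1 py.2) (l ×ˢ 𝓝[s] q) (𝓝 (u₀ q)) := by
    intro q
    simp only [iteratedFDerivWithin_zero_eq_comp]
    exact ((continuousMultilinearCurryFin0 ℝ E F).symm.toHomeomorph.isInducing.tendsto_nhds_iff).symm
  constructor
  · rintro ⟨h1, h2, h3⟩
    exact ⟨h1, h2, fun q hq => (key q).1 (h3 0 le_rfl q hq)⟩
  · rintro ⟨h1, h2, h3⟩
    refine ⟨h1, h2, fun k hk q hq => ?_⟩
    obtain rfl : k = 0 := Nat.le_zero.1 hk
    exact (key q).2 (h3 q hq)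

/-- The derivative of order `k + 1` is, up to a linear isometry, the derivative of order `k` of
`fderivWithin`. This is the induction step behind the Leibniz and chain rules below, which avoids
explicit higher-order formulas. -/
lemma ckTendsto_succ_iff (hs : UniqueDiffOn ℝ s) {n : ℕ} {u : P → E → F} {u₀ : E → F} :
    CkTendsto (n + 1) l u u₀ s ↔ CkTendsto 0 l u u₀ s ∧
      CkTendsto n l (fun p => fderivWithin ℝ (u p) s) (fderivWithin ℝ u₀ s) s := by
  have key : ∀ k, ∀ q ∈ s,
      (Tendsto (fun py : P × E => iteratedFDerivWithin ℝ (k + 1) (u py.1) s py.2)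
        (l ×ˢ 𝓝[s] q) (𝓝 (iteratedFDerivWithin ℝ (k + 1) u₀ s q)) ↔
      Tendsto (fun py : P × E => iteratedFDerivWithin ℝ k (fderivWithin ℝ (u py.1) s) s py.2)
        (l ×ˢ 𝓝[s] q) (𝓝 (iteratedFDerivWithin ℝ k (fderivWithin ℝ u₀ s) s q))) := by
    intro k q hq
    rw [iteratedFDerivWithin_succ_eq_comp_right hs hq]
    refine Iff.trans (tendsto_congr' ?_) (((continuousMultilinearCurryRightEquiv' ℝ k E
      F).symm.toHomeomorph.isInducing.tendsto_nhds_iff).symm)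
    filter_upwards [eventually_prod_mem l s q] with py hpy
    rw [iteratedFDerivWithin_succ_eq_comp_right hs hpy]
    rfl
  constructor
  · intro h
    refine ⟨⟨h.smooth, h.smooth_lim, fun k hk => h.tendsto k (by omega)⟩, ?_, ?_, ?_⟩
    · filter_upwards [h.smooth] with p hp
      exact hp.fderivWithin hs (by simp)
    · exact h.smooth_lim.fderivWithin hs (by simp)
    · exact fun k hk q hq => (key k q hq).1 (h.tendsto (k + 1) (by omega) q hq)
  · rintro ⟨h, h'⟩
    refine ⟨h.smooth, h.smooth_lim, fun k hk q hq => ?_⟩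
    rcases k with _ | k
    · exact h.tendsto 0 le_rfl q hq
    · exact (key k q hq).2 (h'.tendsto k (by omega) q hq)

lemma CkTendsto.mono {n m : ℕ} {u : P → E → F} {u₀ : E → F} (h : CkTendsto n l u u₀ s)
    (hm : m ≤ n) : CkTendsto m l u u₀ s :=
  ⟨h.smooth, h.smooth_lim, fun k hk => h.tendsto k (hk.trans hm)⟩

lemma CkTendsto.tendsto_zero {n : ℕ} {u : P → E → F} {u₀ : E → F} (h : CkTendsto n l u u₀ s)
    {q : E} (hq : q ∈ s) :
    Tendsto (fun py : P × E => u py.1 py.2) (l ×ˢ 𝓝[s] q) (𝓝 (u₀ q)) :=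
  (ckTendsto_zero_iff.1 (h.mono (Nat.zero_le n))).2.2 q hq

lemma CkTendsto.congr {n : ℕ} {u v : P → E → F} {u₀ v₀ : E → F} (h : CkTendsto n l u u₀ s)
    (huv : ∀ᶠ p in l, EqOn (v p) (u p) s) (h₀ : EqOn v₀ u₀ s) : CkTendsto n l v v₀ s := by
  refine ⟨?_, h.smooth_lim.congr h₀, fun k hk q hq => ?_⟩
  · filter_upwards [huv, h.smooth] with p hp hp'
    exact hp'.congr hp
  · rw [iteratedFDerivWithin_congr h₀ hq]
    refine (h.tendsto k hk q hq).congr' ?_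
    filter_upwards [eventually_prod_mem l s q, eventually_prod_fst huv _] with py h1 h2
    exact (iteratedFDerivWithin_congr h2 h1 k).symm

lemma SmoothTendsto.congr {u v : P → E → F} {u₀ v₀ : E → F} (h : SmoothTendsto l u u₀ s)
    (huv : ∀ᶠ p in l, EqOn (v p) (u p) s) (h₀ : EqOn v₀ u₀ s) : SmoothTendsto l v v₀ s :=
  fun n => (h n).congr huv h₀

lemma CkTendsto.add (hs : UniqueDiffOn ℝ s) {n : ℕ} {u v : P → E → F} {u₀ v₀ : E → F}
    (hu : CkTendsto n l u u₀ s) (hv : CkTendsto n l v v₀ s) :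
    CkTendsto n l (fun p x => u p x + v p x) (fun x => u₀ x + v₀ x) s := by
  refine ⟨?_, hu.smooth_lim.add hv.smooth_lim, fun k hk q hq => ?_⟩
  · filter_upwards [hu.smooth, hv.smooth] with p h1 h2 using h1.add h2
  · have hk' : ((k : ℕ∞) : WithTop ℕ∞) ≤ ∞ := by exact_mod_cast le_top
    rw [fun_iteratedFDerivWithin_add_apply ((hu.smooth_lim q hq).of_le hk')
      ((hv.smooth_lim q hq).of_le hk') hs hq]
    refine ((hu.tendsto k hk q hq).add (hv.tendsto k hk q hq)).congr' ?_
    filter_upwards [eventually_prod_mem l s q, eventually_prod_fst hu.smooth _,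
      eventually_prod_fst hv.smooth _] with py h1 h2 h3
    rw [fun_iteratedFDerivWithin_add_apply ((h2 _ h1).of_le hk') ((h3 _ h1).of_le hk') hs h1]

/-- The derivative of a bilinear expression is a sum of two bilinear expressions of lower order with
values in spaces of linear maps; hence the induction runs over all target spaces at once. -/
lemma CkTendsto.bilinear (hs : UniqueDiffOn ℝ s) (B : F →L[ℝ] F' →L[ℝ] G) {n : ℕ}
    {u : P → E → F} {v : P → E → F'} {u₀ : E → F} {v₀ : E → F'}
    (hu : CkTendsto n l u u₀ s) (hv : CkTendsto n l v v₀ s) :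
    CkTendsto n l (fun p x => B (u p x) (v p x)) (fun x => B (u₀ x) (v₀ x)) s := by
  induction n generalizing F F' G with
  | zero =>
    refine ckTendsto_zero_iff.2 ⟨?_, ?_, fun q hq => ?_⟩
    · filter_upwards [hu.smooth, hv.smooth] with p h1 h2
      exact B.isBoundedBilinearMap.contDiff.comp_contDiffOn (h1.prodMk h2)
    · exact B.isBoundedBilinearMap.contDiff.comp_contDiffOn (hu.smooth_lim.prodMk hv.smooth_lim)
    · have := (hu.tendsto_zero hq).prodMk_nhds (hv.tendsto_zero hq)
      exact (B.isBoundedBilinearMap.continuous.tendsto _).comp this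
  | succ n ih =>
    have hu' := (ckTendsto_succ_iff hs).1 hu
    have hv' := (ckTendsto_succ_iff hs).1 hv
    have hd : ∀ {a : E → F} {b : E → F'}, ContDiffOn ℝ ∞ a s → ContDiffOn ℝ ∞ b s →
        EqOn (fderivWithin ℝ (fun x => B (a x) (b x)) s)
          (fun x => B.precompR E (a x) (fderivWithin ℝ b s x) +
            B.precompL E (fderivWithin ℝ a s x) (b x)) s := fun ha hb x hx =>
      ContinuousLinearMap.fderivWithin_of_bilinear B (ha.differentiableOn (by simp) x hx)
        (hb.differentiableOn (by simp) x hx) (hs x hx)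
    refine (ckTendsto_succ_iff hs).2 ⟨?_, ?_⟩
    · refine ckTendsto_zero_iff.2 ⟨?_, ?_, fun q hq => ?_⟩
      · filter_upwards [hu.smooth, hv.smooth] with p h1 h2
        exact B.isBoundedBilinearMap.contDiff.comp_contDiffOn (h1.prodMk h2)
      · exact B.isBoundedBilinearMap.contDiff.comp_contDiffOn (hu.smooth_lim.prodMk hv.smooth_lim)
      · have := (hu.tendsto_zero hq).prodMk_nhds (hv.tendsto_zero hq)
        exact (B.isBoundedBilinearMap.continuous.tendsto _).comp this
    · refine CkTendsto.congr (CkTendsto.add hs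
        (ih (B.precompR E) (hu.mono n.le_succ) hv'.2)
        (ih (B.precompL E) hu'.2 (hv.mono n.le_succ))) ?_ (hd hu.smooth_lim hv.smooth_lim)
      filter_upwards [hu.smooth, hv.smooth] with p h1 h2 using hd h1 h2

/-- By the chain rule the derivative is the composition pairing of `Du(v)` with `Dv`, so the
bilinear case and the induction hypothesis for `Du` apply. The order-zero statement holds because
convergence is required along moving points, which can be substituted. -/
lemma CkTendsto.comp (hs : UniqueDiffOn ℝ s) {t : Set E'} (ht : UniqueDiffOn ℝ t) {n : ℕ}
    {u : P → E' → F} {v : P → E → E'} {u₀ : E' → F} {v₀ : E → E'}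
    (hu : CkTendsto n l u u₀ t) (hv : CkTendsto n l v v₀ s)
    (hm : ∀ᶠ p in l, MapsTo (v p) s t) (hm₀ : MapsTo v₀ s t) :
    CkTendsto n l (fun p x => u p (v p x)) (fun x => u₀ (v₀ x)) s := by
  have base : ∀ {F : Type} [NormedAddCommGroup F] [NormedSpace ℝ F] {u : P → E' → F} {u₀ : E' → F},
      CkTendsto n l u u₀ t → CkTendsto 0 l (fun p x => u p (v p x)) (fun x => u₀ (v₀ x)) s := by
    intro F _ _ u u₀ hu
    refine ckTendsto_zero_iff.2 ⟨?_, hu.smooth_lim.comp hv.smooth_lim hm₀, fun q hq => ?_⟩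
    · filter_upwards [hu.smooth, hv.smooth, hm] with p h1 h2 h3 using h1.comp h2 h3
    · refine (hu.tendsto_zero (hm₀ hq)).comp
        (tendsto_fst.prodMk (tendsto_nhdsWithin_iff.2 ⟨hv.tendsto_zero hq, ?_⟩))
      filter_upwards [eventually_prod_mem l s q, eventually_prod_fst hm _] with py h1 h2
        using h2 h1
  induction n generalizing F with
  | zero => exact base hu
  | succ n ih =>
    have hu' := (ckTendsto_succ_iff ht).1 hu
    have hv' := (ckTendsto_succ_iff hs).1 hv
    refine (ckTendsto_succ_iff hs).2 ⟨base hu, ?_⟩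
    have hd : ∀ {a : E' → F} {b : E → E'}, ContDiffOn ℝ ∞ a t → ContDiffOn ℝ ∞ b s →
        MapsTo b s t → EqOn (fderivWithin ℝ (fun x => a (b x)) s)
          (fun x => ContinuousLinearMap.compL ℝ E E' F (fderivWithin ℝ a t (b x))
            (fderivWithin ℝ b s x)) s := fun ha hb hab x hx =>
      fderivWithin_comp (f := _) x (ha.differentiableOn (by simp) _ (hab hx))
        (hb.differentiableOn (by simp) x hx) hab (hs x hx)
    refine CkTendsto.congr (CkTendsto.bilinear hs (ContinuousLinearMap.compL ℝ E E' F)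
      (ih hu'.2 (hv.mono n.le_succ) ?_) hv'.2) ?_ (hd hu.smooth_lim hv.smooth_lim hm₀)
    · intro F _ _ w w₀ hw
      refine ckTendsto_zero_iff.2 ⟨?_, hw.smooth_lim.comp hv.smooth_lim hm₀, fun q hq => ?_⟩
      · filter_upwards [hw.smooth, hv.smooth, hm] with p h1 h2 h3 using h1.comp h2 h3
      · refine (hw.tendsto_zero (hm₀ hq)).comp
          (tendsto_fst.prodMk (tendsto_nhdsWithin_iff.2 ⟨hv.tendsto_zero hq, ?_⟩))
        filter_upwards [eventually_prod_mem l s q, eventually_prod_fst hm _] with py h1 h2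
          using h2 h1
    · filter_upwards [hu.smooth, hv.smooth, hm] with p h1 h2 h3 using hd h1 h2 h3

lemma SmoothTendsto.add (hs : UniqueDiffOn ℝ s) {u v : P → E → F} {u₀ v₀ : E → F}
    (hu : SmoothTendsto l u u₀ s) (hv : SmoothTendsto l v v₀ s) :
    SmoothTendsto l (fun p x => u p x + v p x) (fun x => u₀ x + v₀ x) s :=
  fun n => (hu n).add hs (hv n)

lemma SmoothTendsto.bilinear (hs : UniqueDiffOn ℝ s) (B : F →L[ℝ] F' →L[ℝ] G)
    {u : P → E → F} {v : P → E → F'} {u₀ : E → F} {v₀ : E → F'}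
    (hu : SmoothTendsto l u u₀ s) (hv : SmoothTendsto l v v₀ s) :
    SmoothTendsto l (fun p x => B (u p x) (v p x)) (fun x => B (u₀ x) (v₀ x)) s :=
  fun n => (hu n).bilinear hs B (hv n)

lemma SmoothTendsto.comp (hs : UniqueDiffOn ℝ s) {t : Set E'} (ht : UniqueDiffOn ℝ t)
    {u : P → E' → F} {v : P → E → E'} {u₀ : E' → F} {v₀ : E → E'}
    (hu : SmoothTendsto l u u₀ t) (hv : SmoothTendsto l v v₀ s)
    (hm : ∀ᶠ p in l, MapsTo (v p) s t) (hm₀ : MapsTo v₀ s t) :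
    SmoothTendsto l (fun p x => u p (v p x)) (fun x => u₀ (v₀ x)) s :=
  fun n => (hu n).comp hs ht (hv n) hm hm₀

lemma smoothTendsto_const (hs : UniqueDiffOn ℝ s) {f : E → F} (hf : ContDiffOn ℝ ∞ f s) :
    SmoothTendsto l (fun _ => f) f s := fun _ =>
  ⟨Eventually.of_forall fun _ => hf, hf, fun k _ q hq =>
    ((hf.continuousOn_iteratedFDerivWithin (by exact_mod_cast le_top) hs) q hq).tendsto.comp
      tendsto_snd⟩

lemma smoothTendsto_of_tendsto {c : P → F} {c₀ : F} (h : Tendsto c l (𝓝 c₀)) :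
    SmoothTendsto l (fun p (_ : E) => c p) (fun _ => c₀) s := by
  refine fun n => ⟨Eventually.of_forall fun _ => contDiffOn_const, contDiffOn_const,
    fun k _ q _ => ?_⟩
  rcases k with _ | k
  · simp only [iteratedFDerivWithin_zero_eq_comp]
    exact ((continuousMultilinearCurryFin0 ℝ E F).symm.continuous.tendsto _).comp
      (h.comp tendsto_fst)
  · simp only [iteratedFDerivWithin_succ_const]
    exact tendsto_const_nhds

/-- Left composition with a fixed smooth map. -/
lemma SmoothTendsto.left (hs : UniqueDiffOn ℝ s) {t : Set E'} (ht : UniqueDiffOn ℝ t)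
    {f : E' → F} (hf : ContDiffOn ℝ ∞ f t) {v : P → E → E'} {v₀ : E → E'}
    (hv : SmoothTendsto l v v₀ s) (hm : ∀ᶠ p in l, MapsTo (v p) s t) (hm₀ : MapsTo v₀ s t) :
    SmoothTendsto l (fun p x => f (v p x)) (fun x => f (v₀ x)) s :=
  (smoothTendsto_const ht hf).comp hs ht hv hm hm₀

/-- Right composition with a fixed smooth map. -/
lemma SmoothTendsto.right (hs : UniqueDiffOn ℝ s) {t : Set E'} (ht : UniqueDiffOn ℝ t)
    {u : P → E' → F} {u₀ : E' → F} (hu : SmoothTendsto l u u₀ t)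
    {f : E → E'} (hf : ContDiffOn ℝ ∞ f s) (hm : MapsTo f s t) :
    SmoothTendsto l (fun p x => u p (f x)) (fun x => u₀ (f x)) s :=
  hu.comp hs ht (smoothTendsto_const hs hf) (Eventually.of_forall fun _ => hm) hm

lemma SmoothTendsto.clm (hs : UniqueDiffOn ℝ s) (L : E' →L[ℝ] F) {v : P → E → E'} {v₀ : E → E'}
    (hv : SmoothTendsto l v v₀ s) : SmoothTendsto l (fun p x => L (v p x)) (fun x => L (v₀ x)) s :=
  hv.left hs uniqueDiffOn_univ L.contDiff.contDiffOn
    (Eventually.of_forall fun _ => mapsTo_univ _ _) (mapsTo_univ _ _)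

lemma SmoothTendsto.prodMk (hs : UniqueDiffOn ℝ s) {u : P → E → F} {v : P → E → F'} {u₀ : E → F}
    {v₀ : E → F'} (hu : SmoothTendsto l u u₀ s) (hv : SmoothTendsto l v v₀ s) :
    SmoothTendsto l (fun p x => (u p x, v p x)) (fun x => (u₀ x, v₀ x)) s := by
  refine ((hu.clm hs (ContinuousLinearMap.inl ℝ F F')).add hs
    (hv.clm hs (ContinuousLinearMap.inr ℝ F F'))).congr (Eventually.of_forall fun p x _ => ?_)
    fun x _ => ?_ <;> simp

/-- Change of the parameter. -/
lemma SmoothTendsto.param {l' : Filter Q} {m : Q → P} (hm : Tendsto m l' l) {u : P → E → F}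
    {u₀ : E → F} (hu : SmoothTendsto l u u₀ s) : SmoothTendsto l' (fun p => u (m p)) u₀ s :=
  fun n => ⟨hm.eventually (hu n).smooth, (hu n).smooth_lim, fun k hk q hq =>
    ((hu n).tendsto k hk q hq).comp (hm.prodMap tendsto_id)⟩

/-- Order-zero convergence gives the inclusion near each point of `K`; finitely many such
neighbourhoods cover `K`. -/
lemma SmoothTendsto.eventually_forall {u : P → E → F} {u₀ : E → F} (h : SmoothTendsto l u u₀ s)
    {K : Set E} (hK : IsCompact K) (hKs : K ⊆ s) {O : Set F} (hO : IsOpen O)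
    (hKO : MapsTo u₀ K O) : ∀ᶠ p in l, MapsTo (u p) K O := by
  have : ∀ q ∈ K, ∃ t ∈ 𝓝[K] q, ∀ᶠ p in l, ∀ y ∈ t, u p y ∈ O := by
    intro q hq
    have h1 := ((h 0).tendsto_zero (hKs hq)).eventually (hO.mem_nhds (hKO hq))
    obtain ⟨a, ha, b, hb, hab⟩ := mem_prod_iff.1 h1
    exact ⟨b, nhdsWithin_mono q hKs hb, by
      filter_upwards [ha] with p hp y hy using hab (show (p, y) ∈ a ×ˢ b from ⟨hp, hy⟩)⟩
  obtain ht := hK.induction_on (p := fun A => ∀ᶠ p in l, ∀ y ∈ A, u p y ∈ O)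
    (Eventually.of_forall fun _ _ h => absurd h (notMem_empty _))
    (fun A B hAB h => h.mono fun p hp y hy => hp y (hAB hy))
    (fun A B hA hB => by
      filter_upwards [hA, hB] with p h1 h2 y hy using hy.elim (h1 y) (h2 y))
    this
  exact ht

end SmoothConvergence

/-! ### Locality of smooth convergence, and functions of one real variable. -/

section Local

variable {P E F : Type} [NormedAddCommGroup E] [NormedSpace ℝ E] [NormedAddCommGroup F]
  [NormedSpace ℝ F] {l : Filter P} {s : Set E} {u : P → E → F} {u₀ : E → F}

lemma SmoothTendsto.inter_open (h : SmoothTendsto l u u₀ s) {W : Set E} (hW : IsOpen W) :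
    SmoothTendsto l u u₀ (s ∩ W) := by
  intro n
  refine ⟨(h n).smooth.mono fun p hp => hp.mono inter_subset_left,
    (h n).smooth_lim.mono inter_subset_left, fun k hk q hq => ?_⟩
  rw [iteratedFDerivWithin_inter_open hW hq.2]
  refine (((h n).tendsto k hk q hq.1).mono_left
    (prod_mono_right _ (nhdsWithin_mono q inter_subset_left))).congr' ?_
  filter_upwards [eventually_prod_mem l (s ∩ W) q] with py hpy
  rw [iteratedFDerivWithin_inter_open hW hpy.2]

lemma smoothTendsto_of_local (hsm : ∀ᶠ p in l, ContDiffOn ℝ ∞ (u p) s)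
    (h : ∀ q ∈ s, ∃ W, IsOpen W ∧ q ∈ W ∧ SmoothTendsto l u u₀ (s ∩ W)) :
    SmoothTendsto l u u₀ s := by
  intro n
  refine ⟨hsm, fun q hq => ?_, fun k hk q hq => ?_⟩
  · obtain ⟨W, hW, hqW, hh⟩ := h q hq
    exact ((hh n).smooth_lim q ⟨hq, hqW⟩).mono_of_mem_nhdsWithin
      (inter_mem_nhdsWithin s (hW.mem_nhds hqW))
  · obtain ⟨W, hW, hqW, hh⟩ := h q hq
    have h1 := (hh n).tendsto k hk q ⟨hq, hqW⟩
    rw [iteratedFDerivWithin_inter_open hW hqW, nhdsWithin_inter_of_mem'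
      (mem_nhdsWithin_of_mem_nhds (hW.mem_nhds hqW))] at h1
    refine h1.congr' ?_
    filter_upwards [tendsto_snd.eventually (mem_nhdsWithin_of_mem_nhds (hW.mem_nhds hqW))]
      with py hpy
    rw [iteratedFDerivWithin_inter_open hW hpy]

lemma tendsto_iteratedDerivWithin_iff {u : P → ℝ → F} {u₀ : ℝ → F} {s : Set ℝ} {k : ℕ} {q : ℝ}
    {l' : Filter (P × ℝ)} :
    Tendsto (fun py : P × ℝ => iteratedFDerivWithin ℝ k (u py.1) s py.2) l'
      (𝓝 (iteratedFDerivWithin ℝ k u₀ s q)) ↔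
    Tendsto (fun py : P × ℝ => iteratedDerivWithin k (u py.1) s py.2) l'
      (𝓝 (iteratedDerivWithin k u₀ s q)) := by
  simp only [iteratedFDerivWithin_eq_equiv_comp]
  exact ((ContinuousMultilinearMap.piFieldEquiv ℝ (Fin k)
    F).toHomeomorph.isInducing.tendsto_nhds_iff).symm

lemma smoothTendsto_real_iff {u : P → ℝ → F} {u₀ : ℝ → F} {s : Set ℝ} :
    SmoothTendsto l u u₀ s ↔ (∀ᶠ p in l, ContDiffOn ℝ ∞ (u p) s) ∧ ContDiffOn ℝ ∞ u₀ s ∧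
      ∀ k, ∀ q ∈ s, Tendsto (fun py : P × ℝ => iteratedDerivWithin k (u py.1) s py.2)
        (l ×ˢ 𝓝[s] q) (𝓝 (iteratedDerivWithin k u₀ s q)) :=
  ⟨fun h => ⟨(h 0).smooth, (h 0).smooth_lim, fun k q hq =>
    tendsto_iteratedDerivWithin_iff.1 ((h k).tendsto k le_rfl q hq)⟩,
  fun h _ => ⟨h.1, h.2.1, fun k _ q hq => tendsto_iteratedDerivWithin_iff.2 (h.2.2 k q hq)⟩⟩

end Local

/-! ### Flat functions on the half line and their extension by zero. -/

section Flat

set_option linter.unusedSectionVars false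

variable {E : Type} [NormedAddCommGroup E] [NormedSpace ℝ E]

/-- `f` is smooth on `[0, ∞)` and all its derivatives vanish at `0`. -/
structure FlatAtZero (f : ℝ → E) : Prop where
  smooth : ContDiffOn ℝ ∞ f (Ici 0)
  flat : ∀ k : ℕ, iteratedDerivWithin k f (Ici 0) 0 = 0

/-- The extension by zero to the negative half line. -/
noncomputable def flatExt (f : ℝ → E) (x : ℝ) : E := if 0 ≤ x then f x else 0

lemma flatExt_of_nonneg (f : ℝ → E) {x : ℝ} (hx : 0 ≤ x) : flatExt f x = f x := if_pos hx

lemma flatExt_of_neg (f : ℝ → E) {x : ℝ} (hx : x < 0) : flatExt f x = 0 := if_neg (not_le.2 hx)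

lemma FlatAtZero.apply_zero {f : ℝ → E} (hf : FlatAtZero f) : f 0 = 0 := by
  simpa using hf.flat 0

lemma FlatAtZero.derivWithin {f : ℝ → E} (hf : FlatAtZero f) :
    FlatAtZero (derivWithin f (Ici 0)) :=
  ⟨hf.smooth.derivWithin (uniqueDiffOn_Ici 0) (by simp), fun k => by
    rw [← iteratedDerivWithin_succ']
    exact hf.flat (k + 1)⟩

lemma flatExt_of_nonpos {f : ℝ → E} (hf : FlatAtZero f) {x : ℝ} (hx : x ≤ 0) :
    flatExt f x = 0 := by
  rcases hx.lt_or_eq with h | rfl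
  · exact flatExt_of_neg f h
  · rw [flatExt_of_nonneg f le_rfl, hf.apply_zero]

/-- Extension by zero commutes with differentiation: at `0` both one-sided derivatives vanish. As
the derivative of a flat function is flat, this iterates to all orders. -/
lemma FlatAtZero.hasDerivAt_flatExt {f : ℝ → E} (hf : FlatAtZero f) (x : ℝ) :
    HasDerivAt (flatExt f) (flatExt (_root_.derivWithin f (Ici 0)) x) x := by
  have hd : ∀ y, 0 ≤ y → HasDerivWithinAt f (_root_.derivWithin f (Ici 0) y) (Ici 0) y := fun y hy =>
    (hf.smooth.differentiableOn (by simp) y hy).hasDerivWithinAt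
  rcases lt_trichotomy x 0 with hx | rfl | hx
  · rw [flatExt_of_neg _ hx]
    refine (hasDerivAt_const x (0 : E)).congr_of_eventuallyEq ?_
    filter_upwards [Iio_mem_nhds hx] with y hy using flatExt_of_neg f hy
  · have h1 : HasDerivWithinAt (flatExt f) 0 (Ici 0) 0 := by
      have h0 := hf.derivWithin.apply_zero
      have := hd 0 le_rfl
      rw [h0] at this
      exact this.congr (fun y hy => flatExt_of_nonneg f hy) (flatExt_of_nonneg f le_rfl)
    have h2 : HasDerivWithinAt (flatExt f) 0 (Iic 0) 0 :=
      (hasDerivWithinAt_const (0 : ℝ) (Iic 0) (0 : E)).congr (fun y hy => flatExt_of_nonpos hf hy)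
        (flatExt_of_nonpos hf le_rfl)
    have h3 := h2.union h1
    rw [Iic_union_Ici, hasDerivWithinAt_univ] at h3
    rwa [flatExt_of_nonpos hf.derivWithin le_rfl]
  · rw [flatExt_of_nonneg _ hx.le]
    refine ((hd x hx.le).hasDerivAt (Ici_mem_nhds hx)).congr_of_eventuallyEq ?_
    filter_upwards [Ioi_mem_nhds hx] with y hy using flatExt_of_nonneg f (le_of_lt hy)

lemma FlatAtZero.deriv_flatExt {f : ℝ → E} (hf : FlatAtZero f) :
    deriv (flatExt f) = flatExt (_root_.derivWithin f (Ici 0)) :=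
  funext fun x => (hf.hasDerivAt_flatExt x).deriv

lemma FlatAtZero.contDiff_flatExt {f : ℝ → E} (hf : FlatAtZero f) : ContDiff ℝ ∞ (flatExt f) := by
  rw [contDiff_infty]
  intro n
  induction n generalizing f with
  | zero => exact contDiff_zero.2 (continuous_iff_continuousAt.2 fun x =>
      (hf.hasDerivAt_flatExt x).continuousAt)
  | succ n ih =>
    rw [Nat.cast_succ]
    refine contDiff_succ_iff_deriv.2 ⟨fun x => (hf.hasDerivAt_flatExt x).differentiableAt,
      fun h => absurd h (by simp), ?_⟩
    rw [hf.deriv_flatExt]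
    exact ih hf.derivWithin

lemma FlatAtZero.iteratedDeriv_flatExt {f : ℝ → E} (hf : FlatAtZero f) (k : ℕ) :
    iteratedDeriv k (flatExt f) = flatExt (iteratedDerivWithin k f (Ici 0)) := by
  induction k generalizing f with
  | zero => rw [iteratedDeriv_zero, iteratedDerivWithin_zero]
  | succ k ih =>
    rw [iteratedDeriv_succ', hf.deriv_flatExt, ih hf.derivWithin]
    funext x
    simp only [flatExt]
    split_ifs with hx
    · rw [iteratedDerivWithin_succ']
    · rfl

/-- Only the point `0` needs care. Approaching it from the right, the hypothesis applies; from the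
left, the derivatives of the extensions are zero, which is also the limit value because `u₀` is
flat. -/
lemma SmoothTendsto.flatExt {P : Type} {l : Filter P} {u : P → ℝ → E} {u₀ : ℝ → E}
    (h : SmoothTendsto l u u₀ (Ici 0)) (hu : ∀ᶠ p in l, FlatAtZero (u p)) (hu₀ : FlatAtZero u₀) :
    SmoothTendsto l (fun p => flatExt (u p)) (flatExt u₀) univ := by
  obtain ⟨-, -, h3⟩ := smoothTendsto_real_iff.1 h
  refine smoothTendsto_real_iff.2 ⟨?_, hu₀.contDiff_flatExt.contDiffOn, fun k q _ => ?_⟩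
  · filter_upwards [hu] with p hp using hp.contDiff_flatExt.contDiffOn
  rw [nhdsWithin_univ, iteratedDerivWithin_univ, hu₀.iteratedDeriv_flatExt]
  refine Tendsto.congr' (f₁ := fun py : P × ℝ =>
    ReebFoliation.flatExt (iteratedDerivWithin k (u py.1) (Ici 0)) py.2) ?_ ?_
  · filter_upwards [eventually_prod_fst hu _] with py hpy
    rw [iteratedDerivWithin_univ, hpy.iteratedDeriv_flatExt]
  rcases lt_or_ge q 0 with hq | hq
  · rw [flatExt_of_neg _ hq]
    refine tendsto_const_nhds.congr' ?_
    filter_upwards [tendsto_snd.eventually (Iio_mem_nhds hq)] with py hpy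
    exact (flatExt_of_neg _ hpy).symm
  · have hsplit : 𝓝 q = 𝓝[Ici 0] q ⊔ 𝓝[Iio 0] q := by
      rw [← nhdsWithin_union, Ici_union_Iio, nhdsWithin_univ]
    rw [hsplit, prod_sup, tendsto_sup]
    constructor
    · rw [flatExt_of_nonneg _ hq]
      refine (h3 k q hq).congr' ?_
      filter_upwards [eventually_prod_mem l (Ici 0) q] with py hpy
      exact (flatExt_of_nonneg _ hpy).symm
    · rcases hq.lt_or_eq with hq' | rfl
      · have : 𝓝[Iio 0] q = ⊥ := by
          rw [← notMem_closure_iff_nhdsWithin_eq_bot, closure_Iio]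
          simpa using hq'
        rw [this, prod_bot]
        exact tendsto_bot
      · rw [flatExt_of_nonneg _ le_rfl, hu₀.flat k]
        refine tendsto_const_nhds.congr' ?_
        filter_upwards [eventually_prod_mem l (Iio 0) 0] with py hpy
        exact (flatExt_of_neg _ hpy).symm

lemma FlatAtZero.isLittleO {f : ℝ → E} (hf : FlatAtZero f) (k : ℕ) :
    f =o[𝓝[Ici 0] 0] fun x => x ^ k := by
  have h := taylor_isLittleO (n := k) (convex_Ici (0 : ℝ)) self_mem_Ici
    (hf.smooth.of_le (by exact_mod_cast le_top))
  have h0 : ∀ x, taylorWithinEval f k (Ici 0) 0 x = 0 := fun x => by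
    rw [taylor_within_apply]
    exact Finset.sum_eq_zero fun i _ => by rw [hf.flat i, smul_zero]
  simpa [h0] using h

/-- The leading term of a smooth function on `[0, ∞)` which is not flat at `0`. -/
lemma exists_leading_term {f : ℝ → E} (hf : ContDiffOn ℝ ∞ f (Ici 0)) (hn : ¬ FlatAtZero f) :
    ∃ (k : ℕ) (c : E), c ≠ 0 ∧ (fun x => f x - x ^ k • c) =o[𝓝[Ici 0] 0] fun x => x ^ k := by
  have hex : ∃ k : ℕ, iteratedDerivWithin k f (Ici 0) 0 ≠ 0 := by
    by_contra! h
    exact hn ⟨hf, h⟩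
  classical
  refine ⟨Nat.find hex, ((Nat.find hex).factorial : ℝ)⁻¹ • iteratedDerivWithin (Nat.find hex) f
    (Ici 0) 0, ?_, ?_⟩
  · exact smul_ne_zero (by positivity) (Nat.find_spec hex)
  · have h := taylor_isLittleO (n := Nat.find hex) (convex_Ici (0 : ℝ)) self_mem_Ici
      (hf.of_le (by exact_mod_cast le_top))
    -- At the first order with a nonzero derivative the Taylor polynomial is a single monomial.
    have h0 : ∀ x, taylorWithinEval f (Nat.find hex) (Ici 0) 0 x = x ^ (Nat.find hex) •
        ((Nat.find hex).factorial : ℝ)⁻¹ • iteratedDerivWithin (Nat.find hex) f (Ici 0) 0 := by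
      intro x
      rw [taylor_within_apply, Finset.sum_range_succ, Finset.sum_eq_zero, zero_add, sub_zero,
        smul_smul, mul_comm]
      intro i hi
      have := Nat.find_min hex (Finset.mem_range.1 hi)
      rw [not_not.1 this, smul_zero]
    simpa [h0] using h

end Flat

/-! ### Dynamics of diffeomorphisms of the half line. -/

section HalfLine

lemma coe_halfLineFun (e : ℝ≥0 → ℝ≥0) (x : ℝ≥0) : halfLineFun e x = e x := by
  simp [halfLineFun]

lemma halfLineFun_coe_mul (η ξ : HalfLineDiffeo) (x : ℝ) :
    halfLineFun (η * ξ).1 x = halfLineFun η.1 (halfLineFun ξ.1 x) :=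
  halfLineFun_comp η.1 ξ.1 x

lemma halfLineFun_one {x : ℝ} (hx : 0 ≤ x) : halfLineFun (1 : HalfLineDiffeo).1 x = x :=
  Real.coe_toNNReal x hx

lemma halfLineFun_inv_apply (η : HalfLineDiffeo) {x : ℝ} (hx : 0 ≤ x) :
    halfLineFun η⁻¹.1 (halfLineFun η.1 x) = x := by
  rw [← halfLineFun_coe_mul, inv_mul_cancel, halfLineFun_one hx]

lemma halfLineFun_apply_inv (η : HalfLineDiffeo) {x : ℝ} (hx : 0 ≤ x) :
    halfLineFun η.1 (halfLineFun η⁻¹.1 x) = x := by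
  rw [← halfLineFun_coe_mul, mul_inv_cancel, halfLineFun_one hx]

lemma halfLineFun_zero (η : HalfLineDiffeo) : halfLineFun η.1 0 = 0 := by
  simp [halfLineFun, homeomorph_zero]

lemma halfLineFun_smooth (η : HalfLineDiffeo) : ContDiffOn ℝ ∞ (halfLineFun η.1) (Ici 0) := η.2.1

lemma homeomorph_strictMono (e : ℝ≥0 ≃ₜ ℝ≥0) : StrictMono e := by
  rcases e.continuous.strictMono_of_inj e.injective with h | h
  · exact h
  · have h1 := h (zero_lt_one (α := ℝ≥0))
    rw [homeomorph_zero] at h1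
    exact absurd h1 not_lt_zero

lemma halfLineFun_strictMonoOn (η : HalfLineDiffeo) : StrictMonoOn (halfLineFun η.1) (Ici 0) := by
  intro x hx y hy hxy
  have : x.toNNReal < y.toNNReal := (Real.toNNReal_lt_toNNReal_iff_of_nonneg hx).2 hxy
  exact_mod_cast homeomorph_strictMono η.1 this

lemma halfLineFun_pos (η : HalfLineDiffeo) {x : ℝ} (hx : 0 < x) : 0 < halfLineFun η.1 x := by
  have := halfLineFun_strictMonoOn η self_mem_Ici hx.le hx
  rwa [halfLineFun_zero] at this

lemma halfLineFun_continuous (η : HalfLineDiffeo) : Continuous (halfLineFun η.1) :=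
  NNReal.continuous_coe.comp (η.1.continuous.comp continuous_real_toNNReal)

lemma coe_pow_apply (η : HalfLineDiffeo) (m : ℕ) (x : ℝ≥0) : (η ^ m).1 x = (η.1)^[m] x := by
  induction m generalizing x with
  | zero => rfl
  | succ m ih =>
    rw [pow_succ, Function.iterate_succ_apply, ← ih]
    rfl

/-- A bounded forward orbit is increasing, so it would converge to a positive fixed point, which an
expanding map does not have. -/
lemma IsExpanding.exists_le_pow {φ : HalfLineDiffeo} (hφ : IsExpanding φ) {x : ℝ≥0} (hx : 0 < x)
    (y : ℝ≥0) : ∃ m : ℕ, y ≤ (φ ^ m).1 x := by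
  by_contra! h
  simp only [coe_pow_apply] at h
  have hmono : Monotone fun m => (φ.1)^[m] x := monotone_nat_of_le_succ fun m => by
    rw [Function.iterate_succ_apply']
    rcases eq_zero_or_pos ((φ.1)^[m] x) with h0 | h0
    · rw [h0]; exact zero_le
    · exact (hφ _ h0).le
  have hb : BddAbove (range fun m => (φ.1)^[m] x) :=
    ⟨y, by rintro _ ⟨m, rfl⟩; exact (h m).le⟩
  have ht := tendsto_atTop_ciSup hmono hb
  have hfix := isFixedPt_of_tendsto_iterate ht φ.1.continuous.continuousAt
  have hpos : 0 < ⨆ m, (φ.1)^[m] x := hx.trans_le (le_ciSup hb 0)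
  exact (hφ _ hpos).ne' hfix

/-- The iterates of a map of the half line without fixed points in `(0, x]` tend to `0`. -/
lemma tendsto_iterate_zero {e : ℝ≥0 → ℝ≥0} (he : Continuous e) {x : ℝ≥0}
    (h0 : e 0 = 0) (h : ∀ y, 0 < y → y ≤ x → e y < y) :
    Tendsto (fun n => e^[n] x) atTop (𝓝 0) := by
  have hle : ∀ n, e^[n] x ≤ x ∧ e^[n + 1] x ≤ e^[n] x := by
    intro n
    induction n with
    | zero =>
      refine ⟨le_rfl, ?_⟩
      rcases eq_zero_or_pos x with hx | hx
      · simp [hx, h0]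
      · exact (h x hx le_rfl).le
    | succ n ih =>
      have h1 := ih.2.trans ih.1
      refine ⟨h1, ?_⟩
      rw [Function.iterate_succ_apply' e (n + 1)]
      rcases eq_zero_or_pos (e^[n + 1] x) with hx | hx
      · rw [hx, h0]
      · exact (h _ hx h1).le
  have hanti : Antitone fun n => e^[n] x := antitone_nat_of_succ_le fun n => (hle n).2
  have ht := tendsto_atTop_ciInf hanti (OrderBot.bddBelow _)
  have hfix := isFixedPt_of_tendsto_iterate ht he.continuousAt
  have hlx : (⨅ n, e^[n] x) ≤ x := ciInf_le (OrderBot.bddBelow _) 0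
  rcases eq_zero_or_pos (⨅ n, e^[n] x) with h1 | h1
  · rwa [h1] at ht
  · exact absurd hfix (h _ h1 hlx).ne

lemma IsExpanding.tendsto_inv_pow {φ : HalfLineDiffeo} (hφ : IsExpanding φ) (x : ℝ≥0) :
    Tendsto (fun n : ℕ => (φ⁻¹ ^ n : HalfLineDiffeo).1 x) atTop (𝓝 0) := by
  simp only [coe_pow_apply]
  refine tendsto_iterate_zero φ⁻¹.1.continuous (homeomorph_zero _) fun y hy _ => ?_
  have h1 : 0 < φ⁻¹.1 y := by
    have := homeomorph_strictMono φ⁻¹.1 hy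
    rwa [homeomorph_zero] at this
  have h2 := hφ _ h1
  have h3 : φ.1 (φ⁻¹.1 y) = y := φ.1.apply_symm_apply y
  rwa [h3] at h2

lemma flatAtZero_of_isFlat {φ : HalfLineDiffeo} (h : IsFlat φ) :
    FlatAtZero fun x => halfLineFun φ.1 x - x :=
  ⟨(halfLineFun_smooth φ).sub contDiffOn_id, h⟩

lemma tendsto_halfLineFun_zero (η : HalfLineDiffeo) :
    Tendsto (halfLineFun η.1) (𝓝[Ici 0] 0) (𝓝[Ici 0] 0) := by
  refine tendsto_nhdsWithin_iff.2 ⟨?_, Eventually.of_forall fun x => halfLineFun_nonneg _ x⟩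
  have := (halfLineFun_continuous η).tendsto 0
  rw [halfLineFun_zero] at this
  exact this.mono_left nhdsWithin_le_nhds

/-- Induction on `φ^(m+1)(x) - x = (φ^m(φ x) - φ x) + (φ x - x)`, where `φ(x) = O(x)` turns powers
of `φ(x)` into powers of `x`. -/
lemma halfLineFun_sub_isLittleO_pow {φ : HalfLineDiffeo} (h : IsFlat φ) (m k : ℕ) :
    (fun x => halfLineFun (φ ^ m : HalfLineDiffeo).1 x - x) =o[𝓝[Ici 0] 0] fun x : ℝ => x ^ k := by
  induction m with
  | zero =>
    refine (Asymptotics.isLittleO_zero (fun x : ℝ => x ^ k) (𝓝[Ici 0] (0 : ℝ))).congr' ?_ .rfl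
    filter_upwards [self_mem_nhdsWithin] with x hx
    rw [pow_zero, halfLineFun_one hx, sub_self]
  | succ m ih =>
    have h1 := ih.comp_tendsto (tendsto_halfLineFun_zero φ)
    have h2 : (halfLineFun φ.1) =O[𝓝[Ici 0] 0] fun x : ℝ => x := by
      have h3 : (fun x => halfLineFun φ.1 x - x) =o[𝓝[Ici 0] 0] fun x : ℝ => x := by
        simpa using (flatAtZero_of_isFlat h).isLittleO 1
      simpa using h3.isBigO.add (Asymptotics.isBigO_refl (fun x : ℝ => x) (𝓝[Ici 0] 0))
    have h4 := (h1.trans_isBigO (h2.pow k)).add ((flatAtZero_of_isFlat h).isLittleO k)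
    refine h4.congr (fun x => ?_) fun x => rfl
    rw [pow_succ, halfLineFun_coe_mul]
    simp

end HalfLine

/-! ### Flatness of the centralizer and of solutions of Schröder's equation. -/

section Centralizer

variable {φ : HalfLineDiffeo}

lemma commute_of_mem_centralizer {η : HalfLineDiffeo} (hη : η ∈ Centralizer φ) :
    Commute φ η := Subgroup.mem_centralizer_singleton_iff.1 hη |>.symm

/-- A sequence tending to `0` along which `φ ^ m - id` is at least `c x ^ k` contradicts flatness. -/
lemma false_of_seq_le (hφ : IsFlat φ) {m k : ℕ} {c : ℝ} (hc : 0 < c) {w : ℕ → ℝ≥0}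
    (hw : Tendsto w atTop (𝓝 0)) (hpos : ∀ n, 0 < w n)
    (hle : ∀ n, c * (w n : ℝ) ^ k ≤ (φ ^ m).1 (w n) - (w n : ℝ)) : False := by
  have h1 := (halfLineFun_sub_isLittleO_pow hφ m k).def (half_pos hc)
  have h2 : Tendsto (fun n => (w n : ℝ)) atTop (𝓝[Ici 0] 0) :=
    tendsto_nhdsWithin_iff.2 ⟨(NNReal.tendsto_coe (x := 0)).2 hw, Eventually.of_forall fun n => (w n).2⟩
  obtain ⟨n, hn⟩ := (h2.eventually h1).exists
  rw [coe_halfLineFun] at hn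
  have h3 : 0 < (w n : ℝ) ^ k := pow_pos (by exact_mod_cast hpos n) k
  have h4 := (le_abs_self _).trans hn
  rw [Real.norm_of_nonneg h3.le] at h4
  nlinarith [hle n]

/-- Elements of the centralizer of an expanding flat diffeomorphism are infinitely tangent to the
identity. -/
lemma flatAtZero_of_mem_centralizer (hφ : IsExpanding φ) (hφ_flat : IsFlat φ) {η : HalfLineDiffeo}
    (hη : η ∈ Centralizer φ) : FlatAtZero fun x => halfLineFun η.1 x - x := by
  by_contra hn
  obtain ⟨k, c, hc, hlead⟩ := exists_leading_term
    ((halfLineFun_smooth η).sub contDiffOn_id) hn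
  have hcomm := commute_of_mem_centralizer hη
  have hd := hlead.def (half_pos (abs_pos.2 hc))
  rw [eventually_nhdsWithin_iff, Metric.eventually_nhds_iff] at hd
  obtain ⟨δ, hδ, hd⟩ := hd
  have hb : ∀ y : ℝ≥0, 0 < y → (y : ℝ) < δ →
      |(η.1 y : ℝ) - y - (y : ℝ) ^ k * c| ≤ |c| / 2 * (y : ℝ) ^ k := by
    intro y hy hyδ
    have := @hd y (by simpa using hyδ) y.2
    rw [coe_halfLineFun, Real.norm_of_nonneg (pow_nonneg (NNReal.coe_nonneg y) k)] at this
    simpa using this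
  obtain ⟨x, hx, hxδ⟩ : ∃ x : ℝ≥0, 0 < x ∧ (x : ℝ) < δ :=
    ⟨⟨δ / 2, by positivity⟩, by exact_mod_cast half_pos hδ, half_lt_self hδ⟩
  have hcomm' : ∀ (m n : ℕ) (ξ : HalfLineDiffeo), Commute φ ξ → ∀ y : ℝ≥0,
      (φ ^ m).1 ((ξ ^ n).1 y) = (ξ ^ n).1 ((φ ^ m).1 y) := by
    intro m n ξ h y
    have := h.pow_pow m n
    exact congrArg (fun e : HalfLineDiffeo => e.1 y) this.eq
  have hposn : ∀ (ξ : HalfLineDiffeo), 0 < ξ.1 x := fun ξ => by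
    have := homeomorph_strictMono ξ.1 hx
    rwa [homeomorph_zero] at this
  -- Suppose `η(x) - x` has a nonzero leading term `c x^k`. Then `η` (if `c < 0`) or its inverse (if
  -- `c > 0`) contracts orbits to `0` and moves points by at least a multiple of `x^k`. As `φ` and
  -- `η` commute, one comparison of a power `φ^m` with `η` at the single point `x` propagates along
  -- the whole orbit, so `φ^m - id` is at least of order `x^k` there.
  rcases lt_or_gt_of_ne hc with hneg | hpos
  · have hlt : ∀ y : ℝ≥0, 0 < y → y ≤ x → |c| / 2 * (y : ℝ) ^ k ≤ y - η.1 y := by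
      intro y hy hyx
      have h1 := hb y hy (lt_of_le_of_lt (by exact_mod_cast hyx) hxδ)
      rw [abs_of_neg hneg] at h1 ⊢
      have := (abs_le.1 h1).2
      nlinarith
    have hlt' : ∀ y : ℝ≥0, 0 < y → y ≤ x → η.1 y < y := by
      intro y hy hyx
      have h1 := hlt y hy hyx
      have h2 : 0 < |c| / 2 * (y : ℝ) ^ k :=
        mul_pos (half_pos (abs_pos.2 hc)) (pow_pos (by exact_mod_cast hy) k)
      exact_mod_cast (by linarith : (η.1 y : ℝ) < y)
    have ht := tendsto_iterate_zero η.1.continuous (homeomorph_zero _) hlt'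
    obtain ⟨m, hm⟩ := hφ.exists_le_pow (hposn η) x
    have hnx : ∀ n, (η ^ n).1 x ≤ x := by
      intro n
      induction n with
      | zero => exact le_rfl
      | succ n ih =>
        have : (η ^ (n + 1)).1 x = η.1 ((η ^ n).1 x) := by rw [pow_succ']; rfl
        rw [this]
        exact (hlt' _ (hposn _) ih).le.trans ih
    refine false_of_seq_le (c := |c| / 2) (m := m) (k := k) (w := fun n => (η ^ (n + 1)).1 x)
      hφ_flat (half_pos (abs_pos.2 hc)) ?_ (fun n => hposn _) fun n => ?_
    · simp only [coe_pow_apply]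
      exact (tendsto_add_atTop_iff_nat 1).2 ht
    · have h1 : (η ^ (n + 1)).1 x = (η ^ n).1 (η.1 x) := by rw [pow_succ]; rfl
      have h1' : (η ^ (n + 1)).1 x = η.1 ((η ^ n).1 x) := by rw [pow_succ']; rfl
      -- This is `η^n` applied to `x ≤ φ^m(η x)`. At `w = η^(n+1) x` it yields `φ^m(w) - w ≥ η^n x -
      -- η(η^n x)`, and `w ≤ η^n x` lets the lower bound be expressed by `w^k`.
      have h2 : (η ^ n).1 x ≤ (φ ^ m).1 ((η ^ (n + 1)).1 x) := by
        rw [h1, hcomm' m n η hcomm]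
        exact (homeomorph_strictMono _).monotone hm
      have h3 := hlt _ (hposn (η ^ n)) (hnx n)
      rw [← h1'] at h3
      have h4 : (η ^ (n + 1)).1 x ≤ (η ^ n).1 x := by
        rw [h1']; exact (hlt' _ (hposn _) (hnx n)).le
      have h5 : ((η ^ (n + 1)).1 x : ℝ) ^ k ≤ ((η ^ n).1 x : ℝ) ^ k :=
        pow_le_pow_left₀ (NNReal.coe_nonneg _) (by exact_mod_cast h4) k
      have h6 : ((η ^ n).1 x : ℝ) ≤ (φ ^ m).1 ((η ^ (n + 1)).1 x) := by exact_mod_cast h2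
      have h7 := mul_le_mul_of_nonneg_left h5 (half_pos (abs_pos.2 hc)).le
      linarith
  · have hlt : ∀ y : ℝ≥0, 0 < y → y ≤ x → |c| / 2 * (y : ℝ) ^ k ≤ η.1 y - y := by
      intro y hy hyx
      have h1 := hb y hy (lt_of_le_of_lt (by exact_mod_cast hyx) hxδ)
      rw [abs_of_pos hpos] at h1 ⊢
      have := (abs_le.1 h1).1
      nlinarith
    have hinv : ∀ y, η.1 (η⁻¹.1 y) = y := fun y => η.1.apply_symm_apply y
    have hlt' : ∀ y : ℝ≥0, 0 < y → y ≤ x → η⁻¹.1 y < y := by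
      intro y hy hyx
      have hy' : 0 < η⁻¹.1 y := by
        have := homeomorph_strictMono η⁻¹.1 hy
        rwa [homeomorph_zero] at this
      by_contra! hle
      have h1 := hlt y hy hyx
      have h2 : 0 < |c| / 2 * (y : ℝ) ^ k :=
        mul_pos (half_pos (abs_pos.2 hc)) (pow_pos (by exact_mod_cast hy) k)
      have h3 : y < η.1 y := by exact_mod_cast (by linarith : (y : ℝ) < η.1 y)
      have h4 := (homeomorph_strictMono η.1).monotone hle
      rw [hinv] at h4
      exact absurd h3 (not_lt.2 h4)
    have ht := tendsto_iterate_zero η⁻¹.1.continuous (homeomorph_zero _) hlt'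
    obtain ⟨m, hm⟩ := hφ.exists_le_pow hx (η.1 x)
    have hnx : ∀ n, (η⁻¹ ^ n : HalfLineDiffeo).1 x ≤ x := by
      intro n
      induction n with
      | zero => exact le_rfl
      | succ n ih =>
        have : (η⁻¹ ^ (n + 1) : HalfLineDiffeo).1 x = η⁻¹.1 ((η⁻¹ ^ n : HalfLineDiffeo).1 x) := by
          rw [pow_succ']; rfl
        rw [this]
        exact (hlt' _ (hposn _) ih).le.trans ih
    refine false_of_seq_le (c := |c| / 2) (m := m) (k := k)
      (w := fun n => (η⁻¹ ^ n : HalfLineDiffeo).1 x)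
      hφ_flat (half_pos (abs_pos.2 hc)) ?_ (fun n => hposn _) fun n => ?_
    · simp only [coe_pow_apply]
      exact ht
    · have h1 : η.1 ((η⁻¹ ^ n : HalfLineDiffeo).1 x) = (η⁻¹ ^ n : HalfLineDiffeo).1 (η.1 x) := by
        have : Commute η (η⁻¹ ^ n) := ((Commute.refl η).inv_right).pow_right n
        exact congrArg (fun e : HalfLineDiffeo => e.1 x) this.eq
      -- This is `η^{-n}` applied to `η x ≤ φ^m x`; so `φ^m` moves the point at least as far as `η`
      -- does.
      have h2 : η.1 ((η⁻¹ ^ n : HalfLineDiffeo).1 x) ≤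
          (φ ^ m).1 ((η⁻¹ ^ n : HalfLineDiffeo).1 x) := by
        rw [h1, hcomm' m n η⁻¹ hcomm.inv_right]
        exact (homeomorph_strictMono _).monotone hm
      have h3 := hlt _ (hposn (η⁻¹ ^ n)) (hnx n)
      have h6 : (η.1 ((η⁻¹ ^ n : HalfLineDiffeo).1 x) : ℝ) ≤
        (φ ^ m).1 ((η⁻¹ ^ n : HalfLineDiffeo).1 x) := by exact_mod_cast h2
      linarith

/-- Smooth solutions of Schröder's equation `b(φ(x)) = λ b(x)`, `|λ| > 1`, are flat at `0`. -/
lemma flatAtZero_of_schroder (hφ_flat : IsFlat φ) {lam : ℂ} (hlam : 1 < ‖lam‖) {b : ℝ → ℂ}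
    (hb : ContDiffOn ℝ ∞ b (Ici 0)) (heq : ∀ x, 0 ≤ x → b (halfLineFun φ.1 x) = lam * b x) :
    FlatAtZero b := by
  by_contra hn
  obtain ⟨k, c, hc, hlead⟩ := exists_leading_term hb hn
  have hφ1 : (fun x => halfLineFun φ.1 x - x) =o[𝓝[Ici 0] 0] fun x : ℝ => x := by
    simpa using (flatAtZero_of_isFlat hφ_flat).isLittleO 1
  have hpos : ∀ᶠ x : ℝ in 𝓝[>] 0, (x : ℝ) ≠ 0 := by
    filter_upwards [self_mem_nhdsWithin] with x hx using (ne_of_gt hx)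
  have hle : 𝓝[>] (0 : ℝ) ≤ 𝓝[Ici 0] 0 := nhdsWithin_mono _ Ioi_subset_Ici_self
  have hq : Tendsto (fun x => halfLineFun φ.1 x / x) (𝓝[>] 0) (𝓝 1) := by
    have h1 := (hφ1.mono hle).tendsto_div_nhds_zero.add_const 1
    rw [zero_add] at h1
    refine h1.congr' ?_
    filter_upwards [hpos] with x hx
    field_simp
    ring
  have hlim : ∀ {g : ℝ → ℝ}, Tendsto g (𝓝[>] 0) (𝓝[>] 0) →
      Tendsto (fun x => ((g x ^ k : ℝ) : ℂ)⁻¹ * b (g x)) (𝓝[>] 0) (𝓝 c) := by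
    intro g hg
    have h1 : Tendsto (fun x : ℝ => ((x ^ k : ℝ) : ℂ)⁻¹ * b x) (𝓝[>] 0) (𝓝 c) := by
      have h2 : (fun x : ℝ => b x - (x ^ k) • c) =o[𝓝[>] 0] fun x : ℝ => ((x ^ k : ℝ) : ℂ) := by
        refine ((hlead.mono hle).norm_norm.congr_right fun x => ?_).of_norm_norm
        simp
      have h3 := h2.tendsto_div_nhds_zero.add_const c
      rw [zero_add] at h3
      refine h3.congr' ?_
      filter_upwards [hpos] with x hx
      have : ((x ^ k : ℝ) : ℂ) ≠ 0 := by exact_mod_cast pow_ne_zero k hx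
      rw [Complex.real_smul]
      field_simp
      ring
    exact h1.comp hg
  have hg : Tendsto (halfLineFun φ.1) (𝓝[>] 0) (𝓝[>] 0) := by
    refine tendsto_nhdsWithin_iff.2 ⟨?_, ?_⟩
    · exact ((tendsto_halfLineFun_zero φ).mono_left hle).mono_right nhdsWithin_le_nhds
    · filter_upwards [self_mem_nhdsWithin] with x hx using halfLineFun_pos φ hx
  have h1 := hlim hg
  have h2 := (hlim tendsto_id).const_mul lam
  have h3 : Tendsto (fun x => (((halfLineFun φ.1 x / x) ^ k : ℝ) : ℂ)) (𝓝[>] 0) (𝓝 1) := by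
    have := (Complex.continuous_ofReal.tendsto _).comp (hq.pow k)
    simpa [Function.comp_def] using this
  have h4 := h3.mul h1
  rw [one_mul] at h4
  -- The quotient `b(φ x) / x^k` is computed in two ways: by the functional equation its limit is `λ
  -- c`, and since `φ(x) / x → 1` its limit is `c`. This is impossible for `c ≠ 0`.
  have h5 : lam * c = c := by
    refine tendsto_nhds_unique h2 (h4.congr' ?_)
    filter_upwards [self_mem_nhdsWithin] with x hx
    have hx' : (x : ℂ) ≠ 0 := by exact_mod_cast (ne_of_gt hx)
    have hx2 : (halfLineFun φ.1 x : ℂ) ≠ 0 := by exact_mod_cast (halfLineFun_pos φ hx).ne'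
    rw [heq x (le_of_lt hx)]
    push_cast
    simp only [id, div_pow]
    field_simp
  have h6 : lam = 1 := mul_right_cancel₀ hc (by rw [h5, one_mul])
  rw [h6] at hlam
  simp at hlam

end Centralizer

/-! ### Holomorphic maps from the elliptic curve into leaves isomorphic to `ℂ`. -/

section CompactLeaf

/-- The unit `exp s`. -/
noncomputable def expUnit (s : ℂ) : ℂˣ := Units.mk0 (Complex.exp s) (Complex.exp_ne_zero s)

@[simp] lemma coe_expUnit (s : ℂ) : (expUnit s : ℂ) = Complex.exp s := rfl

lemma expUnit_add (s t : ℂ) : expUnit (s + t) = expUnit s * expUnit t :=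
  Units.ext (Complex.exp_add s t)

lemma exists_expUnit_eq (u : ℂˣ) : ∃ s, expUnit s = u :=
  ⟨Complex.log u, Units.ext (Complex.exp_log u.ne_zero)⟩

/-- The annulus `1 ≤ |z| < |λ|` is a fundamental domain for multiplication by `λ`. -/
lemma exists_mem_Ico_norm {lam : ℂˣ} (hlam : 1 < ‖(lam : ℂ)‖) (u : ℂˣ) :
    ∃ n : ℤ, 1 ≤ ‖((lam ^ n * u : ℂˣ) : ℂ)‖ ∧ ‖((lam ^ n * u : ℂˣ) : ℂ)‖ < ‖(lam : ℂ)‖ := by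
  obtain ⟨n, hn1, hn2⟩ := exists_mem_Ico_zpow (norm_pos_iff.2 u.ne_zero) hlam
  have hp : 0 < ‖(lam : ℂ)‖ := one_pos.trans hlam
  refine ⟨-n, ?_, ?_⟩
  · rw [Units.val_mul, norm_mul, Units.val_zpow_eq_zpow_val, norm_zpow, zpow_neg,
      ← div_eq_inv_mul, le_div_iff₀ (zpow_pos hp n), one_mul]
    exact hn1
  · rw [Units.val_mul, norm_mul, Units.val_zpow_eq_zpow_val, norm_zpow, zpow_neg,
      ← div_eq_inv_mul, div_lt_iff₀ (zpow_pos hp n), mul_comm, ← zpow_add_one₀ hp.ne']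
    exact hn2

lemma curve_mk_zpow_mul {lam : ℂˣ} (n : ℤ) (u : ℂˣ) :
    ((lam ^ n * u : ℂˣ) : Curve lam) = (u : Curve lam) := by
  rw [mul_comm]
  exact QuotientGroup.mk_mul_of_mem u (Subgroup.zpow_mem_zpowers lam n)

lemma curve_mk_eq_iff {lam u v : ℂˣ} : (u : Curve lam) = (v : Curve lam) ↔
    ∃ n : ℤ, v = lam ^ n * u := by
  constructor
  · intro h
    obtain ⟨n, hn⟩ := Subgroup.mem_zpowers_iff.1 (QuotientGroup.eq.1 h)
    exact ⟨n, by rw [hn, mul_comm, mul_inv_cancel_left]⟩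
  · rintro ⟨n, rfl⟩
    exact (curve_mk_zpow_mul n u).symm

/-- Every point of `H` is the image of a point `exp s` with `s` in a fixed compact set. -/
lemma exists_compact_exp {lam : ℂˣ} (hlam : 1 < ‖(lam : ℂ)‖) :
    ∃ K : Set ℂ, IsCompact K ∧ ∀ s, ∃ s' ∈ K, (expUnit s' : Curve lam) = expUnit s := by
  refine ⟨Icc 0 (Real.log ‖(lam : ℂ)‖) ×ℂ Icc (-Real.pi) Real.pi,
    isCompact_Icc.reProdIm isCompact_Icc, fun s => ?_⟩
  obtain ⟨n, hn1, hn2⟩ := exists_mem_Ico_norm hlam (expUnit s)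
  refine ⟨Complex.log ((lam ^ n * expUnit s : ℂˣ) : ℂ), ?_, ?_⟩
  · rw [Complex.mem_reProdIm, Complex.log_re, Complex.log_im]
    exact ⟨⟨Real.log_nonneg hn1, Real.log_le_log (one_pos.trans_le hn1) hn2.le⟩,
      (Complex.neg_pi_lt_arg _).le, Complex.arg_le_pi _⟩
  · have : expUnit (Complex.log ((lam ^ n * expUnit s : ℂˣ) : ℂ)) = lam ^ n * expUnit s :=
      Units.ext (Complex.exp_log (Units.ne_zero _))
    rw [this, curve_mk_zpow_mul]

/-- A holomorphic function on `H` is constant. -/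
lemma const_of_differentiable_periodic {lam : ℂˣ} (hlam : 1 < ‖(lam : ℂ)‖) {ζ : ℂ → ℂ}
    (hd : Differentiable ℂ ζ)
    (hp : ∀ s s', (expUnit s : Curve lam) = expUnit s' → ζ s = ζ s') (s s' : ℂ) : ζ s = ζ s' := by
  obtain ⟨K, hK, hs⟩ := exists_compact_exp hlam
  refine hd.apply_eq_apply_of_bounded ?_ s s'
  refine ((hK.image hd.continuous).isBounded).subset ?_
  rintro _ ⟨t, rfl⟩
  obtain ⟨t', ht', he⟩ := hs t
  exact ⟨t', ht', hp _ _ he⟩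

variable {X : Type}

/-- `D : ℂ → X` parametrizes a leaf: each slice of each chart is disjoint from the image of `D` or
maps holomorphically into it. -/
structure IsLeafParam (A : Parametrizations X) (D : ℂ → X) : Prop where
  injective : Function.Injective D
  slice : ∀ j y, (∀ z h, A.param j ⟨(z, y), h⟩ ∉ range D) ∨
    ∃ k : ℂ → ℂ, DifferentiableOn ℂ k {z | (z, y) ∈ A.dom j} ∧
      ∀ z h, A.param j ⟨(z, y), h⟩ = D (k z)

/-- `Γ` is a compact leaf given in local coordinates by `x = 0`. -/
def IsCompactLeaf {lam : ℂˣ} (A : Parametrizations X) (Γ : Curve lam → X) : Prop :=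
  ∀ u : ℂˣ, ∃ i, ∃ O : Set ℂ, IsOpen O ∧ (u : ℂ) ∈ O ∧ (0 : ℂ) ∉ O ∧ ∀ v : ℂˣ, (v : ℂ) ∈ O →
    ∃ h : ((v : ℂ), (0 : ℝ)) ∈ A.dom i, Γ v = A.param i ⟨((v : ℂ), 0), h⟩

/-- A leafwise holomorphic map from a compact leaf to a leaf isomorphic to `ℂ` is constant. -/
lemma IsCompactLeaf.map_const {lam : ℂˣ} (hlam : 1 < ‖(lam : ℂ)‖) {A : Parametrizations X}
    {Γ : Curve lam → X} (hΓ : IsCompactLeaf A Γ) {D : ℂ → X} (hD : IsLeafParam A D)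
    {f : X → X} (hf : IsLeafwiseMap A f) {w₀ : Curve lam} (hw₀ : f (Γ w₀) ∈ range D)
    (w w' : Curve lam) : f (Γ w) = f (Γ w') := by
  have hloc : ∀ s : ℂ, ∃ W, IsOpen W ∧ s ∈ W ∧
      ((∀ s' ∈ W, f (Γ (expUnit s')) ∉ range D) ∨
        ∃ k : ℂ → ℂ, DifferentiableOn ℂ k W ∧ ∀ s' ∈ W, f (Γ (expUnit s')) = D (k s')) := by
    intro s
    obtain ⟨i, O, hO, hsO, h0, hi⟩ := hΓ (expUnit s)
    obtain ⟨hdom, hval⟩ := hi _ hsO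
    obtain ⟨j, U, g, hU, hg⟩ := hf i _ hdom
    have hc : Continuous fun s' : ℂ => (Complex.exp s', (0 : ℝ)) :=
      Complex.continuous_exp.prodMk continuous_const
    have hdomi : ∀ s', Complex.exp s' ∈ O → (Complex.exp s', (0 : ℝ)) ∈ A.dom i := fun s' hs' =>
      (hi (expUnit s') hs').1
    refine ⟨Complex.exp ⁻¹' O ∩ (fun s' : ℂ => (Complex.exp s', (0 : ℝ))) ⁻¹' U,
      (hO.preimage Complex.continuous_exp).inter (hg.isOpen.preimage hc), ⟨hsO, hU⟩, ?_⟩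
    have hlift : ∀ s' ∈ Complex.exp ⁻¹' O ∩ (fun s' : ℂ => (Complex.exp s', (0 : ℝ))) ⁻¹' U,
        ∃ hd : ((g (Complex.exp s', 0)).1, (g (Complex.exp s, 0)).2) ∈ A.dom j,
          f (Γ (expUnit s')) = A.param j ⟨_, hd⟩ := by
      intro s' hs'
      obtain ⟨h1, h2⟩ := hi (expUnit s') hs'.1
      obtain ⟨h3, h4⟩ := hg.lift _ h1 hs'.2
      have h5 := hg.slice (Complex.exp s', 0) ⟨hs'.2, h1⟩ (Complex.exp s, 0) ⟨hU, hdom⟩ rfl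
      have h6 : g (Complex.exp s', 0) = ((g (Complex.exp s', 0)).1, (g (Complex.exp s, 0)).2) :=
        Prod.ext rfl h5
      refine ⟨h6 ▸ h3, ?_⟩
      rw [h2, h4]
      congr 1
      exact Subtype.ext h6
    rcases hD.slice j (g (Complex.exp s, 0)).2 with hn | ⟨k, hk, hk'⟩
    · refine Or.inl fun s' hs' => ?_
      obtain ⟨hd, he⟩ := hlift s' hs'
      rw [he]
      exact hn _ hd
    · refine Or.inr ⟨fun s' => k (g (Complex.exp s', 0)).1, ?_, fun s' hs' => ?_⟩
      · refine hk.comp (t := {z | (z, (g (Complex.exp s, 0)).2) ∈ A.dom j})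
          ((hg.holomorphic 0).comp Complex.differentiable_exp.differentiableOn ?_) ?_
        · exact fun s' hs' => ⟨hs'.2, hdomi s' hs'.1⟩
        · exact fun s' hs' => (hlift s' hs').1
      · obtain ⟨hd, he⟩ := hlift s' hs'
        rw [he]
        exact hk' _ hd
  -- Both alternatives are open conditions on `s`, so by connectedness the whole compact leaf goes
  -- into `D`. Its `D`-coordinate `ζ` is then entire and descends to the compact curve, hence is
  -- constant.
  have hclopen : IsClopen {s : ℂ | f (Γ (expUnit s)) ∈ range D} := by
    constructor
    · rw [← isOpen_compl_iff, isOpen_iff_mem_nhds]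
      intro s hs
      obtain ⟨W, hW, hsW, h | ⟨k, -, h⟩⟩ := hloc s
      · filter_upwards [hW.mem_nhds hsW] with s' hs' using h s' hs'
      · exact absurd ⟨k s, (h s hsW).symm⟩ hs
    · rw [isOpen_iff_mem_nhds]
      intro s hs
      obtain ⟨W, hW, hsW, h | ⟨k, -, h⟩⟩ := hloc s
      · exact absurd hs (h s hsW)
      · filter_upwards [hW.mem_nhds hsW] with s' hs' using ⟨k s', (h s' hs').symm⟩
  have huniv : {s : ℂ | f (Γ (expUnit s)) ∈ range D} = univ := by
    refine hclopen.eq_univ ?_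
    obtain ⟨u, rfl⟩ := QuotientGroup.mk_surjective w₀
    obtain ⟨s, rfl⟩ := exists_expUnit_eq u
    exact ⟨s, hw₀⟩
  have hall : ∀ s, ∃ z, D z = f (Γ (expUnit s)) := fun s => eq_univ_iff_forall.1 huniv s
  choose ζ hζ using hall
  have hdiff : Differentiable ℂ ζ := by
    intro s
    obtain ⟨W, hW, hsW, h | ⟨k, hk, h⟩⟩ := hloc s
    · exact absurd ⟨ζ s, hζ s⟩ (h s hsW)
    · refine ((hk s hsW).differentiableAt (hW.mem_nhds hsW)).congr_of_eventuallyEq ?_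
      filter_upwards [hW.mem_nhds hsW] with s' hs'
      exact hD.injective (by rw [hζ, h s' hs'])
  have hconst := const_of_differentiable_periodic hlam hdiff fun s s' he =>
    hD.injective (by rw [hζ, hζ, he])
  obtain ⟨u, rfl⟩ := QuotientGroup.mk_surjective w
  obtain ⟨s, rfl⟩ := exists_expUnit_eq u
  obtain ⟨u', rfl⟩ := QuotientGroup.mk_surjective w'
  obtain ⟨s', rfl⟩ := exists_expUnit_eq u'
  rw [← hζ, ← hζ, hconst s s']

/-- A number whose modulus lies strictly between `1` and `|λ|` is not a power of `λ`. Two distinct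
points are what makes a constant map contradict injectivity. -/
lemma exists_curve_ne {lam : ℂˣ} (hlam : 1 < ‖(lam : ℂ)‖) : ∃ w w' : Curve lam, w ≠ w' := by
  have h2 : (((1 + ‖(lam : ℂ)‖) / 2 : ℝ) : ℂ) ≠ 0 := by
    have : (0 : ℝ) < (1 + ‖(lam : ℂ)‖) / 2 := by linarith
    exact_mod_cast this.ne'
  refine ⟨((1 : ℂˣ) : Curve lam), (Units.mk0 _ h2 : Curve lam), fun h => ?_⟩
  obtain ⟨n, hn⟩ := curve_mk_eq_iff.1 h
  have h3 := congrArg (fun u : ℂˣ => ‖(u : ℂ)‖) hn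
  have h4 : (1 + ‖(lam : ℂ)‖) / 2 = ‖(lam : ℂ)‖ ^ n := by
    have h5 : |1 + ‖(lam : ℂ)‖| = 1 + ‖(lam : ℂ)‖ := abs_of_pos (by linarith)
    simpa [h5, -Complex.ofReal_div, -Complex.ofReal_add] using h3
  have h1 : 1 < (1 + ‖(lam : ℂ)‖) / 2 := by linarith
  have h1' : (1 + ‖(lam : ℂ)‖) / 2 < ‖(lam : ℂ)‖ := by linarith
  have h6 : ‖(lam : ℂ)‖ ^ (0 : ℤ) < ‖(lam : ℂ)‖ ^ n := by rwa [← h4, zpow_zero]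
  have h7 : ‖(lam : ℂ)‖ ^ n < ‖(lam : ℂ)‖ ^ (1 : ℤ) := by rwa [← h4, zpow_one]
  have h8 := (zpow_lt_zpow_iff_right₀ hlam).1 h6
  have h9 := (zpow_lt_zpow_iff_right₀ hlam).1 h7
  omega

end CompactLeaf

/-! ### Deck transformations of the cover. -/

section Deck

variable (φ : HalfLineDiffeo) (lam : ℂˣ)

/-- The deck transformation `T ^ n`, where `T(z, x) = (λ z, φ(x))`. -/
noncomputable def deckFun (n : ℤ) (q : ℂ × ℝ) : ℂ × ℝ :=
  (((lam ^ n : ℂˣ) : ℂ) * q.1, halfLineFun (φ ^ n : HalfLineDiffeo).1 q.2)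

/-- The point `[z, x]` of `R_{φ, λ}`, with a junk value outside the cover. -/
noncomputable def reebPt (q : ℂ × ℝ) : Reeb φ lam :=
  open Classical in
  if h : q ∈ cover then Reeb.mk φ lam ⟨q, h⟩
  else Reeb.mk φ lam ⟨(1, 0), le_rfl, fun h => one_ne_zero (congrArg Prod.fst h)⟩

variable {φ lam}

lemma mem_cover_of_pos {q : ℂ × ℝ} (h : 0 < q.2) : q ∈ cover :=
  ⟨h.le, fun h0 => h.ne' (congrArg Prod.snd h0)⟩

lemma mem_cover_of_ne {q : ℂ × ℝ} (h : 0 ≤ q.2) (h' : q.1 ≠ 0) : q ∈ cover :=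
  ⟨h, fun h0 => h' (congrArg Prod.fst h0)⟩

lemma fst_ne_zero_of_mem_cover {q : ℂ × ℝ} (h : q ∈ cover) (h' : q.2 = 0) : q.1 ≠ 0 :=
  fun h0 => h.2 (Prod.ext h0 h')

lemma mk_eq_reebPt (q : cover) : Reeb.mk φ lam q = reebPt φ lam q.1 := by
  rw [reebPt, dif_pos q.2]

lemma reebPt_of_mem {q : ℂ × ℝ} (hq : q ∈ cover) :
    reebPt φ lam q = Reeb.mk φ lam ⟨q, hq⟩ := (mk_eq_reebPt ⟨q, hq⟩).symm

lemma exists_reebPt (p : Reeb φ lam) : ∃ q ∈ cover, reebPt φ lam q = p := by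
  obtain ⟨q, rfl⟩ := Quotient.exists_rep p
  exact ⟨q.1, q.2, (mk_eq_reebPt q).symm⟩

lemma boundary_eq_reebPt (u : ℂˣ) : boundary φ lam u = reebPt φ lam ((u : ℂ), 0) :=
  (reebPt_of_mem (mem_cover_of_ne le_rfl u.ne_zero)).symm

@[simp] lemma deckFun_fst (n : ℤ) (q : ℂ × ℝ) :
    (deckFun φ lam n q).1 = ((lam ^ n : ℂˣ) : ℂ) * q.1 := rfl

@[simp] lemma deckFun_snd (n : ℤ) (q : ℂ × ℝ) :
    (deckFun φ lam n q).2 = halfLineFun (φ ^ n : HalfLineDiffeo).1 q.2 := rfl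

lemma deckFun_zero {q : ℂ × ℝ} (hq : 0 ≤ q.2) : deckFun φ lam 0 q = q :=
  Prod.ext (by simp) (by rw [deckFun_snd, zpow_zero, halfLineFun_one hq])

lemma deckFun_add (m n : ℤ) (q : ℂ × ℝ) :
    deckFun φ lam (m + n) q = deckFun φ lam m (deckFun φ lam n q) :=
  Prod.ext (by simp [zpow_add, mul_assoc]) (by
    rw [deckFun_snd, zpow_add, halfLineFun_coe_mul]
    rfl)

lemma deckFun_mem (n : ℤ) {q : ℂ × ℝ} (hq : q ∈ cover) : deckFun φ lam n q ∈ cover := by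
  rcases hq.1.lt_or_eq with h | h
  · exact mem_cover_of_pos (halfLineFun_pos _ h)
  · refine mem_cover_of_ne (halfLineFun_nonneg _ _) ?_
    exact mul_ne_zero (Units.ne_zero _) (fst_ne_zero_of_mem_cover hq h.symm)

lemma deckFun_neg_apply (n : ℤ) {q : ℂ × ℝ} (hq : 0 ≤ q.2) :
    deckFun φ lam (-n) (deckFun φ lam n q) = q := by
  rw [← deckFun_add, neg_add_cancel, deckFun_zero hq]

lemma deckFun_continuous (n : ℤ) : Continuous (deckFun φ lam n) :=
  (continuous_const.mul continuous_fst).prodMk ((halfLineFun_continuous _).comp continuous_snd)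

lemma deckFun_smooth (n : ℤ) : ContDiffOn ℝ ∞ (deckFun φ lam n) {q | 0 ≤ q.2} :=
  (contDiff_const.mul contDiff_fst).contDiffOn.prodMk
    ((halfLineFun_smooth _).comp contDiff_snd.contDiffOn fun _ hq => hq)

lemma reebPt_eq_iff {p q : ℂ × ℝ} (hp : p ∈ cover) (hq : q ∈ cover) :
    reebPt φ lam p = reebPt φ lam q ↔ ∃ n : ℤ, q = deckFun φ lam n p := by
  rw [reebPt_of_mem hp, reebPt_of_mem hq]
  refine ⟨fun h => ?_, fun ⟨n, hn⟩ => Quotient.sound ?_⟩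
  · obtain ⟨n, h1, h2⟩ := Quotient.exact h
    exact ⟨n, Prod.ext h1 h2⟩
  · exact ⟨n, congrArg Prod.fst hn, congrArg Prod.snd hn⟩

lemma reebPt_deckFun (n : ℤ) {q : ℂ × ℝ} (hq : q ∈ cover) :
    reebPt φ lam (deckFun φ lam n q) = reebPt φ lam q :=
  ((reebPt_eq_iff hq (deckFun_mem n hq)).2 ⟨n, rfl⟩).symm

lemma IsExpanding.lt_pow (hφ : IsExpanding φ) {x : ℝ} (hx : 0 < x) {n : ℕ} (hn : 0 < n) :
    x < halfLineFun (φ ^ n : HalfLineDiffeo).1 x := by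
  have hφ' : ∀ y : ℝ, 0 < y → y < halfLineFun φ.1 y := by
    intro y hy
    have := hφ ⟨y, hy.le⟩ hy
    have h1 := coe_halfLineFun φ.1 ⟨y, hy.le⟩
    exact lt_of_lt_of_eq (NNReal.coe_lt_coe.2 this) h1.symm
  induction n with
  | zero => omega
  | succ n ih =>
    rw [pow_succ', halfLineFun_coe_mul]
    rcases Nat.eq_zero_or_pos n with h0 | h0
    · rw [h0, pow_zero, halfLineFun_one hx.le]
      exact hφ' x hx
    · exact (ih h0).trans (hφ' _ (halfLineFun_pos _ hx))

lemma IsExpanding.lt_zpow (hφ : IsExpanding φ) {x : ℝ} (hx : 0 < x) {n : ℤ} (hn : 0 < n) :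
    x < halfLineFun (φ ^ n : HalfLineDiffeo).1 x := by
  lift n to ℕ using hn.le
  rw [zpow_natCast]
  exact hφ.lt_pow hx (by exact_mod_cast hn)

lemma IsExpanding.zpow_lt (hφ : IsExpanding φ) {x : ℝ} (hx : 0 < x) {n : ℤ} (hn : n < 0) :
    halfLineFun (φ ^ n : HalfLineDiffeo).1 x < x := by
  have h := hφ.lt_zpow (halfLineFun_pos (φ ^ n) hx) (neg_pos.2 hn)
  rwa [← halfLineFun_coe_mul, ← zpow_add, neg_add_cancel, zpow_zero, halfLineFun_one hx.le] at h

lemma IsExpanding.zpow_eq_zero (hφ : IsExpanding φ) {x : ℝ} (hx : 0 < x) {n : ℤ}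
    (h : halfLineFun (φ ^ n : HalfLineDiffeo).1 x = x) : n = 0 := by
  rcases lt_trichotomy n 0 with hn | hn | hn
  · exact absurd h (hφ.zpow_lt hx hn).ne
  · exact hn
  · exact absurd h (hφ.lt_zpow hx hn).ne'

/-- Every point of the cover has a neighbourhood which is disjoint from its translates. -/
lemma exists_nhd_disjoint (hφ : IsExpanding φ) (hlam : 1 < ‖(lam : ℂ)‖) {q : ℂ × ℝ}
    (hq : q ∈ cover) : ∃ U ∈ 𝓝 q, ∀ n : ℤ, ∀ p ∈ U, deckFun φ lam n p ∈ U → n = 0 := by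
  -- Off the axis `z = 0` the `z`-coordinate separates translates: the open annulus of radii `|q.1|
  -- / √|λ|` and `|q.1| √|λ|` is disjoint from its images. On the axis `x > 0`, and an interval `(y,
  -- φ(y))` containing `x` plays the same role.
  by_cases h0 : q.1 = 0
  · have hx : 0 < q.2 := lt_of_le_of_ne hq.1 fun h => hq.2 (Prod.ext h0 h.symm)
    have h1 : halfLineFun (φ ^ (-1 : ℤ) : HalfLineDiffeo).1 q.2 < q.2 := hφ.zpow_lt hx (by norm_num)
    obtain ⟨y, hy1, hy2⟩ := exists_between h1
    have hy0 : 0 < y := (halfLineFun_pos _ hx).trans hy1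
    have h2 : q.2 < halfLineFun φ.1 y := by
      have := halfLineFun_strictMonoOn φ (halfLineFun_nonneg _ _) hy0.le hy1
      rwa [zpow_neg_one, halfLineFun_apply_inv φ hx.le] at this
    have key : ∀ n : ℤ, 0 < n → ∀ p : ℝ, y < p → halfLineFun φ.1 y <
        halfLineFun (φ ^ n : HalfLineDiffeo).1 p := by
      intro n hn p hp
      have h3 := halfLineFun_strictMonoOn φ hy0.le (hy0.trans hp).le hp
      have h4 : halfLineFun φ.1 p ≤ halfLineFun (φ ^ n : HalfLineDiffeo).1 p := by
        have : (φ ^ n : HalfLineDiffeo) = φ ^ (n - 1) * φ := by rw [← zpow_add_one, sub_add_cancel]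
        rw [this, halfLineFun_coe_mul]
        rcases (show 0 ≤ n - 1 by omega).lt_or_eq with h | h
        · exact (hφ.lt_zpow (halfLineFun_pos φ (hy0.trans hp)) h).le
        · rw [← h, zpow_zero, halfLineFun_one (halfLineFun_nonneg _ _)]
      exact h3.trans_le h4
    refine ⟨{p | y < p.2 ∧ p.2 < halfLineFun φ.1 y}, ?_, ?_⟩
    · exact (((isOpen_lt continuous_const continuous_snd).inter
        (isOpen_lt continuous_snd continuous_const)).mem_nhds ⟨hy2, h2⟩)
    · rintro n p ⟨hp1, hp2⟩ ⟨hp3, hp4⟩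
      rw [deckFun_snd] at hp3 hp4
      rcases lt_trichotomy n 0 with hn | hn | hn
      · have h5 := key (-n) (by omega) _ hp3
        rw [← halfLineFun_coe_mul, ← zpow_add, neg_add_cancel, zpow_zero,
          halfLineFun_one (hy0.trans hp1).le] at h5
        exact absurd hp2 h5.not_gt
      · exact hn
      · exact absurd hp4 (key n hn _ hp1).not_gt
  · have hc : 0 < ‖q.1‖ := norm_pos_iff.2 h0
    set ρ := ‖(lam : ℂ)‖
    have hρ : 0 < ρ := one_pos.trans hlam
    have hr : 1 < √ρ := by rw [Real.lt_sqrt zero_le_one]; simpa using hlam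
    have hrr : √ρ * √ρ = ρ := Real.mul_self_sqrt hρ.le
    refine ⟨{p | ‖q.1‖ < ‖p.1‖ * √ρ ∧ ‖p.1‖ < ‖q.1‖ * √ρ}, ?_, ?_⟩
    · refine ((isOpen_lt continuous_const (continuous_fst.norm.mul continuous_const)).inter
        (isOpen_lt continuous_fst.norm continuous_const)).mem_nhds ⟨?_, ?_⟩ <;>
      exact lt_mul_of_one_lt_right hc hr
    · rintro n p ⟨hp1, hp2⟩ ⟨hp3, hp4⟩
      have hn : ‖(deckFun φ lam n p).1‖ = ρ ^ n * ‖p.1‖ := by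
        rw [deckFun_fst, norm_mul, Units.val_zpow_eq_zpow_val, norm_zpow]
      rw [hn] at hp3 hp4
      have hp0 : 0 < ‖p.1‖ := by
        by_contra h
        have : ‖p.1‖ = 0 := le_antisymm (not_lt.1 h) (norm_nonneg _)
        rw [this, zero_mul] at hp1
        exact absurd hc hp1.not_gt
      have hzp : 0 < ρ ^ n := zpow_pos hρ n
      have h5 : ρ ^ n < ρ ^ (1 : ℤ) := by
        rw [zpow_one]
        have : ρ ^ n * ‖p.1‖ < ρ * ‖p.1‖ := by
          calc ρ ^ n * ‖p.1‖ < ‖q.1‖ * √ρ := hp4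
            _ < ‖p.1‖ * √ρ * √ρ := mul_lt_mul_of_pos_right hp1 (by positivity)
            _ = ρ * ‖p.1‖ := by rw [mul_assoc, hrr, mul_comm]
        exact lt_of_mul_lt_mul_right this hp0.le
      have h6 : ρ ^ (0 : ℤ) < ρ ^ (n + 1) := by
        rw [zpow_zero, zpow_add_one₀ hρ.ne']
        have : 1 * ‖q.1‖ < ρ ^ n * ρ * ‖q.1‖ := by
          calc 1 * ‖q.1‖ < ρ ^ n * ‖p.1‖ * √ρ := by rw [one_mul]; exact hp3
            _ < ρ ^ n * (‖q.1‖ * √ρ) * √ρ := by gcongr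
            _ = ρ ^ n * (√ρ * √ρ) * ‖q.1‖ := by ring
            _ = ρ ^ n * ρ * ‖q.1‖ := by rw [hrr]
        exact lt_of_mul_lt_mul_right this hc.le
      have h7 := (zpow_lt_zpow_iff_right₀ hlam).1 h5
      have h8 := (zpow_lt_zpow_iff_right₀ hlam).1 h6
      omega

lemma deckFun_eq_self (hφ : IsExpanding φ) (hlam : 1 < ‖(lam : ℂ)‖) {q : ℂ × ℝ}
    (hq : q ∈ cover) {n : ℤ} (h : deckFun φ lam n q = q) : n = 0 := by
  obtain ⟨U, hU, hn⟩ := exists_nhd_disjoint hφ hlam hq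
  exact hn n q (mem_of_mem_nhds hU) (h.symm ▸ mem_of_mem_nhds hU)

lemma deckFun_injective (hφ : IsExpanding φ) (hlam : 1 < ‖(lam : ℂ)‖) {q : ℂ × ℝ}
    (hq : q ∈ cover) {m n : ℤ} (h : deckFun φ lam m q = deckFun φ lam n q) : m = n := by
  have h1 : deckFun φ lam (-n + m) q = q := by rw [deckFun_add, h, deckFun_neg_apply n hq.1]
  have := deckFun_eq_self hφ hlam hq h1
  omega

/-- Near `c` both lifts lie in a neighbourhood which meets none of its nontrivial translates, so the
deck transformation relating them is the identity. -/
lemma eventuallyEq_of_lifts (hφ : IsExpanding φ) (hlam : 1 < ‖(lam : ℂ)‖) {α : Type}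
    {l : Filter α} {g₁ g₂ : α → ℂ × ℝ} {c : ℂ × ℝ} (hc : c ∈ cover) (h1 : Tendsto g₁ l (𝓝 c))
    (h2 : Tendsto g₂ l (𝓝 c))
    (h : ∀ᶠ a in l, g₁ a ∈ cover ∧ g₂ a ∈ cover ∧ reebPt φ lam (g₁ a) = reebPt φ lam (g₂ a)) :
    g₁ =ᶠ[l] g₂ := by
  obtain ⟨U, hU, hn⟩ := exists_nhd_disjoint hφ hlam hc
  filter_upwards [h, h1 hU, h2 hU] with a ha hU1 hU2
  obtain ⟨n, hn'⟩ := (reebPt_eq_iff ha.1 ha.2.1).1 ha.2.2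
  have : n = 0 := hn n _ hU1 (hn' ▸ hU2)
  rw [hn', this, deckFun_zero ha.1.1]

lemma boundary_injective : Function.Injective (boundary φ lam) := by
  intro w w' h
  obtain ⟨u, rfl⟩ := QuotientGroup.mk_surjective w
  obtain ⟨v, rfl⟩ := QuotientGroup.mk_surjective w'
  change boundary φ lam (u : Curve lam) = boundary φ lam (v : Curve lam) at h
  change (u : Curve lam) = (v : Curve lam)
  rw [boundary_eq_reebPt, boundary_eq_reebPt, reebPt_eq_iff
    (mem_cover_of_ne le_rfl u.ne_zero) (mem_cover_of_ne le_rfl v.ne_zero)] at h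
  obtain ⟨n, hn⟩ := h
  exact curve_mk_eq_iff.2 ⟨n, Units.ext (congrArg Prod.fst hn)⟩

lemma reebPt_mem_range_boundary {q : ℂ × ℝ} (hq : q ∈ cover) :
    reebPt φ lam q ∈ range (boundary φ lam) ↔ q.2 = 0 := by
  constructor
  · rintro ⟨w, hw⟩
    obtain ⟨u, rfl⟩ := QuotientGroup.mk_surjective w
    change boundary φ lam (u : Curve lam) = _ at hw
    rw [boundary_eq_reebPt, reebPt_eq_iff (mem_cover_of_ne le_rfl u.ne_zero) hq] at hw
    obtain ⟨n, hn⟩ := hw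
    rw [hn, deckFun_snd, halfLineFun_zero]
  · intro h
    refine ⟨(Units.mk0 q.1 (fst_ne_zero_of_mem_cover hq h) : ℂˣ), ?_⟩
    rw [boundary_eq_reebPt]
    congr 1
    exact Prod.ext rfl h.symm

end Deck

/-! ### The cover is contractible and the projection is a covering map. -/

section Covering

/-- The missing corner destroys convexity, but on a segment starting at the interior point `(0, 1)`
only the other end can have `x = 0`. Contractibility supplies the simple connectivity needed for
lifting maps. -/
lemma cover_starConvex : StarConvex ℝ ((0 : ℂ), (1 : ℝ)) cover := by
  intro q hq a b ha hb hab
  have h2 : (a • ((0 : ℂ), (1 : ℝ)) + b • q).2 = a + b * q.2 := by simp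
  rcases ha.lt_or_eq with h | h
  · refine mem_cover_of_pos ?_
    rw [h2]
    have := mul_nonneg hb hq.1
    linarith
  · have hb1 : b = 1 := by linarith
    rw [← h, hb1]
    simpa using hq

instance : ContractibleSpace cover :=
  cover_starConvex.contractibleSpace ⟨(0, 1), mem_cover_of_pos one_pos⟩

/-- A ball which avoids the origin meets the closed half space in a convex set. -/
instance : LocallyPathConnectedSpace cover := by
  refine LocallyPathConnectedSpace.of_bases
    (p := fun (q : cover) (r : ℝ) => 0 < r ∧ Metric.ball q.1 r ⊆ {0}ᶜ)
    (s := fun q r => Metric.ball q r) (fun q => ?_) (fun q r hr => ?_)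
  · refine Metric.nhds_basis_ball.to_hasBasis (fun r hr => ?_) fun r hr => ⟨r, hr.1, Subset.rfl⟩
    obtain ⟨δ, hδ, hδ'⟩ := Metric.isOpen_iff.1 (isOpen_compl_singleton (x := (0 : ℂ × ℝ))) q.1 q.2.2
    exact ⟨min r δ, ⟨lt_min hr hδ, (Metric.ball_subset_ball (min_le_right _ _)).trans hδ'⟩,
      Metric.ball_subset_ball (min_le_left _ _)⟩
  · have hconv : Convex ℝ (Metric.ball q.1 r ∩ {p : ℂ × ℝ | 0 ≤ p.2}) :=
      (convex_ball _ _).inter (convex_halfSpace_ge (ContinuousLinearMap.snd ℝ ℂ ℝ).isLinear 0)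
    have himg : Subtype.val '' (Metric.ball q r) = Metric.ball q.1 r ∩ {p : ℂ × ℝ | 0 ≤ p.2} := by
      ext p
      constructor
      · rintro ⟨p, hp, rfl⟩
        exact ⟨hp, p.2.1⟩
      · rintro ⟨hp, hp'⟩
        exact ⟨⟨p, hp', hr.2 hp⟩, hp, rfl⟩
    rw [Topology.IsInducing.subtypeVal.isPathConnected_iff, himg]
    exact hconv.isPathConnected ⟨q.1, Metric.mem_ball_self hr.1, q.2.1⟩

variable (φ : HalfLineDiffeo) (lam : ℂˣ)

/-- The action of `ℤ` on the cover by deck transformations. -/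
@[reducible] noncomputable def deckAction : AddAction ℤ cover where
  vadd n q := ⟨deckFun φ lam n q.1, deckFun_mem n q.2⟩
  zero_vadd q := Subtype.ext (deckFun_zero q.2.1)
  add_vadd m n q := Subtype.ext (deckFun_add m n q.1)

variable {φ lam}

/-- The group `ℤ` acts by homeomorphisms, and every point has a neighbourhood disjoint from its
nontrivial translates. -/
lemma isCoveringMap_reebMk (hφ : IsExpanding φ) (hlam : 1 < ‖(lam : ℂ)‖) :
    IsCoveringMap (Reeb.mk φ lam) := by
  let := deckAction φ lam
  have hcov : IsAddQuotientCoveringMap (Reeb.mk φ lam) ℤ :=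
    { toIsQuotientMap := isQuotientMap_quotient_mk'
      continuous_const_vadd := fun n => ((deckFun_continuous n).comp
        continuous_subtype_val).subtype_mk fun q => deckFun_mem n q.2
      apply_eq_iff_mem_orbit := by
        intro p q
        rw [eq_comm, mk_eq_reebPt, mk_eq_reebPt, reebPt_eq_iff q.2 p.2, AddAction.mem_orbit_iff]
        exact exists_congr fun n => ⟨fun h => Subtype.ext h.symm, fun h => (congrArg Subtype.val h).symm⟩
      disjoint := by
        intro q
        obtain ⟨U, hU, hn⟩ := exists_nhd_disjoint hφ hlam q.2
        refine ⟨Subtype.val ⁻¹' U, continuous_subtype_val.continuousAt.preimage_mem_nhds hU, ?_⟩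
        rintro n ⟨_, ⟨p, hp, rfl⟩, hp'⟩
        exact hn n p.1 hp hp' }
  exact hcov.isCoveringMap

end Covering

/-! ### Lifts of self-maps of the Reeb component. -/

section DeckLift

variable {φ : HalfLineDiffeo} {lam : ℂˣ}

/-- `G` is a lift of `f` to the cover. -/
structure IsDeckLift (f : Reeb φ lam → Reeb φ lam) (G : ℂ × ℝ → ℂ × ℝ) : Prop where
  maps : ∀ q ∈ cover, G q ∈ cover
  cont : ContinuousOn G cover
  lift : ∀ q ∈ cover, f (reebPt φ lam q) = reebPt φ lam (G q)

lemma exists_isDeckLift (hφ : IsExpanding φ) (hlam : 1 < ‖(lam : ℂ)‖)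
    {f : Reeb φ lam → Reeb φ lam} (hf : Continuous f) : ∃ G, IsDeckLift f G := by
  classical
  have hmk : Continuous (Reeb.mk φ lam) := continuous_quotient_mk'
  let q₀ : cover := ⟨(0, 1), mem_cover_of_pos one_pos⟩
  obtain ⟨e₀, he₀⟩ := Quotient.exists_rep (f (Reeb.mk φ lam q₀))
  obtain ⟨F, ⟨-, hF⟩, -⟩ := (isCoveringMap_reebMk hφ hlam).existsUnique_continuousMap_lifts
    ⟨fun q => f (Reeb.mk φ lam q), hf.comp hmk⟩ q₀ e₀ he₀
  refine ⟨fun q => if h : q ∈ cover then (F ⟨q, h⟩).1 else 0, fun q hq => ?_, ?_, fun q hq => ?_⟩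
  · simp only [dif_pos hq]
    exact (F ⟨q, hq⟩).2
  · rw [continuousOn_iff_continuous_domRestrict]
    refine (continuous_subtype_val.comp F.continuous).congr fun q => ?_
    simp [q.2]
  · simp only [dif_pos hq]
    rw [← mk_eq_reebPt, reebPt_of_mem hq]
    exact (congrFun hF ⟨q, hq⟩).symm

lemma IsDeckLift.deck {f : Reeb φ lam → Reeb φ lam} {G : ℂ × ℝ → ℂ × ℝ} (h : IsDeckLift f G)
    (n : ℤ) : IsDeckLift f fun q => deckFun φ lam n (G q) :=
  ⟨fun q hq => deckFun_mem n (h.maps q hq), (deckFun_continuous n).comp_continuousOn h.cont,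
    fun q hq => by rw [h.lift q hq, reebPt_deckFun n (h.maps q hq)]⟩

lemma IsDeckLift.comp_deck {f : Reeb φ lam → Reeb φ lam} {G : ℂ × ℝ → ℂ × ℝ} (h : IsDeckLift f G)
    (n : ℤ) : IsDeckLift f fun q => G (deckFun φ lam n q) :=
  ⟨fun q hq => h.maps _ (deckFun_mem n hq),
    h.cont.comp (deckFun_continuous n).continuousOn fun q hq => deckFun_mem n hq,
    fun q hq => by rw [← h.lift _ (deckFun_mem n hq), reebPt_deckFun n hq]⟩

lemma IsDeckLift.comp {f f' : Reeb φ lam → Reeb φ lam} {G G' : ℂ × ℝ → ℂ × ℝ}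
    (h : IsDeckLift f G) (h' : IsDeckLift f' G') :
    IsDeckLift (fun p => f' (f p)) fun q => G' (G q) :=
  ⟨fun q hq => h'.maps _ (h.maps q hq), h'.cont.comp h.cont h.maps,
    fun q hq => by rw [h.lift q hq, h'.lift _ (h.maps q hq)]⟩

lemma isDeckLift_id : IsDeckLift (fun p : Reeb φ lam => p) fun q => q :=
  ⟨fun _ hq => hq, continuousOn_id, fun _ _ => rfl⟩

lemma IsDeckLift.unique (hφ : IsExpanding φ) (hlam : 1 < ‖(lam : ℂ)‖)
    {f : Reeb φ lam → Reeb φ lam} {G G' : ℂ × ℝ → ℂ × ℝ} (h : IsDeckLift f G)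
    (h' : IsDeckLift f G') : ∃ n : ℤ, ∀ q ∈ cover, G' q = deckFun φ lam n (G q) := by
  have h0 : ((0 : ℂ), (1 : ℝ)) ∈ cover := mem_cover_of_pos one_pos
  -- The two lifts are matched at one point by a deck transformation; unique lifting on the
  -- connected cover does the rest.
  obtain ⟨n, hn⟩ := (reebPt_eq_iff (h.maps _ h0) (h'.maps _ h0)).1
    ((h.lift _ h0).symm.trans (h'.lift _ h0))
  have hd := h.deck n
  have toCont : ∀ {H : ℂ × ℝ → ℂ × ℝ} (hH : IsDeckLift f H),
      Continuous fun q : cover => (⟨H q.1, hH.maps _ q.2⟩ : cover) := fun hH =>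
    (continuousOn_iff_continuous_domRestrict.1 hH.cont).subtype_mk _
  refine ⟨n, fun q hq => ?_⟩
  have := (isCoveringMap_reebMk hφ hlam).eq_of_comp_eq (toCont h') (toCont hd) (by
    funext q
    simp only [Function.comp_apply, mk_eq_reebPt]
    rw [← h'.lift _ q.2, ← hd.lift _ q.2]) ⟨(0, 1), h0⟩ (Subtype.ext hn)
  exact congrArg Subtype.val (congrFun this ⟨q, hq⟩)

lemma IsLeafwiseMap.continuous_reeb {f : Reeb φ lam → Reeb φ lam}
    (hf : IsLeafwiseMap (reebParam φ lam) f) : Continuous f := by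
  have hmk : Continuous (Reeb.mk φ lam) := continuous_quotient_mk'
  refine (isQuotientMap_quotient_mk'.continuous_iff).2 (continuous_iff_continuousAt.2 fun q => ?_)
  obtain ⟨j, U, g, hU, hg⟩ := hf () q.1 q.2
  have hopen : IsOpen (Subtype.val ⁻¹' U : Set cover) := hg.isOpen.preimage continuous_subtype_val
  have hon : ContinuousOn (fun p : cover => f (Reeb.mk φ lam p)) (Subtype.val ⁻¹' U) := by
    rw [continuousOn_iff_continuous_domRestrict]
    have h1 : Continuous fun p : (Subtype.val ⁻¹' U : Set cover) => g p.1.1 :=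
      hg.smooth.continuousOn.comp_continuous
        (continuous_subtype_val.comp continuous_subtype_val) fun p => ⟨p.2, p.1.2⟩
    refine (hmk.comp (h1.subtype_mk fun p => (hg.lift p.1.1 p.1.2 p.2).1)).congr fun p => ?_
    exact ((hg.lift p.1.1 p.1.2 p.2).2).symm
  exact hon.continuousAt (hopen.mem_nhds hU)

/-- Near `q` the global lift differs from a local expression of `f` by one fixed deck
transformation, which is smooth, preserves slices and is linear on them. So the continuous lift
inherits the regularity of `f`. -/
lemma IsDeckLift.leafwiseLift_local (hφ : IsExpanding φ) (hlam : 1 < ‖(lam : ℂ)‖)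
    {f : Reeb φ lam → Reeb φ lam} (hf : IsLeafwiseMap (reebParam φ lam) f) {G : ℂ × ℝ → ℂ × ℝ}
    (h : IsDeckLift f G) {q : ℂ × ℝ} (hq : q ∈ cover) :
    ∃ U, q ∈ U ∧ LeafwiseLift (reebParam φ lam) f () () U G := by
  obtain ⟨_, U, g, hU, hg⟩ := hf () q hq
  have hlift : ∀ p ∈ cover, p ∈ U → g p ∈ cover ∧ f (reebPt φ lam p) = reebPt φ lam (g p) := by
    intro p hp hpU
    obtain ⟨h1, h2⟩ := hg.lift p hp hpU
    refine ⟨h1, ?_⟩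
    rw [reebPt_of_mem hp, reebPt_of_mem h1]
    exact h2
  obtain ⟨n, hn⟩ := (reebPt_eq_iff (hlift q hq hU).1 (h.maps q hq)).1
    ((hlift q hq hU).2.symm.trans (h.lift q hq))
  have hUq : U ∈ 𝓝 q := hg.isOpen.mem_nhds hU
  have hgc : ContinuousWithinAt g cover q :=
    (hg.smooth.continuousOn q ⟨hU, hq⟩).mono_of_mem_nhdsWithin (inter_mem
      (mem_nhdsWithin_of_mem_nhds hUq) self_mem_nhdsWithin)
  have hev : G =ᶠ[𝓝[cover] q] fun p => deckFun φ lam n (g p) := by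
    refine eventuallyEq_of_lifts hφ hlam (h.maps q hq) (h.cont q hq) ?_ ?_
    · have := ((deckFun_continuous (φ := φ) (lam := lam) n).tendsto (g q)).comp hgc
      rw [← hn] at this
      exact this
    · filter_upwards [self_mem_nhdsWithin, mem_nhdsWithin_of_mem_nhds hUq] with p hp hpU
      obtain ⟨h1, h2⟩ := hlift p hp hpU
      exact ⟨h.maps p hp, deckFun_mem n h1, by rw [reebPt_deckFun n h1, ← h2, h.lift p hp]⟩
  obtain ⟨V, hV, hqV, hVG⟩ := mem_nhdsWithin.1 hev
  have hVG' : ∀ p ∈ (U ∩ V) ∩ cover, G p = deckFun φ lam n (g p) := fun p hp => hVG ⟨hp.1.2, hp.2⟩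
  have hsub : (U ∩ V) ∩ cover ⊆ U ∩ cover := fun p hp => ⟨hp.1.1, hp.2⟩
  refine ⟨U ∩ V, ⟨hU, hqV⟩, hg.isOpen.inter hV, fun p hp _ => ⟨h.maps p hp, ?_⟩, ?_, ?_, ?_⟩
  · have := h.lift p hp
    rwa [reebPt_of_mem hp, reebPt_of_mem (h.maps p hp)] at this
  · refine ((deckFun_smooth (φ := φ) (lam := lam) n).comp (hg.smooth.mono hsub) fun p hp => ?_).congr
      hVG'
    exact (hlift p hp.2 hp.1.1).1.1
  · intro p hp p' hp' he
    rw [hVG' p hp, hVG' p' hp', deckFun_snd, deckFun_snd, hg.slice p (hsub hp) p' (hsub hp') he]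
  · intro x
    have h1 : DifferentiableOn ℂ (fun z => ((lam ^ n : ℂˣ) : ℂ) * (g (z, x)).1)
        {z | (z, x) ∈ (U ∩ V) ∩ cover} :=
      ((hg.holomorphic x).mono fun z hz => hsub hz).const_mul _
    exact h1.congr fun z hz => by rw [hVG' _ hz, deckFun_fst]

end DeckLift

/-! ### The boundary leaf is preserved. -/

section BoundaryLeaf

variable {φ : HalfLineDiffeo} {lam : ℂˣ}

/-- No nontrivial power of `φ` fixes `x₀`, so the slice embeds in the quotient; the other slices of
the same leaf are its translates, related to it by multiplication by a power of `λ`. -/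
lemma isLeafParam_reeb (hφ : IsExpanding φ) {x₀ : ℝ} (hx₀ : 0 < x₀) :
    IsLeafParam (reebParam φ lam) fun z => reebPt φ lam (z, x₀) := by
  have hc : ∀ z : ℂ, (z, x₀) ∈ cover := fun z => mem_cover_of_pos hx₀
  constructor
  · intro z z' h
    obtain ⟨n, hn⟩ := (reebPt_eq_iff (hc z) (hc z')).1 h
    have h0 := hφ.zpow_eq_zero hx₀ (congrArg Prod.snd hn).symm
    rw [h0, deckFun_zero (hc z).1] at hn
    exact (congrArg Prod.fst hn).symm
  · intro j y
    by_cases hy : ∃ n : ℤ, y = halfLineFun (φ ^ n : HalfLineDiffeo).1 x₀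
    · obtain ⟨n, rfl⟩ := hy
      refine Or.inr ⟨fun z => ((lam ^ (-n) : ℂˣ) : ℂ) * z, by fun_prop, fun z h => ?_⟩
      change Reeb.mk φ lam ⟨_, h⟩ = _
      rw [mk_eq_reebPt, eq_comm, reebPt_eq_iff (hc _) h]
      refine ⟨n, Prod.ext ?_ rfl⟩
      rw [deckFun_fst, ← mul_assoc, ← Units.val_mul, ← zpow_add, add_neg_cancel, zpow_zero]
      simp
    · refine Or.inl fun z h => ?_
      rintro ⟨z', hz'⟩
      change _ = Reeb.mk φ lam ⟨_, h⟩ at hz'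
      rw [mk_eq_reebPt, reebPt_eq_iff (hc z') h] at hz'
      obtain ⟨n, hn⟩ := hz'
      exact hy ⟨n, congrArg Prod.snd hn⟩

lemma isCompactLeaf_reeb : IsCompactLeaf (reebParam φ lam) (boundary φ lam) := fun u =>
  ⟨(), {0}ᶜ, isOpen_compl_singleton, u.ne_zero, fun h => h rfl, fun v _ =>
    ⟨mem_cover_of_ne le_rfl v.ne_zero, rfl⟩⟩

/-- A boundary point sent to an interior leaf would force `f` to be constant on the whole boundary
leaf, against injectivity. -/
lemma map_boundary_mem (hφ : IsExpanding φ) (hlam : 1 < ‖(lam : ℂ)‖)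
    {f : Reeb φ lam → Reeb φ lam} (hf : IsLeafwiseMap (reebParam φ lam) f)
    (hinj : Function.Injective f) (w : Curve lam) :
    f (boundary φ lam w) ∈ range (boundary φ lam) := by
  obtain ⟨q, hq, he⟩ := exists_reebPt (f (boundary φ lam w))
  rw [← he, reebPt_mem_range_boundary hq]
  by_contra h0
  have hpos : 0 < q.2 := lt_of_le_of_ne hq.1 (Ne.symm h0)
  obtain ⟨w₁, w₂, hne⟩ := exists_curve_ne hlam
  exact hne (boundary_injective (hinj (isCompactLeaf_reeb.map_const hlam
    (isLeafParam_reeb hφ hpos) hf (w₀ := w) ⟨q.1, he⟩ w₁ w₂)))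

lemma IsDeckLift.snd_eq_zero (hφ : IsExpanding φ) (hlam : 1 < ‖(lam : ℂ)‖)
    {f : Reeb φ lam → Reeb φ lam} (hf : IsLeafwiseMap (reebParam φ lam) f)
    (hinj : Function.Injective f) {G : ℂ × ℝ → ℂ × ℝ} (h : IsDeckLift f G) {q : ℂ × ℝ}
    (hq : q ∈ cover) (h0 : q.2 = 0) : (G q).2 = 0 := by
  obtain ⟨w, hw⟩ := (reebPt_mem_range_boundary (φ := φ) (lam := lam) hq).2 h0
  rw [← reebPt_mem_range_boundary (φ := φ) (lam := lam) (h.maps q hq), ← h.lift q hq, ← hw]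
  exact map_boundary_mem hφ hlam hf hinj w

/-- A lift of an injective leafwise map is a leafwise map of the whole cover. -/
lemma IsDeckLift.leafwiseLift (hφ : IsExpanding φ) (hlam : 1 < ‖(lam : ℂ)‖)
    {f : Reeb φ lam → Reeb φ lam} (hf : IsLeafwiseMap (reebParam φ lam) f)
    (hinj : Function.Injective f) {G : ℂ × ℝ → ℂ × ℝ} (h : IsDeckLift f G) :
    LeafwiseLift (reebParam φ lam) f () () univ G := by
  refine ⟨isOpen_univ, fun q hq _ => ⟨h.maps q hq, ?_⟩, ?_, ?_, ?_⟩
  · have := h.lift q hq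
    rwa [reebPt_of_mem hq, reebPt_of_mem (h.maps q hq)] at this
  · rw [univ_inter]
    intro q hq
    obtain ⟨U, hU, hG⟩ := h.leafwiseLift_local hφ hlam hf hq
    exact (hG.smooth q ⟨hU, hq⟩).mono_of_mem_nhdsWithin (inter_mem
      (mem_nhdsWithin_of_mem_nhds (hG.isOpen.mem_nhds hU)) self_mem_nhdsWithin)
  · rintro ⟨z, x⟩ ⟨-, hq⟩ ⟨z', x'⟩ ⟨-, hq'⟩ (rfl : x = x')
    rcases (show 0 ≤ x from hq.1).lt_or_eq with hx | hx
    · have hlc : IsLocallyConstant fun z : ℂ => (G (z, x)).2 := by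
        rw [IsLocallyConstant.iff_eventually_eq]
        intro z
        obtain ⟨U, hU, hG⟩ := h.leafwiseLift_local hφ hlam hf
          (mem_cover_of_pos (q := (z, x)) hx)
        have hc : Continuous fun z : ℂ => (z, x) := by fun_prop
        filter_upwards [hc.continuousAt.preimage_mem_nhds (hG.isOpen.mem_nhds hU)] with z' hz'
        exact hG.slice _ ⟨hz', mem_cover_of_pos hx⟩ _ ⟨hU, mem_cover_of_pos hx⟩ rfl
      exact hlc.apply_eq_of_preconnectedSpace z z'
    · rw [h.snd_eq_zero hφ hlam hf hinj hq hx.symm, h.snd_eq_zero hφ hlam hf hinj hq' hx.symm]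
  · intro x z hz
    obtain ⟨U, hU, hG⟩ := h.leafwiseLift_local hφ hlam hf hz.2
    have hc : Continuous fun z : ℂ => (z, x) := by fun_prop
    refine (hG.holomorphic x z ⟨hU, hz.2⟩).mono_of_mem_nhdsWithin ?_
    filter_upwards [self_mem_nhdsWithin, mem_nhdsWithin_of_mem_nhds
      (hc.continuousAt.preimage_mem_nhds (hG.isOpen.mem_nhds hU))] with z' h1 h2
    exact ⟨h2, h1.2⟩

end BoundaryLeaf

/-! ### Liouville's theorem for linear growth. -/

section Affine

/-- An entire function of at most linear growth is affine. -/
lemma affine_of_linear_growth {g : ℂ → ℂ} (hg : Differentiable ℂ g) {C : ℝ}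
    (hC : ∀ z, ‖g z‖ ≤ C * (1 + ‖z‖)) (z : ℂ) : g z = (g 2 - g 1) * z + (2 * g 1 - g 2) := by
  have hC0 : 0 ≤ C := by simpa using (norm_nonneg _).trans (hC 0)
  -- Cauchy's estimate on the circle of radius `1 + |z|` about `z`, where `|w| ≤ 1 + 2 |z|`.
  have hb : ∀ z, ‖deriv g z‖ ≤ 2 * C := by
    intro z
    have hR : 0 < 1 + ‖z‖ := by positivity
    have h1 := Complex.norm_deriv_le_of_forall_mem_sphere_norm_le (c := z) (R := 1 + ‖z‖)
      (C := C * (2 * (1 + ‖z‖))) hR hg.diffContOnCl fun w hw => (hC w).trans ?_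
    · refine h1.trans (le_of_eq ?_)
      field_simp
    · have h2 : ‖w‖ ≤ ‖z‖ + (1 + ‖z‖) := by
        have h3 : ‖w - z‖ = 1 + ‖z‖ := mem_sphere_iff_norm.1 hw
        calc ‖w‖ = ‖z + (w - z)‖ := by rw [add_sub_cancel]
          _ ≤ ‖z‖ + ‖w - z‖ := norm_add_le _ _
          _ = _ := by rw [h3]
      exact mul_le_mul_of_nonneg_left (by linarith) hC0
  have hd : Differentiable ℂ (deriv g) := hg.deriv
  have hbd : Bornology.IsBounded (range (deriv g)) := by
    rw [isBounded_iff_forall_norm_le]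
    exact ⟨2 * C, by rintro _ ⟨z, rfl⟩; exact hb z⟩
  have hconst : ∀ z, deriv g z = deriv g 0 := fun z => hd.apply_eq_apply_of_bounded hbd z 0
  have haff : ∀ z, g z = deriv g 0 * z + g 0 := by
    intro z
    have h1 : Differentiable ℂ fun z => g z - deriv g 0 * z := by fun_prop
    have h2 := is_const_of_deriv_eq_zero h1 (fun w => by
      have := ((hg w).hasDerivAt.sub ((hasDerivAt_id w).const_mul (deriv g 0))).deriv
      rw [mul_one, hconst w, sub_self] at this
      exact this) z 0
    simp only [mul_zero, sub_zero] at h2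
    rw [← h2]
    ring
  -- The coefficients are expressed by the values at `1` and `2`, not at `0`: when `z ↦ G(z, x)` is
  -- considered up to `x = 0`, the point `z = 0` is missing from the boundary slice.
  rw [haff z, haff 2, haff 1]
  ring

end Affine

/-! ### Normal form of the automorphisms of a Reeb component. -/

section Structure

variable {φ : HalfLineDiffeo} {lam : ℂˣ}

/-- `G ∘ T` is again a lift of `f`, so it equals `T^k ∘ G`. The integer `k` is the endomorphism
induced on the deck group. -/
lemma IsDeckLift.exists_equivariant (hφ : IsExpanding φ) (hlam : 1 < ‖(lam : ℂ)‖)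
    {f : Reeb φ lam → Reeb φ lam} {G : ℂ × ℝ → ℂ × ℝ} (h : IsDeckLift f G) :
    ∃ k : ℤ, ∀ n : ℤ, ∀ q ∈ cover, G (deckFun φ lam n q) = deckFun φ lam (k * n) (G q) := by
  obtain ⟨k, hk⟩ := h.unique hφ hlam (h.comp_deck 1)
  have hneg : ∀ q ∈ cover, G (deckFun φ lam (-1) q) = deckFun φ lam (-k) (G q) := by
    intro q hq
    have h1 := hk _ (deckFun_mem (φ := φ) (lam := lam) (-1) hq)
    have h2 : deckFun φ lam 1 (deckFun φ lam (-1) q) = q := by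
      simpa using deckFun_neg_apply (φ := φ) (lam := lam) (-1) hq.1
    simp only [h2] at h1
    rw [h1, deckFun_neg_apply k (h.maps _ (deckFun_mem (-1) hq)).1]
  refine ⟨k, fun n => ?_⟩
  induction n using Int.induction_on with
  | zero => intro q hq; rw [mul_zero, deckFun_zero hq.1, deckFun_zero (h.maps q hq).1]
  | succ n ih =>
    intro q hq
    rw [deckFun_add, ih _ (deckFun_mem 1 hq), hk q hq, ← deckFun_add]
    congr 1
    ring
  | pred n ih =>
    intro q hq
    rw [sub_eq_add_neg, deckFun_add, ih _ (deckFun_mem (-1) hq), hneg q hq, ← deckFun_add]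
    congr 1
    ring

lemma IsDeckLift.injOn {f : Reeb φ lam → Reeb φ lam} (hφ : IsExpanding φ)
    (hinj : Function.Injective f) {G : ℂ × ℝ → ℂ × ℝ}
    (h : IsDeckLift f G) {x : ℝ} (hx : 0 < x) : Function.Injective fun z : ℂ => G (z, x) := by
  intro z z' he
  refine (isLeafParam_reeb (lam := lam) hφ hx).injective (hinj ?_)
  rw [h.lift _ (mem_cover_of_pos hx), h.lift _ (mem_cover_of_pos hx)]
  exact congrArg _ he

/-- A point `(z, x)` with `|z| ≥ 1` is `T^n p`, where `p` lies in the compact set of an annulus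
times `[0, x]`: negative powers of `φ` decrease the height. Equivariance multiplies the bound on
that set by `|λ|^(k n)`, while `|λ|^n ≤ |z|`. -/
lemma IsDeckLift.exists_growth (hφ : IsExpanding φ) (hlam : 1 < ‖(lam : ℂ)‖)
    {f : Reeb φ lam → Reeb φ lam} {G : ℂ × ℝ → ℂ × ℝ} (h : IsDeckLift f G) {k : ℤ}
    (hk : ∀ n : ℤ, ∀ q ∈ cover, G (deckFun φ lam n q) = deckFun φ lam (k * n) (G q))
    {x : ℝ} (hx : 0 < x) : ∃ C : ℝ, 0 ≤ C ∧ (∀ z, ‖z‖ ≤ 1 → ‖(G (z, x)).1‖ ≤ C) ∧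
      ∀ z, 1 ≤ ‖z‖ → ∃ n : ℕ, ‖(lam : ℂ)‖ ^ n ≤ ‖z‖ ∧
        ‖(G (z, x)).1‖ ≤ ‖(lam : ℂ)‖ ^ (k * n) * C := by
  have hp : 0 < ‖(lam : ℂ)‖ := one_pos.trans hlam
  have hK : IsCompact (((Metric.closedBall (0 : ℂ) ‖(lam : ℂ)‖ ∩ {z | 1 ≤ ‖z‖}) ×ˢ Icc 0 x) ∪
      (Metric.closedBall (0 : ℂ) 1 ×ˢ {x})) :=
    (((isCompact_closedBall _ _).inter_right
      (isClosed_le continuous_const continuous_norm)).prod isCompact_Icc).union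
      ((isCompact_closedBall _ _).prod isCompact_singleton)
  have hsub : (((Metric.closedBall (0 : ℂ) ‖(lam : ℂ)‖ ∩ {z | 1 ≤ ‖z‖}) ×ˢ Icc 0 x) ∪
      (Metric.closedBall (0 : ℂ) 1 ×ˢ {x})) ⊆ cover := by
    rintro ⟨z, y⟩ (⟨⟨-, h1⟩, h2⟩ | ⟨-, h2⟩)
    · exact mem_cover_of_ne h2.1 (norm_pos_iff.1 (one_pos.trans_le h1))
    · exact mem_cover_of_pos (h2.symm ▸ hx)
  obtain ⟨C, hC⟩ := hK.exists_bound_of_continuousOn (continuous_fst.comp_continuousOn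
    (h.cont.mono hsub))
  have hball : ∀ z : ℂ, ‖z‖ ≤ 1 → ‖(G (z, x)).1‖ ≤ C := fun z hz =>
    hC (z, x) (Or.inr ⟨by simpa using hz, rfl⟩)
  refine ⟨C, (norm_nonneg _).trans (hball 0 (by simp)), hball, fun z hz => ?_⟩
  have hz0 : z ≠ 0 := norm_pos_iff.1 (one_pos.trans_le hz)
  obtain ⟨m, hm1, hm2⟩ := exists_mem_Ico_norm hlam (Units.mk0 z hz0)
  have hnorm : ‖((lam ^ m * Units.mk0 z hz0 : ℂˣ) : ℂ)‖ = ‖(lam : ℂ)‖ ^ m * ‖z‖ := by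
    rw [Units.val_mul, norm_mul, Units.val_zpow_eq_zpow_val, norm_zpow]
    rfl
  have hm : m ≤ 0 := by
    by_contra! hm
    rw [hnorm] at hm2
    have h1 : ‖(lam : ℂ)‖ ^ (1 : ℤ) ≤ ‖(lam : ℂ)‖ ^ m := zpow_le_zpow_right₀ hlam.le (by omega)
    rw [zpow_one] at h1
    nlinarith
  obtain ⟨n, rfl⟩ : ∃ n : ℕ, m = -n := ⟨m.natAbs, by omega⟩
  refine ⟨n, ?_, ?_⟩
  · rw [hnorm, zpow_neg, zpow_natCast, ← div_eq_inv_mul, le_div_iff₀ (pow_pos hp n), one_mul] at hm1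
    exact hm1
  · set p : ℂ × ℝ := deckFun φ lam (-n) (z, x)
    have hpc : p ∈ cover := deckFun_mem _ (mem_cover_of_pos hx)
    have hzp : (z, x) = deckFun φ lam n p := by
      have := deckFun_neg_apply (φ := φ) (lam := lam) (-n) (q := (z, x)) hx.le
      rw [neg_neg] at this
      exact this.symm
    have hp1 : ‖p.1‖ = ‖((lam ^ (-n : ℤ) * Units.mk0 z hz0 : ℂˣ) : ℂ)‖ := rfl
    have hp2 : p.2 ≤ x := by
      rcases Nat.eq_zero_or_pos n with h0 | h0
      · have : p.2 = halfLineFun (φ ^ (-(n : ℤ)) : HalfLineDiffeo).1 x := rfl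
        rw [this, h0]
        simp only [Nat.cast_zero, neg_zero, zpow_zero, halfLineFun_one hx.le, le_refl]
      · exact (hφ.zpow_lt hx (by omega)).le
    have hCp := hC p (Or.inl ⟨⟨by rw [mem_closedBall_zero_iff, hp1]; exact hm2.le,
      by rw [mem_ofPred_eq, hp1]; exact hm1⟩, hpc.1, hp2⟩)
    rw [hzp, hk n p hpc, deckFun_fst, norm_mul, Units.val_zpow_eq_zpow_val, norm_zpow]
    exact mul_le_mul_of_nonneg_left hCp (zpow_nonneg hp.le _)

lemma IsDeckLift.differentiable (hφ : IsExpanding φ) (hlam : 1 < ‖(lam : ℂ)‖)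
    {f : Reeb φ lam → Reeb φ lam} (hf : IsLeafwiseMap (reebParam φ lam) f)
    (hinj : Function.Injective f) {G : ℂ × ℝ → ℂ × ℝ} (h : IsDeckLift f G) {x : ℝ} (hx : 0 < x) :
    Differentiable ℂ fun z => (G (z, x)).1 := by
  have h1 := (h.leafwiseLift hφ hlam hf hinj).holomorphic x
  have h2 : {z : ℂ | (z, x) ∈ univ ∩ (reebParam φ lam).dom ()} = univ :=
    eq_univ_of_forall fun z => ⟨mem_univ _, mem_cover_of_pos hx⟩
  rw [h2] at h1
  exact differentiableOn_univ.1 h1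

/-- For `k ≤ 0` the growth estimate bounds `G` on the slice `x = 1`; by Liouville it is constant
there, which contradicts injectivity on slices. -/
lemma IsDeckLift.equivariant_pos (hφ : IsExpanding φ) (hlam : 1 < ‖(lam : ℂ)‖)
    {f : Reeb φ lam → Reeb φ lam} (hf : IsLeafwiseMap (reebParam φ lam) f)
    (hinj : Function.Injective f) {G : ℂ × ℝ → ℂ × ℝ} (h : IsDeckLift f G) {k : ℤ}
    (hk : ∀ n : ℤ, ∀ q ∈ cover, G (deckFun φ lam n q) = deckFun φ lam (k * n) (G q)) : 0 < k := by
  by_contra! hk0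
  obtain ⟨C, hC0, hC1, hC2⟩ := h.exists_growth hφ hlam hk one_pos
  have hb : Bornology.IsBounded (range fun z => (G (z, 1)).1) := by
    rw [isBounded_iff_forall_norm_le]
    refine ⟨C, ?_⟩
    rintro _ ⟨z, rfl⟩
    rcases le_total ‖z‖ 1 with hz | hz
    · exact hC1 z hz
    · obtain ⟨n, -, hn⟩ := hC2 z hz
      refine hn.trans (mul_le_of_le_one_left hC0 ?_)
      exact zpow_le_one_of_nonpos₀ hlam.le (mul_nonpos_of_nonpos_of_nonneg hk0 (by positivity))
  have h1 := (h.differentiable hφ hlam hf hinj one_pos).apply_eq_apply_of_bounded hb 0 1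
  have h2 := (h.leafwiseLift hφ hlam hf hinj).slice (0, 1) ⟨mem_univ _, mem_cover_of_pos one_pos⟩
    (1, 1) ⟨mem_univ _, mem_cover_of_pos one_pos⟩ rfl
  exact zero_ne_one (h.injOn hφ hinj one_pos (Prod.ext h1 h2))

/-- The structure of the automorphisms of a Reeb component:
`[z, x] ↦ [a z + b(x), η(x)]` with `η` in the centralizer of `φ` and `b` a solution of Schröder's
equation. -/
structure IsReebLift (f : Reeb φ lam → Reeb φ lam) (a : ℂˣ) (b : ℝ → ℂ) (η : HalfLineDiffeo) :
    Prop where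
  smooth : ContDiffOn ℝ ∞ b (Ici 0)
  schroder : ∀ x, 0 ≤ x → b (halfLineFun φ.1 x) = lam * b x
  mem_centralizer : η ∈ Centralizer φ
  apply : ∀ q ∈ cover, f (reebPt φ lam q) = reebPt φ lam (a * q.1 + b q.2, halfLineFun η.1 q.2)

/-- Invertibility forces `k = 1`, so the growth on slices is linear and `G` is affine in `z`. The
coefficients are smooth up to `x = 0`, and equivariance determines how each of them transforms under
`φ`. -/
lemma exists_isReebLift (hφ : IsExpanding φ) (hlam : 1 < ‖(lam : ℂ)‖) (f : AutReeb φ lam) :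
    ∃ a b η, IsReebLift (f.1 : Reeb φ lam → Reeb φ lam) a b η := by
  obtain ⟨G, hG⟩ := exists_isDeckLift hφ hlam f.1.continuous
  obtain ⟨G', hG'⟩ := exists_isDeckLift hφ hlam f.1.symm.continuous
  obtain ⟨k, hk⟩ := hG.exists_equivariant hφ hlam
  obtain ⟨k', hk'⟩ := hG'.exists_equivariant hφ hlam
  have hid : IsDeckLift (fun p : Reeb φ lam => p) fun q => G' (G q) := by
    have := hG.comp hG'
    simpa using this
  obtain ⟨m, hm⟩ := isDeckLift_id.unique hφ hlam hid
  have hkpos := hG.equivariant_pos hφ hlam f.2.1 f.1.injective hk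
  have hk'pos := hG'.equivariant_pos hφ hlam f.2.2 f.1.symm.injective hk'
  have hc1 : ((0 : ℂ), (1 : ℝ)) ∈ cover := mem_cover_of_pos one_pos
  -- `G' ∘ G` lifts the identity, so it is `T^m`; evaluating it at `T(0, 1)` in two ways compares
  -- `k' k + m` with `m + 1`.
  have hkk : k' * k = 1 := by
    have h1 := hm _ (deckFun_mem (φ := φ) (lam := lam) 1 hc1)
    rw [hk 1 _ hc1, hk' _ _ (hG.maps _ hc1), hm _ hc1, ← deckFun_add, ← deckFun_add] at h1
    have := deckFun_injective hφ hlam hc1 h1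
    linarith
  have hk1 : k = 1 := by
    rcases Int.eq_one_or_neg_one_of_mul_eq_one' hkk with h | h <;> omega
  subst hk1
  simp only [one_mul] at hk
  -- the lift of the inverse
  obtain ⟨G'', hG'', hGG, hGG'⟩ : ∃ G'' : ℂ × ℝ → ℂ × ℝ, IsDeckLift f.1.symm G'' ∧
      (∀ q ∈ cover, G'' (G q) = q) ∧ (∀ q ∈ cover, G (G'' q) = q) := by
    refine ⟨_, hG'.deck (-m), fun q hq => ?_, fun q hq => ?_⟩
    · rw [hm q hq, deckFun_neg_apply m hq.1]
    · have hid' : IsDeckLift (fun p : Reeb φ lam => p) fun q => G (deckFun φ lam (-m) (G' q)) := by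
        have := (hG'.deck (-m)).comp hG
        simpa using this
      obtain ⟨j, hj⟩ := isDeckLift_id.unique hφ hlam hid'
      have h1 := hj _ (hG.maps _ hc1)
      rw [hm _ hc1, deckFun_neg_apply m hc1.1] at h1
      have h2 := deckFun_eq_self hφ hlam (hG.maps _ hc1) h1.symm
      rw [hj q hq, h2, deckFun_zero hq.1]
  have hL := hG.leafwiseLift hφ hlam f.2.1 f.1.injective
  have hL'' := hG''.leafwiseLift hφ hlam f.2.2 f.1.symm.injective
  have hcz : ∀ {z : ℂ} {x : ℝ}, z ≠ 0 → 0 ≤ x → (z, x) ∈ cover := fun hz hx =>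
    mem_cover_of_ne hx hz
  have h10 : (1 : ℂ) ≠ 0 := one_ne_zero
  have h20 : (2 : ℂ) ≠ 0 := two_ne_zero
  have hline : ∀ {H : ℂ × ℝ → ℂ × ℝ} {f' : Reeb φ lam → Reeb φ lam},
      LeafwiseLift (reebParam φ lam) f' () () univ H →
      ∀ z : ℂ, z ≠ 0 → ContDiffOn ℝ ∞ (fun x : ℝ => H (z, x)) (Ici 0) := by
    intro H f' hH z hz
    have h1 : ContDiffOn ℝ ∞ H cover :=
      hH.smooth.mono fun q hq => ⟨mem_univ q, hq⟩
    exact h1.comp (contDiffOn_const.prodMk contDiffOn_id) fun x hx => hcz hz hx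
  set a : ℝ → ℂ := fun x => (G (2, x)).1 - (G (1, x)).1 with ha
  set b : ℝ → ℂ := fun x => 2 * (G (1, x)).1 - (G (2, x)).1 with hb
  set η : ℝ → ℝ := fun x => (G (1, x)).2 with hη
  have ha_smooth : ContDiffOn ℝ ∞ a (Ici 0) :=
    (contDiff_fst.comp_contDiffOn (hline hL 2 h20)).sub
      (contDiff_fst.comp_contDiffOn (hline hL 1 h10))
  have hb_smooth : ContDiffOn ℝ ∞ b (Ici 0) :=
    (contDiffOn_const.mul (contDiff_fst.comp_contDiffOn (hline hL 1 h10))).sub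
      (contDiff_fst.comp_contDiffOn (hline hL 2 h20))
  have hη_smooth : ContDiffOn ℝ ∞ η (Ici 0) := contDiff_snd.comp_contDiffOn (hline hL 1 h10)
  have haff : ∀ x, 0 < x → ∀ z, (G (z, x)).1 = a x * z + b x := by
    intro x hx z
    obtain ⟨C, hC0, hC1, hC2⟩ := hG.exists_growth hφ hlam (k := 1) (by simpa using hk) hx
    refine affine_of_linear_growth (hG.differentiable hφ hlam f.2.1 f.1.injective hx) (C := C)
      (fun z => ?_) z
    rcases le_total ‖z‖ 1 with hz | hz
    · exact (hC1 z hz).trans (le_mul_of_one_le_right hC0 (by linarith [norm_nonneg z]))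
    · obtain ⟨n, hn1, hn2⟩ := hC2 z hz
      rw [one_mul, zpow_natCast] at hn2
      refine hn2.trans ?_
      rw [mul_comm]
      exact mul_le_mul_of_nonneg_left (by linarith) hC0
  -- On the boundary slice the affine formula is obtained as the limit `x → 0` at fixed `z ≠ 0`.
  have hG_eq : ∀ q ∈ cover, G q = (a q.2 * q.1 + b q.2, η q.2) := by
    rintro ⟨z, x⟩ hq
    rcases (show 0 ≤ x from hq.1).lt_or_eq with hx | rfl
    · refine Prod.ext (haff x hx z) ?_
      exact hL.slice _ ⟨mem_univ _, hq⟩ (1, x) ⟨mem_univ _, hcz h10 hx.le⟩ rfl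
    · have hz : z ≠ 0 := fst_ne_zero_of_mem_cover hq rfl
      refine Prod.ext ?_ (hL.slice _ ⟨mem_univ _, hq⟩ (1, 0) ⟨mem_univ _, hcz h10 le_rfl⟩ rfl)
      have hle : 𝓝[>] (0 : ℝ) ≤ 𝓝[Ici 0] 0 := nhdsWithin_mono _ Ioi_subset_Ici_self
      have h1 : Tendsto (fun x : ℝ => (G (z, x)).1) (𝓝[>] 0) (𝓝 (G (z, 0)).1) :=
        ((continuous_fst.comp_continuousOn (hline hL z hz).continuousOn) 0
          self_mem_Ici).tendsto.mono_left hle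
      have h2 : Tendsto (fun x : ℝ => a x * z + b x) (𝓝[>] 0) (𝓝 (a 0 * z + b 0)) :=
        (((ha_smooth.continuousOn.mul continuousOn_const).add hb_smooth.continuousOn) 0
          self_mem_Ici).tendsto.mono_left hle
      refine tendsto_nhds_unique h1 (h2.congr' ?_)
      filter_upwards [self_mem_nhdsWithin] with x hx using (haff x hx z).symm
  have hequiv : ∀ x, 0 ≤ x → ∀ z : ℂ, z ≠ 0 →
      a (halfLineFun φ.1 x) * (lam * z) + b (halfLineFun φ.1 x) = lam * (a x * z + b x) ∧
      η (halfLineFun φ.1 x) = halfLineFun φ.1 (η x) := by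
    intro x hx z hz
    have h1 := hk 1 (z, x) (hcz hz hx)
    rw [hG_eq _ (hcz hz hx), hG_eq _ (deckFun_mem 1 (hcz hz hx))] at h1
    simp only [deckFun, zpow_one, Prod.mk.injEq] at h1
    exact h1
  have ha_inv : ∀ x, 0 ≤ x → a (halfLineFun φ.1 x) = a x := by
    intro x hx
    have h1 := (hequiv x hx 1 h10).1
    have h2 := (hequiv x hx 2 h20).1
    have h3 : (lam : ℂ) * (a (halfLineFun φ.1 x) - a x) = 0 := by linear_combination h2 - h1
    rcases mul_eq_zero.1 h3 with h | h
    · exact absurd h lam.ne_zero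
    · exact sub_eq_zero.1 h
  have hb_eq : ∀ x, 0 ≤ x → b (halfLineFun φ.1 x) = lam * b x := by
    intro x hx
    have h1 := (hequiv x hx 1 h10).1
    rw [ha_inv x hx] at h1
    linear_combination h1
  -- `a` is constant along the backward orbit `φ^{-n} x`, which tends to `0`, and `a` is continuous
  -- at `0`.
  have ha_const : ∀ x, 0 ≤ x → a x = a 0 := by
    intro x hx
    have h1 : ∀ n : ℕ, a (((φ⁻¹ ^ n : HalfLineDiffeo).1 ⟨x, hx⟩ : ℝ≥0) : ℝ) = a x := by
      intro n
      induction n with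
      | zero => rfl
      | succ n ih =>
        rw [← ih, ← ha_inv _ (NNReal.coe_nonneg _), coe_halfLineFun]
        congr 2
        have : (φ * φ⁻¹ ^ (n + 1) : HalfLineDiffeo) = φ⁻¹ ^ n := by
          rw [pow_succ', mul_inv_cancel_left]
        exact congrArg (fun e : HalfLineDiffeo => e.1 ⟨x, hx⟩) this
    have h2 : Tendsto (fun n : ℕ => (((φ⁻¹ ^ n : HalfLineDiffeo).1 ⟨x, hx⟩ : ℝ≥0) : ℝ)) atTop
        (𝓝[Ici 0] 0) := tendsto_nhdsWithin_iff.2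
      ⟨(NNReal.tendsto_coe (x := 0)).2 (hφ.tendsto_inv_pow ⟨x, hx⟩),
        Eventually.of_forall fun n => NNReal.coe_nonneg _⟩
    have h3 := ((ha_smooth.continuousOn 0 self_mem_Ici).tendsto).comp h2
    refine tendsto_nhds_unique (tendsto_const_nhds.congr fun n => ?_) h3
    exact (h1 n).symm
  have ha_ne : a 0 ≠ 0 := by
    intro h0
    refine h10 ?_
    have h1 : G (1, 1) = G (2, 1) := by
      rw [hG_eq _ (hcz h10 zero_le_one), hG_eq _ (hcz h20 zero_le_one)]
      simp only [ha_const 1 zero_le_one, h0, zero_mul]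
    have := hG.injOn hφ f.1.injective one_pos h1
    norm_num at this
  -- the transverse diffeomorphism
  set η' : ℝ → ℝ := fun x => (G'' (1, x)).2 with hη'
  have hη'_smooth : ContDiffOn ℝ ∞ η' (Ici 0) := contDiff_snd.comp_contDiffOn (hline hL'' 1 h10)
  have hη_nn : ∀ x, 0 ≤ x → 0 ≤ η x := fun x hx => (hG.maps _ (hcz h10 hx)).1
  have hη'_nn : ∀ x, 0 ≤ x → 0 ≤ η' x := fun x hx => (hG''.maps _ (hcz h10 hx)).1
  -- The transverse part of a lift depends only on the slice, so `η` and `η'` may be composed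
  -- although their defining points on a slice differ.
  have hinv : ∀ x, 0 ≤ x → η' (η x) = x := by
    intro x hx
    have h1 := hL''.slice (G (1, x)) ⟨mem_univ _, hG.maps _ (hcz h10 hx)⟩ (1, η x)
      ⟨mem_univ _, hcz h10 (hη_nn x hx)⟩ rfl
    rw [hGG _ (hcz h10 hx)] at h1
    exact h1.symm
  have hinv' : ∀ x, 0 ≤ x → η (η' x) = x := by
    intro x hx
    have h1 := hL.slice (G'' (1, x)) ⟨mem_univ _, hG''.maps _ (hcz h10 hx)⟩ (1, η' x)
      ⟨mem_univ _, hcz h10 (hη'_nn x hx)⟩ rfl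
    rw [hGG' _ (hcz h10 hx)] at h1
    exact h1.symm
  have hcont : ∀ {ξ : ℝ → ℝ} (h : ∀ x, 0 ≤ x → 0 ≤ ξ x), ContDiffOn ℝ ∞ ξ (Ici 0) →
      Continuous fun x : ℝ≥0 => (⟨ξ x, h x x.2⟩ : ℝ≥0) := fun h hs =>
    (hs.continuousOn.comp_continuous NNReal.continuous_coe fun x => x.2).subtype_mk _
  let e : ℝ≥0 ≃ₜ ℝ≥0 :=
    { toFun := fun x => ⟨η x, hη_nn x x.2⟩
      invFun := fun x => ⟨η' x, hη'_nn x x.2⟩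
      left_inv := fun x => Subtype.ext (hinv x x.2)
      right_inv := fun x => Subtype.ext (hinv' x x.2)
      continuous_toFun := hcont hη_nn hη_smooth
      continuous_invFun := hcont hη'_nn hη'_smooth }
  have he1 : ∀ x, 0 ≤ x → halfLineFun e x = η x := fun x hx => by
    change η (x.toNNReal : ℝ) = η x
    rw [Real.coe_toNNReal x hx]
  have he2 : ∀ x, 0 ≤ x → halfLineFun e.symm x = η' x := fun x hx => by
    change η' (x.toNNReal : ℝ) = η' x
    rw [Real.coe_toNNReal x hx]
  let eη : HalfLineDiffeo := ⟨e, hη_smooth.congr he1, hη'_smooth.congr he2⟩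
  refine ⟨Units.mk0 (a 0) ha_ne, b, eη, hb_smooth, hb_eq, ?_, ?_⟩
  · rw [Subgroup.mem_centralizer_singleton_iff]
    refine Subtype.ext (Homeomorph.ext fun x => ?_)
    have h1 := (hequiv x x.2 1 h10).2
    have h2 : ((eη.1 (φ.1 x) : ℝ≥0) : ℝ) = φ.1 (eη.1 x) := by
      have h3 : ((eη.1 (φ.1 x) : ℝ≥0) : ℝ) = η (φ.1 x) := rfl
      have h4 : ((eη.1 x : ℝ≥0) : ℝ) = η x := rfl
      rw [h3, ← coe_halfLineFun φ.1 x, ← coe_halfLineFun φ.1 (eη.1 x), h4]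
      exact h1
    exact_mod_cast h2
  · intro q hq
    rw [hG.lift q hq, hG_eq q hq, ha_const q.2 hq.1]
    congr 2
    exact (he1 q.2 hq.1).symm

end Structure

/-! ### Maps in normal form: composition with deck transformations and quotients. -/

section ReebMap

variable {φ : HalfLineDiffeo} {lam : ℂˣ}

/-- The map `(z, x) ↦ (a z + b(x), η(x))`. -/
noncomputable def reebMap (a : ℂˣ) (b : ℝ → ℂ) (η : HalfLineDiffeo) (q : ℂ × ℝ) : ℂ × ℝ :=
  (a * q.1 + b q.2, halfLineFun η.1 q.2)

lemma reebMap_smooth {a : ℂˣ} {b : ℝ → ℂ} {η : HalfLineDiffeo} (hb : ContDiffOn ℝ ∞ b (Ici 0)) :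
    ContDiffOn ℝ ∞ (reebMap a b η) {q | 0 ≤ q.2} :=
  ((contDiff_const.mul contDiff_fst).contDiffOn.add
    (hb.comp contDiff_snd.contDiffOn fun _ hq => hq)).prodMk
    ((halfLineFun_smooth η).comp contDiff_snd.contDiffOn fun _ hq => hq)

lemma reebMap_mem {a : ℂˣ} {b : ℝ → ℂ} {η : HalfLineDiffeo} (hb : b 0 = 0) {q : ℂ × ℝ}
    (hq : q ∈ cover) : reebMap a b η q ∈ cover := by
  rcases hq.1.lt_or_eq with h | h
  · exact mem_cover_of_pos (halfLineFun_pos η h)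
  · refine mem_cover_of_ne (halfLineFun_nonneg _ _) ?_
    change (a : ℂ) * q.1 + b q.2 ≠ 0
    rw [← h, hb, add_zero]
    exact mul_ne_zero a.ne_zero (fst_ne_zero_of_mem_cover hq h.symm)

lemma reebMap_zero_mem {a : ℂˣ} {η : HalfLineDiffeo} {q : ℂ × ℝ} (hq : q ∈ cover) :
    reebMap a 0 η q ∈ cover := reebMap_mem (b := 0) (Pi.zero_apply 0) hq

section

variable {f : Reeb φ lam → Reeb φ lam} {a : ℂˣ} {b : ℝ → ℂ} {η : HalfLineDiffeo}

/-- Schröder's equation at the fixed point `0` reads `b(0) = λ b(0)`. This keeps the lift away from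
the missing corner. -/
lemma IsReebLift.apply_zero (h : IsReebLift f a b η) (hlam : 1 < ‖(lam : ℂ)‖) : b 0 = 0 := by
  have h1 := h.schroder 0 le_rfl
  rw [halfLineFun_zero] at h1
  by_contra h0
  have h2 : (lam : ℂ) = 1 := mul_right_cancel₀ h0 (by rw [← h1, one_mul])
  rw [h2] at hlam
  simp at hlam

lemma IsReebLift.flat (h : IsReebLift f a b η) (hφ_flat : IsFlat φ) (hlam : 1 < ‖(lam : ℂ)‖) :
    FlatAtZero b := flatAtZero_of_schroder hφ_flat hlam h.smooth h.schroder

lemma IsReebLift.apply' (h : IsReebLift f a b η) {q : ℂ × ℝ} (hq : q ∈ cover) :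
    f (reebPt φ lam q) = reebPt φ lam (reebMap a b η q) := h.apply q hq

lemma IsReebLift.leafwiseLift (h : IsReebLift f a b η) (hlam : 1 < ‖(lam : ℂ)‖) :
    LeafwiseLift (reebParam φ lam) f () () univ (reebMap a b η) := by
  refine ⟨isOpen_univ, fun q hq _ => ⟨reebMap_mem (h.apply_zero hlam) hq, ?_⟩, ?_, ?_, ?_⟩
  · have := h.apply' hq
    rwa [reebPt_of_mem hq, reebPt_of_mem (reebMap_mem (h.apply_zero hlam) hq)] at this
  · exact (reebMap_smooth h.smooth).mono fun q hq => hq.2.1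
  · intro q _ q' _ he
    change halfLineFun η.1 q.2 = halfLineFun η.1 q'.2
    rw [he]
  · intro x
    exact (((differentiable_id.const_mul (a : ℂ)).add_const (b x))).differentiableOn

lemma IsReebLift.boundary_apply (h : IsReebLift f a b η) (hlam : 1 < ‖(lam : ℂ)‖)
    (w : Curve lam) : f (boundary φ lam w) = boundary φ lam ((a : Curve lam) * w) := by
  obtain ⟨u, rfl⟩ := QuotientGroup.mk_surjective w
  change f (boundary φ lam (u : Curve lam)) = boundary φ lam ((a * u : ℂˣ) : Curve lam)
  rw [boundary_eq_reebPt, boundary_eq_reebPt, h.apply' (mem_cover_of_ne le_rfl u.ne_zero)]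
  congr 1
  exact Prod.ext (by simp [reebMap, h.apply_zero hlam]) (halfLineFun_zero η)

lemma IsReebLift.deck (h : IsReebLift f a b η) (hlam : 1 < ‖(lam : ℂ)‖) (n : ℤ) :
    IsReebLift f (lam ^ n * a) (fun x => ((lam ^ n : ℂˣ) : ℂ) * b x) (φ ^ n * η) := by
  refine ⟨contDiffOn_const.mul h.smooth, fun x hx => ?_, ?_, fun q hq => ?_⟩
  · rw [h.schroder x hx]; ring
  · refine mul_mem (zpow_mem ?_ n) h.mem_centralizer
    exact Subgroup.mem_centralizer_singleton_iff.2 rfl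
  · rw [h.apply' hq, ← reebPt_deckFun n (reebMap_mem (h.apply_zero hlam) hq)]
    congr 1
    refine Prod.ext ?_ (halfLineFun_coe_mul _ _ _).symm
    simp [reebMap]
    ring

lemma reebMap_deck (n : ℤ) (a : ℂˣ) (b : ℝ → ℂ) (η : HalfLineDiffeo) (q : ℂ × ℝ) :
    deckFun φ lam n (reebMap a b η q) =
      reebMap (lam ^ n * a) (fun x => ((lam ^ n : ℂˣ) : ℂ) * b x) (φ ^ n * η) q := by
  refine Prod.ext ?_ (halfLineFun_coe_mul _ _ _).symm
  simp [reebMap]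
  ring

end

/-- The lift of `f₀⁻¹ f` determined by lifts of `f` and `f₀`. -/
lemma IsReebLift.inv_mul {f f₀ : AutReeb φ lam} {a a₀ : ℂˣ} {b b₀ : ℝ → ℂ}
    {η η₀ : HalfLineDiffeo} (hlam : 1 < ‖(lam : ℂ)‖) (h : IsReebLift f.1 a b η)
    (h₀ : IsReebLift f₀.1 a₀ b₀ η₀) :
    IsReebLift (f₀⁻¹ * f).1 (a₀⁻¹ * a)
      (fun x => ((a₀⁻¹ : ℂˣ) : ℂ) * (b x - b₀ (halfLineFun (η₀⁻¹ * η).1 x))) (η₀⁻¹ * η) := by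
  have hmem : η₀⁻¹ * η ∈ Centralizer φ := mul_mem (inv_mem h₀.mem_centralizer) h.mem_centralizer
  have hb₁ : ((a₀⁻¹ : ℂˣ) : ℂ) * (b 0 - b₀ (halfLineFun (η₀⁻¹ * η).1 0)) = 0 := by
    rw [halfLineFun_zero, h.apply_zero hlam, h₀.apply_zero hlam]; simp
  refine ⟨?_, fun x hx => ?_, hmem, fun q hq => ?_⟩
  · exact contDiffOn_const.mul (h.smooth.sub (h₀.smooth.comp (halfLineFun_smooth _)
      fun x _ => halfLineFun_nonneg _ x))
  · have hc := commute_of_mem_centralizer hmem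
    have h1 : halfLineFun (η₀⁻¹ * η).1 (halfLineFun φ.1 x) =
        halfLineFun φ.1 (halfLineFun (η₀⁻¹ * η).1 x) := by
      rw [← halfLineFun_coe_mul, ← halfLineFun_coe_mul, hc.eq]
    rw [h1, h.schroder x hx, h₀.schroder _ (halfLineFun_nonneg _ _)]
    ring
  · change f₀.1.symm (f.1 _) = _
    rw [Homeomorph.symm_apply_eq, h.apply' hq]
    have hq' := reebMap_mem (a := a₀⁻¹ * a) (η := η₀⁻¹ * η)
      (b := fun x => ((a₀⁻¹ : ℂˣ) : ℂ) * (b x - b₀ (halfLineFun (η₀⁻¹ * η).1 x))) hb₁ hq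
    refine Eq.trans ?_ (h₀.apply' hq').symm
    congr 1
    refine Prod.ext ?_ ?_
    · simp only [reebMap, Units.val_mul]
      rw [mul_add, ← mul_assoc, ← mul_assoc, ← mul_assoc, Units.mul_inv, one_mul, one_mul]
      ring
    · simp only [reebMap]
      rw [← halfLineFun_coe_mul, mul_inv_cancel_left]

end ReebMap

/-! ### The automorphisms with `b = 0`. -/

section Linear

variable {φ : HalfLineDiffeo} {lam : ℂˣ}

/-- The self-map `[z, x] ↦ [a z, η(x)]` of the Reeb component. -/
noncomputable def linFun (a : ℂˣ) {η : HalfLineDiffeo} (hη : η ∈ Centralizer φ) :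
    Reeb φ lam → Reeb φ lam :=
  Quotient.map (fun q : cover => (⟨reebMap a 0 η q.1, reebMap_zero_mem q.2⟩ : cover)) (by
    rintro p q ⟨n, h1, h2⟩
    refine ⟨n, ?_, ?_⟩
    · simp only [reebMap, h1, Pi.zero_apply, add_zero]
      ring
    · simp only [reebMap, h2]
      rw [← halfLineFun_coe_mul, ← halfLineFun_coe_mul,
        ((commute_of_mem_centralizer hη).zpow_left n).eq])

lemma linFun_reebPt (a : ℂˣ) {η : HalfLineDiffeo} (hη : η ∈ Centralizer φ) {q : ℂ × ℝ}
    (hq : q ∈ cover) :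
    linFun (lam := lam) a hη (reebPt φ lam q) = reebPt φ lam (reebMap a 0 η q) := by
  rw [reebPt_of_mem hq, reebPt_of_mem (reebMap_zero_mem hq)]
  rfl

lemma isReebLift_linFun (a : ℂˣ) {η : HalfLineDiffeo} (hη : η ∈ Centralizer φ) :
    IsReebLift (linFun (lam := lam) a hη) a 0 η :=
  ⟨contDiffOn_const, fun x _ => by simp, hη, fun q hq => linFun_reebPt a hη hq⟩

lemma isLeafwiseMap_linFun (hlam : 1 < ‖(lam : ℂ)‖) (a : ℂˣ) {η : HalfLineDiffeo}
    (hη : η ∈ Centralizer φ) : IsLeafwiseMap (reebParam φ lam) (linFun a hη) := fun _ _ _ =>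
  ⟨(), univ, _, mem_univ _, (isReebLift_linFun a hη).leafwiseLift hlam⟩

lemma reebMap_linear_comp (a a' : ℂˣ) (η η' : HalfLineDiffeo) (q : ℂ × ℝ) :
    reebMap a 0 η (reebMap a' 0 η' q) = reebMap (a * a') 0 (η * η') q := by
  refine Prod.ext ?_ (halfLineFun_coe_mul _ _ _).symm
  simp [reebMap, mul_assoc]

lemma reebMap_one {q : ℂ × ℝ} (hq : 0 ≤ q.2) : reebMap 1 0 1 q = q :=
  Prod.ext (by simp [reebMap]) (halfLineFun_one hq)

lemma linFun_comp (a a' : ℂˣ) {η η' : HalfLineDiffeo} (hη : η ∈ Centralizer φ)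
    (hη' : η' ∈ Centralizer φ) (p : Reeb φ lam) :
    linFun a hη (linFun a' hη' p) = linFun (a * a') (mul_mem hη hη') p := by
  obtain ⟨q, hq, rfl⟩ := exists_reebPt p
  rw [linFun_reebPt a' hη' hq, linFun_reebPt a hη (reebMap_zero_mem hq), linFun_reebPt _ _ hq,
    reebMap_linear_comp]

lemma linFun_eq_self {a : ℂˣ} {η : HalfLineDiffeo} (hη : η ∈ Centralizer φ) (ha : a = 1)
    (he : η = 1) (p : Reeb φ lam) : linFun a hη p = p := by
  subst ha he
  obtain ⟨q, hq, rfl⟩ := exists_reebPt p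
  rw [linFun_reebPt 1 hη hq, reebMap_one hq.1]

/-- The automorphisms `[z, x] ↦ [a z, η(x)]`. -/
noncomputable def linAut (hlam : 1 < ‖(lam : ℂ)‖) : ℂˣ × Centralizer φ →* AutReeb φ lam where
  toFun c := ⟨
    { toFun := linFun c.1 c.2.2
      invFun := linFun c.1⁻¹ (c.2⁻¹).2
      left_inv := fun p => by
        rw [linFun_comp]
        exact linFun_eq_self _ (by simp) (by simp) p
      right_inv := fun p => by
        rw [linFun_comp]
        exact linFun_eq_self _ (by simp) (by simp) p
      continuous_toFun := (isLeafwiseMap_linFun hlam _ _).continuous_reeb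
      continuous_invFun := (isLeafwiseMap_linFun hlam _ _).continuous_reeb },
    isLeafwiseMap_linFun hlam c.1 c.2.2, isLeafwiseMap_linFun hlam c.1⁻¹ (c.2⁻¹).2⟩
  map_one' := Subtype.ext (Homeomorph.ext fun p => linFun_eq_self (one_mem _) rfl rfl p)
  map_mul' c d := Subtype.ext (Homeomorph.ext fun p => (linFun_comp c.1 d.1 c.2.2 d.2.2 p).symm)

lemma isReebLift_linAut (hlam : 1 < ‖(lam : ℂ)‖) (c : ℂˣ × Centralizer φ) :
    IsReebLift (linAut hlam c).1 c.1 0 c.2.1 := isReebLift_linFun c.1 c.2.2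

end Linear

/-! ### The mirror has the same automorphisms. -/

section Mirror

variable {φ : HalfLineDiffeo} {lam : ℂˣ}

/-- The reflection `(z, x) ↦ (z, -x)`. -/
def flip : (ℂ × ℝ) → ℂ × ℝ := fun q => (q.1, -q.2)

@[simp] lemma flip_snd (q : ℂ × ℝ) : (flip q).2 = -q.2 := rfl
@[simp] lemma flip_flip (q : ℂ × ℝ) : flip (flip q) = q := Prod.ext rfl (neg_neg _)

lemma flip_contDiff : ContDiff ℝ ∞ flip := contDiff_fst.prodMk contDiff_snd.neg

lemma flip_mem_cover {q : ℂ × ℝ} {i : (mirrorParam φ lam).ι} :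
    flip q ∈ cover ↔ q ∈ (mirrorParam φ lam).dom i := by
  change (0 ≤ -q.2 ∧ flip q ≠ 0) ↔ (q.2 ≤ 0 ∧ q ≠ 0)
  have : flip q = 0 ↔ q = 0 := by
    constructor
    · intro h
      have := congrArg flip h
      rw [flip_flip] at this
      rw [this]
      exact Prod.ext rfl neg_zero
    · rintro rfl
      exact Prod.ext rfl neg_zero
  rw [neg_nonneg, Ne, this]

lemma flip_mem_dom {q : ℂ × ℝ} {i : (mirrorParam φ lam).ι} :
    flip q ∈ (mirrorParam φ lam).dom i ↔ q ∈ cover := by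
  rw [← flip_mem_cover, flip_flip]

lemma mirrorParam_param {i : (mirrorParam φ lam).ι} (q : (mirrorParam φ lam).dom i) :
    (mirrorParam φ lam).param i q = reebPt φ lam (flip q.1) :=
  mk_eq_reebPt (φ := φ) (lam := lam) ⟨flip q.1, flip_mem_cover.2 q.2⟩

lemma reebParam_param {i : (reebParam φ lam).ι} (q : (reebParam φ lam).dom i) :
    (reebParam φ lam).param i q = reebPt φ lam q.1 := mk_eq_reebPt (φ := φ) (lam := lam) q

/-- Local expressions are conjugated by the reflection, a smooth involution that permutes the slices
and does not change the leaf coordinate. -/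
lemma isLeafwiseMap_mirror_iff {f : Reeb φ lam → Reeb φ lam} :
    IsLeafwiseMap (mirrorParam φ lam) f ↔ IsLeafwiseMap (reebParam φ lam) f := by
  have hslice : ∀ (U : Set (ℂ × ℝ)) (x : ℝ) (A : Set (ℂ × ℝ)) (B : Set (ℂ × ℝ)),
      (∀ q, flip q ∈ A ↔ q ∈ B) →
      {z : ℂ | (z, x) ∈ flip ⁻¹' U ∩ B} = {z : ℂ | (z, -x) ∈ U ∩ A} := by
    intro U x A B hAB
    ext z
    exact and_congr Iff.rfl (hAB (z, x)).symm
  constructor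
  · intro h _ q hq
    obtain ⟨_, U, g, hU, hg⟩ := h () (flip q) (flip_mem_dom.2 hq)
    refine ⟨(), flip ⁻¹' U, fun p => flip (g (flip p)), hU,
      hg.isOpen.preimage flip_contDiff.continuous, fun p hp hpU => ?_, ?_, ?_, fun x => ?_⟩
    · obtain ⟨h1, h2⟩ := hg.lift (flip p) (flip_mem_dom.2 hp) hpU
      refine ⟨flip_mem_cover.2 h1, ?_⟩
      have h3 := ((congrArg f (mirrorParam_param _)).symm.trans h2).trans (mirrorParam_param _)
      refine (congrArg f (reebParam_param _)).trans
        (Eq.trans ?_ (reebParam_param (i := ()) ⟨_, _⟩).symm)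
      simpa using h3
    · exact flip_contDiff.comp_contDiffOn (hg.smooth.comp flip_contDiff.contDiffOn fun p hp =>
        ⟨hp.1, flip_mem_dom.2 hp.2⟩)
    · intro p hp p' hp' he
      simp only [flip_snd]
      rw [hg.slice (flip p) ⟨hp.1, flip_mem_dom.2 hp.2⟩ (flip p') ⟨hp'.1, flip_mem_dom.2 hp'.2⟩
        (by simp [he])]
    · exact (hslice U x _ _ fun q => flip_mem_dom (φ := φ) (lam := lam) (i := ())) ▸
        hg.holomorphic (-x)
  · intro h _ q hq
    obtain ⟨_, U, g, hU, hg⟩ := h () (flip q) (flip_mem_cover.2 hq)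
    refine ⟨(), flip ⁻¹' U, fun p => flip (g (flip p)), hU,
      hg.isOpen.preimage flip_contDiff.continuous, fun p hp hpU => ?_, ?_, ?_, fun x => ?_⟩
    · obtain ⟨h1, h2⟩ := hg.lift (flip p) (flip_mem_cover.2 hp) hpU
      refine ⟨flip_mem_dom.2 h1, ?_⟩
      have h3 := ((congrArg f (reebParam_param _)).symm.trans h2).trans (reebParam_param _)
      refine (congrArg f (mirrorParam_param _)).trans
        (Eq.trans ?_ (mirrorParam_param (i := ()) ⟨_, _⟩).symm)
      simpa using h3
    · exact flip_contDiff.comp_contDiffOn (hg.smooth.comp flip_contDiff.contDiffOn fun p hp =>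
        ⟨hp.1, flip_mem_cover.2 hp.2⟩)
    · intro p hp p' hp' he
      simp only [flip_snd]
      rw [hg.slice (flip p) ⟨hp.1, flip_mem_cover.2 hp.2⟩ (flip p')
        ⟨hp'.1, flip_mem_cover.2 hp'.2⟩ (by simp [he])]
    · exact (hslice U x _ _ fun q => flip_mem_cover (φ := φ) (lam := lam) (i := ())) ▸
        hg.holomorphic (-x)

lemma autMirror_eq : AutMirror φ lam = AutReeb φ lam := by
  ext f
  exact and_congr isLeafwiseMap_mirror_iff isLeafwiseMap_mirror_iff

/-- The automorphisms of the mirror are those of the Reeb component. -/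
def mirrorEquiv : AutMirror φ lam ≃* AutReeb φ lam := MulEquiv.subgroupCongr autMirror_eq

end Mirror

/-! ### Restriction to the boundary leaf as a homomorphism to the translations. -/

section Restriction

variable {lam : ℂˣ}

lemma isHolomorphic_mul (c : Curve lam) : IsHolomorphic fun w : Curve lam => c * w := by
  obtain ⟨v, rfl⟩ := QuotientGroup.mk_surjective c
  refine fun u => ⟨{0}ᶜ, fun z => v * z, u.ne_zero, isOpen_compl_singleton, fun h => h rfl,
    by fun_prop, fun u _ => ⟨v * u, Units.val_mul v u, rfl⟩⟩

/-- The translations of `H`. -/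
noncomputable def rotation : Curve lam →* AutCurve lam where
  toFun c := ⟨Homeomorph.mulLeft c, isHolomorphic_mul c, isHolomorphic_mul c⁻¹⟩
  map_one' := Subtype.ext (Homeomorph.ext fun w => one_mul w)
  map_mul' c d := Subtype.ext (Homeomorph.ext fun w => mul_assoc c d w)

lemma expUnit_continuous : Continuous expUnit := by
  refine Units.continuous_iff.2 ⟨Complex.continuous_exp, ?_⟩
  have : (fun s => ((expUnit s)⁻¹ : ℂˣ).val) = fun s => Complex.exp (-s) := by
    funext s
    rw [Units.val_inv_eq_inv_val, coe_expUnit, Complex.exp_neg]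
  change Continuous fun s => ((expUnit s)⁻¹ : ℂˣ).val
  rw [this]
  exact Complex.continuous_exp.comp continuous_neg

/-- The translations form the image of `ℂ` under the continuous map sending `s` to the translation
by `exp s`; this image is connected and contains the identity. -/
lemma rotation_mem (c : Curve lam) : rotation c ∈ AutCurveZero lam := by
  have hmk : Continuous fun s : ℂ => (expUnit s : Curve lam) :=
    QuotientGroup.continuous_mk.comp expUnit_continuous
  have hcont : Continuous fun s : ℂ => rotation (expUnit s : Curve lam) := by
    refine continuous_induced_rng.2 (Continuous.prodMk ?_ ?_)
    · exact (ContinuousMap.curry ⟨fun p : ℂ × Curve lam => (expUnit p.1 : Curve lam) * p.2,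
        (hmk.comp continuous_fst).mul continuous_snd⟩).continuous
    · exact (ContinuousMap.curry ⟨fun p : ℂ × Curve lam => (expUnit p.1 : Curve lam)⁻¹ * p.2,
        (hmk.comp continuous_fst).inv.mul continuous_snd⟩).continuous
  have hpre : IsPreconnected (range fun s : ℂ => rotation (expUnit s : Curve lam)) :=
    isPreconnected_range hcont
  have h1 : (1 : AutCurve lam) ∈ range fun s : ℂ => rotation (expUnit s : Curve lam) := by
    refine ⟨0, ?_⟩
    have : expUnit 0 = 1 := Units.ext Complex.exp_zero
    simp only [this]
    exact map_one rotation
  have hc : rotation c ∈ range fun s : ℂ => rotation (expUnit s : Curve lam) := by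
    obtain ⟨u, rfl⟩ := QuotientGroup.mk_surjective c
    obtain ⟨s, rfl⟩ := exists_expUnit_eq u
    exact ⟨s, rfl⟩
  exact hpre.subset_connectedComponent h1 hc

/-- The translations of `H`, as elements of `Aut_0 H`. -/
noncomputable def rotationZero : Curve lam →* AutCurveZero lam :=
  rotation.codRestrict _ rotation_mem

variable {φ : HalfLineDiffeo}

lemma exists_boundaryClass (hφ : IsExpanding φ) (hlam : 1 < ‖(lam : ℂ)‖) (f : AutReeb φ lam) :
    ∃ c : Curve lam, ∀ w, f.1 (boundary φ lam w) = boundary φ lam (c * w) := by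
  obtain ⟨a, b, η, h⟩ := exists_isReebLift hφ hlam f
  exact ⟨a, h.boundary_apply hlam⟩

lemma curve_mul_one (c : Curve lam) : c * ((1 : ℂˣ) : Curve lam) = c := by
  obtain ⟨u, rfl⟩ := QuotientGroup.mk_surjective c
  exact congrArg QuotientGroup.mk (mul_one u)

/-- The translation of the boundary leaf induced by an automorphism. -/
noncomputable def boundaryClass (hφ : IsExpanding φ) (hlam : 1 < ‖(lam : ℂ)‖) :
    AutReeb φ lam →* Curve lam :=
  MonoidHom.mk' (fun f => (exists_boundaryClass hφ hlam f).choose) fun f g => by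
    have h1 := (exists_boundaryClass hφ hlam (f * g)).choose_spec ((1 : ℂˣ) : Curve lam)
    have h2 := ((exists_boundaryClass hφ hlam f).choose_spec _).symm.trans
      ((congrArg f.1 ((exists_boundaryClass hφ hlam g).choose_spec ((1 : ℂˣ) : Curve lam))).symm.trans h1)
    have h3 := boundary_injective h2
    rw [curve_mul_one, curve_mul_one] at h3
    exact h3.symm

lemma boundaryClass_spec (hφ : IsExpanding φ) (hlam : 1 < ‖(lam : ℂ)‖) (f : AutReeb φ lam)
    (w : Curve lam) :
    f.1 (boundary φ lam w) = boundary φ lam (boundaryClass hφ hlam f * w) :=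
  (exists_boundaryClass hφ hlam f).choose_spec w

lemma IsReebLift.boundaryClass_eq (hφ : IsExpanding φ) (hlam : 1 < ‖(lam : ℂ)‖)
    {f : AutReeb φ lam} {a : ℂˣ} {b : ℝ → ℂ} {η : HalfLineDiffeo} (h : IsReebLift f.1 a b η) :
    boundaryClass hφ hlam f = a := by
  have h1 := boundary_injective ((boundaryClass_spec hφ hlam f ((1 : ℂˣ) : Curve lam)).symm.trans
    (h.boundary_apply hlam ((1 : ℂˣ) : Curve lam)))
  rwa [curve_mul_one, curve_mul_one] at h1

end Restriction

/-! ### Holomorphic maps between elliptic curves in logarithmic coordinates. -/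

section CurveMaps

variable {lam mu : ℂˣ} {h : Curve lam → Curve mu} {O O' : Set ℂ} {ℓ ℓ' : ℂ → ℂ}

lemma HolLift.source_ne_zero (hl : HolLift h O ℓ) {z : ℂ} (hz : z ∈ O) : z ≠ 0 := fun h0 =>
  hl.zero_notMem (h0 ▸ hz)

lemma HolLift.ne_zero (hl : HolLift h O ℓ) {z : ℂ} (hz : z ∈ O) : ℓ z ≠ 0 := by
  obtain ⟨v, hv, -⟩ := hl.lift (Units.mk0 z (hl.source_ne_zero hz)) hz
  rw [Units.val_mk0] at hv
  rw [← hv]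
  exact v.ne_zero

lemma HolLift.apply (hl : HolLift h O ℓ) {z : ℂ} (hz : z ∈ O) :
    h (Units.mk0 z (hl.source_ne_zero hz) : Curve lam) =
      (Units.mk0 (ℓ z) (hl.ne_zero hz) : Curve mu) := by
  obtain ⟨v, hv, hv'⟩ := hl.lift (Units.mk0 z (hl.source_ne_zero hz)) hz
  rw [hv']
  congr 1
  exact Units.ext hv

/-- Two holomorphic lifts differ locally by a constant factor. -/
lemma HolLift.eventually_eq (hmu : 1 < ‖(mu : ℂ)‖) (hl : HolLift h O ℓ) (hl' : HolLift h O' ℓ')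
    {z : ℂ} (hz : z ∈ O) (hz' : z ∈ O') : ∃ c : ℂ, c ≠ 0 ∧ ∀ᶠ w in 𝓝 z, ℓ' w = c * ℓ w := by
  have hn : ∀ w ∈ O ∩ O', ∃ n : ℤ, ℓ' w = ((mu ^ n : ℂˣ) : ℂ) * ℓ w := by
    intro w hw
    obtain ⟨n, hn⟩ := curve_mk_eq_iff.1 ((hl.apply hw.1).symm.trans (hl'.apply hw.2))
    exact ⟨n, by simpa using congrArg Units.val hn⟩
  obtain ⟨m, hm⟩ := hn z ⟨hz, hz'⟩
  refine ⟨((mu ^ m : ℂˣ) : ℂ), Units.ne_zero _, ?_⟩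
  have hp : 0 < ‖(mu : ℂ)‖ := one_pos.trans hmu
  -- This quotient takes values in the powers of `|μ|` and equals `1` at `z`; by continuity it stays
  -- strictly between `|μ|⁻¹` and `|μ|` nearby, so the exponent cannot jump.
  have hc : ContinuousAt (fun w => ‖ℓ' w / (((mu ^ m : ℂˣ) : ℂ) * ℓ w)‖) z := by
    refine (ContinuousAt.div ?_ (continuousAt_const.mul ?_) ?_).norm
    · exact (hl'.holomorphic z hz').differentiableAt (hl'.isOpen.mem_nhds hz') |>.continuousAt
    · exact (hl.holomorphic z hz).differentiableAt (hl.isOpen.mem_nhds hz) |>.continuousAt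
    · exact mul_ne_zero (Units.ne_zero _) (hl.ne_zero hz)
  have h1 : ‖ℓ' z / (((mu ^ m : ℂˣ) : ℂ) * ℓ z)‖ = 1 := by
    rw [hm, div_self (mul_ne_zero (Units.ne_zero _) (hl.ne_zero hz)), norm_one]
  have h2 : Ioo ‖(mu : ℂ)‖⁻¹ ‖(mu : ℂ)‖ ∈ 𝓝 ‖ℓ' z / (((mu ^ m : ℂˣ) : ℂ) * ℓ z)‖ := by
    rw [h1]
    exact Ioo_mem_nhds (inv_lt_one_of_one_lt₀ hmu) hmu
  filter_upwards [hc.preimage_mem_nhds h2, hl.isOpen.mem_nhds hz, hl'.isOpen.mem_nhds hz']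
    with w hw hw1 hw2
  obtain ⟨n, hn⟩ := hn w ⟨hw1, hw2⟩
  have h3 : ‖ℓ' w / (((mu ^ m : ℂˣ) : ℂ) * ℓ w)‖ = ‖(mu : ℂ)‖ ^ (n - m) := by
    rw [hn, mul_div_mul_right _ _ (hl.ne_zero hw1), norm_div, zpow_sub₀ hp.ne']
    simp
  rw [mem_preimage, h3, mem_Ioo, ← zpow_neg_one] at hw
  have h4 := (zpow_lt_zpow_iff_right₀ hmu).1 hw.1
  have h5 := (zpow_lt_zpow_iff_right₀ hmu).1 (hw.2.trans_eq (zpow_one _).symm)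
  have h6 : n = m := by omega
  rw [hn, h6]

lemma HolLift.scale (hl : HolLift h O ℓ) (n : ℤ) :
    HolLift h ((fun z => ((lam ^ n : ℂˣ) : ℂ) * z) ⁻¹' O)
      (fun z => ℓ (((lam ^ n : ℂˣ) : ℂ) * z)) := by
  refine ⟨hl.isOpen.preimage (continuous_const_mul _), fun h0 => ?_, ?_, fun u hu => ?_⟩
  · rw [mem_preimage, mul_zero] at h0
    exact hl.zero_notMem h0
  · exact hl.holomorphic.comp (differentiable_id.const_mul _).differentiableOn fun z hz => hz
  · obtain ⟨v, hv, hv'⟩ := hl.lift (lam ^ n * u) (by simpa using hu)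
    exact ⟨v, by simpa using hv, by rw [← hv', curve_mk_zpow_mul]⟩

lemma HolLift.const_mul (hl : HolLift h O ℓ) (n : ℤ) :
    HolLift h O (fun z => ((mu ^ n : ℂˣ) : ℂ) * ℓ z) := by
  refine ⟨hl.isOpen, hl.zero_notMem, hl.holomorphic.const_mul _, fun u hu => ?_⟩
  obtain ⟨v, hv, hv'⟩ := hl.lift u hu
  exact ⟨mu ^ n * v, by rw [Units.val_mul, hv], by rw [hv', curve_mk_zpow_mul]⟩

/-- The logarithmic derivatives of holomorphic lifts are constant. -/
lemma exists_logDeriv (hlam : 1 < ‖(lam : ℂ)‖) (hmu : 1 < ‖(mu : ℂ)‖) (hh : IsHolomorphic h) :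
    ∃ κ : ℂ, ∀ O ℓ, HolLift h O ℓ → ∀ z ∈ O, z * deriv ℓ z = κ * ℓ z := by
  choose P L hP hL using hh
  -- The logarithmic derivative `z ℓ'(z) / ℓ(z)` is unchanged when the lift is multiplied by a
  -- constant or `z` by a power of `λ`. So it is a function on the curve, entire in `s = log z`, and
  -- therefore constant.
  have key : ∀ (s : ℂ) (O : Set ℂ) (ℓ : ℂ → ℂ), HolLift h O ℓ → Complex.exp s ∈ O →
      ∀ s', (expUnit s : Curve lam) = expUnit s' →
      Complex.exp s * deriv ℓ (Complex.exp s) / ℓ (Complex.exp s) =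
        Complex.exp s' * deriv (L (expUnit s')) (Complex.exp s') /
          L (expUnit s') (Complex.exp s') := by
    intro s O ℓ hl hs s' he
    obtain ⟨n, hn⟩ := curve_mk_eq_iff.1 he
    have hn' : Complex.exp s' = ((lam ^ n : ℂˣ) : ℂ) * Complex.exp s := by
      simpa using congrArg Units.val hn
    have hs' : Complex.exp s ∈ (fun z => ((lam ^ n : ℂˣ) : ℂ) * z) ⁻¹' P (expUnit s') := by
      rw [mem_preimage, ← hn']
      exact hP (expUnit s')
    obtain ⟨c, hc0, hc⟩ := hl.eventually_eq hmu ((hL (expUnit s')).scale n) hs hs'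
    have hd := Filter.EventuallyEq.deriv_eq hc
    have hv := hc.self_of_nhds
    rw [deriv_comp_mul_left, deriv_const_mul_field, ← hn', smul_eq_mul] at hd
    rw [← hn'] at hv
    rw [hv, div_eq_div_iff (hl.ne_zero hs) (mul_ne_zero hc0 (hl.ne_zero hs))]
    linear_combination (-(Complex.exp s * ℓ (Complex.exp s))) * hd -
      deriv (L (expUnit s')) (Complex.exp s') * ℓ (Complex.exp s) * hn'
  set K : ℂ → ℂ := fun s => Complex.exp s * deriv (L (expUnit s)) (Complex.exp s) /
    L (expUnit s) (Complex.exp s) with hK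
  have hdiff : Differentiable ℂ K := by
    intro s
    have hO := (hL (expUnit s)).isOpen
    have hs : Complex.exp s ∈ P (expUnit s) := hP (expUnit s)
    have h1 := ((hL (expUnit s)).holomorphic.differentiableAt (hO.mem_nhds hs))
    have h2 := (((hL (expUnit s)).holomorphic.deriv hO).differentiableAt (hO.mem_nhds hs))
    have h3 : DifferentiableAt ℂ (fun s' => Complex.exp s' *
        deriv (L (expUnit s)) (Complex.exp s') / L (expUnit s) (Complex.exp s')) s := by
      refine DifferentiableAt.div (Complex.differentiableAt_exp.mul ?_) ?_
        ((hL (expUnit s)).ne_zero hs)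
      · exact h2.comp s Complex.differentiableAt_exp
      · exact h1.comp s Complex.differentiableAt_exp
    refine h3.congr_of_eventuallyEq ?_
    filter_upwards [Complex.continuous_exp.continuousAt.preimage_mem_nhds (hO.mem_nhds hs)]
      with s' hs'
    exact (key s' _ _ (hL (expUnit s)) hs' s' rfl).symm
  have hconst := const_of_differentiable_periodic hlam hdiff fun s s' he =>
    key s _ _ (hL (expUnit s)) (hP (expUnit s)) s' he
  refine ⟨K 0, fun O ℓ hl z hz => ?_⟩
  obtain ⟨s, hs⟩ := exists_expUnit_eq (Units.mk0 z (hl.source_ne_zero hz))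
  have hs' : Complex.exp s = z := congrArg Units.val hs
  rw [← hs'] at hz ⊢
  rw [hconst 0 s, hK]
  simp only
  rw [← key s O ℓ hl hz s rfl, div_mul_cancel₀ _ (hl.ne_zero hz)]

/-- Along a segment of the logarithm, a lift is multiplied by an exponential. -/
lemma HolLift.exp_mul {κ : ℂ} (hκ : ∀ O ℓ, HolLift h O ℓ → ∀ z ∈ O, z * deriv ℓ z = κ * ℓ z)
    (hl : HolLift h O ℓ) {z s : ℂ} (hs : ∀ t ∈ Icc (0 : ℝ) 1, Complex.exp (t * s) * z ∈ O) :
    ℓ (Complex.exp s * z) = Complex.exp (κ * s) * ℓ z := by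
  -- By the equation for the logarithmic derivative, `y` has derivative zero along the segment.
  set y : ℝ → ℂ := fun t => Complex.exp (-(κ * (t * s))) * ℓ (Complex.exp (t * s) * z) with hy
  have hd : ∀ t ∈ Icc (0 : ℝ) 1, HasDerivAt y 0 t := by
    intro t ht
    have h1 : HasDerivAt ℓ (deriv ℓ (Complex.exp (t * s) * z)) (Complex.exp (t * s) * z) :=
      (hl.holomorphic.differentiableAt (hl.isOpen.mem_nhds (hs t ht))).hasDerivAt
    have h0 : HasDerivAt (fun t : ℂ => t * s) s (t : ℂ) := by
      simpa using (hasDerivAt_id (t : ℂ)).mul_const s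
    have h2 : HasDerivAt (fun t : ℂ => Complex.exp (t * s) * z) (Complex.exp (t * s) * s * z)
        (t : ℂ) := h0.cexp.mul_const z
    have h3 : HasDerivAt (fun t : ℂ => Complex.exp (-(κ * (t * s))))
        (Complex.exp (-(κ * (t * s))) * -(κ * s)) (t : ℂ) := (h0.const_mul κ).neg.cexp
    have h4 := (h3.mul (HasDerivAt.comp (t : ℂ) h1 h2)).comp_ofReal
    have h5 := hκ O ℓ hl _ (hs t ht)
    refine h4.congr_deriv ?_
    simp only [Function.comp_apply]
    linear_combination (Complex.exp (-(κ * (t * s))) * s) * h5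
  have h1 : y 1 = y 0 := by
    refine constant_of_has_deriv_right_zero (a := 0) (b := 1)
      (fun t ht => (hd t ht).continuousAt.continuousWithinAt)
      (fun t ht => (hd t ⟨ht.1, ht.2.le⟩).hasDerivWithinAt) 1 ⟨zero_le_one, le_rfl⟩
  simp only [hy, Complex.ofReal_one, one_mul, Complex.ofReal_zero, zero_mul, mul_zero, neg_zero,
    Complex.exp_zero] at h1
  rw [← h1, ← mul_assoc, ← Complex.exp_add, add_neg_cancel, Complex.exp_zero, one_mul]

/-- A radius uniform in the base point is needed later, both to solve for the correction in a collar
and to get one chart for all nearby automorphisms. Balls are star-shaped, so the segment required by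
`HolLift.exp_mul` remains in the domain. -/
lemma HolLift.exists_ball {κ : ℂ}
    (hκ : ∀ O ℓ, HolLift h O ℓ → ∀ z ∈ O, z * deriv ℓ z = κ * ℓ z)
    (hl : HolLift h O ℓ) {z₀ : ℂ} (hz₀ : z₀ ∈ O) :
    ∃ δ > 0, ∀ z ∈ Metric.ball z₀ δ, ∀ s ∈ Metric.ball (0 : ℂ) δ, z ∈ O ∧
      Complex.exp s * z ∈ O ∧ ℓ (Complex.exp s * z) = Complex.exp (κ * s) * ℓ z := by
  have hc : Continuous fun p : ℂ × ℂ => Complex.exp p.1 * p.2 := by fun_prop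
  have hm : (fun p : ℂ × ℂ => Complex.exp p.1 * p.2) ⁻¹' O ∈ 𝓝 ((0 : ℂ), z₀) := by
    refine hc.continuousAt.preimage_mem_nhds (hl.isOpen.mem_nhds ?_)
    simpa using hz₀
  obtain ⟨δ, hδ, hsub⟩ := Metric.mem_nhds_iff.1 hm
  have hmem : ∀ z ∈ Metric.ball z₀ δ, ∀ s ∈ Metric.ball (0 : ℂ) δ, Complex.exp s * z ∈ O := by
    intro z hz s hs
    refine hsub (a := (s, z)) ?_
    rw [← ball_prod_same]
    exact ⟨hs, hz⟩
  refine ⟨δ, hδ, fun z hz s hs => ⟨?_, hmem z hz s hs, hl.exp_mul hκ fun t ht => ?_⟩⟩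
  · simpa using hmem z hz 0 (Metric.mem_ball_self hδ)
  · refine hmem z hz _ ?_
    rw [mem_ball_zero_iff] at hs ⊢
    refine lt_of_le_of_lt ?_ hs
    rw [norm_mul, Complex.norm_real, Real.norm_of_nonneg ht.1]
    exact mul_le_of_le_one_left (norm_nonneg s) ht.2

lemma curve_one_mul (c : Curve lam) : ((1 : ℂˣ) : Curve lam) * c = c := by
  obtain ⟨u, rfl⟩ := QuotientGroup.mk_surjective c
  exact congrArg QuotientGroup.mk (one_mul u)

/-- The function `s ↦ exp(-κ s) h(exp(s) u)` is locally constant by the local formula for lifts,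
hence constant on `ℂ`. -/
lemma map_expUnit_mul {κ : ℂ} (hκ : ∀ O ℓ, HolLift h O ℓ → ∀ z ∈ O, z * deriv ℓ z = κ * ℓ z)
    (hh : IsHolomorphic h) (s : ℂ) (w : Curve lam) :
    h ((expUnit s : Curve lam) * w) = (expUnit (κ * s) : Curve mu) * h w := by
  obtain ⟨u, rfl⟩ := QuotientGroup.mk_surjective w
  have hlc : IsLocallyConstant fun s : ℂ => (expUnit (-(κ * s)) : Curve mu) *
      h ((expUnit s * u : ℂˣ) : Curve lam) := by
    rw [IsLocallyConstant.iff_eventually_eq]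
    intro s₀
    obtain ⟨O, ℓ, hO, hl⟩ := hh (expUnit s₀ * u)
    obtain ⟨δ, hδ, hb⟩ := hl.exists_ball hκ hO
    filter_upwards [Metric.ball_mem_nhds s₀ hδ] with s hs
    have hs' : s - s₀ ∈ Metric.ball (0 : ℂ) δ := by
      rwa [mem_ball_zero_iff, ← dist_eq_norm]
    obtain ⟨h1, h2, h3⟩ := hb _ (Metric.mem_ball_self hδ) _ hs'
    have h4 : (expUnit s * u : ℂˣ) = expUnit (s - s₀) * (expUnit s₀ * u) := by
      rw [← mul_assoc, ← expUnit_add, sub_add_cancel]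
    obtain ⟨v, hv, hv'⟩ := hl.lift _ hO
    obtain ⟨v', hv1, hv1'⟩ := hl.lift (expUnit s * u) (by rw [h4]; exact h2)
    have h5 : v' = expUnit (κ * (s - s₀)) * v := by
      ext
      rw [hv1, h4, Units.val_mul (expUnit (κ * (s - s₀))) v, hv]
      exact h3
    rw [hv', hv1', h5, ← QuotientGroup.mk_mul, ← QuotientGroup.mk_mul, ← mul_assoc, ← expUnit_add]
    congr 3
    ring
  have h1 := hlc.apply_eq_of_preconnectedSpace s 0
  have h0 : expUnit 0 = 1 := Units.ext Complex.exp_zero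
  simp only [mul_zero, neg_zero, h0, one_mul] at h1
  have h2 : (expUnit (κ * s) : Curve mu) * ((expUnit (-(κ * s)) : Curve mu) *
      h ((expUnit s * u : ℂˣ) : Curve lam)) = (expUnit (κ * s) : Curve mu) * h (u : Curve lam) := by
    rw [h1, curve_one_mul]
  rw [← mul_assoc, ← QuotientGroup.mk_mul, ← expUnit_add, add_neg_cancel, h0] at h2
  rw [← h2, curve_one_mul]
  rfl

/-- If `κ = 0`, then `h` is invariant under all translations, that is, constant. Division by `κ` is
what inverts lifts locally. -/
lemma logDeriv_ne_zero {κ : ℂ} (hκ : ∀ O ℓ, HolLift h O ℓ → ∀ z ∈ O, z * deriv ℓ z = κ * ℓ z)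
    (hlam : 1 < ‖(lam : ℂ)‖) (hh : IsHolomorphic h) (hinj : Function.Injective h) : κ ≠ 0 := by
  rintro rfl
  obtain ⟨w, v, hne⟩ := exists_curve_ne hlam
  refine hne (hinj ?_)
  have key : ∀ w : Curve lam, h w = h ((1 : ℂˣ) : Curve lam) := by
    intro w
    obtain ⟨u, rfl⟩ := QuotientGroup.mk_surjective w
    obtain ⟨s, rfl⟩ := exists_expUnit_eq u
    have h1 := map_expUnit_mul hκ hh s ((1 : ℂˣ) : Curve lam)
    rw [curve_mul_one, zero_mul] at h1
    have h0 : expUnit 0 = 1 := Units.ext Complex.exp_zero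
    rw [h0] at h1
    exact h1.trans (curve_one_mul _)
  rw [key w, key v]

/-- The linear part of a holomorphic map between curves. -/
noncomputable def curveHom {κ : ℂ}
    (hκ : ∀ O ℓ, HolLift h O ℓ → ∀ z ∈ O, z * deriv ℓ z = κ * ℓ z) (hh : IsHolomorphic h) :
    Curve lam →* Curve mu :=
  MonoidHom.mk' (fun c => h c * (h ((1 : ℂˣ) : Curve lam))⁻¹) fun c d => by
    obtain ⟨u, rfl⟩ := QuotientGroup.mk_surjective c
    obtain ⟨s, rfl⟩ := exists_expUnit_eq u
    have h1 := map_expUnit_mul hκ hh s d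
    have h2 := map_expUnit_mul hκ hh s ((1 : ℂˣ) : Curve lam)
    rw [curve_mul_one] at h2
    rw [h1, h2, mul_inv_cancel_right, mul_assoc]

lemma curveHom_mul {κ : ℂ}
    (hκ : ∀ O ℓ, HolLift h O ℓ → ∀ z ∈ O, z * deriv ℓ z = κ * ℓ z) (hh : IsHolomorphic h)
    (c w : Curve lam) : h (c * w) = curveHom hκ hh c * h w := by
  obtain ⟨u, rfl⟩ := QuotientGroup.mk_surjective c
  obtain ⟨s, rfl⟩ := exists_expUnit_eq u
  have h2 := map_expUnit_mul hκ hh s ((1 : ℂˣ) : Curve lam)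
  rw [curve_mul_one] at h2
  rw [map_expUnit_mul hκ hh s w]
  congr 1
  change _ = h _ * (h ((1 : ℂˣ) : Curve lam))⁻¹
  rw [h2, mul_inv_cancel_right]

lemma curveHom_expUnit {κ : ℂ}
    (hκ : ∀ O ℓ, HolLift h O ℓ → ∀ z ∈ O, z * deriv ℓ z = κ * ℓ z) (hh : IsHolomorphic h)
    (s : ℂ) : curveHom hκ hh (expUnit s : Curve lam) = (expUnit (κ * s) : Curve mu) := by
  have h2 := map_expUnit_mul hκ hh s ((1 : ℂˣ) : Curve lam)
  rw [curve_mul_one] at h2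
  change h _ * (h ((1 : ℂˣ) : Curve lam))⁻¹ = _
  rw [h2, mul_inv_cancel_right]

/-- A lift of `h`, moved by translations which correspond to each other under `h`. -/
lemma HolLift.translate {κ : ℂ}
    (hκ : ∀ O ℓ, HolLift h O ℓ → ∀ z ∈ O, z * deriv ℓ z = κ * ℓ z) (hh : IsHolomorphic h)
    (hl : HolLift h O ℓ) {a a' : ℂˣ} (ha : curveHom hκ hh (a : Curve lam) = (a' : Curve mu)) :
    HolLift h ((fun z => ((a⁻¹ : ℂˣ) : ℂ) * z) ⁻¹' O)
      (fun z => a' * ℓ (((a⁻¹ : ℂˣ) : ℂ) * z)) := by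
  refine ⟨hl.isOpen.preimage (continuous_const_mul _), fun h0 => ?_, ?_, fun u hu => ?_⟩
  · rw [mem_preimage, mul_zero] at h0
    exact hl.zero_notMem h0
  · exact (hl.holomorphic.comp (differentiable_id.const_mul _).differentiableOn
      fun z hz => hz).const_mul _
  · obtain ⟨v, hv, hv'⟩ := hl.lift (a⁻¹ * u) hu
    refine ⟨a' * v, by rw [Units.val_mul, hv, Units.val_mul], ?_⟩
    rw [QuotientGroup.mk_mul, ← hv', ← ha, ← curveHom_mul, ← QuotientGroup.mk_mul,
      mul_inv_cancel_left]

/-- Near each point, a lift which takes a prescribed value has a holomorphic right inverse. -/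
lemma exists_section {κ : ℂ} (hκ : ∀ O ℓ, HolLift h O ℓ → ∀ z ∈ O, z * deriv ℓ z = κ * ℓ z)
    (hκ0 : κ ≠ 0) (hh : IsHolomorphic h) (hsurj : Function.Surjective h) (v : ℂˣ) :
    ∃ O ℓ V k, HolLift h O ℓ ∧ IsOpen V ∧ (v : ℂ) ∈ V ∧ DifferentiableOn ℂ k V ∧ ∀ w ∈ V,
      k w ∈ O ∧ ℓ (k w) = w := by
  obtain ⟨w, hw⟩ := hsurj (v : Curve mu)
  obtain ⟨u, rfl⟩ := QuotientGroup.mk_surjective w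
  obtain ⟨O, ℓ₀, hO, hl₀⟩ := hh u
  obtain ⟨v₀, hv₀, hv₀'⟩ := hl₀.lift u hO
  obtain ⟨n, hn⟩ := curve_mk_eq_iff.1 (hv₀'.symm.trans hw)
  have hl := hl₀.const_mul n
  have hval : ((mu ^ n : ℂˣ) : ℂ) * ℓ₀ u = v := by rw [← hv₀, ← Units.val_mul, ← hn]
  obtain ⟨δ, hδ, hb⟩ := hl.exists_ball hκ hO
  -- `S` solves `exp(κ S(w)) = w / v`; since the chosen lift sends `u` to `v`, it sends `exp(S(w))
  -- u` to `w`.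
  set S : ℂ → ℂ := fun w => Complex.log (w / v) / κ with hS
  have hd : ∀ w, w / (v : ℂ) ∈ Complex.slitPlane → DifferentiableAt ℂ S w := by
    intro w hw
    exact ((differentiableAt_id.div_const _).clog hw).div_const κ
  have hv1 : (v : ℂ) / v ∈ Complex.slitPlane := by
    rw [div_self v.ne_zero]
    exact Complex.one_mem_slitPlane
  have hS0 : S v = 0 := by simp [hS]
  have hm : ∀ᶠ w in 𝓝 (v : ℂ), w / (v : ℂ) ∈ Complex.slitPlane ∧ S w ∈ Metric.ball (0 : ℂ) δ := by
    refine Filter.Eventually.and ?_ ?_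
    · have hc : ContinuousAt (fun w : ℂ => w / (v : ℂ)) v := by fun_prop
      exact hc.preimage_mem_nhds (Complex.isOpen_slitPlane.mem_nhds hv1)
    · refine (hd _ hv1).continuousAt.preimage_mem_nhds ?_
      rw [hS0]
      exact Metric.ball_mem_nhds 0 hδ
  obtain ⟨V, hV, hVo, hvV⟩ := mem_nhds_iff.1 hm
  refine ⟨O, _, V, fun w => Complex.exp (S w) * u, hl, hVo, hvV, fun w hw => ?_, fun w hw => ?_⟩
  · exact ((hd w (hV hw).1).cexp.mul_const _).differentiableWithinAt
  · obtain ⟨-, h1, h2⟩ := hb u (Metric.mem_ball_self hδ) (S w) (hV hw).2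
    refine ⟨h1, h2.trans ?_⟩
    have hw0 : w / (v : ℂ) ≠ 0 := Complex.slitPlane_ne_zero (hV hw).1
    rw [hval, hS, mul_div_cancel₀ _ hκ0, Complex.exp_log hw0, div_mul_cancel₀ _ v.ne_zero]

end CurveMaps

/-! ### The pasted manifold, its leaves and its two sides. -/

section PastedSpace

variable {φ ψ : HalfLineDiffeo} {lam mu : ℂˣ} {h : Curve lam ≃ₜ Curve mu}

lemma inl_boundary (w : Curve lam) :
    Pasted.inl φ ψ h (boundary φ lam w) = Pasted.inr φ ψ h (boundary ψ mu (h w)) :=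
  Quot.sound (GlueRel.glue w)

/-- The gluing relation generates the identification without itself being an equivalence. A
predicate invariant under it descends to the quotient, and the one chosen here is true exactly on
the intended class of `p`. -/
lemma inl_eq_iff (p : Reeb φ lam) :
    (∀ p', Pasted.inl φ ψ h p' = Pasted.inl φ ψ h p → p' = p) ∧
    (∀ p', Pasted.inr φ ψ h p' = Pasted.inl φ ψ h p →
      ∃ w, boundary φ lam w = p ∧ boundary ψ mu (h w) = p') := by
  let P : Reeb φ lam ⊕ Reeb ψ mu → Prop := Sum.elim (fun p' => p' = p)
    fun p' => ∃ w, boundary φ lam w = p ∧ boundary ψ mu (h w) = p'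
  have hP : ∀ x y, GlueRel φ ψ h x y → P x = P y := by
    rintro _ _ ⟨w⟩
    refine propext ⟨fun hw => ⟨w, hw, rfl⟩, ?_⟩
    rintro ⟨w', h1, h2⟩
    have h3 : w' = w := h.injective (boundary_injective h2)
    rw [← h3]
    exact h1
  have hp : Quot.lift P hP (Pasted.inl φ ψ h p) := rfl
  exact ⟨fun p' he => show Quot.lift P hP (Pasted.inl φ ψ h p') from he ▸ hp,
    fun p' he => show Quot.lift P hP (Pasted.inr φ ψ h p') from he ▸ hp⟩

lemma inl_injective : Function.Injective (Pasted.inl φ ψ h) := fun p p' he =>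
  (inl_eq_iff p').1 p he

lemma inr_injective : Function.Injective (Pasted.inr φ ψ h) := by
  intro p₁ p₂ he
  let P : Reeb φ lam ⊕ Reeb ψ mu → Prop := Sum.elim
    (fun p' => ∃ w, boundary φ lam w = p' ∧ boundary ψ mu (h w) = p₂) fun p' => p' = p₂
  have hP : ∀ x y, GlueRel φ ψ h x y → P x = P y := by
    rintro _ _ ⟨w⟩
    refine propext ⟨?_, fun hw => ⟨w, rfl, hw⟩⟩
    rintro ⟨w', h1, h2⟩
    rw [← boundary_injective h1]
    exact h2
  have hp : Quot.lift P hP (Pasted.inr φ ψ h p₂) := rfl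
  exact show Quot.lift P hP (Pasted.inr φ ψ h p₁) from he ▸ hp

lemma inl_mem_range_inr {p : Reeb φ lam} :
    Pasted.inl φ ψ h p ∈ range (Pasted.inr φ ψ h) ↔ p ∈ range (boundary φ lam) := by
  constructor
  · rintro ⟨p', he⟩
    obtain ⟨w, hw, -⟩ := (inl_eq_iff p).2 p' he
    exact ⟨w, hw⟩
  · rintro ⟨w, rfl⟩
    exact ⟨_, (inl_boundary w).symm⟩

lemma inr_mem_range_inl {p : Reeb ψ mu} :
    Pasted.inr φ ψ h p ∈ range (Pasted.inl φ ψ h) ↔ p ∈ range (boundary ψ mu) := by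
  constructor
  · rintro ⟨p', he⟩
    obtain ⟨w, -, hw⟩ := (inl_eq_iff p').2 p he.symm
    exact ⟨h w, hw⟩
  · rintro ⟨w, rfl⟩
    exact ⟨boundary φ lam (h.symm w), by rw [inl_boundary, h.apply_symm_apply]⟩

lemma inl_or_inr (P : Pasted φ ψ h) :
    P ∈ range (Pasted.inl φ ψ h) ∨ P ∈ range (Pasted.inr φ ψ h) := by
  obtain ⟨p | p, rfl⟩ := Quot.exists_rep P
  · exact Or.inl ⟨p, rfl⟩
  · exact Or.inr ⟨p, rfl⟩

/-- The leafwise coordinate on the mirror side of a local parametrization. -/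
def mirrorCoord : (pastedParam φ ψ h).ι → ℂ → ℂ
  | .left => id
  | .right => id
  | .collar _ ℓ _ => ℓ

lemma mirrorCoord_differentiableOn (i : (pastedParam φ ψ h).ι) (y : ℝ) :
    DifferentiableOn ℂ (mirrorCoord i) {z | (z, y) ∈ (pastedParam φ ψ h).dom i} := by
  match i with
  | .left => exact differentiableOn_id
  | .right => exact differentiableOn_id
  | .collar O ℓ hl => exact hl.holomorphic

lemma mirrorCoord_contDiffOn (i : (pastedParam φ ψ h).ι) :
    ContDiffOn ℝ ∞ (fun q : ℂ × ℝ => (mirrorCoord i q.1, -q.2)) ((pastedParam φ ψ h).dom i) := by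
  refine ContDiffOn.prodMk ?_ contDiff_snd.neg.contDiffOn
  match i with
  | .left => exact contDiff_fst.contDiffOn
  | .right => exact contDiff_fst.contDiffOn
  | .collar O ℓ hl =>
    exact ((hl.holomorphic.contDiffOn hl.isOpen).restrict_scalars ℝ).comp contDiff_fst.contDiffOn
      fun q hq => hq

lemma isOpen_pastedDom (i : (pastedParam φ ψ h).ι) : IsOpen ((pastedParam φ ψ h).dom i) := by
  match i with
  | .left => exact isOpen_lt continuous_const continuous_snd
  | .right => exact isOpen_lt continuous_snd continuous_const
  | .collar O ℓ hl => exact hl.isOpen.preimage continuous_fst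

variable {i : (pastedParam φ ψ h).ι} {q : ℂ × ℝ}

lemma mem_cover_of_mem_pastedDom (hq : q ∈ (pastedParam φ ψ h).dom i) (h0 : 0 ≤ q.2) :
    q ∈ cover := by
  match i with
  | .left => exact mem_cover_of_pos hq
  | .right => exact absurd (show q.2 < 0 from hq) (not_lt.2 h0)
  | .collar O ℓ hl => exact mem_cover_of_ne h0 (hl.source_ne_zero hq)

lemma mirrorCoord_mem_cover (hq : q ∈ (pastedParam φ ψ h).dom i) (h0 : q.2 ≤ 0) :
    (mirrorCoord i q.1, -q.2) ∈ cover := by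
  match i with
  | .left => exact absurd (show 0 < q.2 from hq) (not_lt.2 h0)
  | .right => exact mem_cover_of_pos (neg_pos.2 hq)
  | .collar O ℓ hl => exact mem_cover_of_ne (neg_nonneg.2 h0) (hl.ne_zero hq)

lemma pastedParam_of_nonneg (hq : q ∈ (pastedParam φ ψ h).dom i) (h0 : 0 ≤ q.2) :
    (pastedParam φ ψ h).param i ⟨q, hq⟩ = Pasted.inl φ ψ h (reebPt φ lam q) := by
  rw [reebPt_of_mem (mem_cover_of_mem_pastedDom hq h0)]
  match i with
  | .left => rfl
  | .right => exact absurd (show q.2 < 0 from hq) (not_lt.2 h0)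
  | .collar O ℓ hl => exact dif_pos h0

lemma pastedParam_of_nonpos (hq : q ∈ (pastedParam φ ψ h).dom i) (h0 : q.2 ≤ 0) :
    (pastedParam φ ψ h).param i ⟨q, hq⟩ =
      Pasted.inr φ ψ h (reebPt ψ mu (mirrorCoord i q.1, -q.2)) := by
  rcases h0.lt_or_eq with h1 | h1
  · rw [reebPt_of_mem (mirrorCoord_mem_cover hq h0)]
    match i with
    | .left => exact absurd (show 0 < q.2 from hq) (not_lt.2 h0)
    | .right => rfl
    | .collar O ℓ hl => exact dif_neg (not_le.2 h1)
  · rw [pastedParam_of_nonneg hq h1.ge]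
    obtain ⟨z, x⟩ := q
    obtain rfl : x = 0 := h1
    match i with
    | .left => exact absurd (show (0 : ℝ) < 0 from hq) (lt_irrefl _)
    | .right => exact absurd (show (0 : ℝ) < 0 from hq) (lt_irrefl _)
    | .collar O ℓ hl =>
      have hz : z ∈ O := hq
      have h2 := inl_boundary (φ := φ) (ψ := ψ) (h := h)
        ((Units.mk0 z (hl.source_ne_zero hz) : ℂˣ) : Curve lam)
      rw [hl.apply hz, boundary_eq_reebPt, boundary_eq_reebPt] at h2
      simpa [mirrorCoord] using h2

lemma pastedParam_mem_range_inl (hq : q ∈ (pastedParam φ ψ h).dom i) :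
    (pastedParam φ ψ h).param i ⟨q, hq⟩ ∈ range (Pasted.inl φ ψ h) ↔ 0 ≤ q.2 := by
  refine ⟨fun hm => ?_, fun h0 => ⟨_, (pastedParam_of_nonneg hq h0).symm⟩⟩
  by_contra h1
  rw [not_le] at h1
  rw [pastedParam_of_nonpos hq h1.le, inr_mem_range_inl,
    reebPt_mem_range_boundary (mirrorCoord_mem_cover hq h1.le)] at hm
  exact h1.ne (neg_eq_zero.1 hm)

lemma pastedParam_mem_range_inr (hq : q ∈ (pastedParam φ ψ h).dom i) :
    (pastedParam φ ψ h).param i ⟨q, hq⟩ ∈ range (Pasted.inr φ ψ h) ↔ q.2 ≤ 0 := by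
  refine ⟨fun hm => ?_, fun h0 => ⟨_, (pastedParam_of_nonpos hq h0).symm⟩⟩
  by_contra h1
  rw [not_le] at h1
  rw [pastedParam_of_nonneg hq h1.le, inl_mem_range_inr,
    reebPt_mem_range_boundary (mem_cover_of_mem_pastedDom hq h1.le)] at hm
  exact h1.ne' hm

lemma isLeafParam_inl (hφ : IsExpanding φ) {x₀ : ℝ} (hx₀ : 0 < x₀) :
    IsLeafParam (pastedParam φ ψ h) fun z => Pasted.inl φ ψ h (reebPt φ lam (z, x₀)) := by
  have hr := isLeafParam_reeb (lam := lam) hφ hx₀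
  refine ⟨inl_injective.comp hr.injective, fun j y => ?_⟩
  rcases lt_or_ge y 0 with hy | hy
  · refine Or.inl fun z hz => ?_
    rintro ⟨z', hz'⟩
    exact absurd ((pastedParam_mem_range_inl hz).1 ⟨_, hz'⟩) (not_le.2 hy)
  · have hc : ∀ z, (z, y) ∈ (pastedParam φ ψ h).dom j → (z, y) ∈ cover := fun z hz =>
      mem_cover_of_mem_pastedDom hz hy
    rcases hr.slice () y with hn | ⟨k, hk, hk'⟩
    · refine Or.inl fun z hz => ?_
      rintro ⟨z', hz'⟩
      rw [pastedParam_of_nonneg hz hy] at hz'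
      exact hn z (hc z hz) ⟨z', (inl_injective hz').trans (reebPt_of_mem (hc z hz))⟩
    · refine Or.inr ⟨k, hk.mono hc, fun z hz => ?_⟩
      rw [pastedParam_of_nonneg hz hy, reebPt_of_mem (hc z hz)]
      exact congrArg _ (hk' z (hc z hz))

lemma isLeafParam_inr (hψ : IsExpanding ψ) {x₀ : ℝ} (hx₀ : 0 < x₀) :
    IsLeafParam (pastedParam φ ψ h) fun z => Pasted.inr φ ψ h (reebPt ψ mu (z, x₀)) := by
  have hr := isLeafParam_reeb (lam := mu) hψ hx₀
  refine ⟨inr_injective.comp hr.injective, fun j y => ?_⟩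
  rcases lt_or_ge 0 y with hy | hy
  · refine Or.inl fun z hz => ?_
    rintro ⟨z', hz'⟩
    exact absurd ((pastedParam_mem_range_inr hz).1 ⟨_, hz'⟩) (not_le.2 hy)
  · have hc : ∀ z, (z, y) ∈ (pastedParam φ ψ h).dom j → (mirrorCoord j z, -y) ∈ cover :=
      fun z hz => mirrorCoord_mem_cover hz hy
    rcases hr.slice () (-y) with hn | ⟨k, hk, hk'⟩
    · refine Or.inl fun z hz => ?_
      rintro ⟨z', hz'⟩
      rw [pastedParam_of_nonpos hz hy] at hz'
      exact hn _ (hc z hz) ⟨z', (inr_injective hz').trans (reebPt_of_mem (hc z hz))⟩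
    · refine Or.inr ⟨fun z => k (mirrorCoord j z),
        hk.comp (mirrorCoord_differentiableOn j y) hc, fun z hz => ?_⟩
      rw [pastedParam_of_nonpos hz hy, reebPt_of_mem (hc z hz)]
      exact congrArg _ (hk' _ (hc z hz))

lemma isCompactLeaf_pasted (hh : IsHolomorphic h) :
    IsCompactLeaf (pastedParam φ ψ h) fun w => Pasted.inl φ ψ h (boundary φ lam w) := by
  intro u
  obtain ⟨O, ℓ, hO, hl⟩ := hh u
  refine ⟨PastedIndex.collar O ℓ hl, O, hl.isOpen, hO, hl.zero_notMem, fun v hv => ⟨hv, ?_⟩⟩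
  exact (congrArg _ (boundary_eq_reebPt v)).trans
    (pastedParam_of_nonneg (i := PastedIndex.collar O ℓ hl) (q := ((v : ℂ), 0)) hv le_rfl).symm

/-- The common boundary leaf of the two components. -/
lemma mem_boundary_iff {P : Pasted φ ψ h} :
    P ∈ range (fun w => Pasted.inl φ ψ h (boundary φ lam w)) ↔
      P ∈ range (Pasted.inl φ ψ h) ∧ P ∈ range (Pasted.inr φ ψ h) := by
  constructor
  · rintro ⟨w, rfl⟩
    exact ⟨⟨_, rfl⟩, ⟨_, (inl_boundary w).symm⟩⟩
  · rintro ⟨⟨p, rfl⟩, hr⟩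
    obtain ⟨w, rfl⟩ := inl_mem_range_inr.1 hr
    exact ⟨w, rfl⟩

/-- Every other leaf is an interior leaf of one of the components and so a copy of `ℂ`; an injective
leafwise map cannot send the compact leaf into it. -/
lemma map_boundary_pasted (hφ : IsExpanding φ) (hψ : IsExpanding ψ) (hlam : 1 < ‖(lam : ℂ)‖)
    (hh : IsHolomorphic h) {F : Pasted φ ψ h → Pasted φ ψ h}
    (hF : IsLeafwiseMap (pastedParam φ ψ h) F) (hinj : Function.Injective F) {P : Pasted φ ψ h}
    (hP : P ∈ range (Pasted.inl φ ψ h) ∧ P ∈ range (Pasted.inr φ ψ h)) :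
    F P ∈ range (Pasted.inl φ ψ h) ∧ F P ∈ range (Pasted.inr φ ψ h) := by
  obtain ⟨w, rfl⟩ := mem_boundary_iff.2 hP
  obtain ⟨w₁, w₂, hne⟩ := exists_curve_ne hlam
  have hG := isCompactLeaf_pasted (φ := φ) (ψ := ψ) hh
  have key : ∀ D : ℂ → Pasted φ ψ h, IsLeafParam (pastedParam φ ψ h) D →
      F (Pasted.inl φ ψ h (boundary φ lam w)) ∉ range D := fun D hD hm =>
    hne (boundary_injective (inl_injective (hinj (hG.map_const hlam hD hF hm w₁ w₂))))
  rcases inl_or_inr (F (Pasted.inl φ ψ h (boundary φ lam w))) with ⟨p, hp⟩ | ⟨p, hp⟩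
  · refine ⟨⟨p, hp⟩, ?_⟩
    obtain ⟨q, hq, rfl⟩ := exists_reebPt p
    simp only [← hp]
    rw [inl_mem_range_inr, reebPt_mem_range_boundary hq]
    by_contra h0
    exact key _ (isLeafParam_inl hφ (lt_of_le_of_ne hq.1 (Ne.symm h0))) ⟨q.1, hp⟩
  · refine ⟨?_, ⟨p, hp⟩⟩
    obtain ⟨q, hq, rfl⟩ := exists_reebPt p
    simp only [← hp]
    rw [inr_mem_range_inl, reebPt_mem_range_boundary hq]
    by_contra h0
    exact key _ (isLeafParam_inr hψ (lt_of_le_of_ne hq.1 (Ne.symm h0))) ⟨q.1, hp⟩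

lemma isOpen_compl_range_boundary : IsOpen {p : Reeb φ lam | p ∉ range (boundary φ lam)} := by
  refine isQuotientMap_quotient_mk'.isOpen_preimage.1 ?_
  have : (Quotient.mk (reebSetoid φ lam) ⁻¹' {p : Reeb φ lam | p ∉ range (boundary φ lam)}) =
      {q : cover | q.1.2 ≠ 0} := by
    ext q
    change Reeb.mk φ lam q ∉ range (boundary φ lam) ↔ q.1.2 ≠ 0
    rw [mk_eq_reebPt, reebPt_mem_range_boundary q.2]
  exact this ▸ isOpen_ne_fun (continuous_snd.comp continuous_subtype_val) continuous_const

lemma isOpen_compl_range_inr : IsOpen {P : Pasted φ ψ h | P ∉ range (Pasted.inr φ ψ h)} := by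
  refine isQuotientMap_quot_mk.isOpen_preimage.1 (isOpen_sum_iff.2 ⟨?_, ?_⟩)
  · have : (Sum.inl ⁻¹' (Quot.mk (GlueRel φ ψ h) ⁻¹'
        {P : Pasted φ ψ h | P ∉ range (Pasted.inr φ ψ h)})) =
        {p : Reeb φ lam | p ∉ range (boundary φ lam)} := by
      ext p
      exact not_congr inl_mem_range_inr
    exact this ▸ isOpen_compl_range_boundary
  · convert isOpen_empty
    exact eq_empty_of_forall_notMem fun p hp => hp ⟨p, rfl⟩

lemma isOpen_compl_range_inl : IsOpen {P : Pasted φ ψ h | P ∉ range (Pasted.inl φ ψ h)} := by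
  refine isQuotientMap_quot_mk.isOpen_preimage.1 (isOpen_sum_iff.2 ⟨?_, ?_⟩)
  · convert isOpen_empty
    exact eq_empty_of_forall_notMem fun p hp => hp ⟨p, rfl⟩
  · have : (Sum.inr ⁻¹' (Quot.mk (GlueRel φ ψ h) ⁻¹'
        {P : Pasted φ ψ h | P ∉ range (Pasted.inl φ ψ h)})) =
        {p : Reeb ψ mu | p ∉ range (boundary ψ mu)} := by
      ext p
      exact not_congr inr_mem_range_inl
    exact this ▸ isOpen_compl_range_boundary

lemma continuous_inl : Continuous (Pasted.inl φ ψ h) := continuous_quot_mk.comp _root_.continuous_inl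

lemma continuous_inr : Continuous (Pasted.inr φ ψ h) := continuous_quot_mk.comp _root_.continuous_inr

lemma continuousOn_reebPt : ContinuousOn (reebPt φ lam) cover := by
  rw [continuousOn_iff_continuous_domRestrict]
  refine (continuous_quotient_mk' (s := reebSetoid φ lam)).congr fun q => ?_
  exact mk_eq_reebPt (φ := φ) (lam := lam) q

/-- A connected open leaf family stays on one side of the boundary leaf. -/
lemma map_connected_mem {S : Set (ℂ × ℝ)} (hS : IsPreconnected S) {G : ℂ × ℝ → Pasted φ ψ h}
    (hG : ContinuousOn G S)
    (hn : ∀ q ∈ S, ¬ (G q ∈ range (Pasted.inl φ ψ h) ∧ G q ∈ range (Pasted.inr φ ψ h)))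
    {A B : Set (Pasted φ ψ h)} (hA : IsOpen {P | P ∉ A}) (hB : IsOpen {P | P ∉ B})
    (hAB : ∀ P, P ∈ A ∨ P ∈ B) (hAB' : ∀ P, P ∈ A ∧ P ∈ B →
      P ∈ range (Pasted.inl φ ψ h) ∧ P ∈ range (Pasted.inr φ ψ h))
    {q₀ : ℂ × ℝ} (hq₀ : q₀ ∈ S) (h0 : G q₀ ∈ A) {q : ℂ × ℝ} (hq : q ∈ S) : G q ∈ A := by
  have him : IsPreconnected (G '' S) := hS.image G hG
  have hsub : G '' S ⊆ {P | P ∉ B} := by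
    refine him.subset_left_of_subset_union hB hA ?_ ?_ ⟨G q₀, ⟨q₀, hq₀, rfl⟩, fun hb =>
      hn q₀ hq₀ (hAB' _ ⟨h0, hb⟩)⟩
    · rw [Set.disjoint_left]
      intro P hP hP'
      rcases hAB P with hp | hp
      · exact hP' hp
      · exact hP hp
    · rintro _ ⟨p, hp, rfl⟩
      by_contra hc
      simp only [mem_union, mem_ofPred_eq, not_or, not_not] at hc
      exact hn p hp (hAB' _ ⟨hc.2, hc.1⟩)
  exact (hAB (G q)).resolve_right (hsub ⟨q, hq, rfl⟩)

variable (F : AutPasted φ ψ h)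

lemma autPasted_boundary_iff (hφ : IsExpanding φ) (hψ : IsExpanding ψ) (hlam : 1 < ‖(lam : ℂ)‖)
    (hh : IsHolomorphic h) {P : Pasted φ ψ h}
    (hP : F.1.1 P ∈ range (Pasted.inl φ ψ h) ∧ F.1.1 P ∈ range (Pasted.inr φ ψ h)) :
    P ∈ range (Pasted.inl φ ψ h) ∧ P ∈ range (Pasted.inr φ ψ h) := by
  have := map_boundary_pasted hφ hψ hlam hh F.1.2.2 F.1.1.symm.injective hP
  rwa [F.1.1.symm_apply_apply] at this

/-- Near a boundary point, an automorphism preserves the two sides. -/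
lemma exists_sides (hφ : IsExpanding φ) (hψ : IsExpanding ψ) (hlam : 1 < ‖(lam : ℂ)‖)
    (hh : IsHolomorphic h) :
    (∃ q : ℂ × ℝ, 0 < q.2 ∧
      F.1.1 (Pasted.inl φ ψ h (reebPt φ lam q)) ∈ range (Pasted.inl φ ψ h)) ∧
    ∃ q : ℂ × ℝ, 0 < q.2 ∧
      F.1.1 (Pasted.inr φ ψ h (reebPt ψ mu q)) ∈ range (Pasted.inr φ ψ h) := by
  obtain ⟨O, ℓ, hO, hl⟩ := hh 1
  set i : (pastedParam φ ψ h).ι := PastedIndex.collar O ℓ hl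
  have hdom : ∀ x : ℝ, (((1 : ℂˣ) : ℂ), x) ∈ (pastedParam φ ψ h).dom i := fun x => hO
  obtain ⟨j, U, g, hU, hg, hi⟩ := F.2.1 i _ (hdom 0)
  have hc : Continuous fun x : ℝ => (((1 : ℂˣ) : ℂ), x) := by fun_prop
  have hev : ∀ᶠ x in 𝓝 (0 : ℝ), (((1 : ℂˣ) : ℂ), x) ∈ U :=
    hc.continuousAt.preimage_mem_nhds (hg.isOpen.mem_nhds hU)
  obtain ⟨ε, hε, hball⟩ := Metric.eventually_nhds_iff.1 hev
  have hp : (((1 : ℂˣ) : ℂ), ε / 2) ∈ U := hball (by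
    rw [Real.dist_eq, sub_zero, abs_of_pos (half_pos hε)]; exact half_lt_self hε)
  have hm : (((1 : ℂˣ) : ℂ), -(ε / 2)) ∈ U := hball (by
    rw [Real.dist_eq, sub_zero, abs_neg, abs_of_pos (half_pos hε)]; exact half_lt_self hε)
  -- The boundary leaf is preserved, so height `0` goes to height `0`; the strict monotonicity of
  -- `g` across the collar then preserves the sign of `x`.
  have h0 : (g (((1 : ℂˣ) : ℂ), 0)).2 = 0 := by
    obtain ⟨h1, h2⟩ := hg.lift _ (hdom 0) hU
    have h3 := map_boundary_pasted hφ hψ hlam hh F.1.2.1 F.1.1.injective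
      ⟨(pastedParam_mem_range_inl (hdom 0)).2 le_rfl, (pastedParam_mem_range_inr (hdom 0)).2 le_rfl⟩
    rw [h2, pastedParam_mem_range_inl h1, pastedParam_mem_range_inr h1] at h3
    exact le_antisymm h3.2 h3.1
  constructor
  · refine ⟨(((1 : ℂˣ) : ℂ), ε / 2), half_pos hε, ?_⟩
    have h4 := hi _ ⟨hU, hdom 0⟩ _ ⟨hp, hdom (ε / 2)⟩ (half_pos hε)
    obtain ⟨h1, h2⟩ := hg.lift _ (hdom (ε / 2)) hp
    rw [pastedParam_of_nonneg (hdom (ε / 2)) (half_pos hε).le] at h2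
    rw [h2, pastedParam_mem_range_inl h1]
    exact (h0 ▸ h4).le
  · refine ⟨(ℓ ((1 : ℂˣ) : ℂ), ε / 2), half_pos hε, ?_⟩
    have h4 := hi _ ⟨hm, hdom _⟩ _ ⟨hU, hdom 0⟩ (neg_neg_of_pos (half_pos hε))
    obtain ⟨h1, h2⟩ := hg.lift _ (hdom _) hm
    rw [pastedParam_of_nonpos (hdom _) (neg_neg_of_pos (half_pos hε)).le] at h2
    have h5 : (mirrorCoord i ((((1 : ℂˣ) : ℂ), -(ε / 2)) : ℂ × ℝ).1, -(-(ε / 2))) =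
        (ℓ ((1 : ℂˣ) : ℂ), ε / 2) := Prod.ext rfl (neg_neg _)
    rw [h5] at h2
    rw [h2, pastedParam_mem_range_inr h1]
    exact (h0 ▸ h4).le

lemma isPreconnected_interior : IsPreconnected {q : ℂ × ℝ | 0 < q.2} := by
  have : Convex ℝ {q : ℂ × ℝ | 0 < q.2} :=
    convex_halfSpace_gt (f := fun q : ℂ × ℝ => q.2) (LinearMap.snd ℝ ℂ ℝ).isLinear 0
  exact this.isPreconnected

/-- The interior is connected and its image avoids the boundary leaf, because the inverse preserves
that leaf too. So one interior point kept on its side decides for all. -/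
lemma map_inl_mem (hφ : IsExpanding φ) (hψ : IsExpanding ψ) (hlam : 1 < ‖(lam : ℂ)‖)
    (hh : IsHolomorphic h) (p : Reeb φ lam) :
    F.1.1 (Pasted.inl φ ψ h p) ∈ range (Pasted.inl φ ψ h) := by
  obtain ⟨q, hq, rfl⟩ := exists_reebPt p
  rcases hq.1.lt_or_eq with hx | hx
  · obtain ⟨q₀, hq₀, h0⟩ := (exists_sides F hφ hψ hlam hh).1
    refine map_connected_mem isPreconnected_interior (G := fun q =>
      F.1.1 (Pasted.inl φ ψ h (reebPt φ lam q))) ?_ ?_ isOpen_compl_range_inl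
      isOpen_compl_range_inr inl_or_inr (fun _ => id) hq₀ h0 hx
    · exact (F.1.1.continuous.comp continuous_inl).comp_continuousOn
        (continuousOn_reebPt.mono fun q hq => mem_cover_of_pos hq)
    · intro q' hq' hm
      have h1 := (autPasted_boundary_iff F hφ hψ hlam hh hm).2
      rw [inl_mem_range_inr, reebPt_mem_range_boundary (mem_cover_of_pos hq')] at h1
      exact (show (0 : ℝ) < q'.2 from hq').ne' h1
  · exact (map_boundary_pasted hφ hψ hlam hh F.1.2.1 F.1.1.injective ⟨⟨_, rfl⟩,
      inl_mem_range_inr.2 ((reebPt_mem_range_boundary hq).2 hx.symm)⟩).1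

lemma map_inr_mem (hφ : IsExpanding φ) (hψ : IsExpanding ψ) (hlam : 1 < ‖(lam : ℂ)‖)
    (hh : IsHolomorphic h) (p : Reeb ψ mu) :
    F.1.1 (Pasted.inr φ ψ h p) ∈ range (Pasted.inr φ ψ h) := by
  obtain ⟨q, hq, rfl⟩ := exists_reebPt p
  rcases hq.1.lt_or_eq with hx | hx
  · obtain ⟨q₀, hq₀, h0⟩ := (exists_sides F hφ hψ hlam hh).2
    refine map_connected_mem isPreconnected_interior (G := fun q =>
      F.1.1 (Pasted.inr φ ψ h (reebPt ψ mu q))) ?_ ?_ isOpen_compl_range_inr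
      isOpen_compl_range_inl (fun P => (inl_or_inr P).symm) (fun _ => And.symm) hq₀ h0 hx
    · exact (F.1.1.continuous.comp continuous_inr).comp_continuousOn
        (continuousOn_reebPt.mono fun q hq => mem_cover_of_pos hq)
    · intro q' hq' hm
      have h1 := (autPasted_boundary_iff F hφ hψ hlam hh hm).1
      rw [inr_mem_range_inl, reebPt_mem_range_boundary (mem_cover_of_pos hq')] at h1
      exact (show (0 : ℝ) < q'.2 from hq').ne' h1
  · exact (map_boundary_pasted hφ hψ hlam hh F.1.2.1 F.1.1.injective
      ⟨inr_mem_range_inl.2 ((reebPt_mem_range_boundary hq).2 hx.symm), ⟨_, rfl⟩⟩).2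

end PastedSpace

/-! ### Restriction of automorphisms of `M` to the two components. -/

section Restrict

variable {φ ψ : HalfLineDiffeo} {lam mu : ℂˣ} {h : Curve lam ≃ₜ Curve mu}

lemma LeafwiseLift.of_inl {F : Pasted φ ψ h → Pasted φ ψ h} {f : Reeb φ lam → Reeb φ lam}
    (hf : ∀ p, F (Pasted.inl φ ψ h p) = Pasted.inl φ ψ h (f p)) {i j : (pastedParam φ ψ h).ι}
    {U : Set (ℂ × ℝ)} {g : ℂ × ℝ → ℂ × ℝ} (hg : LeafwiseLift (pastedParam φ ψ h) F i j U g) :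
    LeafwiseLift (reebParam φ lam) f () () (U ∩ (pastedParam φ ψ h).dom i) g := by
  refine ⟨hg.isOpen.inter (isOpen_pastedDom i), fun p hp hpU => ?_, hg.smooth.mono fun p hp => hp.1,
    fun p hp p' hp' he => hg.slice p hp.1 p' hp'.1 he,
    fun x => (hg.holomorphic x).mono fun z hz => hz.1⟩
  obtain ⟨h1, h2⟩ := hg.lift p hpU.2 hpU.1
  rw [pastedParam_of_nonneg hpU.2 hp.1, hf] at h2
  have h3 : 0 ≤ (g p).2 := (pastedParam_mem_range_inl h1).1 ⟨_, h2⟩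
  rw [pastedParam_of_nonneg h1 h3] at h2
  have h4 := mem_cover_of_mem_pastedDom h1 h3
  refine ⟨h4, ?_⟩
  have h5 := inl_injective h2
  rwa [reebPt_of_mem hp, reebPt_of_mem h4] at h5

lemma isLeafwiseMap_of_inl (hh : IsHolomorphic h) {F : Pasted φ ψ h → Pasted φ ψ h}
    (hF : IsLeafwiseMap (pastedParam φ ψ h) F) {f : Reeb φ lam → Reeb φ lam}
    (hf : ∀ p, F (Pasted.inl φ ψ h p) = Pasted.inl φ ψ h (f p)) :
    IsLeafwiseMap (reebParam φ lam) f := by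
  intro _ q hq
  have hi : ∃ i : (pastedParam φ ψ h).ι, q ∈ (pastedParam φ ψ h).dom i := by
    rcases hq.1.lt_or_eq with hx | hx
    · exact ⟨PastedIndex.left, hx⟩
    · obtain ⟨O, ℓ, hO, hl⟩ := hh (Units.mk0 q.1 (fst_ne_zero_of_mem_cover hq hx.symm))
      exact ⟨PastedIndex.collar O ℓ hl, hO⟩
  obtain ⟨i, hi⟩ := hi
  obtain ⟨j, U, g, hU, hg⟩ := hF i q hi
  exact ⟨(), U ∩ (pastedParam φ ψ h).dom i, g, ⟨hU, hi⟩, hg.of_inl hf⟩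

/-- On the negative side of a collar the leaf coordinate of the second component is `ℓ(z)`. A local
expression of `F` must therefore be conjugated by lifts, with a holomorphic local inverse of `ℓ` on
the source side. -/
lemma isLeafwiseMap_of_inr (hlam : 1 < ‖(lam : ℂ)‖) (hmu : 1 < ‖(mu : ℂ)‖)
    (hh : IsHolomorphic h) {F : Pasted φ ψ h → Pasted φ ψ h}
    (hF : IsLeafwiseMap (pastedParam φ ψ h) F) {f : Reeb ψ mu → Reeb ψ mu}
    (hf : ∀ p, F (Pasted.inr φ ψ h p) = Pasted.inr φ ψ h (f p)) :
    IsLeafwiseMap (reebParam ψ mu) f := by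
  obtain ⟨κ, hκ⟩ := exists_logDeriv hlam hmu hh
  have hκ0 := logDeriv_ne_zero hκ hlam hh h.injective
  intro _ q hq
  have hi : ∃ (i : (pastedParam φ ψ h).ι) (V : Set (ℂ × ℝ)) (k : ℂ → ℂ), IsOpen V ∧ q ∈ V ∧
      (∀ x, DifferentiableOn ℂ k {z | (z, x) ∈ V}) ∧
      ContDiffOn ℝ ∞ (fun p : ℂ × ℝ => k p.1) V ∧
      ∀ p ∈ V, (k p.1, -p.2) ∈ (pastedParam φ ψ h).dom i ∧ mirrorCoord i (k p.1) = p.1 := by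
    rcases hq.1.lt_or_eq with hx | hx
    · exact ⟨PastedIndex.right, {q | 0 < q.2}, id, isOpen_lt continuous_const continuous_snd, hx,
        fun _ => differentiableOn_id, contDiff_fst.contDiffOn, fun p hp => ⟨show -p.2 < 0 from neg_neg_of_pos hp, rfl⟩⟩
    · obtain ⟨O, ℓ, V, k, hl, hV, hvV, hk, hs⟩ := exists_section hκ hκ0 hh h.surjective
        (Units.mk0 q.1 (fst_ne_zero_of_mem_cover hq hx.symm))
      exact ⟨PastedIndex.collar O ℓ hl, Prod.fst ⁻¹' V, k, hV.preimage continuous_fst, hvV,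
        fun _ => hk, ((hk.contDiffOn hV).restrict_scalars ℝ).comp contDiff_fst.contDiffOn
        fun p hp => hp, fun p hp => hs _ hp⟩
  obtain ⟨i, V, k, hV, hqV, hkd, hks, hkV⟩ := hi
  obtain ⟨j, U, g, hU, hg⟩ := hF i _ (hkV q hqV).1
  set n : ℂ × ℝ → ℂ × ℝ := fun p => (k p.1, -p.2) with hn
  have hns : ContDiffOn ℝ ∞ n V := hks.prodMk contDiff_snd.neg.contDiffOn
  have hdom : ∀ p ∈ V ∩ n ⁻¹' U, n p ∈ U ∩ (pastedParam φ ψ h).dom i := fun p hp =>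
    ⟨hp.2, (hkV p hp.1).1⟩
  have hlift : ∀ p ∈ cover, p ∈ V ∩ n ⁻¹' U → g (n p) ∈ (pastedParam φ ψ h).dom j ∧
      (mirrorCoord j (g (n p)).1, -(g (n p)).2) ∈ cover ∧
      f (reebPt ψ mu p) = reebPt ψ mu (mirrorCoord j (g (n p)).1, -(g (n p)).2) := by
    intro p hp hpV
    obtain ⟨h1, h2⟩ := hg.lift _ (hdom p hpV).2 hpV.2
    have h0 : (n p).2 ≤ 0 := neg_nonpos.2 hp.1
    rw [pastedParam_of_nonpos (hdom p hpV).2 h0] at h2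
    have h3 : (mirrorCoord i (n p).1, -(n p).2) = p :=
      Prod.ext (hkV p hpV.1).2 (neg_neg _)
    rw [h3, hf] at h2
    have h4 : (g (n p)).2 ≤ 0 := (pastedParam_mem_range_inr h1).1 ⟨_, h2⟩
    rw [pastedParam_of_nonpos h1 h4] at h2
    exact ⟨h1, mirrorCoord_mem_cover h1 h4, inr_injective h2⟩
  refine ⟨(), V ∩ n ⁻¹' U, fun p => (mirrorCoord j (g (n p)).1, -(g (n p)).2), ⟨hqV, hU⟩,
    hns.continuousOn.isOpen_inter_preimage hV hg.isOpen, fun p hp hpV => ?_, ?_, ?_, fun x => ?_⟩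
  · obtain ⟨-, h2, h3⟩ := hlift p hp hpV
    exact ⟨h2, by rwa [reebPt_of_mem hp, reebPt_of_mem h2] at h3⟩
  · exact (mirrorCoord_contDiffOn j).comp (hg.smooth.comp (hns.mono fun p hp => hp.1.1)
      fun p hp => hdom p hp.1) fun p hp => (hlift p hp.2 hp.1).1
  · intro p hp p' hp' he
    simp only
    rw [hg.slice _ (hdom p hp.1) _ (hdom p' hp'.1) (by simp [hn, he])]
  · intro z hz
    have hsl : ∀ w ∈ {z | (z, x) ∈ V ∩ n ⁻¹' U ∩ (reebParam ψ mu).dom ()},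
        (g (n (w, x))).2 = (g (n (z, x))).2 := fun w hw =>
      hg.slice _ (hdom _ hw.1) _ (hdom _ hz.1) rfl
    refine ((mirrorCoord_differentiableOn j (g (n (z, x))).2).comp
      (s := {z | (z, x) ∈ V ∩ n ⁻¹' U ∩ (reebParam ψ mu).dom ()})
      ((hg.holomorphic (-x)).comp ((hkd x).mono fun w hw => hw.1.1)
        fun w hw => hdom _ hw.1) fun w hw => ?_) z hz
    have h1 := (hlift _ hw.2 hw.1).1
    rw [← Prod.mk.eta (p := g (n (w, x))), hsl w hw] at h1
    exact h1

/-- An automorphism of `M` restricts to the first component. -/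
lemma exists_restrict_inl (hφ : IsExpanding φ) (hψ : IsExpanding ψ) (hlam : 1 < ‖(lam : ℂ)‖)
    (hh : IsHolomorphic h) (F : AutPasted φ ψ h) :
    ∃ f : AutReeb φ lam, ∀ p, F.1.1 (Pasted.inl φ ψ h p) = Pasted.inl φ ψ h (f.1 p) := by
  choose f hf using map_inl_mem F hφ hψ hlam hh
  choose f' hf' using map_inl_mem F⁻¹ hφ hψ hlam hh
  have hL := isLeafwiseMap_of_inl hh F.1.2.1 fun p => (hf p).symm
  have hL' := isLeafwiseMap_of_inl hh F.1.2.2 fun p => (hf' p).symm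
  refine ⟨⟨⟨⟨f, f', fun p => ?_, fun p => ?_⟩, hL.continuous_reeb, hL'.continuous_reeb⟩, hL, hL'⟩,
    fun p => (hf p).symm⟩
  · refine inl_injective (φ := φ) (ψ := ψ) (h := h) ?_
    rw [hf', hf]
    exact F.1.1.symm_apply_apply _
  · refine inl_injective (φ := φ) (ψ := ψ) (h := h) ?_
    rw [hf, hf']
    exact F.1.1.apply_symm_apply _

/-- An automorphism of `M` restricts to the second component. -/
lemma exists_restrict_inr (hφ : IsExpanding φ) (hψ : IsExpanding ψ) (hlam : 1 < ‖(lam : ℂ)‖)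
    (hmu : 1 < ‖(mu : ℂ)‖) (hh : IsHolomorphic h) (F : AutPasted φ ψ h) :
    ∃ f : AutReeb ψ mu, ∀ p, F.1.1 (Pasted.inr φ ψ h p) = Pasted.inr φ ψ h (f.1 p) := by
  choose f hf using map_inr_mem F hφ hψ hlam hh
  choose f' hf' using map_inr_mem F⁻¹ hφ hψ hlam hh
  have hL := isLeafwiseMap_of_inr hlam hmu hh F.1.2.1 fun p => (hf p).symm
  have hL' := isLeafwiseMap_of_inr hlam hmu hh F.1.2.2 fun p => (hf' p).symm
  refine ⟨⟨⟨⟨f, f', fun p => ?_, fun p => ?_⟩, hL.continuous_reeb, hL'.continuous_reeb⟩, hL, hL'⟩,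
    fun p => (hf p).symm⟩
  · refine inr_injective (φ := φ) (ψ := ψ) (h := h) ?_
    rw [hf', hf]
    exact F.1.1.symm_apply_apply _
  · refine inr_injective (φ := φ) (ψ := ψ) (h := h) ?_
    rw [hf, hf']
    exact F.1.1.apply_symm_apply _

end Restrict

/-! ### Joining transverse diffeomorphisms at the boundary leaf. -/

section TwoSided

/-- The map which is `η` on `[0, ∞)` and the reflection of `ξ` on `(-∞, 0]`. -/
noncomputable def twoSided (η ξ : HalfLineDiffeo) (x : ℝ) : ℝ :=
  x + flatExt (fun y => halfLineFun η.1 y - y) x - flatExt (fun y => halfLineFun ξ.1 y - y) (-x)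

variable {η ξ : HalfLineDiffeo}

lemma twoSided_of_nonneg (hξ : FlatAtZero fun y => halfLineFun ξ.1 y - y) {x : ℝ} (hx : 0 ≤ x) :
    twoSided η ξ x = halfLineFun η.1 x := by
  rw [twoSided, flatExt_of_nonneg _ hx, flatExt_of_nonpos hξ (neg_nonpos.2 hx)]
  ring

lemma twoSided_of_nonpos (hη : FlatAtZero fun y => halfLineFun η.1 y - y) {x : ℝ} (hx : x ≤ 0) :
    twoSided η ξ x = -halfLineFun ξ.1 (-x) := by
  rw [twoSided, flatExt_of_nonneg _ (neg_nonneg.2 hx), flatExt_of_nonpos hη hx]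
  ring

lemma twoSided_contDiff (hη : FlatAtZero fun y => halfLineFun η.1 y - y)
    (hξ : FlatAtZero fun y => halfLineFun ξ.1 y - y) : ContDiff ℝ ∞ (twoSided η ξ) :=
  (contDiff_id.add hη.contDiff_flatExt).sub (hξ.contDiff_flatExt.comp contDiff_neg)

lemma twoSided_strictMono (hη : FlatAtZero fun y => halfLineFun η.1 y - y)
    (hξ : FlatAtZero fun y => halfLineFun ξ.1 y - y) : StrictMono (twoSided η ξ) := by
  have h1 : StrictMonoOn (twoSided η ξ) (Ici 0) := fun x hx y hy hxy => by
    rw [twoSided_of_nonneg hξ hx, twoSided_of_nonneg hξ hy]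
    exact halfLineFun_strictMonoOn η hx hy hxy
  have h2 : StrictMonoOn (twoSided η ξ) (Iic 0) := fun x hx y hy hxy => by
    rw [twoSided_of_nonpos hη hx, twoSided_of_nonpos hη hy]
    exact neg_lt_neg (halfLineFun_strictMonoOn ξ (mem_Ici.2 (neg_nonneg.2 hy))
      (mem_Ici.2 (neg_nonneg.2 hx)) (neg_lt_neg hxy))
  exact h2.Iic_union_Ici h1

end TwoSided

/-! ### Pasting automorphisms, and the fibre product. -/

section Gluing

variable {φ ψ : HalfLineDiffeo} {lam mu : ℂˣ} {h : Curve lam ≃ₜ Curve mu}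
  {F : Pasted φ ψ h → Pasted φ ψ h} {f : Reeb φ lam → Reeb φ lam} {f' : Reeb ψ mu → Reeb ψ mu}
  {a a' : ℂˣ} {b b' : ℝ → ℂ} {η ξ : HalfLineDiffeo}

lemma leafwiseLift_of_pos (hF : ∀ p, F (Pasted.inl φ ψ h p) = Pasted.inl φ ψ h (f p))
    (hf : IsReebLift f a b η) (i : (pastedParam φ ψ h).ι) :
    LeafwiseLift (pastedParam φ ψ h) F i PastedIndex.left {q | 0 < q.2} (reebMap a b η) := by
  refine ⟨isOpen_lt continuous_const continuous_snd, fun q hq (hqU : 0 < q.2) => ?_, ?_, ?_, ?_⟩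
  · have hpos : 0 < (reebMap a b η q).2 := halfLineFun_pos η hqU
    refine ⟨hpos, ?_⟩
    rw [pastedParam_of_nonneg hq hqU.le, hF, hf.apply' (mem_cover_of_pos hqU)]
    exact (pastedParam_of_nonneg (i := PastedIndex.left) hpos hpos.le).symm
  · exact (reebMap_smooth hf.smooth).mono fun q hq => (show 0 < q.2 from hq.1).le
  · intro q _ q' _ he
    simp only [reebMap, he]
  · exact fun x => ((differentiable_id.const_mul (a : ℂ)).add_const (b x)).differentiableOn

lemma leafwiseLift_of_neg (hF : ∀ p, F (Pasted.inr φ ψ h p) = Pasted.inr φ ψ h (f' p))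
    (hf' : IsReebLift f' a' b' ξ) (i : (pastedParam φ ψ h).ι) :
    LeafwiseLift (pastedParam φ ψ h) F i PastedIndex.right {q | q.2 < 0}
      (fun q => flip (reebMap a' b' ξ (mirrorCoord i q.1, -q.2))) := by
  refine ⟨isOpen_lt continuous_snd continuous_const, fun q hq (hqU : q.2 < 0) => ?_, ?_, ?_, ?_⟩
  · have hpos : 0 < (reebMap a' b' ξ (mirrorCoord i q.1, -q.2)).2 :=
      halfLineFun_pos ξ (neg_pos.2 hqU)
    have hneg : (flip (reebMap a' b' ξ (mirrorCoord i q.1, -q.2))).2 < 0 := neg_neg_of_pos hpos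
    refine ⟨hneg, ?_⟩
    rw [pastedParam_of_nonpos hq hqU.le, hF, hf'.apply' (mirrorCoord_mem_cover hq hqU.le)]
    refine Eq.trans ?_ (pastedParam_of_nonpos (i := PastedIndex.right) hneg hneg.le).symm
    congr 2
    exact Prod.ext rfl (neg_neg _).symm
  · exact flip_contDiff.comp_contDiffOn ((reebMap_smooth hf'.smooth).comp
      ((mirrorCoord_contDiffOn i).mono inter_subset_right) fun q hq =>
      (neg_nonneg.2 (le_of_lt hq.1) : 0 ≤ -q.2))
  · intro q _ q' _ he
    simp only [reebMap, flip_snd, he]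
  · intro x
    have h1 : DifferentiableOn ℂ (mirrorCoord i)
        {z | (z, x) ∈ {q : ℂ × ℝ | q.2 < 0} ∩ (pastedParam φ ψ h).dom i} :=
      (mirrorCoord_differentiableOn i x).mono fun z hz => hz.2
    have h2 := (h1.const_mul (a' : ℂ)).add_const (b' (-x))
    exact h2

/-- The expression of a glued map across the boundary leaf. -/
lemma exists_leafwiseLift_collar {κ : ℂ}
    (hκ : ∀ O ℓ, HolLift h O ℓ → ∀ z ∈ O, z * deriv ℓ z = κ * ℓ z) (hκ0 : κ ≠ 0)
    (hh : IsHolomorphic h) (hF : ∀ p, F (Pasted.inl φ ψ h p) = Pasted.inl φ ψ h (f p))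
    (hF' : ∀ p, F (Pasted.inr φ ψ h p) = Pasted.inr φ ψ h (f' p))
    (hf : IsReebLift f a b η) (hf' : IsReebLift f' a' b' ξ)
    (ha : curveHom hκ hh (a : Curve lam) = (a' : Curve mu)) (hb : FlatAtZero b)
    (hb' : FlatAtZero b') (hη : FlatAtZero fun y => halfLineFun η.1 y - y)
    (hξ : FlatAtZero fun y => halfLineFun ξ.1 y - y) {O : Set ℂ} {ℓ : ℂ → ℂ}
    (hl : HolLift h O ℓ) {z₀ : ℂ} (hz₀ : z₀ ∈ O) :
    ∃ j U g, (z₀, (0 : ℝ)) ∈ U ∧ LeafwiseLift (pastedParam φ ψ h) F (PastedIndex.collar O ℓ hl) j U g ∧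
      ∀ p ∈ U, ∀ p' ∈ U, p.2 < p'.2 → (g p).2 < (g p').2 := by
  obtain ⟨δ, hδ, hball⟩ := hl.exists_ball hκ hz₀
  -- On the negative side the image must have `ℓ`-coordinate `a' ℓ(z) + b'(-x) = a' N ℓ(z)`.
  -- Multiplying `z` by `exp(E)` multiplies `ℓ(z)` by `exp(κ E)`, so `E = log(N) / κ` is the right
  -- correction. For `x ≥ 0` flat extension makes `N = 1` and `E = 0`, and the formula reduces to
  -- the one of the first component.
  set N : ℂ × ℝ → ℂ := fun p => 1 + flatExt b' (-p.2) / (a' * ℓ p.1) with hN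
  set E : ℂ × ℝ → ℂ := fun p => Complex.log (N p) / κ with hE
  set g : ℂ × ℝ → ℂ × ℝ := fun p =>
    (a * (Complex.exp (E p) * p.1) + flatExt b p.2, twoSided η ξ p.2) with hg
  have hℓ : ∀ p : ℂ × ℝ, p.1 ∈ O → ContDiffAt ℝ ∞ (fun p : ℂ × ℝ => ℓ p.1) p := fun p hp =>
    ContDiffAt.comp (g := ℓ) p (((hl.holomorphic.contDiffOn hl.isOpen).contDiffAt
      (hl.isOpen.mem_nhds hp)).restrict_scalars ℝ) contDiffAt_fst
  have hNs : ∀ p : ℂ × ℝ, p.1 ∈ O → ContDiffAt ℝ ∞ N p := fun p hp => by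
    simp only [hN, div_eq_mul_inv]
    refine contDiffAt_const.add (ContDiffAt.mul ?_ ((contDiffAt_const.mul (hℓ p hp)).inv
      (mul_ne_zero a'.ne_zero (hl.ne_zero hp))))
    exact (hb'.contDiff_flatExt.comp contDiff_snd.neg).contDiffAt
  have hEs : ∀ p : ℂ × ℝ, p.1 ∈ O → N p ∈ Complex.slitPlane → ContDiffAt ℝ ∞ E p := fun p hp hs =>
    (ContDiffAt.comp (g := Complex.log) p ((Complex.contDiffAt_log hs).restrict_scalars ℝ)
      (hNs p hp)).div_const κ
  have hes : ∀ p : ℂ × ℝ, p.1 ∈ O → N p ∈ Complex.slitPlane →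
      ContDiffAt ℝ ∞ (fun p => Complex.exp (E p) * p.1) p := fun p hp hs =>
    (hEs p hp hs).cexp.mul contDiffAt_fst
  have hgs : ∀ p : ℂ × ℝ, p.1 ∈ O → N p ∈ Complex.slitPlane → ContDiffAt ℝ ∞ g p := fun p hp hs =>
    ((contDiffAt_const.mul (hes p hp hs)).add
      (hb.contDiff_flatExt.comp contDiff_snd).contDiffAt).prodMk
      ((twoSided_contDiff hη hξ).comp contDiff_snd).contDiffAt
  have hNpos : ∀ p : ℂ × ℝ, 0 ≤ p.2 → N p = 1 := fun p hp => by
    simp only [hN]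
    rw [flatExt_of_nonpos hb' (neg_nonpos.2 hp), zero_div, add_zero]
  have hEpos : ∀ p : ℂ × ℝ, 0 ≤ p.2 → E p = 0 := fun p hp => by
    simp only [hE]
    rw [hNpos p hp, Complex.log_one, zero_div]
  have hgpos : ∀ p : ℂ × ℝ, 0 ≤ p.2 → g p = reebMap a b η p := fun p hp => by
    simp only [hg, reebMap]
    rw [hEpos p hp, Complex.exp_zero, one_mul, flatExt_of_nonneg _ hp, twoSided_of_nonneg hξ hp]
  have hN1 : N (z₀, 0) ∈ Complex.slitPlane := by
    rw [hNpos _ le_rfl]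
    exact Complex.one_mem_slitPlane
  -- All these conditions are open and hold at `(z₀, 0)`: the logarithm is defined, `E` is small
  -- enough for the exponential formula, and the image lies in the translated collar.
  have hcond : ∀ᶠ p in 𝓝 (z₀, (0 : ℝ)), p.1 ∈ Metric.ball z₀ δ ∧ p.1 ∈ O ∧
      N p ∈ Complex.slitPlane ∧ E p ∈ Metric.ball (0 : ℂ) δ ∧ ((a⁻¹ : ℂˣ) : ℂ) * (g p).1 ∈ O := by
    refine (continuousAt_fst.eventually_mem (Metric.ball_mem_nhds _ hδ)).and
      ((continuousAt_fst.eventually_mem (hl.isOpen.mem_nhds hz₀)).and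
      (((hNs (z₀, 0) hz₀).continuousAt.eventually_mem
        (Complex.isOpen_slitPlane.mem_nhds hN1)).and
      (((hEs (z₀, 0) hz₀ hN1).continuousAt.eventually_mem ?_).and ?_)))
    · rw [hEpos _ le_rfl]
      exact Metric.ball_mem_nhds 0 hδ
    · have hc : ContinuousAt (fun p => ((a⁻¹ : ℂˣ) : ℂ) * (g p).1) (z₀, (0 : ℝ)) :=
        continuousAt_const.mul (hgs (z₀, 0) hz₀ hN1).continuousAt.fst
      refine hc.eventually_mem (hl.isOpen.mem_nhds ?_)
      rw [hgpos _ le_rfl]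
      simpa [reebMap, hb.apply_zero] using hz₀
  obtain ⟨U, hU, hUo, hzU⟩ := mem_nhds_iff.1 hcond
  -- The target chart is the same lift moved by `a` on the source and `a'` on the target, which is
  -- again a lift of `h` exactly because the two boundary translations correspond.
  have hl' := hl.translate hκ hh ha
  refine ⟨PastedIndex.collar _ _ hl', U, g, hzU, ⟨hUo, fun p hp hpU => ?_, ?_, ?_, ?_⟩, ?_⟩
  · obtain ⟨h1, h2, h3, h4, h5⟩ := hU hpU
    refine ⟨h5, ?_⟩
    rcases le_total 0 p.2 with hx | hx
    · have h6 : 0 ≤ (g p).2 := by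
        rw [hgpos p hx]
        exact halfLineFun_nonneg _ _
      refine Eq.trans ?_ (pastedParam_of_nonneg (i := PastedIndex.collar _ _ hl') h5 h6).symm
      rw [pastedParam_of_nonneg hp hx, hF, hf.apply' (mem_cover_of_mem_pastedDom hp hx), hgpos p hx]
    · have h6 : (g p).2 = -halfLineFun ξ.1 (-p.2) := twoSided_of_nonpos hη hx
      have h7 : (g p).2 ≤ 0 := by
        rw [h6]
        exact neg_nonpos.2 (halfLineFun_nonneg _ _)
      refine Eq.trans ?_ (pastedParam_of_nonpos (i := PastedIndex.collar _ _ hl') h5 h7).symm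
      rw [pastedParam_of_nonpos hp hx, hF', hf'.apply' (mirrorCoord_mem_cover hp hx)]
      congr 2
      refine Prod.ext ?_ (by rw [h6, neg_neg]; rfl)
      change (a' : ℂ) * ℓ p.1 + b' (-p.2) = a' * ℓ (((a⁻¹ : ℂˣ) : ℂ) * (g p).1)
      have h8 : ((a⁻¹ : ℂˣ) : ℂ) * (g p).1 = Complex.exp (E p) * p.1 := by
        simp only [hg]
        rw [flatExt_of_nonpos hb hx, add_zero, ← mul_assoc, Units.inv_mul, one_mul]
      have h9 : Complex.exp (κ * E p) = N p := by
        simp only [hE]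
        rw [mul_div_cancel₀ _ hκ0, Complex.exp_log (Complex.slitPlane_ne_zero h3)]
      have h10 := mul_ne_zero a'.ne_zero (hl.ne_zero h2)
      rw [h8, (hball _ h1 _ h4).2.2, h9]
      simp only [hN]
      rw [flatExt_of_nonneg _ (neg_nonneg.2 hx), mul_left_comm, add_mul, one_mul,
        div_mul_cancel₀ _ h10]
  · intro p hp
    exact (hgs p (hU hp.1).2.1 (hU hp.1).2.2.1).contDiffWithinAt
  · intro p _ p' _ he
    simp only [hg, he]
  · intro x z hz
    obtain ⟨-, h2, h3, -, -⟩ := hU hz.1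
    have h4 : DifferentiableAt ℂ ℓ z := hl.holomorphic.differentiableAt (hl.isOpen.mem_nhds h2)
    have h5 : DifferentiableAt ℂ (fun z => N (z, x)) z :=
      (differentiableAt_const (1 : ℂ)).add ((differentiableAt_const (flatExt b' (-x))).fun_div (h4.const_mul _)
        (mul_ne_zero a'.ne_zero (hl.ne_zero h2)))
    have h6 : DifferentiableAt ℂ (fun z => E (z, x)) z := (h5.clog h3).div_const κ
    exact (((h6.cexp.mul differentiableAt_id).const_mul (a : ℂ)).add_const
      (flatExt b x)).differentiableWithinAt
  · exact fun p _ p' _ hlt => twoSided_strictMono hη hξ hlt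

lemma exists_leafwiseLift_glued {κ : ℂ}
    (hκ : ∀ O ℓ, HolLift h O ℓ → ∀ z ∈ O, z * deriv ℓ z = κ * ℓ z) (hκ0 : κ ≠ 0)
    (hh : IsHolomorphic h) (hF : ∀ p, F (Pasted.inl φ ψ h p) = Pasted.inl φ ψ h (f p))
    (hF' : ∀ p, F (Pasted.inr φ ψ h p) = Pasted.inr φ ψ h (f' p))
    (hf : IsReebLift f a b η) (hf' : IsReebLift f' a' b' ξ)
    (ha : curveHom hκ hh (a : Curve lam) = (a' : Curve mu)) (hb : FlatAtZero b)
    (hb' : FlatAtZero b') (hη : FlatAtZero fun y => halfLineFun η.1 y - y)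
    (hξ : FlatAtZero fun y => halfLineFun ξ.1 y - y) :
    IsTransverselyIncreasing (pastedParam φ ψ h) F := by
  intro i q hq
  rcases lt_trichotomy q.2 0 with hx | hx | hx
  · refine ⟨_, _, _, hx, leafwiseLift_of_neg hF' hf' i, fun p hp p' hp' hlt => ?_⟩
    exact neg_lt_neg (halfLineFun_strictMonoOn ξ (mem_Ici.2 (neg_nonneg.2 (show p'.2 < 0 from hp'.1).le))
      (mem_Ici.2 (neg_nonneg.2 (show p.2 < 0 from hp.1).le)) (neg_lt_neg hlt))
  · match i with
    | .left => exact absurd (show 0 < q.2 from hq) hx.not_gt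
    | .right => exact absurd (show q.2 < 0 from hq) hx.not_lt
    | .collar O ℓ hl =>
      obtain ⟨j, U, g, h1, h2, h3⟩ := exists_leafwiseLift_collar hκ hκ0 hh hF hF' hf hf' ha hb hb'
        hη hξ hl (z₀ := q.1) hq
      exact ⟨j, U, g, by rwa [← Prod.mk.eta (p := q), hx], h2,
        fun p hp p' hp' => h3 p hp.1 p' hp'.1⟩
  · refine ⟨_, _, _, hx, leafwiseLift_of_pos hF hf i, fun p hp p' hp' hlt => ?_⟩
    exact halfLineFun_strictMonoOn η (mem_Ici.2 (show 0 < p.2 from hp.1).le)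
      (mem_Ici.2 (show 0 < p'.2 from hp'.1).le) hlt

lemma IsTransverselyIncreasing.isLeafwiseMap {X : Type} {A : Parametrizations X} {f : X → X}
    (hf : IsTransverselyIncreasing A f) : IsLeafwiseMap A f := fun i q hq => by
  obtain ⟨j, U, g, h1, h2, -⟩ := hf i q hq
  exact ⟨j, U, g, h1, h2⟩

/-- The map of `M` given by maps of the two components which agree on the boundary leaf. -/
def glueFun (f : Reeb φ lam → Reeb φ lam) (f' : Reeb ψ mu → Reeb ψ mu)
    (hc : ∀ w, ∃ w', f (boundary φ lam w) = boundary φ lam w' ∧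
      f' (boundary ψ mu (h w)) = boundary ψ mu (h w')) : Pasted φ ψ h → Pasted φ ψ h :=
  Quot.map (Sum.map f f') (by
    rintro _ _ ⟨w⟩
    obtain ⟨w', h1, h2⟩ := hc w
    simp only [Sum.map_inl, Sum.map_inr, h1, h2]
    exact GlueRel.glue w')

lemma glueFun_continuous {f : Reeb φ lam → Reeb φ lam} {f' : Reeb ψ mu → Reeb ψ mu}
    (hc : ∀ w, ∃ w', f (boundary φ lam w) = boundary φ lam w' ∧
      f' (boundary ψ mu (h w)) = boundary ψ mu (h w')) (hf : Continuous f) (hf' : Continuous f') :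
    Continuous (glueFun f f' hc) :=
  continuous_quot_lift _ (continuous_quot_mk.comp (hf.sumMap hf'))

/-- Compatible automorphisms of the two components can be pasted together. -/
lemma exists_glued (hφ : IsExpanding φ) (hψ : IsExpanding ψ) (hφ_flat : IsFlat φ)
    (hψ_flat : IsFlat ψ) (hlam : 1 < ‖(lam : ℂ)‖) (hmu : 1 < ‖(mu : ℂ)‖)
    (hh : IsHolomorphic h) (f : AutReeb φ lam) (f' : AutReeb ψ mu)
    (hff : ∀ w, h (boundaryClass hφ hlam f * w) = boundaryClass hψ hmu f' * h w) :
    ∃ F : AutPasted φ ψ h, (∀ p, F.1.1 (Pasted.inl φ ψ h p) = Pasted.inl φ ψ h (f.1 p)) ∧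
      ∀ p, F.1.1 (Pasted.inr φ ψ h p) = Pasted.inr φ ψ h (f'.1 p) := by
  obtain ⟨κ, hκ⟩ := exists_logDeriv hlam hmu hh
  have hκ0 := logDeriv_ne_zero hκ hlam hh h.injective
  -- The fibre product condition at the unit point, after cancelling `h(1)`.
  have hcl : curveHom hκ hh (boundaryClass hφ hlam f) = boundaryClass hψ hmu f' := by
    have h1 := (curveHom_mul hκ hh (boundaryClass hφ hlam f) ((1 : ℂˣ) : Curve lam)).symm.trans
      (hff _)
    have h2 := congrArg (fun c => c * (h ((1 : ℂˣ) : Curve lam))⁻¹) h1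
    simpa only [mul_inv_cancel_right] using h2
  have key : ∀ (e : AutReeb φ lam) (e' : AutReeb ψ mu) (G : Pasted φ ψ h → Pasted φ ψ h),
      curveHom hκ hh (boundaryClass hφ hlam e) = boundaryClass hψ hmu e' →
      (∀ p, G (Pasted.inl φ ψ h p) = Pasted.inl φ ψ h (e.1 p)) →
      (∀ p, G (Pasted.inr φ ψ h p) = Pasted.inr φ ψ h (e'.1 p)) →
      IsTransverselyIncreasing (pastedParam φ ψ h) G := by
    intro e e' G hc h1 h2
    obtain ⟨a, b, η, he⟩ := exists_isReebLift hφ hlam e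
    obtain ⟨a', b', ξ, he'⟩ := exists_isReebLift hψ hmu e'
    rw [he.boundaryClass_eq hφ hlam, he'.boundaryClass_eq hψ hmu] at hc
    exact exists_leafwiseLift_glued hκ hκ0 hh h1 h2 he he' hc (he.flat hφ_flat hlam)
      (he'.flat hψ_flat hmu) (flatAtZero_of_mem_centralizer hφ hφ_flat he.mem_centralizer)
      (flatAtZero_of_mem_centralizer hψ hψ_flat he'.mem_centralizer)
  have hcomp : ∀ (e : AutReeb φ lam) (e' : AutReeb ψ mu),
      curveHom hκ hh (boundaryClass hφ hlam e) = boundaryClass hψ hmu e' → ∀ w, ∃ w',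
      e.1 (boundary φ lam w) = boundary φ lam w' ∧
      e'.1 (boundary ψ mu (h w)) = boundary ψ mu (h w') := fun e e' hc w =>
    ⟨_, boundaryClass_spec hφ hlam e w, by
      rw [boundaryClass_spec hψ hmu e', curveHom_mul hκ hh, hc]⟩
  have hcl' : curveHom hκ hh (boundaryClass hφ hlam f⁻¹) = boundaryClass hψ hmu f'⁻¹ := by
    rw [map_inv, map_inv, map_inv, hcl]
  have hT := key f f' (glueFun f.1 f'.1 (hcomp f f' hcl)) hcl (fun _ => rfl) fun _ => rfl
  have hT' := key f⁻¹ f'⁻¹ (glueFun (f⁻¹).1 (f'⁻¹).1 (hcomp f⁻¹ f'⁻¹ hcl')) hcl' (fun _ => rfl)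
    fun _ => rfl
  refine ⟨⟨⟨⟨⟨_, _, fun P => ?_, fun P => ?_⟩,
    glueFun_continuous (hcomp f f' hcl) f.1.continuous f'.1.continuous,
    glueFun_continuous (hcomp f⁻¹ f'⁻¹ hcl') (f⁻¹).1.continuous (f'⁻¹).1.continuous⟩,
    hT.isLeafwiseMap, hT'.isLeafwiseMap⟩, hT, hT'⟩, fun _ => rfl, fun _ => rfl⟩
  · rcases inl_or_inr P with ⟨p, rfl⟩ | ⟨p, rfl⟩
    · exact congrArg (Pasted.inl φ ψ h) (f.1.symm_apply_apply p)
    · exact congrArg (Pasted.inr φ ψ h) (f'.1.symm_apply_apply p)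
  · rcases inl_or_inr P with ⟨p, rfl⟩ | ⟨p, rfl⟩
    · exact congrArg (Pasted.inl φ ψ h) (f.1.apply_symm_apply p)
    · exact congrArg (Pasted.inr φ ψ h) (f'.1.apply_symm_apply p)

/-- The restriction of automorphisms to the boundary leaf. -/
noncomputable def boundaryRestriction (hφ : IsExpanding φ) (hlam : 1 < ‖(lam : ℂ)‖) :
    AutReeb φ lam →* AutCurveZero lam :=
  rotationZero.comp (boundaryClass hφ hlam)

/-- The restriction of automorphisms of the mirror to the boundary leaf. -/
noncomputable def mirrorRestriction (hψ : IsExpanding ψ) (hmu : 1 < ‖(mu : ℂ)‖) :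
    AutMirror ψ mu →* AutCurveZero mu :=
  (boundaryRestriction hψ hmu).comp mirrorEquiv.toMonoidHom

lemma autPasted_ext {F G : AutPasted φ ψ h}
    (h1 : ∀ p, F.1.1 (Pasted.inl φ ψ h p) = G.1.1 (Pasted.inl φ ψ h p))
    (h2 : ∀ p, F.1.1 (Pasted.inr φ ψ h p) = G.1.1 (Pasted.inr φ ψ h p)) : F = G := by
  refine Subtype.ext (Subtype.ext (Homeomorph.ext fun P => ?_))
  rcases inl_or_inr P with ⟨p, rfl⟩ | ⟨p, rfl⟩
  · exact h1 p
  · exact h2 p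

/-- The automorphism group of `M` is the fibre product of those of the two components. -/
theorem exists_fibreProduct_equiv (hφ : IsExpanding φ) (hψ : IsExpanding ψ) (hφ_flat : IsFlat φ)
    (hψ_flat : IsFlat ψ) (hlam : 1 < ‖(lam : ℂ)‖) (hmu : 1 < ‖(mu : ℂ)‖)
    (hh : IsHolomorphic h) :
    ∃ Φ : AutPasted φ ψ h ≃* fibreProduct h (boundaryRestriction hφ hlam)
      (mirrorRestriction hψ hmu), ∀ F,
        (∀ p, F.1.1 (Pasted.inl φ ψ h p) = Pasted.inl φ ψ h ((Φ F).1.1.1 p)) ∧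
        (∀ p, F.1.1 (Pasted.inr φ ψ h p) = Pasted.inr φ ψ h ((Φ F).1.2.1 p)) := by
  choose L hL using exists_restrict_inl (φ := φ) (ψ := ψ) (h := h) hφ hψ hlam hh
  choose R hR using exists_restrict_inr (φ := φ) (ψ := ψ) (h := h) hφ hψ hlam hmu hh
  have hmem : ∀ F, (L F, mirrorEquiv.symm (R F)) ∈ fibreProduct h (boundaryRestriction hφ hlam)
      (mirrorRestriction hψ hmu) := by
    intro F w
    change h (boundaryClass hφ hlam (L F) * w) = boundaryClass hψ hmu (R F) * h w
    -- Both restrictions describe the same map on the common boundary leaf, read once through each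
    -- component.
    refine boundary_injective (φ := ψ) (inr_injective (φ := φ) (h := h) ?_)
    rw [← inl_boundary, ← boundaryClass_spec, ← boundaryClass_spec, ← hL, ← hR, inl_boundary]
  let Φ₀ : AutPasted φ ψ h →* fibreProduct h (boundaryRestriction hφ hlam)
      (mirrorRestriction hψ hmu) := MonoidHom.mk' (fun F => ⟨_, hmem F⟩) fun F G => by
    refine Subtype.ext (Prod.ext (Subtype.ext (Homeomorph.ext fun p => ?_))
      (Subtype.ext (Homeomorph.ext fun p => ?_)))
    · refine inl_injective (φ := φ) (ψ := ψ) (h := h) ?_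
      change Pasted.inl φ ψ h ((L (F * G)).1 p) = Pasted.inl φ ψ h ((L F).1 ((L G).1 p))
      rw [← hL, ← hL, ← hL]
      rfl
    · refine inr_injective (φ := φ) (ψ := ψ) (h := h) ?_
      change Pasted.inr φ ψ h ((R (F * G)).1 p) = Pasted.inr φ ψ h ((R F).1 ((R G).1 p))
      rw [← hR, ← hR, ← hR]
      rfl
  have hinj : Function.Injective Φ₀ := by
    intro F G he
    have h1 : L F = L G := congrArg (fun x => x.1.1) he
    have h2 : R F = R G := congrArg (fun x => mirrorEquiv x.1.2) he
    exact autPasted_ext (fun p => by rw [hL, hL, h1]) fun p => by rw [hR, hR, h2]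
  have hsurj : Function.Surjective Φ₀ := by
    rintro ⟨⟨f, f'⟩, hff⟩
    obtain ⟨F, h1, h2⟩ := exists_glued hφ hψ hφ_flat hψ_flat hlam hmu hh f (mirrorEquiv f') hff
    refine ⟨F, Subtype.ext (Prod.ext (Subtype.ext (Homeomorph.ext fun p => ?_))
      (Subtype.ext (Homeomorph.ext fun p => ?_)))⟩
    · exact inl_injective (φ := φ) (ψ := ψ) (h := h) ((hL F p).symm.trans (h1 p))
    · exact inr_injective (φ := φ) (ψ := ψ) (h := h) ((hR F p).symm.trans (h2 p))
  exact ⟨MulEquiv.ofBijective Φ₀ ⟨hinj, hsurj⟩, fun F => ⟨hL F, hR F⟩⟩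

end Gluing

/-! ### Restriction of convergence to open subsets. -/

section CkTendsto

variable {P Q E F : Type} [NormedAddCommGroup E] [NormedSpace ℝ E] [NormedAddCommGroup F]
  [NormedSpace ℝ F] {n : ℕ} {l : Filter P} {s : Set E} {u : P → E → F} {u₀ : E → F}

lemma CkTendsto.param {l' : Filter Q} {m : Q → P} (hm : Tendsto m l' l)
    (hu : CkTendsto n l u u₀ s) : CkTendsto n l' (fun p => u (m p)) u₀ s :=
  ⟨hm.eventually hu.smooth, hu.smooth_lim, fun k hk q hq =>
    (hu.tendsto k hk q hq).comp (hm.prodMap tendsto_id)⟩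

lemma tendsto_inter_open_iff {k : ℕ} {W : Set E} (hW : IsOpen W) {q : E} (hq : q ∈ W) :
    Tendsto (fun py : P × E => iteratedFDerivWithin ℝ k (u py.1) (s ∩ W) py.2)
      (l ×ˢ 𝓝[s ∩ W] q) (𝓝 (iteratedFDerivWithin ℝ k u₀ (s ∩ W) q)) ↔
    Tendsto (fun py : P × E => iteratedFDerivWithin ℝ k (u py.1) s py.2)
      (l ×ˢ 𝓝[s] q) (𝓝 (iteratedFDerivWithin ℝ k u₀ s q)) := by
  have hmem : W ∈ 𝓝[s] q := nhdsWithin_le_nhds (hW.mem_nhds hq)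
  rw [iteratedFDerivWithin_inter_open hW hq, nhdsWithin_inter_of_mem' hmem]
  refine tendsto_congr' ?_
  filter_upwards [tendsto_snd.eventually hmem] with py hpy
  exact iteratedFDerivWithin_inter_open hW hpy

end CkTendsto

/-! ### Gaining one derivative by Baire category. -/

section Baire

lemma contDiffOn_iteratedDerivWithin {f : ℝ → ℝ} (hf : ContDiffOn ℝ ∞ f (Ici 0)) (n : ℕ) :
    ContDiffOn ℝ ∞ (iteratedDerivWithin n f (Ici 0)) (Ici 0) := by
  induction n with
  | zero => simpa only [iteratedDerivWithin_zero] using hf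
  | succ n ih =>
    rw [iteratedDerivWithin_succ]
    exact ih.derivWithin (uniqueDiffOn_Ici 0) (by simp)

/-- First order Taylor estimate for a function smooth up to the end point, on a bounded interval. -/
lemma exists_taylor_bound {f : ℝ → ℝ} (hf : ContDiffOn ℝ ∞ f (Ici 0)) (X : ℝ) :
    ∃ C : ℝ, ∀ x ∈ Icc 0 X, ∀ t ∈ Ioc (0 : ℝ) 1,
      |(f (x + t) - f x) / t - derivWithin f (Ici 0) x| ≤ C * t := by
  have hf' : ContDiffOn ℝ ∞ (derivWithin f (Ici 0)) (Ici 0) :=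
    hf.derivWithin (uniqueDiffOn_Ici 0) (by simp)
  have hf'' : ContinuousOn (derivWithin (derivWithin f (Ici 0)) (Ici 0)) (Ici 0) :=
    (hf'.derivWithin (m := ∞) (uniqueDiffOn_Ici 0) (by simp)).continuousOn
  obtain ⟨C, hC⟩ := (isCompact_Icc (a := (0 : ℝ)) (b := X + 1)).exists_bound_of_continuousOn
    (hf''.mono Icc_subset_Ici_self)
  refine ⟨C, fun x hx t ht => ?_⟩
  have hC0 : 0 ≤ C := (norm_nonneg _).trans (hC 0 ⟨le_rfl, by linarith [hx.1, hx.2]⟩)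
  have hsub : Icc x (x + t) ⊆ Icc 0 (X + 1) := Icc_subset_Icc hx.1 (by linarith [hx.2, ht.2])
  have hd : ∀ g : ℝ → ℝ, ContDiffOn ℝ ∞ g (Ici 0) → ∀ y ∈ Icc x (x + t),
      HasDerivWithinAt g (derivWithin g (Ici 0) y) (Icc x (x + t)) y := fun g hg y hy =>
    (hg.differentiableOn (by simp) y (hsub hy).1).hasDerivWithinAt.mono
      (hsub.trans Icc_subset_Ici_self)
  have h1 : ∀ y ∈ Icc x (x + t), ‖derivWithin f (Ici 0) y - derivWithin f (Ici 0) x‖ ≤ C * t := by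
    intro y hy
    have := (convex_Icc x (x + t)).norm_image_sub_le_of_norm_hasDerivWithin_le
      (hd _ hf') (fun y hy => hC y (hsub hy)) (left_mem_Icc.2 (hy.1.trans hy.2)) hy
    refine this.trans (mul_le_mul_of_nonneg_left ?_ hC0)
    rw [Real.norm_of_nonneg (sub_nonneg.2 hy.1)]
    linarith [hy.2]
  -- Mean value inequality for `f` minus its tangent line at `x`, whose derivative on the interval
  -- is at most `C t`.
  have h2 := (convex_Icc x (x + t)).norm_image_sub_le_of_norm_hasDerivWithin_le
    (f := fun y => f y - y * derivWithin f (Ici 0) x)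
    (fun y hy => (hd f hf y hy).sub ((hasDerivWithinAt_id y _).mul_const _))
    (fun y hy => by simpa using h1 y hy) (left_mem_Icc.2 (by linarith [ht.1]))
    (right_mem_Icc.2 (by linarith [ht.1]))
  rw [add_sub_cancel_left, Real.norm_of_nonneg ht.1.le, Real.norm_eq_abs] at h2
  have h3 : (f (x + t) - f x) / t - derivWithin f (Ici 0) x =
      (f (x + t) - (x + t) * derivWithin f (Ici 0) x - (f x - x * derivWithin f (Ici 0) x)) / t := by
    have := ht.1.ne'
    field_simp
    ring
  rw [h3, abs_div, abs_of_pos ht.1, div_le_iff₀ ht.1]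
  exact h2

/-- If a family of smooth functions depends continuously on a real parameter, then so do the
derivatives, at some positive parameter. -/
lemma exists_tendsto_derivWithin {u : ℝ → ℝ → ℝ} (hu : ∀ t, ContDiffOn ℝ ∞ (u t) (Ici 0))
    (hc : ∀ t, ∀ q ∈ Ici (0 : ℝ),
      Tendsto (fun p : ℝ × ℝ => u p.1 p.2) (𝓝 t ×ˢ 𝓝[Ici 0] q) (𝓝 (u t q))) (X : ℝ) :
    ∃ t₁ > 0, ∀ q ∈ Ici (0 : ℝ), q < X →
      Tendsto (fun p : ℝ × ℝ => derivWithin (u p.1) (Ici 0) p.2) (𝓝 t₁ ×ˢ 𝓝[Ici 0] q)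
        (𝓝 (derivWithin (u t₁) (Ici 0) q)) := by
  have hcx : ∀ x ∈ Ici (0 : ℝ), Continuous fun t => u t x := fun x hx =>
    continuous_iff_continuousAt.2 fun t => (hc t x hx).comp
      (tendsto_id.prodMk (tendsto_const_pure.mono_right (pure_le_nhdsWithin hx)))
  -- A uniform Cauchy condition on difference quotients. It involves only values of `u t`, not
  -- derivatives, so continuity in `t` makes each set closed; the Taylor estimate shows that they
  -- exhaust the line.
  let C : ℕ → Set ℝ := fun N => {t | ∀ x ∈ Icc 0 X, ∀ r ∈ Ioc (0 : ℝ) 1, ∀ r' ∈ Ioc (0 : ℝ) 1,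
    |(u t (x + r) - u t x) / r - (u t (x + r') - u t x) / r'| ≤ N * (r + r')}
  have hclosed : ∀ N, IsClosed (C N) := by
    intro N
    simp only [C, ofPred_forall]
    refine isClosed_iInter fun x => isClosed_iInter fun hx => isClosed_iInter fun r =>
      isClosed_iInter fun hr => isClosed_iInter fun r' => isClosed_iInter fun hr' => ?_
    refine isClosed_le (Continuous.abs ?_) continuous_const
    have h0 := hcx x hx.1
    have h1 := hcx (x + r) (add_nonneg hx.1 hr.1.le)
    have h2 := hcx (x + r') (add_nonneg hx.1 hr'.1.le)
    exact ((h1.sub h0).div_const r).sub ((h2.sub h0).div_const r')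
  have hunion : ⋃ N, C N = univ := by
    refine eq_univ_of_forall fun t => ?_
    obtain ⟨B, hB⟩ := exists_taylor_bound (hu t) X
    obtain ⟨N, hN⟩ := exists_nat_ge B
    refine mem_iUnion.2 ⟨N, fun x hx r hr r' hr' => ?_⟩
    have h1 := hB x hx r hr
    have h2 := hB x hx r' hr'
    have h3 := abs_sub_le ((u t (x + r) - u t x) / r) (derivWithin (u t) (Ici 0) x)
      ((u t (x + r') - u t x) / r')
    rw [abs_sub_comm (derivWithin (u t) (Ici 0) x)] at h3
    have h4 := mul_le_mul_of_nonneg_right hN hr.1.le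
    have h5 := mul_le_mul_of_nonneg_right hN hr'.1.le
    rw [mul_add]
    linarith
  have hdense := dense_iUnion_interior_of_closed hclosed hunion
  -- The interiors have dense union, so a positive parameter can be chosen. Positivity matters for
  -- the flow, where `θ(-t₁)` has to map `[0, X)` into itself.
  obtain ⟨t₁, ht₁, hm⟩ := hdense.exists_mem_open (isOpen_Ioi (a := (0 : ℝ))) ⟨1, mem_Ioi.2 one_pos⟩ |>.imp
    fun _ h => h.symm
  obtain ⟨N, hN⟩ := mem_iUnion.1 hm
  refine ⟨t₁, ht₁, fun q hq hqX => ?_⟩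
  have key : ∀ t ∈ C N, ∀ x ∈ Icc 0 X, ∀ r ∈ Ioc (0 : ℝ) 1,
      |(u t (x + r) - u t x) / r - derivWithin (u t) (Ici 0) x| ≤ N * r := by
    intro t ht x hx r hr
    have hlim : Tendsto (fun r' => (u t (x + r') - u t x) / r') (𝓝[>] 0)
        (𝓝 (derivWithin (u t) (Ici 0) x)) := by
      have h1 := ((hu t).differentiableOn (by simp) x hx.1).hasDerivWithinAt
      have h2 : HasDerivWithinAt (u t) (derivWithin (u t) (Ici 0) x) (Ioi x) x :=
        h1.mono (Ioi_subset_Ici hx.1)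
      rw [hasDerivWithinAt_iff_tendsto_slope' self_notMem_Ioi] at h2
      have h3 : Tendsto (fun r' : ℝ => x + r') (𝓝[>] 0) (𝓝[>] x) := by
        refine tendsto_nhdsWithin_iff.2 ⟨?_, ?_⟩
        · have : Tendsto (fun r' : ℝ => x + r') (𝓝 0) (𝓝 (x + 0)) := tendsto_id.const_add x
          rw [add_zero] at this
          exact this.mono_left nhdsWithin_le_nhds
        · filter_upwards [self_mem_nhdsWithin] with r' hr'
          exact lt_add_of_pos_right x hr'
      refine (h2.comp h3).congr fun r' => ?_
      rw [Function.comp_apply, slope_def_field, add_sub_cancel_left]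
    have hlim' : Tendsto (fun r' : ℝ => (N : ℝ) * (r + r')) (𝓝[>] 0) (𝓝 (N * (r + 0))) :=
      ((tendsto_id.const_add r).const_mul _).mono_left nhdsWithin_le_nhds
    rw [add_zero] at hlim'
    refine le_of_tendsto_of_tendsto (tendsto_const_nhds.sub hlim).abs hlim' ?_
    filter_upwards [Ioc_mem_nhdsGT one_pos] with r' hr'
    exact ht x hx r hr r' hr'
  rw [Metric.tendsto_nhds]
  intro ε hε
  -- Difference quotients with this step approximate the derivatives within `ε / 4`, uniformly in
  -- `t` near `t₁` and `x`; at fixed step they converge by hypothesis.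
  obtain ⟨r, hr0, hr1, hrε⟩ : ∃ r : ℝ, 0 < r ∧ r ≤ 1 ∧ N * r < ε / 4 := by
    refine ⟨min 1 (ε / (8 * (N + 1))), lt_min one_pos (by positivity), min_le_left _ _, ?_⟩
    have h1 : (N : ℝ) * min 1 (ε / (8 * (N + 1))) ≤ (N + 1) * (ε / (8 * (N + 1))) :=
      mul_le_mul (by linarith) (min_le_right _ _) (le_min zero_le_one (by positivity))
        (by positivity)
    have h2 : ((N : ℝ) + 1) * (ε / (8 * (N + 1))) = ε / 8 := by field_simp
    linarith
  have hshift : Tendsto (fun p : ℝ × ℝ => u p.1 (p.2 + r)) (𝓝 t₁ ×ˢ 𝓝[Ici 0] q)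
      (𝓝 (u t₁ (q + r))) := by
    have hq' : q + r ∈ Ici (0 : ℝ) := add_nonneg hq hr0.le
    refine (hc t₁ (q + r) hq').comp (f := fun p : ℝ × ℝ => (p.1, p.2 + r))
      (tendsto_fst.prodMk (tendsto_nhdsWithin_iff.2 ⟨?_, ?_⟩))
    · exact (tendsto_snd.mono_right nhdsWithin_le_nhds).add_const r
    · filter_upwards [eventually_prod_mem (𝓝 t₁) (Ici 0) q] with p hp
      exact add_nonneg hp hr0.le
  have hquot : Tendsto (fun p : ℝ × ℝ => (u p.1 (p.2 + r) - u p.1 p.2) / r)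
      (𝓝 t₁ ×ˢ 𝓝[Ici 0] q) (𝓝 ((u t₁ (q + r) - u t₁ q) / r)) :=
    (hshift.sub (hc t₁ q hq)).div_const r
  have h1 := Metric.tendsto_nhds.1 hquot (ε / 4) (by linarith)
  have h2 := key t₁ (interior_subset hN) q ⟨hq, hqX.le⟩ r ⟨hr0, hr1⟩
  have hX : ∀ᶠ p : ℝ × ℝ in 𝓝 t₁ ×ˢ 𝓝[Ici 0] q, p.2 < X :=
    tendsto_snd.eventually (nhdsWithin_le_nhds (Iio_mem_nhds hqX))
  filter_upwards [h1, eventually_prod_mem (𝓝 t₁) (Ici 0) q, hX,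
    eventually_prod_fst (mem_interior_iff_mem_nhds.1 hN) _] with p hp1 hp2 hp3 hp4
  have h3 := key p.1 hp4 p.2 ⟨hp2, hp3.le⟩ r ⟨hr0, hr1⟩
  rw [Real.dist_eq] at hp1 ⊢
  rw [abs_lt] at hp1 ⊢
  rw [abs_le] at h2 h3
  constructor <;> linarith [hp1.1, hp1.2, h2.1, h2.2, h3.1, h3.2]

end Baire

/-! ### Smooth continuity of increasing one-parameter groups. -/

section Flow

variable {θ : ℝ → HalfLineDiffeo}

lemma flow_zero (hadd : ∀ s t, θ (s + t) = θ s * θ t) : θ 0 = 1 := by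
  have := hadd 0 0
  rw [add_zero] at this
  exact (mul_eq_left.1 this.symm)

lemma flow_apply (hadd : ∀ s t, θ (s + t) = θ s * θ t) (s t x : ℝ) :
    halfLineFun (θ (s + t)).1 x = halfLineFun (θ s).1 (halfLineFun (θ t).1 x) := by
  rw [hadd, halfLineFun_coe_mul]

lemma flow_zero_apply (hadd : ∀ s t, θ (s + t) = θ s * θ t) {x : ℝ} (hx : 0 ≤ x) :
    halfLineFun (θ 0).1 x = x := by
  rw [flow_zero hadd, halfLineFun_one hx]

lemma flow_mono (hmono : ∀ s t, s ≤ t → ∀ x, (θ s).1 x ≤ (θ t).1 x) {s t x y : ℝ} (hst : s ≤ t)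
    (hx : 0 ≤ x) (hxy : x ≤ y) : halfLineFun (θ s).1 x ≤ halfLineFun (θ t).1 y :=
  ((halfLineFun_strictMonoOn (θ s)).monotoneOn hx (hx.trans hxy) hxy).trans
    (NNReal.coe_le_coe.2 (hmono s t hst _))

/-- An increasing one-parameter group is pointwise continuous. -/
lemma flow_tendsto_apply (hadd : ∀ s t, θ (s + t) = θ s * θ t)
    (hmono : ∀ s t, s ≤ t → ∀ x, (θ s).1 x ≤ (θ t).1 x) {x : ℝ} (hx : 0 ≤ x) :
    Tendsto (fun t => halfLineFun (θ t).1 x) (𝓝 0) (𝓝 x) := by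
  have hm : Monotone fun t => halfLineFun (θ t).1 x := fun s t hst => flow_mono hmono hst hx le_rfl
  -- A monotone function has only countably many discontinuities; composing with `θ(-t₁)` moves a
  -- point of continuity to `0`.
  obtain ⟨t₁, ht₁⟩ : ∃ t₁, ContinuousAt (fun t => halfLineFun (θ t).1 x) t₁ := by
    by_contra! hn
    refine not_countable_univ (α := ℝ) (hm.countable_not_continuousAt.mono fun t _ => hn t)
  have h1 : Tendsto (fun t => halfLineFun (θ (t₁ + t)).1 x) (𝓝 0) (𝓝 (halfLineFun (θ t₁).1 x)) := by
    have h2 : Tendsto (fun t => t₁ + t) (𝓝 0) (𝓝 t₁) := by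
      simpa using (tendsto_id (α := ℝ) (x := 𝓝 0)).const_add t₁
    exact ht₁.tendsto.comp h2
  have h2 := ((halfLineFun_continuous (θ (-t₁))).tendsto _).comp h1
  rw [← flow_apply hadd, neg_add_cancel, flow_zero_apply hadd hx] at h2
  refine h2.congr fun t => ?_
  rw [Function.comp_apply, ← flow_apply hadd, neg_add_cancel_left]

/-- Each `θ t` is increasing in `x`, so convergence at the two points `q ± ε / 2` (the left one cut
off at `0`) controls all points between them. -/
lemma flow_ckTendsto_zero (hadd : ∀ s t, θ (s + t) = θ s * θ t)
    (hmono : ∀ s t, s ≤ t → ∀ x, (θ s).1 x ≤ (θ t).1 x) :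
    CkTendsto 0 (𝓝 0) (fun t => halfLineFun (θ t).1) id (Ici 0) := by
  refine ckTendsto_zero_iff.2 ⟨Eventually.of_forall fun t => halfLineFun_smooth _, contDiffOn_id,
    fun q hq => ?_⟩
  rw [Metric.tendsto_nhds]
  intro ε hε
  have h1 := (flow_tendsto_apply hadd hmono (x := q + ε / 2)
    (add_nonneg hq (by linarith))).eventually (Iio_mem_nhds (show q + ε / 2 < q + ε by linarith))
  have h2 := (flow_tendsto_apply hadd hmono (x := max (q - ε / 2) 0)
    (le_max_right _ _)).eventually (Ioi_mem_nhds
    (show q - ε < max (q - ε / 2) 0 from lt_max_of_lt_left (by linarith)))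
  have hy : ∀ᶠ y in 𝓝[Ici 0] q, q - ε / 2 < y ∧ y < q + ε / 2 ∧ 0 ≤ y := by
    filter_upwards [self_mem_nhdsWithin, nhdsWithin_le_nhds (Ioo_mem_nhds
      (show q - ε / 2 < q by linarith) (show q < q + ε / 2 by linarith))] with y hy1 hy2
    exact ⟨hy2.1, hy2.2, hy1⟩
  filter_upwards [(h1.and h2).prod_mk hy] with p hp
  obtain ⟨⟨hp1, hp2⟩, hp3, hp4, hp5⟩ := hp
  rw [Real.dist_eq, id, abs_lt]
  constructor
  · have := flow_mono hmono (le_refl p.1) (le_max_right (q - ε / 2) 0) (max_le hp3.le hp5)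
    have h3 : q - ε < halfLineFun (θ p.1).1 (max (q - ε / 2) 0) := hp2
    linarith
  · have := flow_mono hmono (le_refl p.1) hp5 hp4.le
    have h3 : halfLineFun (θ p.1).1 (q + ε / 2) < q + ε := hp1
    linarith

/-- `θ t'` is the fixed smooth map `θ t` composed with `θ (t' - t)`, which tends to the identity. -/
lemma flow_ckTendsto_at (hadd : ∀ s t, θ (s + t) = θ s * θ t) {n : ℕ}
    (h : CkTendsto n (𝓝 0) (fun t => halfLineFun (θ t).1) id (Ici 0)) (t : ℝ) :
    CkTendsto n (𝓝 t) (fun t => halfLineFun (θ t).1) (halfLineFun (θ t).1) (Ici 0) := by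
  have hs := uniqueDiffOn_Ici (0 : ℝ)
  have h1 : Tendsto (fun t' => t' - t) (𝓝 t) (𝓝 0) := by
    simpa using (tendsto_id (α := ℝ) (x := 𝓝 t)).sub_const t
  refine ((smoothTendsto_const (l := 𝓝 t) hs (halfLineFun_smooth (θ t)) n).comp hs hs (h.param h1)
    (Eventually.of_forall fun _ x _ => halfLineFun_nonneg _ x) (mapsTo_id _)).congr
    (Eventually.of_forall fun t' x _ => ?_) fun x _ => rfl
  simp only
  rw [← flow_apply hadd, add_sub_cancel]

/-- The category argument applied to the `n`-th derivatives gives convergence of order `n + 1` at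
some `t₁ > 0`. Writing `θ t = θ (t + t₁) ∘ θ (-t₁)` carries it back to `0`. -/
lemma flow_ckTendsto_succ (hadd : ∀ s t, θ (s + t) = θ s * θ t)
    (hmono : ∀ s t, s ≤ t → ∀ x, (θ s).1 x ≤ (θ t).1 x) {n : ℕ}
    (h : CkTendsto n (𝓝 0) (fun t => halfLineFun (θ t).1) id (Ici 0)) (X : ℝ) :
    CkTendsto (n + 1) (𝓝 0) (fun t => halfLineFun (θ t).1) id (Ici 0 ∩ Iio X) := by
  have hs := uniqueDiffOn_Ici (0 : ℝ)
  have hsX : UniqueDiffOn ℝ (Ici (0 : ℝ) ∩ Iio X) := hs.inter isOpen_Iio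
  obtain ⟨t₁, ht₁, hd⟩ := exists_tendsto_derivWithin
    (u := fun t => iteratedDerivWithin n (halfLineFun (θ t).1) (Ici 0))
    (fun t => contDiffOn_iteratedDerivWithin (halfLineFun_smooth (θ t)) n)
    (fun t q hq => (tendsto_iteratedDerivWithin_iff (u := fun t => halfLineFun (θ t).1)).1
      ((flow_ckTendsto_at hadd h t).tendsto n le_rfl q hq)) X
  have h1 : CkTendsto (n + 1) (𝓝 t₁) (fun t => halfLineFun (θ t).1) (halfLineFun (θ t₁).1)
      (Ici 0 ∩ Iio X) := by
    refine ⟨Eventually.of_forall fun t => (halfLineFun_smooth _).mono inter_subset_left,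
      (halfLineFun_smooth _).mono inter_subset_left, fun k hk q hq => ?_⟩
    refine (tendsto_inter_open_iff (u := fun t => halfLineFun (θ t).1) isOpen_Iio hq.2).2 ?_
    rcases hk.lt_or_eq with hk' | rfl
    · exact (flow_ckTendsto_at hadd h t₁).tendsto k (Nat.lt_succ_iff.1 hk') q hq.1
    · refine (tendsto_iteratedDerivWithin_iff (u := fun t => halfLineFun (θ t).1)).2 ?_
      simpa only [iteratedDerivWithin_succ] using hd q hq.1 hq.2
  have h2 : Tendsto (fun t => t + t₁) (𝓝 0) (𝓝 t₁) := by
    simpa using (tendsto_id (α := ℝ) (x := 𝓝 0)).add_const t₁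
  have hmaps : MapsTo (halfLineFun (θ (-t₁)).1) (Ici 0 ∩ Iio X) (Ici 0 ∩ Iio X) := by
    intro x hx
    refine ⟨halfLineFun_nonneg _ x, mem_Iio.2 (lt_of_le_of_lt ?_ hx.2)⟩
    have := flow_mono hmono (show -t₁ ≤ 0 by linarith) hx.1 le_rfl
    rwa [flow_zero_apply hadd hx.1] at this
  refine ((h1.param h2).comp hsX hsX (smoothTendsto_const hsX
    ((halfLineFun_smooth (θ (-t₁))).mono inter_subset_left) (n + 1))
    (Eventually.of_forall fun _ => hmaps) hmaps).congr
    (Eventually.of_forall fun t x _ => ?_) fun x hx => ?_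
  · simp only
    rw [← flow_apply hadd, add_neg_cancel_right]
  · simp only [id]
    rw [← flow_apply hadd, add_neg_cancel, flow_zero_apply hadd hx.1]

/-- An increasing one-parameter group of diffeomorphisms is continuous in the smooth topology. -/
theorem flow_smoothTendsto (hadd : ∀ s t, θ (s + t) = θ s * θ t)
    (hmono : ∀ s t, s ≤ t → ∀ x, (θ s).1 x ≤ (θ t).1 x) :
    SmoothTendsto (𝓝 0) (fun t => halfLineFun (θ t).1) id (Ici 0) := by
  intro n
  induction n with
  | zero => exact flow_ckTendsto_zero hadd hmono
  | succ n ih =>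
    refine ⟨ih.smooth, contDiffOn_id, fun k hk q hq => ?_⟩
    refine (tendsto_inter_open_iff (u := fun t => halfLineFun (θ t).1) isOpen_Iio
      (show q ∈ Iio (q + 1) from lt_add_one q)).1 ?_
    exact (flow_ckTendsto_succ hadd hmono ih (q + 1)).tendsto k hk q ⟨hq, lt_add_one q⟩

end Flow

/-! ### A criterion for convergence in the smooth topology. -/

section AutTopology

lemma eventually_forall_of_isCompact {P E : Type} [TopologicalSpace E] {l : Filter P} {K : Set E}
    (hK : IsCompact K) {R : P → E → Prop}
    (h : ∀ q ∈ K, ∀ᶠ py : P × E in l ×ˢ 𝓝[K] q, R py.1 py.2) : ∀ᶠ p in l, ∀ y ∈ K, R p y := by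
  refine hK.induction_on (p := fun A => ∀ᶠ p in l, ∀ y ∈ A, R p y)
    (Eventually.of_forall fun _ _ h => absurd h (notMem_empty _))
    (fun A B hAB h => h.mono fun p hp y hy => hp y (hAB hy))
    (fun A B hA hB => by
      filter_upwards [hA, hB] with p h1 h2 y hy using hy.elim (h1 y) (h2 y)) fun q hq => ?_
  obtain ⟨a, ha, b, hb, hab⟩ := mem_prod_iff.1 (h q hq)
  exact ⟨b, hb, by filter_upwards [ha] with p hp y hy using hab (show (p, y) ∈ a ×ˢ b from ⟨hp, hy⟩)⟩

variable {X : Type} [TopologicalSpace X] {A : Parametrizations X}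

/-- Convergence in the `C^∞` topology, in terms of local expressions of `F₀⁻¹ F p`. -/
lemma tendsto_aut (hd : ∀ i, UniqueDiffOn ℝ (A.dom i))
    (hc : ∀ i K U, IsCompact K → K ⊆ A.dom i → IsOpen U → K ⊆ U → ∃ L W, IsCompact L ∧ IsOpen W ∧
      K ⊆ W ∧ W ∩ A.dom i ⊆ L ∧ L ⊆ A.dom i ∩ U)
    {P : Type} {l : Filter P} {F : P → Aut A} {F₀ : Aut A}
    (h : ∀ i K, IsCompact K → K ⊆ A.dom i → ∃ W, ∃ e : P → ℂ × ℝ → ℂ × ℝ, IsOpen W ∧ K ⊆ W ∧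
      (∀ᶠ p in l, LeafwiseLift A (F₀⁻¹ * F p).1 i i W (e p)) ∧
      SmoothTendsto l e id (A.dom i ∩ W)) :
    Tendsto F l (𝓝 F₀) := by
  refine TopologicalSpace.tendsto_nhds_generateFrom_iff.2 ?_
  rintro _ ⟨f₁, i, j, K, U₁, g₁, n, ε, hK, hKd, hKU₁, hg₁, hε, rfl⟩ ⟨U, g, hKU, hg, hclose⟩
  obtain ⟨W₁, e, hW₁, hKW₁, hlift, hsm⟩ := h i K hK hKd
  obtain ⟨L, W, hL, hW, hKW, hWL, hLU⟩ := hc i K (U ∩ W₁) hK hKd (hg.isOpen.inter hW₁)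
    (subset_inter hKU hKW₁)
  have hmap : ∀ᶠ p in l, MapsTo (e p) L U :=
    hsm.eventually_forall hL (fun q hq => ⟨(hLU hq).1, (hLU hq).2.2⟩) hg.isOpen
      fun q hq => (hLU hq).2.1
  set s := (A.dom i ∩ W₁) ∩ W with hs
  have hsL : s ⊆ L := fun q hq => hWL ⟨hq.2, hq.1.1⟩
  have hKs : K ⊆ s := fun q hq => ⟨⟨hKd hq, hKW₁ hq⟩, hKW hq⟩
  have hus : UniqueDiffOn ℝ s := ((hd i).inter hW₁).inter hW
  have hut : UniqueDiffOn ℝ (U ∩ A.dom i) := by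
    rw [inter_comm]
    exact (hd i).inter hg.isOpen
  -- `F p = F₀ (F₀⁻¹ F p)` has the local expression `g ∘ e p`, where `g` expresses `F₀`. The compact
  -- set `L` around `K` ensures that `e p` eventually takes values where `g` is defined.
  have hcomp : SmoothTendsto l (fun p q => g (e p q)) (fun q => g (id q)) s := by
    refine (hsm.inter_open hW).left hus hut hg.smooth ?_ ?_
    · filter_upwards [hmap, hlift] with p hp hp' q hq
      exact ⟨hp (hsL hq), (hp'.lift q hq.1.1 hq.1.2).1⟩
    · exact fun q hq => ⟨(hLU (hsL hq)).2.1, hq.1.1⟩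
  have hder : ∀ k ≤ n, ∀ᶠ p in l, ∀ y ∈ K, ‖iteratedFDerivWithin ℝ k (fun q => g (e p q)) s y -
      iteratedFDerivWithin ℝ k g₁ (A.dom i) y‖ < ε := by
    intro k hk
    refine eventually_forall_of_isCompact hK fun q hq => ?_
    have h1 := ((hcomp k).tendsto k le_rfl q (hKs hq)).mono_left
      (prod_mono_right l (nhdsWithin_mono q hKs))
    have h2 : ContinuousWithinAt (iteratedFDerivWithin ℝ k g₁ (A.dom i)) K q := by
      have hu1 : UniqueDiffOn ℝ (A.dom i ∩ U₁) := (hd i).inter hg₁.isOpen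
      have h3 := (((inter_comm U₁ (A.dom i) ▸ hg₁.smooth).continuousOn_iteratedFDerivWithin
        (m := k) (by exact_mod_cast le_top) hu1) q ⟨hKd hq, hKU₁ hq⟩).mono
        (fun y hy => (⟨hKd hy, hKU₁ hy⟩ : y ∈ A.dom i ∩ U₁))
      refine h3.congr (fun y hy => ?_) ?_
      · exact (iteratedFDerivWithin_inter_open hg₁.isOpen (hKU₁ hy)).symm
      · exact (iteratedFDerivWithin_inter_open hg₁.isOpen (hKU₁ hq)).symm
    have h3 := (h1.sub (h2.tendsto.comp tendsto_snd)).norm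
    refine h3.eventually (Iio_mem_nhds ?_)
    rw [iteratedFDerivWithin_inter_open hW (hKW hq), iteratedFDerivWithin_inter_open hW₁ (hKW₁ hq)]
    -- The strict estimate is only known for `F₀` itself, whose expression `g` may differ from the
    -- centre `g₁` of the basic neighbourhood; it persists for nearby `p` uniformly on `K`.
    exact hclose k hk q hq
  have hall := (eventually_all_finite (finite_Iic n)).2 hder
  filter_upwards [hall, hmap, hlift] with p h1 h2 h3
  obtain ⟨V, hV, hVl⟩ := h3.comp hg
  refine ⟨V, fun q => g (e p q), fun q hq => ((hV q).2 ⟨⟨hKW₁ hq, hKd hq⟩, h2 (hsL (hKs hq))⟩).1, ?_, ?_⟩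
  · convert hVl using 1
    funext x
    exact (F₀.1.apply_symm_apply ((F p).1 x)).symm
  · intro k hk q hq
    have h4 := h1 k hk q hq
    rwa [iteratedFDerivWithin_inter_open hW (hKW hq),
      iteratedFDerivWithin_inter_open hW₁ (hKW₁ hq)] at h4

end AutTopology

/-! ### Differentiability and compactness on the cover. -/

section Cover

lemma uniqueDiffOn_halfSpace : UniqueDiffOn ℝ {q : ℂ × ℝ | 0 ≤ q.2} := by
  have : {q : ℂ × ℝ | 0 ≤ q.2} = univ ×ˢ Ici 0 := by
    ext q
    simp
  rw [this]
  exact uniqueDiffOn_univ.prod (uniqueDiffOn_Ici 0)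

lemma cover_eq : cover = {q : ℂ × ℝ | 0 ≤ q.2} ∩ {0}ᶜ := rfl

lemma uniqueDiffOn_cover : UniqueDiffOn ℝ cover :=
  cover_eq ▸ uniqueDiffOn_halfSpace.inter isOpen_compl_singleton

/-- The cover is closed in the complement of the origin, so a compact neighbourhood avoiding the
origin may simply be cut by the half space. -/
lemma exists_compact_cover {K U : Set (ℂ × ℝ)} (hK : IsCompact K) (hKc : K ⊆ cover)
    (hU : IsOpen U) (hKU : K ⊆ U) : ∃ L W, IsCompact L ∧ IsOpen W ∧ K ⊆ W ∧ W ∩ cover ⊆ L ∧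
      L ⊆ cover ∩ U := by
  obtain ⟨L, hL, hKL, hLU⟩ := exists_compact_between hK (hU.inter isOpen_compl_singleton)
    (subset_inter hKU fun q hq => (hKc hq).2)
  refine ⟨L ∩ {q | 0 ≤ q.2}, interior L, hL.inter_right (isClosed_le continuous_const
    continuous_snd), isOpen_interior, hKL, fun q hq => ⟨interior_subset hq.1, hq.2.1⟩,
    fun q hq => ⟨⟨hq.2, (hLU hq.1).2⟩, (hLU hq.1).1⟩⟩

end Cover

/-! ### Convergence of automorphisms through their lifts. -/

section LiftData

variable (φ : HalfLineDiffeo) (lam : ℂˣ)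

/-- An automorphism of the Reeb component together with a lift `(z, x) ↦ (a z + b(x), η(x))`. -/
structure LiftData where
  aut : AutReeb φ lam
  scale : ℂˣ
  shift : ℝ → ℂ
  trans : HalfLineDiffeo
  isLift : IsReebLift (aut.1 : Reeb φ lam → Reeb φ lam) scale shift trans

variable {φ lam}

/-- The lift to the cover. -/
noncomputable def LiftData.map (p : LiftData φ lam) : ℂ × ℝ → ℂ × ℝ :=
  reebMap p.scale p.shift p.trans

lemma LiftData.map_smooth (p : LiftData φ lam) : ContDiffOn ℝ ∞ p.map cover :=
  (reebMap_smooth p.isLift.smooth).mono fun _ hq => hq.1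

/-- The lifts whose derivatives up to order `n` are close to those of `p₀` on `K`. -/
def liftNhd (K : Set (ℂ × ℝ)) (p₀ : LiftData φ lam) (n : ℕ) : Set (LiftData φ lam) :=
  {p | ∀ k ≤ n, ∀ q ∈ K, ‖iteratedFDerivWithin ℝ k p.map cover q -
    iteratedFDerivWithin ℝ k p₀.map cover q‖ < 1 / ((n : ℝ) + 1)}

/-- The filter of lifts which converge to `p₀` on `K`. -/
def liftFilter (K : Set (ℂ × ℝ)) (p₀ : LiftData φ lam) : Filter (LiftData φ lam) :=
  ⨅ n, 𝓟 (liftNhd K p₀ n)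

lemma mem_liftFilter {K : Set (ℂ × ℝ)} {p₀ : LiftData φ lam} {s : Set (LiftData φ lam)} :
    s ∈ liftFilter K p₀ ↔ ∃ n, liftNhd K p₀ n ⊆ s := by
  rw [liftFilter, mem_iInf_of_directed]
  · simp only [mem_principal]
  · refine Antitone.directed_ge fun m n hmn => ?_
    refine principal_mono.2 fun p hp k hk q hq => (hp k (hk.trans hmn) q hq).trans_le ?_
    have : (m : ℝ) ≤ n := by exact_mod_cast hmn
    exact one_div_le_one_div_of_le (by positivity) (by linarith)

lemma liftNhd_mem (K : Set (ℂ × ℝ)) (p₀ : LiftData φ lam) (n : ℕ) :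
    liftNhd K p₀ n ∈ liftFilter K p₀ := mem_liftFilter.2 ⟨n, Subset.rfl⟩

lemma smoothTendsto_map {K W : Set (ℂ × ℝ)} (p₀ : LiftData φ lam) (hW : IsOpen W)
    (hWK : cover ∩ W ⊆ K) :
    SmoothTendsto (liftFilter K p₀) LiftData.map p₀.map (cover ∩ W) := by
  refine fun n => ⟨Eventually.of_forall fun p => p.map_smooth.mono inter_subset_left,
    p₀.map_smooth.mono inter_subset_left, fun k _ q hq => ?_⟩
  have hcont := (p₀.map_smooth.continuousOn_iteratedFDerivWithin (m := k)
    (by exact_mod_cast le_top) uniqueDiffOn_cover) q hq.1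
  have h1 : Tendsto (fun py : LiftData φ lam × (ℂ × ℝ) =>
      iteratedFDerivWithin ℝ k py.1.map cover py.2 - iteratedFDerivWithin ℝ k p₀.map cover py.2)
      (liftFilter K p₀ ×ˢ 𝓝[cover ∩ W] q) (𝓝 0) := by
    rw [Metric.tendsto_nhds]
    intro ε hε
    obtain ⟨m, hm⟩ := exists_nat_one_div_lt hε
    have hle : liftNhd K p₀ (max k m) ∈ liftFilter K p₀ := liftNhd_mem _ _ _
    filter_upwards [eventually_prod_fst (E := ℂ × ℝ) hle (𝓝[cover ∩ W] q),
      eventually_prod_mem (liftFilter K p₀) (cover ∩ W) q] with py h2 h3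
    rw [dist_zero_right]
    refine ((h2 k (le_max_left k m) py.2 (hWK h3)).trans_le ?_).trans hm
    have : (m : ℝ) ≤ (max k m : ℕ) := by exact_mod_cast le_max_right k m
    exact one_div_le_one_div_of_le (by positivity) (by linarith)
  have h2 := h1.add ((hcont.mono_left (nhdsWithin_mono q inter_subset_left)).comp
    (tendsto_snd (f := liftFilter K p₀)))
  rw [zero_add] at h2
  rw [iteratedFDerivWithin_inter_open hW hq.2]
  refine h2.congr' ?_
  filter_upwards [eventually_prod_mem (liftFilter K p₀) (cover ∩ W) q] with py hpy
  rw [iteratedFDerivWithin_inter_open hW hpy.2, Function.comp_apply, sub_add_cancel]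

/-- Convergence of the components of the lifts on `[0, X)`. -/
structure LiftTendsto (l : Filter (LiftData φ lam)) (p₀ : LiftData φ lam) (s : Set ℝ) : Prop where
  scale : Tendsto (fun p : LiftData φ lam => (p.scale : ℂ)) l (𝓝 p₀.scale)
  shift : SmoothTendsto l (fun p => p.shift) p₀.shift s
  trans : SmoothTendsto l (fun p => halfLineFun p.trans.1) (halfLineFun p₀.trans.1) s

/-- The line `z = 1` carries all the data: the value at `x = 0` is `a` because `b(0) = 0`, the first
coordinate minus `a` is `b`, and the second coordinate is `η`. -/
lemma liftTendsto_of_box (hlam : 1 < ‖(lam : ℂ)‖) (p₀ : LiftData φ lam) {r X : ℝ} (hr : 0 < r)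
    (hX : 0 < X) :
    LiftTendsto (liftFilter (Metric.closedBall 1 r ×ˢ Icc 0 X) p₀) p₀ (Ici 0 ∩ Iio X) := by
  set l := liftFilter (Metric.closedBall 1 r ×ˢ Icc 0 X) p₀ with hl
  have hs : UniqueDiffOn ℝ (Ici (0 : ℝ) ∩ Iio X) := (uniqueDiffOn_Ici 0).inter isOpen_Iio
  have hWo : IsOpen (Metric.ball (1 : ℂ) r ×ˢ Iio X) := Metric.isOpen_ball.prod isOpen_Iio
  have hW := smoothTendsto_map (K := Metric.closedBall 1 r ×ˢ Icc 0 X)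
    (W := Metric.ball 1 r ×ˢ Iio X) p₀ hWo
    fun q hq => ⟨Metric.ball_subset_closedBall hq.2.1, hq.1.1, (mem_Iio.1 hq.2.2).le⟩
  have hline : SmoothTendsto l (fun p (x : ℝ) => p.map (1, x)) (fun x => p₀.map (1, x))
      (Ici 0 ∩ Iio X) := by
    refine hW.right hs (uniqueDiffOn_cover.inter hWo) (f := fun x : ℝ => ((1 : ℂ), x))
      (contDiff_const.prodMk contDiff_id).contDiffOn fun x hx => ?_
    exact ⟨mem_cover_of_ne hx.1 one_ne_zero, Metric.mem_ball_self hr, hx.2⟩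
  have h1 := hline.clm hs (ContinuousLinearMap.fst ℝ ℂ ℝ)
  have h2 := hline.clm hs (ContinuousLinearMap.snd ℝ ℂ ℝ)
  have h0 : (0 : ℝ) ∈ Ici 0 ∩ Iio X := ⟨self_mem_Ici, hX⟩
  have hz : ∀ p : LiftData φ lam, (p.map (1, 0)).1 = p.scale := fun p => by
    simp [LiftData.map, reebMap, p.isLift.apply_zero hlam]
  have hscale : Tendsto (fun p : LiftData φ lam => (p.scale : ℂ)) l (𝓝 p₀.scale) := by
    have h3 : Tendsto (fun p : LiftData φ lam => (p, (0 : ℝ))) l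
        (l ×ˢ 𝓝[Ici 0 ∩ Iio X] 0) :=
      tendsto_id.prodMk (tendsto_const_pure.mono_right (pure_le_nhdsWithin h0))
    have h4 := ((h1 0).tendsto_zero h0).comp h3
    simp only [ContinuousLinearMap.coe_fst', hz] at h4
    exact h4.congr fun p => hz p
  refine ⟨hscale, ?_, h2⟩
  have h3 : SmoothTendsto l (fun p (_ : ℝ) => -(p.scale : ℂ)) (fun _ => -(p₀.scale : ℂ))
      (Ici 0 ∩ Iio X) := smoothTendsto_of_tendsto hscale.neg
  refine (h1.add hs h3).congr (Eventually.of_forall fun p x _ => ?_) fun x _ => ?_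
  · simp [LiftData.map, reebMap]
  · simp [LiftData.map, reebMap]

lemma shift_pow (p : LiftData φ lam) (m : ℕ) {x : ℝ} (hx : 0 ≤ x) :
    p.shift (halfLineFun (φ ^ m : HalfLineDiffeo).1 x) = (lam : ℂ) ^ m * p.shift x := by
  induction m generalizing x with
  | zero => rw [pow_zero, pow_zero, one_mul, halfLineFun_one hx]
  | succ m ih =>
    rw [pow_succ, halfLineFun_coe_mul, ih (halfLineFun_nonneg _ _), p.isLift.schroder x hx]
    ring

/-- Convergence near the end point implies convergence on the half line. -/
lemma LiftTendsto.extend (hφ : IsExpanding φ) {l : Filter (LiftData φ lam)} {p₀ : LiftData φ lam}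
    {X : ℝ} (hX : 0 < X) (h : LiftTendsto l p₀ (Ici 0 ∩ Iio X)) : LiftTendsto l p₀ (Ici 0) := by
  have hs : UniqueDiffOn ℝ (Ici (0 : ℝ) ∩ Iio X) := (uniqueDiffOn_Ici 0).inter isOpen_Iio
  -- A power of `φ⁻¹` brings any point into `[0, X)`, and there `b = λ^m b ∘ φ^{-m}` and `η = φ^m η
  -- φ^{-m}` transport convergence back to a neighbourhood of the point.
  have hm : ∀ q ∈ Ici (0 : ℝ), ∃ m : ℕ, halfLineFun (φ⁻¹ ^ m : HalfLineDiffeo).1 q < X := by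
    intro q hq
    have h1 := (NNReal.tendsto_coe.2 (hφ.tendsto_inv_pow q.toNNReal)).eventually
      (Iio_mem_nhds (show ((0 : ℝ≥0) : ℝ) < X from hX))
    exact h1.exists
  have hinv : ∀ (m : ℕ) {x : ℝ}, 0 ≤ x → halfLineFun (φ ^ m : HalfLineDiffeo).1
      (halfLineFun (φ⁻¹ ^ m : HalfLineDiffeo).1 x) = x := fun m x hx => by
    rw [inv_pow, halfLineFun_apply_inv _ hx]
  have hW : ∀ m : ℕ, IsOpen {x | halfLineFun (φ⁻¹ ^ m : HalfLineDiffeo).1 x < X} := fun m =>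
    isOpen_lt (halfLineFun_continuous _) continuous_const
  have hu : ∀ m : ℕ, UniqueDiffOn ℝ
      (Ici (0 : ℝ) ∩ {x | halfLineFun (φ⁻¹ ^ m : HalfLineDiffeo).1 x < X}) := fun m =>
    (uniqueDiffOn_Ici 0).inter (hW m)
  have hmaps : ∀ m : ℕ, MapsTo (halfLineFun (φ⁻¹ ^ m : HalfLineDiffeo).1)
      (Ici (0 : ℝ) ∩ {x | halfLineFun (φ⁻¹ ^ m : HalfLineDiffeo).1 x < X}) (Ici 0 ∩ Iio X) :=
    fun m x hx => ⟨halfLineFun_nonneg _ x, hx.2⟩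
  have hsm : ∀ m : ℕ, ContDiffOn ℝ ∞ (halfLineFun (φ⁻¹ ^ m : HalfLineDiffeo).1)
      (Ici (0 : ℝ) ∩ {x | halfLineFun (φ⁻¹ ^ m : HalfLineDiffeo).1 x < X}) := fun m =>
    (halfLineFun_smooth _).mono inter_subset_left
  refine ⟨h.scale, ?_, ?_⟩
  · refine smoothTendsto_of_local (Eventually.of_forall fun p => p.isLift.smooth) fun q hq => ?_
    obtain ⟨m, hm⟩ := hm q hq
    refine ⟨_, hW m, hm, ?_⟩
    have h1 := (h.shift.right (hu m) hs (hsm m) (hmaps m)).clm (hu m)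
      (ContinuousLinearMap.mul ℝ ℂ ((lam : ℂ) ^ m))
    refine h1.congr (Eventually.of_forall fun p x hx => ?_) fun x hx => ?_
    · simp only [ContinuousLinearMap.mul_apply']
      rw [← shift_pow _ m (halfLineFun_nonneg _ _), hinv m hx.1]
    · simp only [ContinuousLinearMap.mul_apply']
      rw [← shift_pow _ m (halfLineFun_nonneg _ _), hinv m hx.1]
  · refine smoothTendsto_of_local (Eventually.of_forall fun p => halfLineFun_smooth _)
      fun q hq => ?_
    obtain ⟨m, hm⟩ := hm q hq
    refine ⟨_, hW m, hm, ?_⟩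
    have h1 := (h.trans.right (hu m) hs (hsm m) (hmaps m)).left (hu m) (uniqueDiffOn_Ici 0)
      (halfLineFun_smooth (φ ^ m)) (Eventually.of_forall fun p x _ => halfLineFun_nonneg _ _)
      fun x _ => halfLineFun_nonneg _ _
    have hconj : ∀ p : LiftData φ lam, ∀ x, 0 ≤ x → halfLineFun p.trans.1 x =
        halfLineFun (φ ^ m : HalfLineDiffeo).1 (halfLineFun p.trans.1
          (halfLineFun (φ⁻¹ ^ m : HalfLineDiffeo).1 x)) := fun p x hx => by
      rw [← halfLineFun_coe_mul (φ ^ m) p.trans,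
        ((commute_of_mem_centralizer p.isLift.mem_centralizer).pow_left m).eq,
        halfLineFun_coe_mul, hinv m hx]
    exact h1.congr (Eventually.of_forall fun p x hx => hconj p x hx.1) fun x hx => hconj p₀ x hx.1

/-- The components of the lift of `p₀⁻¹ p`. -/
noncomputable def relShift (p₀ p : LiftData φ lam) (x : ℝ) : ℂ :=
  ((p₀.scale⁻¹ : ℂˣ) : ℂ) * (p.shift x - p₀.shift (halfLineFun (p₀.trans⁻¹ * p.trans).1 x))

lemma isReebLift_rel (hlam : 1 < ‖(lam : ℂ)‖) (p₀ p : LiftData φ lam) :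
    IsReebLift ((p₀.aut⁻¹ * p.aut).1 : Reeb φ lam → Reeb φ lam) (p₀.scale⁻¹ * p.scale)
      (relShift p₀ p) (p₀.trans⁻¹ * p.trans) := p.isLift.inv_mul hlam p₀.isLift

lemma LiftTendsto.rel_scale {l : Filter (LiftData φ lam)} {p₀ : LiftData φ lam}
    (h : LiftTendsto l p₀ (Ici 0)) :
    Tendsto (fun p : LiftData φ lam => ((p₀.scale⁻¹ * p.scale : ℂˣ) : ℂ)) l (𝓝 1) := by
  have h1 := h.scale.const_mul ((p₀.scale⁻¹ : ℂˣ) : ℂ)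
  rw [Units.inv_mul] at h1
  exact h1.congr fun p => (Units.val_mul _ _).symm

lemma LiftTendsto.rel_trans {l : Filter (LiftData φ lam)} {p₀ : LiftData φ lam}
    (h : LiftTendsto l p₀ (Ici 0)) :
    SmoothTendsto l (fun p => halfLineFun (p₀.trans⁻¹ * p.trans).1) id (Ici 0) := by
  have hs := uniqueDiffOn_Ici (0 : ℝ)
  refine (h.trans.left hs hs (halfLineFun_smooth p₀.trans⁻¹)
    (Eventually.of_forall fun p x _ => halfLineFun_nonneg _ _)
    fun x _ => halfLineFun_nonneg _ _).congr (Eventually.of_forall fun p x _ => ?_) fun x hx => ?_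
  · exact halfLineFun_coe_mul _ _ _
  · exact (halfLineFun_inv_apply _ hx).symm

lemma LiftTendsto.rel_shift {l : Filter (LiftData φ lam)} {p₀ : LiftData φ lam}
    (h : LiftTendsto l p₀ (Ici 0)) : SmoothTendsto l (relShift p₀) 0 (Ici 0) := by
  have hs := uniqueDiffOn_Ici (0 : ℝ)
  have h1 := (h.rel_trans.left hs hs p₀.isLift.smooth
    (Eventually.of_forall fun p x _ => halfLineFun_nonneg _ _) fun x hx => hx).clm hs
    (-ContinuousLinearMap.id ℝ ℂ)
  refine ((h.shift.add hs h1).clm hs (ContinuousLinearMap.mul ℝ ℂ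
    ((p₀.scale⁻¹ : ℂˣ) : ℂ))).congr (Eventually.of_forall fun p x _ => ?_) fun x hx => ?_
  · simp [relShift, sub_eq_add_neg]
  · simp

/-- Lifts `(z, x) ↦ (a z + b(x), η(x))` converge to the identity if their components do. -/
lemma smoothTendsto_reebMap {P : Type} {l : Filter P} {a : P → ℂˣ} {b : P → ℝ → ℂ}
    {η : P → HalfLineDiffeo} (ha : Tendsto (fun p => (a p : ℂ)) l (𝓝 1))
    (hb : SmoothTendsto l b 0 (Ici 0)) (hη : SmoothTendsto l (fun p => halfLineFun (η p).1) id (Ici 0)) :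
    SmoothTendsto l (fun p => reebMap (a p) (b p) (η p)) id {q | 0 ≤ q.2} := by
  have hs := uniqueDiffOn_halfSpace
  have hs' := uniqueDiffOn_Ici (0 : ℝ)
  have h1 : SmoothTendsto l (fun p (q : ℂ × ℝ) => (a p : ℂ) * q.1) (fun q => 1 * q.1)
      {q : ℂ × ℝ | 0 ≤ q.2} := (smoothTendsto_of_tendsto ha).bilinear hs
    (ContinuousLinearMap.mul ℝ ℂ) (smoothTendsto_const hs contDiff_fst.contDiffOn)
  have h2 := hb.right hs hs' (f := fun q : ℂ × ℝ => q.2) contDiff_snd.contDiffOn fun q hq => hq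
  have h3 := hη.right hs hs' (f := fun q : ℂ × ℝ => q.2) contDiff_snd.contDiffOn fun q hq => hq
  refine ((h1.add hs h2).prodMk hs h3).congr (Eventually.of_forall fun p q _ => rfl) fun q _ => ?_
  exact Prod.ext (by simp) rfl

/-- Convergence of lifts implies convergence of the automorphisms. -/
lemma LiftTendsto.tendsto_aut (hlam : 1 < ‖(lam : ℂ)‖) {l : Filter (LiftData φ lam)}
    {p₀ : LiftData φ lam} (h : LiftTendsto l p₀ (Ici 0)) : Tendsto LiftData.aut l (𝓝 p₀.aut) := by
  refine ReebFoliation.tendsto_aut (fun _ => uniqueDiffOn_cover)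
    (fun _ K U hK hKd hU hKU => exists_compact_cover hK hKd hU hKU) fun _ K _ _ =>
    ⟨univ, fun p => reebMap (p₀.scale⁻¹ * p.scale) (relShift p₀ p) (p₀.trans⁻¹ * p.trans),
      isOpen_univ, subset_univ K, ?_, ?_⟩
  · exact Eventually.of_forall fun p => (isReebLift_rel hlam p₀ p).leafwiseLift hlam
  · rw [inter_univ]
    exact (smoothTendsto_reebMap h.rel_scale h.rel_shift h.rel_trans).inter_open
      isOpen_compl_singleton

/-- A local expression of an automorphism near a connected set agrees with a global lift. -/
lemma exists_liftData_eventuallyEq (hφ : IsExpanding φ) (hlam : 1 < ‖(lam : ℂ)‖)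
    (f : AutReeb φ lam) {U K : Set (ℂ × ℝ)} {g : ℂ × ℝ → ℂ × ℝ}
    (hg : LeafwiseLift (reebParam φ lam) f.1 () () U g) (hKU : K ⊆ U) (hKc : K ⊆ cover)
    (hK : IsPreconnected K) (hne : K.Nonempty) :
    ∃ p : LiftData φ lam, p.aut = f ∧ ∀ q ∈ K, g =ᶠ[𝓝[cover] q] p.map := by
  obtain ⟨a, b, η, hf⟩ := exists_isReebLift hφ hlam f
  have hgl : ∀ q ∈ cover, q ∈ U → g q ∈ cover ∧ f.1 (reebPt φ lam q) = reebPt φ lam (g q) := by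
    intro q hq hqU
    obtain ⟨h1, h2⟩ := hg.lift q hq hqU
    refine ⟨h1, ?_⟩
    rw [reebPt_of_mem hq, reebPt_of_mem (show g q ∈ cover from h1)]
    exact h2
  have hGm : ∀ q ∈ cover, reebMap a b η q ∈ cover := fun q hq => reebMap_mem (hf.apply_zero hlam) hq
  have key : ∀ q : K, ∃ n : ℤ, g =ᶠ[𝓝[cover] q.1] fun y => deckFun φ lam n (reebMap a b η y) := by
    intro q
    have hqc := hKc q.2
    have hqU := hKU q.2
    obtain ⟨h1, h2⟩ := hgl q.1 hqc hqU
    obtain ⟨n, hn⟩ := (reebPt_eq_iff (hGm _ hqc) h1).1 ((hf.apply' hqc).symm.trans h2)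
    refine ⟨n, eventuallyEq_of_lifts hφ hlam h1 ?_ ?_ ?_⟩
    · exact ((hg.smooth q.1 ⟨hqU, hqc⟩).continuousWithinAt.mono_of_mem_nhdsWithin
        (inter_mem (nhdsWithin_le_nhds (hg.isOpen.mem_nhds hqU)) self_mem_nhdsWithin))
    · rw [hn]
      exact ((deckFun_continuous n).tendsto _).comp
        ((reebMap_smooth hf.smooth).continuousOn.mono (fun y hy => hy.1) q.1 hqc)
    · filter_upwards [self_mem_nhdsWithin, nhdsWithin_le_nhds (hg.isOpen.mem_nhds hqU)] with y hy hyU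
      obtain ⟨h3, h4⟩ := hgl y hy hyU
      refine ⟨h3, deckFun_mem n (hGm y hy), ?_⟩
      rw [← h4, hf.apply' hy, reebPt_deckFun n (hGm y hy)]
  choose N hN using key
  -- The deck transformation relating the local expression to a fixed global lift is locally
  -- constant on `K`, since the action is free. Connectedness of `K` gives a single exponent, which
  -- is absorbed in the choice of lift.
  have hlc : IsLocallyConstant N := by
    rw [IsLocallyConstant.iff_eventually_eq]
    intro q
    have h1 : ∀ᶠ y in 𝓝[K] q.1, g y = deckFun φ lam (N q) (reebMap a b η y) :=
      nhdsWithin_mono q.1 hKc (hN q)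
    rw [← map_nhds_subtype_val] at h1
    filter_upwards [h1] with y hy
    have hy' := (hN y).self_of_nhdsWithin (hKc y.2)
    exact deckFun_injective hφ hlam (hGm _ (hKc y.2)) (hy'.symm.trans hy)
  have := isPreconnected_iff_preconnectedSpace.1 hK
  obtain ⟨q₀, hq₀⟩ := hne
  refine ⟨⟨f, _, _, _, hf.deck hlam (N ⟨q₀, hq₀⟩)⟩, rfl, fun q hq => ?_⟩
  have h1 := hN ⟨q, hq⟩
  rw [hlc.apply_eq_of_preconnectedSpace ⟨q, hq⟩ ⟨q₀, hq₀⟩] at h1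
  filter_upwards [h1] with y hy
  rw [hy, reebMap_deck]
  rfl

lemma exists_liftData_mem (hφ : IsExpanding φ) (hlam : 1 < ‖(lam : ℂ)‖) (p₀ : LiftData φ lam)
    (f : AutReeb φ lam) {U K : Set (ℂ × ℝ)} {g : ℂ × ℝ → ℂ × ℝ}
    (hg : LeafwiseLift (reebParam φ lam) f.1 () () U g) (hKU : K ⊆ U) (hKc : K ⊆ cover)
    (hK : IsPreconnected K) (hne : K.Nonempty) {n : ℕ}
    (hn : ∀ k ≤ n, ∀ q ∈ K, ‖iteratedFDerivWithin ℝ k g cover q -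
      iteratedFDerivWithin ℝ k p₀.map cover q‖ < 1 / ((n : ℝ) + 1)) :
    ∃ p ∈ liftNhd K p₀ n, p.aut = f := by
  obtain ⟨p, hp, he⟩ := exists_liftData_eventuallyEq hφ hlam f hg hKU hKc hK hne
  refine ⟨p, fun k hk q hq => ?_, hp⟩
  rw [← (he q hq).iteratedFDerivWithin_eq ((he q hq).self_of_nhdsWithin (hKc hq)) k]
  exact hn k hk q hq

/-- A map on automorphisms which converges along the lifts converges along every filter which
controls the lifts. -/
lemma tendsto_of_liftFilter {Y : Type} {K : Set (ℂ × ℝ)} {p₀ : LiftData φ lam}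
    {m : AutReeb φ lam → Y} {l : Filter (AutReeb φ lam)} {l' : Filter Y}
    (hm : Tendsto (fun p : LiftData φ lam => m p.aut) (liftFilter K p₀) l')
    (hl : ∀ n, ∀ᶠ f in l, ∃ p ∈ liftNhd K p₀ n, p.aut = f) : Tendsto m l l' := by
  intro s hs
  obtain ⟨n, hn⟩ := mem_liftFilter.1 (hm hs)
  refine mem_map.2 ?_
  filter_upwards [hl n] with f hf
  obtain ⟨p, hp, rfl⟩ := hf
  exact hn hp

end LiftData

/-! ### Splitting the restriction to the boundary leaf. -/

section Splitting

/-- If `Z_ψ` is a one-parameter group, the translations of the boundary leaf extend to the Reeb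
component by a homomorphism. -/
lemma exists_splitting {ψ : HalfLineDiffeo} {mu : ℂˣ} (hmu : 1 < ‖(mu : ℂ)‖)
    (hZ : CentralizerIsoReal ψ) : ∃ (S : Curve mu →* AutReeb ψ mu) (θ : ℝ → HalfLineDiffeo) (c : ℝ),
      (∀ a : ℂˣ, IsReebLift (S (a : Curve mu)).1 a 0 (θ (c * Real.log ‖(a : ℂ)‖))) ∧
      SmoothTendsto (𝓝 0) (fun t => halfLineFun (θ t).1) id (Ici 0) := by
  obtain ⟨Θ, hΘ⟩ := hZ
  have hψ : ψ ∈ Centralizer ψ := Subgroup.mem_centralizer_singleton_iff.2 rfl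
  obtain ⟨τ, hτ⟩ := Θ.surjective ⟨ψ, hψ⟩
  have hlog : Real.log ‖(mu : ℂ)‖ ≠ 0 := (Real.log_pos hmu).ne'
  -- Normalized so that `a = μ` receives the transverse part `ψ`: the automorphism attached to `μ`
  -- is then induced by the deck transformation, which is trivial on the quotient.
  set c : ℝ := τ.toAdd / Real.log ‖(mu : ℂ)‖ with hc
  let ν : ℂˣ →* Multiplicative ℝ := MonoidHom.mk' (fun a => .ofAdd (c * Real.log ‖(a : ℂ)‖))
    fun a b => by
      rw [Units.val_mul, norm_mul, Real.log_mul (norm_ne_zero_iff.2 a.ne_zero)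
        (norm_ne_zero_iff.2 b.ne_zero), mul_add, ofAdd_add]
  let S₀ : ℂˣ →* AutReeb ψ mu := (linAut hmu).comp ((MonoidHom.id ℂˣ).prod
    (Θ.toMonoidHom.comp ν))
  have hνmu : ν mu = τ := by
    change Multiplicative.ofAdd (c * Real.log ‖(mu : ℂ)‖) = τ
    rw [hc, div_mul_cancel₀ _ hlog]
    rfl
  have hker : Subgroup.zpowers mu ≤ S₀.ker := by
    rw [Subgroup.zpowers_le, MonoidHom.mem_ker]
    refine Subtype.ext (Homeomorph.ext fun p => ?_)
    obtain ⟨q, hq, rfl⟩ := exists_reebPt p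
    have h1 : S₀ mu = linAut hmu (mu, ⟨ψ, hψ⟩) := by
      change linAut hmu (mu, Θ (ν mu)) = _
      rw [hνmu, hτ]
    rw [h1, (isReebLift_linAut hmu (mu, ⟨ψ, hψ⟩)).apply' hq]
    have h2 : reebMap mu 0 ψ q = deckFun ψ mu 1 q := by
      simp [reebMap, deckFun]
    change reebPt ψ mu (reebMap mu 0 ψ q) = reebPt ψ mu q
    rw [h2, reebPt_deckFun 1 hq]
  refine ⟨QuotientGroup.lift _ S₀ hker, fun t => (Θ (.ofAdd t)).1, c, fun a => ?_, ?_⟩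
  · exact isReebLift_linAut hmu (a, Θ (ν a))
  · refine flow_smoothTendsto (fun s t => ?_) fun s t hst => (hΘ s t).1 hst
    rw [ofAdd_add, map_mul]
    rfl

end Splitting

/-! ### Extending automorphisms of the first component to `M`. -/

section Extension

variable {φ ψ : HalfLineDiffeo} {lam mu : ℂˣ} {h : Curve lam ≃ₜ Curve mu}

/-- On the second component the splitting supplies an automorphism with the boundary translation
prescribed by `f` through `h`. All ingredients are homomorphisms and pasted maps are determined by
their two restrictions, so the extension is multiplicative. -/
lemma exists_extension (hφ : IsExpanding φ) (hψ : IsExpanding ψ) (hφ_flat : IsFlat φ)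
    (hψ_flat : IsFlat ψ) (hlam : 1 < ‖(lam : ℂ)‖) (hmu : 1 < ‖(mu : ℂ)‖)
    (hh : IsHolomorphic h) {κ : ℂ}
    (hκ : ∀ O ℓ, HolLift h O ℓ → ∀ z ∈ O, z * deriv ℓ z = κ * ℓ z) (S : Curve mu →* AutReeb ψ mu)
    (hS : ∀ c, boundaryClass hψ hmu (S c) = c) :
    ∃ i : AutReeb φ lam →* AutPasted φ ψ h, ∀ f,
      (∀ p, (i f).1.1 (Pasted.inl φ ψ h p) = Pasted.inl φ ψ h (f.1 p)) ∧
      ∀ p, (i f).1.1 (Pasted.inr φ ψ h p) =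
        Pasted.inr φ ψ h ((S (curveHom hκ hh (boundaryClass hφ hlam f))).1 p) := by
  have hex := fun f => exists_glued hφ hψ hφ_flat hψ_flat hlam hmu hh f
    (S (curveHom hκ hh (boundaryClass hφ hlam f))) fun w => by rw [hS, curveHom_mul hκ hh]
  choose i hi hi' using hex
  refine ⟨MonoidHom.mk' i fun f g => autPasted_ext (fun p => ?_) fun p => ?_,
    fun f => ⟨hi f, hi' f⟩⟩
  · change _ = (i f).1.1 ((i g).1.1 _)
    rw [hi, hi, hi]
    rfl
  · change _ = (i f).1.1 ((i g).1.1 _)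
    rw [hi', hi', hi', map_mul, map_mul, map_mul]
    rfl

/-- The expression, in one collar, of an automorphism near the identity. -/
noncomputable def collarMap (s : ℂ) (b : ℝ → ℂ) (η ξ : HalfLineDiffeo) (q : ℂ × ℝ) : ℂ × ℝ :=
  (Complex.exp s * q.1 + flatExt b q.2, twoSided η ξ q.2)

/-- With no shift on the second side the logarithmic correction of the general collar formula
disappears. For small `s` the same collar can serve as source and target, as required for
convergence to the identity in a fixed chart. -/
lemma leafwiseLift_collarMap {κ : ℂ} {F : Pasted φ ψ h → Pasted φ ψ h} {f : Reeb φ lam → Reeb φ lam}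
    {f' : Reeb ψ mu → Reeb ψ mu} {s : ℂ} {b : ℝ → ℂ} {η ξ : HalfLineDiffeo}
    (hF : ∀ p, F (Pasted.inl φ ψ h p) = Pasted.inl φ ψ h (f p))
    (hF' : ∀ p, F (Pasted.inr φ ψ h p) = Pasted.inr φ ψ h (f' p))
    (hf : IsReebLift f (expUnit s) b η) (hf' : IsReebLift f' (expUnit (κ * s)) 0 ξ)
    (hb : FlatAtZero b) (hη : FlatAtZero fun y => halfLineFun η.1 y - y)
    (hξ : FlatAtZero fun y => halfLineFun ξ.1 y - y) {O : Set ℂ} {ℓ : ℂ → ℂ}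
    (hl : HolLift h O ℓ) {W : Set (ℂ × ℝ)} (hW : IsOpen W)
    (hO : ∀ q ∈ W, (collarMap s b η ξ q).1 ∈ O)
    (hs : ∀ q ∈ W, ℓ (Complex.exp s * q.1) = Complex.exp (κ * s) * ℓ q.1) :
    LeafwiseLift (pastedParam φ ψ h) F (PastedIndex.collar O ℓ hl) (PastedIndex.collar O ℓ hl) W
      (collarMap s b η ξ) := by
  refine ⟨hW, fun p hp hpW => ⟨hO p hpW, ?_⟩, ?_, fun q _ q' _ he => ?_, fun x => ?_⟩
  · have h5 : collarMap s b η ξ p ∈ (pastedParam φ ψ h).dom (PastedIndex.collar O ℓ hl) := hO p hpW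
    rcases le_total 0 p.2 with hx | hx
    · have h1 : collarMap s b η ξ p = reebMap (expUnit s) b η p := by
        simp only [collarMap, reebMap]
        rw [flatExt_of_nonneg _ hx, twoSided_of_nonneg hξ hx, coe_expUnit]
      have h6 : 0 ≤ (collarMap s b η ξ p).2 := by
        rw [h1]
        exact halfLineFun_nonneg _ _
      refine Eq.trans ?_ (pastedParam_of_nonneg h5 h6).symm
      rw [pastedParam_of_nonneg hp hx, hF, hf.apply' (mem_cover_of_mem_pastedDom hp hx), h1]
    · have h6 : (collarMap s b η ξ p).2 = -halfLineFun ξ.1 (-p.2) := twoSided_of_nonpos hη hx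
      have h7 : (collarMap s b η ξ p).2 ≤ 0 := by
        rw [h6]
        exact neg_nonpos.2 (halfLineFun_nonneg _ _)
      refine Eq.trans ?_ (pastedParam_of_nonpos h5 h7).symm
      rw [pastedParam_of_nonpos hp hx, hF', hf'.apply' (mirrorCoord_mem_cover hp hx)]
      congr 2
      refine Prod.ext ?_ (by rw [h6, neg_neg]; rfl)
      change Complex.exp (κ * s) * ℓ p.1 + 0 = ℓ (Complex.exp s * p.1 + flatExt b p.2)
      rw [flatExt_of_nonpos hb hx, add_zero, add_zero, hs p hpW]
  · exact (((contDiff_const.mul contDiff_fst).add (hb.contDiff_flatExt.comp contDiff_snd)).prodMk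
      ((twoSided_contDiff hη hξ).comp contDiff_snd)).contDiffOn
  · simp only [collarMap, he]
  · exact ((differentiable_id.const_mul (Complex.exp s)).add_const (flatExt b x)).differentiableOn

lemma flatAtZero_zero {E : Type} [NormedAddCommGroup E] [NormedSpace ℝ E] :
    FlatAtZero (0 : ℝ → E) :=
  ⟨contDiffOn_const, fun k => by simp⟩

lemma smoothTendsto_collarMap {P : Type} {l : Filter P} {s : P → ℂ} {b : P → ℝ → ℂ}
    {η ξ : P → HalfLineDiffeo} (hs : Tendsto s l (𝓝 0)) (hb : SmoothTendsto l b 0 (Ici 0))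
    (hη : SmoothTendsto l (fun p => halfLineFun (η p).1) id (Ici 0))
    (hξ : SmoothTendsto l (fun p => halfLineFun (ξ p).1) id (Ici 0))
    (hb' : ∀ p, FlatAtZero (b p)) (hη' : ∀ p, FlatAtZero fun y => halfLineFun (η p).1 y - y)
    (hξ' : ∀ p, FlatAtZero fun y => halfLineFun (ξ p).1 y - y) :
    SmoothTendsto l (fun p => collarMap (s p) (b p) (η p) (ξ p)) id univ := by
  have hu : UniqueDiffOn ℝ (univ : Set (ℂ × ℝ)) := uniqueDiffOn_univ
  have hu' : UniqueDiffOn ℝ (univ : Set ℝ) := uniqueDiffOn_univ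
  have hi := uniqueDiffOn_Ici (0 : ℝ)
  have hsub : ∀ η : P → HalfLineDiffeo,
      SmoothTendsto l (fun p => halfLineFun (η p).1) id (Ici 0) →
      (∀ p, FlatAtZero fun y => halfLineFun (η p).1 y - y) →
      SmoothTendsto l (fun p => flatExt fun y => halfLineFun (η p).1 y - y) (flatExt 0) univ := by
    intro η hη hη'
    refine SmoothTendsto.flatExt ?_ (Eventually.of_forall hη') flatAtZero_zero
    refine (hη.add hi (smoothTendsto_const hi (contDiff_neg (𝕜 := ℝ)).contDiffOn)).congr
      (Eventually.of_forall fun p x _ => sub_eq_add_neg _ _) fun x _ => (add_neg_cancel x).symm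
  have hz : ∀ {E : Type} [NormedAddCommGroup E] (x : ℝ), flatExt (0 : ℝ → E) x = 0 := fun x => by
    simp [flatExt]
  have hexp : Tendsto (fun p => Complex.exp (s p)) l (𝓝 1) := by
    have := (Complex.continuous_exp.tendsto 0).comp hs
    rwa [Complex.exp_zero] at this
  have h1 := (smoothTendsto_of_tendsto (s := (univ : Set (ℂ × ℝ))) hexp).bilinear hu
    (ContinuousLinearMap.mul ℝ ℂ) (smoothTendsto_const hu contDiff_fst.contDiffOn)
  have h2 := (hb.flatExt (Eventually.of_forall hb') flatAtZero_zero).right hu hu'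
    (f := fun q : ℂ × ℝ => q.2) contDiff_snd.contDiffOn (mapsTo_univ _ _)
  have h3 := (hsub η hη hη').right hu hu' (f := fun q : ℂ × ℝ => q.2) contDiff_snd.contDiffOn
    (mapsTo_univ _ _)
  have h4 := ((hsub ξ hξ hξ').right hu hu' (f := fun q : ℂ × ℝ => -q.2)
    contDiff_snd.neg.contDiffOn (mapsTo_univ _ _)).clm hu (-ContinuousLinearMap.id ℝ ℝ)
  have h5 := smoothTendsto_const (l := l) hu (f := fun q : ℂ × ℝ => q.2) contDiff_snd.contDiffOn
  refine ((h1.add hu h2).prodMk hu ((h5.add hu h3).add hu h4)).congr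
    (Eventually.of_forall fun p q _ => ?_) fun q _ => ?_
  · simp [collarMap, twoSided, sub_eq_add_neg]
  · simp [hz]

/-- Automorphisms of `M` converge if the lifts to the two components do. -/
lemma tendsto_pasted {κ : ℂ} (hκ : ∀ O ℓ, HolLift h O ℓ → ∀ z ∈ O, z * deriv ℓ z = κ * ℓ z)
    {P : Type} {l : Filter P} {F : P → Aut (pastedParam φ ψ h)} {F₀ : Aut (pastedParam φ ψ h)}
    {f : P → Reeb φ lam → Reeb φ lam} {f' : P → Reeb ψ mu → Reeb ψ mu} {s : P → ℂ}
    {b : P → ℝ → ℂ} {η ξ : P → HalfLineDiffeo}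
    (hF : ∀ p q, (F₀⁻¹ * F p).1 (Pasted.inl φ ψ h q) = Pasted.inl φ ψ h (f p q))
    (hF' : ∀ p q, (F₀⁻¹ * F p).1 (Pasted.inr φ ψ h q) = Pasted.inr φ ψ h (f' p q))
    (hf : ∀ p, IsReebLift (f p) (expUnit (s p)) (b p) (η p))
    (hf' : ∀ p, IsReebLift (f' p) (expUnit (κ * s p)) 0 (ξ p))
    (hs : Tendsto s l (𝓝 0)) (hb : SmoothTendsto l b 0 (Ici 0))
    (hη : SmoothTendsto l (fun p => halfLineFun (η p).1) id (Ici 0))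
    (hξ : SmoothTendsto l (fun p => halfLineFun (ξ p).1) id (Ici 0))
    (hb' : ∀ p, FlatAtZero (b p)) (hη' : ∀ p, FlatAtZero fun y => halfLineFun (η p).1 y - y)
    (hξ' : ∀ p, FlatAtZero fun y => halfLineFun (ξ p).1 y - y) : Tendsto F l (𝓝 F₀) := by
  have hexp : ∀ κ : ℂ, Tendsto (fun p => (expUnit (κ * s p) : ℂ)) l (𝓝 1) := fun κ => by
    have := (Complex.continuous_exp.tendsto (κ * 0)).comp (hs.const_mul κ)
    rwa [mul_zero, Complex.exp_zero] at this
  refine tendsto_aut (fun i => (isOpen_pastedDom i).uniqueDiffOn) ?_ ?_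
  · intro i K U hK hKd hU hKU
    obtain ⟨L, hL, hKL, hLU⟩ := exists_compact_between hK ((isOpen_pastedDom i).inter hU)
      (subset_inter hKd hKU)
    exact ⟨L, interior L, hL, isOpen_interior, hKL, fun q hq => interior_subset hq.1, hLU⟩
  intro i K hK hKd
  have hs0 := uniqueDiffOn_halfSpace
  match i, hKd with
  | .left, hKd =>
    refine ⟨{q | 0 < q.2}, fun p => reebMap (expUnit (s p)) (b p) (η p),
      isOpen_lt continuous_const continuous_snd, hKd,
      Eventually.of_forall fun p => leafwiseLift_of_pos (hF p) (hf p) _, ?_⟩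
    have h1 := (smoothTendsto_reebMap (a := fun p => expUnit (s p)) (by simpa using hexp 1) hb
      hη).inter_open (isOpen_lt continuous_const continuous_snd : IsOpen {q : ℂ × ℝ | 0 < q.2})
    convert h1 using 1
    ext q
    exact ⟨fun hq => ⟨(show 0 < q.2 from hq.2).le, hq.2⟩, fun hq => ⟨hq.2, hq.2⟩⟩
  | .right, hKd =>
    refine ⟨{q | q.2 < 0}, fun p q => flip (reebMap (expUnit (κ * s p)) 0 (ξ p) (flip q)),
      isOpen_lt continuous_snd continuous_const, hKd,
      Eventually.of_forall fun p => leafwiseLift_of_neg (hF' p) (hf' p) _, ?_⟩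
    have ho : IsOpen {q : ℂ × ℝ | q.2 < 0} := isOpen_lt continuous_snd continuous_const
    have h0 : SmoothTendsto l (fun (_ : P) (_ : ℝ) => (0 : ℂ)) 0 (Ici 0) :=
      smoothTendsto_of_tendsto tendsto_const_nhds
    have h1 := (smoothTendsto_reebMap (b := fun _ => 0) (hexp κ) h0 hξ).right ho.uniqueDiffOn hs0
      flip_contDiff.contDiffOn fun q hq => (neg_pos.2 (show q.2 < 0 from hq)).le
    have h2 := h1.left ho.uniqueDiffOn uniqueDiffOn_univ flip_contDiff.contDiffOn
      (Eventually.of_forall fun p => mapsTo_univ _ _) (mapsTo_univ _ _)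
    have hset : (pastedParam φ ψ h).dom PastedIndex.right ∩ {q | q.2 < 0} = {q | q.2 < 0} :=
      inter_self _
    rw [hset]
    exact h2.congr (Eventually.of_forall fun p q _ => rfl) fun q _ => (flip_flip q).symm
  | .collar O ℓ hl, hKd =>
    have hO : IsOpen {q : ℂ × ℝ | q.1 ∈ O} := hl.isOpen.preimage continuous_fst
    obtain ⟨L, hL, hKL, hLO⟩ := exists_compact_between hK hO hKd
    have hsm := smoothTendsto_collarMap hs hb hη hξ hb' hη' hξ'
    refine ⟨interior L, fun p => collarMap (s p) (b p) (η p) (ξ p), isOpen_interior, hKL, ?_, ?_⟩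
    · have h1 := hsm.eventually_forall hL (subset_univ L) hO hLO
      -- As `s p → 0`, the exponential formula for `ℓ` holds near each point of the compact set `L`,
      -- hence on all of it eventually.
      have h2 : ∀ᶠ p in l, ∀ q ∈ L,
          ℓ (Complex.exp (s p) * q.1) = Complex.exp (κ * s p) * ℓ q.1 := by
        refine eventually_forall_of_isCompact hL fun q hq => ?_
        obtain ⟨δ, hδ, hball⟩ := hl.exists_ball hκ (hLO hq)
        have h3 : ∀ᶠ y : ℂ × ℝ in 𝓝[L] q, y.1 ∈ Metric.ball q.1 δ :=
          nhdsWithin_le_nhds (continuousAt_fst.eventually_mem (Metric.ball_mem_nhds _ hδ))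
        filter_upwards [(hs.eventually_mem (Metric.ball_mem_nhds 0 hδ)).prod_mk h3] with py hpy
        exact (hball _ hpy.2 _ hpy.1).2.2
      filter_upwards [h1, h2] with p h1 h2
      exact leafwiseLift_collarMap (hF p) (hF' p) (hf p) (hf' p) (hb' p) (hη' p) (hξ' p) hl
        isOpen_interior (fun q hq => h1 (interior_subset hq)) fun q hq => h2 q (interior_subset hq)
    · have h1 := hsm.inter_open ((isOpen_pastedDom (φ := φ) (ψ := ψ) (h := h)
        (PastedIndex.collar O ℓ hl)).inter (isOpen_interior (s := L)))
      rwa [univ_inter] at h1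

end Extension

/-! ### The topological embedding. -/

section Embedding

lemma smoothNhd_mem_nhds {X : Type} [TopologicalSpace X] {A : Parametrizations X} {f₀ : Aut A}
    {i j : A.ι} {K U₀ : Set (ℂ × ℝ)} {g₀ : ℂ × ℝ → ℂ × ℝ} (hK : IsCompact K) (hKd : K ⊆ A.dom i)
    (hKU : K ⊆ U₀) (hg : LeafwiseLift A f₀.1 i j U₀ g₀) (n : ℕ) {ε : ℝ} (hε : 0 < ε) :
    smoothNhd A i j K g₀ n ε ∈ 𝓝 f₀ :=
  IsOpen.mem_nhds (TopologicalSpace.isOpen_generateFrom_of_mem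
    ⟨f₀, i, j, K, U₀, g₀, n, ε, hK, hKd, hKU, hg, hε, rfl⟩)
    ⟨U₀, g₀, hKU, hg, fun k _ q _ => by rwa [sub_self, norm_zero]⟩

variable {φ ψ : HalfLineDiffeo} {lam mu : ℂˣ} {h : Curve lam ≃ₜ Curve mu}

lemma isPreconnected_box (r X : ℝ) :
    IsPreconnected (Metric.closedBall (1 : ℂ) r ×ˢ Icc (0 : ℝ) X) :=
  ((convex_closedBall 1 r).isPreconnected).prod isPreconnected_Icc

lemma isCompact_box (r X : ℝ) : IsCompact (Metric.closedBall (1 : ℂ) r ×ˢ Icc (0 : ℝ) X) :=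
  (isCompact_closedBall 1 r).prod isCompact_Icc

/-- A disc of radius less than `1` about `1` avoids `z = 0`, so the box may include `x = 0`. -/
lemma box_subset_cover {r X : ℝ} (hr : r < 1) :
    Metric.closedBall (1 : ℂ) r ×ˢ Icc (0 : ℝ) X ⊆ cover := by
  refine fun q hq => mem_cover_of_ne hq.2.1 fun h0 => ?_
  have h1 := Metric.mem_closedBall.1 hq.1
  rw [h0, dist_zero_left, norm_one] at h1
  exact h1.not_gt hr

/-- A map on automorphisms which is continuous along converging lifts is continuous. -/
lemma continuousAt_of_liftTendsto (hφ : IsExpanding φ) (hlam : 1 < ‖(lam : ℂ)‖) {Y : Type}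
    [TopologicalSpace Y] {m : AutReeb φ lam → Y} (f₀ : AutReeb φ lam)
    (hm : ∀ (l : Filter (LiftData φ lam)) (p₀ : LiftData φ lam), p₀.aut = f₀ →
      LiftTendsto l p₀ (Ici 0) → Tendsto (fun p : LiftData φ lam => m p.aut) l (𝓝 (m f₀))) :
    ContinuousAt m f₀ := by
  obtain ⟨a, b, η, hf⟩ := exists_isReebLift hφ hlam f₀
  set p₀ : LiftData φ lam := ⟨f₀, a, b, η, hf⟩ with hp₀
  refine tendsto_of_liftFilter (hm _ p₀ rfl ((liftTendsto_of_box hlam p₀ one_half_pos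
    one_pos).extend hφ one_pos)) fun n => ?_
  have hc := box_subset_cover (X := 1) one_half_lt_one
  filter_upwards [smoothNhd_mem_nhds (A := reebParam φ lam) (isCompact_box (1 / 2) 1) hc
    (subset_univ _) (hf.leafwiseLift hlam) n (Nat.one_div_pos_of_nat (α := ℝ) (n := n))] with f hf
  obtain ⟨U, g, hKU, hg, hclose⟩ := hf
  exact exists_liftData_mem hφ hlam p₀ f hg hKU hc (isPreconnected_box _ _)
    ⟨(1, 0), Metric.mem_closedBall_self one_half_pos.le, left_mem_Icc.2 zero_le_one⟩ hclose

/-- The restriction of automorphisms of `M` to the first component is continuous. -/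
lemma comap_nhds_le (hφ : IsExpanding φ) (hlam : 1 < ‖(lam : ℂ)‖) (hh : IsHolomorphic h)
    {i : AutReeb φ lam → Aut (pastedParam φ ψ h)}
    (hi : ∀ f p, (i f).1 (Pasted.inl φ ψ h p) = Pasted.inl φ ψ h (f.1 p)) (f₀ : AutReeb φ lam) :
    comap i (𝓝 (i f₀)) ≤ 𝓝 f₀ := by
  obtain ⟨O, ℓ, h1O, hl⟩ := hh 1
  let c : (pastedParam φ ψ h).ι := PastedIndex.collar O ℓ hl
  obtain ⟨j, U₀, g₀, hU₀, hg₀⟩ := (i f₀).2.1 c (1, 0) h1O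
  have hopen : IsOpen ((pastedParam φ ψ h).dom c) := isOpen_pastedDom c
  have hnhds : U₀ ∩ (pastedParam φ ψ h).dom c ∈ 𝓝 ((1 : ℂ), (0 : ℝ)) :=
    (hg₀.isOpen.inter hopen).mem_nhds ⟨hU₀, h1O⟩
  obtain ⟨ε, hε, hball⟩ := Metric.nhds_basis_closedBall.mem_iff.1 hnhds
  -- `ε` keeps the box inside one collar and the domain of `g₀`; the bound `1 / 2` keeps it off `z =
  -- 0`. Control in this single collar box determines the automorphism of the whole component.
  set r : ℝ := min ε (1 / 2) with hr
  have hr0 : 0 < r := lt_min hε one_half_pos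
  have hr1 : r < 1 := (min_le_right _ _).trans_lt one_half_lt_one
  set K : Set (ℂ × ℝ) := Metric.closedBall (1 : ℂ) r ×ˢ Icc (0 : ℝ) r with hK
  have hKU : K ⊆ U₀ ∩ (pastedParam φ ψ h).dom c := by
    refine fun q hq => hball (Metric.mem_closedBall.2 (max_le ?_ ?_))
    · exact (Metric.mem_closedBall.1 hq.1).trans (min_le_left _ _)
    · rw [Real.dist_eq, sub_zero, abs_of_nonneg hq.2.1]
      exact hq.2.2.trans (min_le_left _ _)
  have hKc : K ⊆ cover := box_subset_cover hr1
  have hKne : K.Nonempty := ⟨(1, 0), Metric.mem_closedBall_self hr0.le, left_mem_Icc.2 hr0.le⟩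
  obtain ⟨p₀, hp₀, he⟩ := exists_liftData_eventuallyEq hφ hlam f₀ (hg₀.of_inl (hi f₀)) hKU hKc
    (isPreconnected_box r r) hKne
  -- The collar expression is smooth on a full neighbourhood of `q`, including `x < 0`, so its
  -- derivatives within the collar and within the half-space cover both equal the full derivatives.
  have hder : ∀ {f : AutReeb φ lam} {U : Set (ℂ × ℝ)} {g : ℂ × ℝ → ℂ × ℝ},
      LeafwiseLift (pastedParam φ ψ h) (i f).1 c j U g → K ⊆ U → ∀ (k : ℕ), ∀ q ∈ K,
      iteratedFDerivWithin ℝ k g ((pastedParam φ ψ h).dom c) q =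
        iteratedFDerivWithin ℝ k g cover q := by
    intro f U g hg hKU' k q hq
    have hs : ContDiffAt ℝ k g q := ((hg.smooth.contDiffAt
      ((hg.isOpen.inter hopen).mem_nhds ⟨hKU' hq, (hKU hq).2⟩)).of_le (by exact_mod_cast le_top))
    rw [iteratedFDerivWithin_eq_iteratedFDeriv hopen.uniqueDiffOn hs (hKU hq).2,
      iteratedFDerivWithin_eq_iteratedFDeriv uniqueDiffOn_cover hs (hKc hq)]
  have hT := ((liftTendsto_of_box hlam p₀ hr0 hr0).extend hφ hr0).tendsto_aut hlam
  rw [hp₀] at hT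
  refine tendsto_id'.1 (tendsto_of_liftFilter (m := id) hT fun n => ?_)
  have hN := preimage_mem_comap (m := i) (smoothNhd_mem_nhds (isCompact_box r r)
    (fun q hq => (hKU hq).2) (fun q hq => (hKU hq).1) hg₀ n
    (Nat.one_div_pos_of_nat (α := ℝ) (n := n)))
  filter_upwards [hN] with f hf
  obtain ⟨U, g, hKU', hg, hclose⟩ := hf
  refine exists_liftData_mem hφ hlam p₀ f (hg.of_inl (hi f))
    (fun q hq => ⟨hKU' hq, (hKU hq).2⟩) hKc (isPreconnected_box r r) hKne fun k hk q hq => ?_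
  rw [← (he q hq).iteratedFDerivWithin_eq ((he q hq).self_of_nhdsWithin (hKc hq)) k,
    ← hder hg hKU' k q hq, ← hder hg₀ (fun q hq => (hKU hq).1) k q hq]
  exact hclose k hk q hq

/-- If `Z_ψ` is a one-parameter group, then `Aut R_{φ, λ}` embeds into the automorphism group of
`M`. -/
theorem exists_isEmbedding (hφ : IsExpanding φ) (hψ : IsExpanding ψ) (hφ_flat : IsFlat φ)
    (hψ_flat : IsFlat ψ) (hlam : 1 < ‖(lam : ℂ)‖) (hmu : 1 < ‖(mu : ℂ)‖)
    (hh : IsHolomorphic h) (hZ : CentralizerIsoReal ψ) :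
    ∃ i : AutReeb φ lam →* AutPasted φ ψ h, Topology.IsEmbedding i := by
  obtain ⟨κ, hκ⟩ := exists_logDeriv hlam hmu hh
  obtain ⟨S, θ, c, hS, hθ⟩ := exists_splitting hmu hZ
  have hSb : ∀ w, boundaryClass hψ hmu (S w) = w := fun w => by
    obtain ⟨a, rfl⟩ := QuotientGroup.mk_surjective w
    exact (hS a).boundaryClass_eq hψ hmu
  obtain ⟨i, hi⟩ := exists_extension hφ hψ hφ_flat hψ_flat hlam hmu hh hκ S hSb
  refine ⟨i, ⟨?_, fun f g hfg => Subtype.ext (Homeomorph.ext fun p => ?_)⟩⟩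
  · rw [← Topology.IsInducing.subtypeVal.of_comp_iff, Topology.isInducing_iff_nhds]
    refine fun f₀ => le_antisymm (map_le_iff_le_comap.1 ?_)
      (comap_nhds_le hφ hlam hh (fun f p => (hi f).1 p) f₀)
    refine continuousAt_of_liftTendsto hφ hlam f₀ fun l p₀ hp₀ hl => ?_
    subst hp₀
    have hlift := isReebLift_rel hlam p₀
    -- The principal logarithm is continuous at `1`, so `s → 0`. The second component is then scaled
    -- by `exp(κ s)` with flow time `c log |exp(κ s)| = c Re(κ s)`, which also tends to `0`.
    set s : LiftData φ lam → ℂ := fun p => Complex.log ((p₀.scale⁻¹ * p.scale : ℂˣ) : ℂ) with hs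
    have hexp : ∀ p, expUnit (s p) = p₀.scale⁻¹ * p.scale := fun p =>
      Units.ext (Complex.exp_log (Units.ne_zero _))
    have hs0 : Tendsto s l (𝓝 0) := by
      have := (continuousAt_clog Complex.one_mem_slitPlane).tendsto.comp hl.rel_scale
      rwa [Complex.log_one] at this
    have hf' : ∀ p, IsReebLift
        (S (curveHom hκ hh (boundaryClass hφ hlam (p₀.aut⁻¹ * p.aut)))).1
        (expUnit (κ * s p)) 0 (θ (c * Real.log ‖(expUnit (κ * s p) : ℂ)‖)) := fun p => by
      rw [(hlift p).boundaryClass_eq hφ hlam, ← hexp, curveHom_expUnit]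
      exact hS _
    have ht : Tendsto (fun p => c * Real.log ‖(expUnit (κ * s p) : ℂ)‖) l (𝓝 0) := by
      have h1 := ((Complex.continuous_re.tendsto _).comp (hs0.const_mul κ)).const_mul c
      rw [mul_zero, Complex.zero_re, mul_zero] at h1
      refine h1.congr fun p => ?_
      simp [Complex.norm_exp]
    refine tendsto_pasted (F := fun p => (i p.aut).1) (F₀ := (i p₀.aut).1) hκ
      (f := fun p => (p₀.aut⁻¹ * p.aut).1)
      (fun p q => ?_) (fun p q => ?_) (fun p => ?_) hf' hs0 hl.rel_shift
      hl.rel_trans (hθ.param ht) (fun p => (hlift p).flat hφ_flat hlam)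
      (fun p => flatAtZero_of_mem_centralizer hφ hφ_flat (hlift p).mem_centralizer)
      fun p => flatAtZero_of_mem_centralizer hψ hψ_flat (hf' p).mem_centralizer
    · have h1 := (hi (p₀.aut⁻¹ * p.aut)).1 q
      rw [map_mul, map_inv] at h1
      exact h1
    · have h1 := (hi (p₀.aut⁻¹ * p.aut)).2 q
      rw [map_mul i, map_inv i] at h1
      exact h1
    · rw [hexp]
      exact hlift p
  · exact inl_injective (φ := φ) (ψ := ψ) (h := h) (by rw [← (hi f).1, ← (hi g).1, hfg])

end Embedding

end ReebFoliation

theorem theorem4p1 (φ ψ : HalfLineDiffeo) (hφ : IsExpanding φ) (hψ : IsExpanding ψ)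
    (hφ_flat : IsFlat φ) (hψ_flat : IsFlat ψ)
    (lam mu : ℂˣ) (hlam : 1 < ‖(lam : ℂ)‖) (hmu : 1 < ‖(mu : ℂ)‖)
    (h : Curve lam ≃ₜ Curve mu) (hh : IsBiholomorphic h) :
    -- the restrictions to the boundary leaf take values in `Aut_0 H`
    ∃ (r : AutReeb φ lam →* AutCurveZero lam) (r' : AutMirror ψ mu →* AutCurveZero mu),
      (∀ f w, f.1 (boundary φ lam w) = boundary φ lam ((r f).1.1 w)) ∧
      (∀ f w, f.1 (boundary ψ mu w) = boundary ψ mu ((r' f).1.1 w)) ∧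
      -- the restrictions to the two components identify `Aut M` with the fibre product
      (∃ Φ : AutPasted φ ψ h ≃* fibreProduct h r r', ∀ F,
        (∀ p, F.1.1 (Pasted.inl φ ψ h p) = Pasted.inl φ ψ h ((Φ F).1.1.1 p)) ∧
        (∀ p, F.1.1 (Pasted.inr φ ψ h p) = Pasted.inr φ ψ h ((Φ F).1.2.1 p))) ∧
      (CentralizerIsoReal ψ →
        ∃ i : AutReeb φ lam →* AutPasted φ ψ h, Topology.IsEmbedding i) := by
  exact ⟨boundaryRestriction hφ hlam, mirrorRestriction hψ hmu, boundaryClass_spec hφ hlam,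
    fun f w => boundaryClass_spec hψ hmu (mirrorEquiv f) w,
    exists_fibreProduct_equiv hφ hψ hφ_flat hψ_flat hlam hmu hh.1,
    exists_isEmbedding hφ hψ hφ_flat hψ_flat hlam hmu hh.1⟩
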